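/- A mosaic tile is one of eleven unit squares: the blank tile, the four single arcs joining the midpoints of two adjacent edges, the horizontal and the vertical line segment, the two double arcs, and the two crossings. An $n$-mosaic is an $n\times n$ array of mosaic tiles in which every endpoint of a curve drawn on a tile touches an endpoint of a curve on an adjacent tile; it is a diagram of a knot or link. Its tile number is the number of its non-blank tiles, and a row or column is occupied if it contains a non-blank tile. An $n$-mosaic is reduced if no simple closed curve in the plane meets the diagram transversely at a single crossing and at no other point. It is space-efficient if it is reduced and no $n$-mosaic of the same knot or link has a smaller tile number. Theorem. Let $n\ge 4$, and suppose we have a space-efficient $n$-mosaic of a knot or link $K$ with no unknotted, unlinked components, in which every row is occupied or every column is occupied. If $n$ is even, then the tile number of the mosaic is at most $n^2-4$. If $n$ is odd, then the tile number of the mosaic is at most $n^2-8$. If $K$ is a prime knot, then the tile number of the mosaic is at least $5n-8$. -/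

import Mathlib

namespace KnotMosaic

/-! ### Knots and links in the three-sphere -/

/-- Euclidean three-space. -/
abbrev E3 : Type := EuclideanSpace ℝ (Fin 3)

/-- The three-sphere, as the one-point compactification of Euclidean three-space. -/
abbrev S3 : Type := OnePoint E3

/-- Two subsets of the three-sphere are ambient isotopic if an isotopy of the three-sphere that
starts at the identity carries the first onto the second. -/
def AmbientIsotopic (L L' : Set S3) : Prop :=
  ∃ H : unitInterval → (S3 ≃ₜ S3),
    Continuous (fun p : unitInterval × S3 => H p.1 p.2) ∧
      H 0 = Homeomorph.refl S3 ∧ H 1 '' L = L'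

/-- The round unit circle in the horizontal plane. -/
def stdCircle : Set S3 :=
  (fun v : E3 => (v : S3)) '' {v : E3 | v 0 ^ 2 + v 1 ^ 2 = 1 ∧ v 2 = 0}

/-- The closed unit ball. -/
def stdBall : Set S3 :=
  (fun v : E3 => (v : S3)) '' Metric.closedBall (0 : E3) 1

/-- The vertical diameter of the closed unit ball. -/
def stdDiameter : Set S3 :=
  (fun v : E3 => (v : S3)) '' segment ℝ (!₂[0, 0, -1] : E3) (!₂[0, 0, 1] : E3)

/-- A knot, as a subset of the three-sphere: an embedded circle. (The knots to which this is
applied are polygons, hence tame.) -/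
def IsKnot (K : Set S3) : Prop := Nonempty (Circle ≃ₜ K)

/-- The trivial knot. -/
def IsUnknot (K : Set S3) : Prop := AmbientIsotopic K stdCircle

/-- A tame closed three-ball in the three-sphere. -/
def IsTameBall (B : Set S3) : Prop := ∃ h : S3 ≃ₜ S3, h '' stdBall = B

/-- `C` is an unknotted, unlinked component of the link `L`: a connected component of `L` which is
a trivial knot and which some tame ball separates from the other components. -/
def IsTrivialComponent (L C : Set S3) : Prop :=
  (∃ x ∈ L, C = connectedComponentIn L x) ∧ IsUnknot C ∧
    ∃ B : Set S3, IsTameBall B ∧ C ⊆ interior B ∧ Disjoint B (L \ C)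

/-- The surface `S` and the curve `K` meet transversely at `x`: in suitable coordinates around `x`,
the surface is the horizontal coordinate plane and the curve is the vertical coordinate axis. -/
def MeetTransverselyAt (S K : Set S3) (x : S3) : Prop :=
  ∃ φ : OpenPartialHomeomorph S3 E3, x ∈ φ.source ∧ φ x = 0 ∧
    ∀ y ∈ φ.source, (y ∈ S ↔ φ y 2 = 0) ∧ (y ∈ K ↔ φ y 0 = 0 ∧ φ y 1 = 0)

/-- `a` is an unknotted arc in the ball `B`: the pair is homeomorphic to the unit ball with a
diameter. -/
def IsUnknottedArc (B a : Set S3) : Prop :=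
  ∃ g : S3 ≃ₜ S3, g '' B = stdBall ∧ g '' a = stdDiameter

/-- A prime knot: a nontrivial knot such that every tame two-sphere that meets it transversely in
exactly two points bounds, on one of its two sides, a ball that meets the knot in an unknotted
arc. -/
def IsPrimeKnot (K : Set S3) : Prop :=
  IsKnot K ∧ ¬ IsUnknot K ∧
    ∀ B : Set S3, IsTameBall B → (frontier B ∩ K).ncard = 2 →
      (∀ x ∈ frontier B ∩ K, MeetTransverselyAt (frontier B) K x) →
        IsUnknottedArc B (B ∩ K) ∨ IsUnknottedArc (closure Bᶜ) (closure Bᶜ ∩ K)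

/-! ### Mosaic tiles -/

/-- The four edges of a tile; each stands also for its midpoint. -/
inductive Side
  | left | right | top | bottom
  deriving DecidableEq

/-- The opposite edge. -/
def Side.opposite : Side → Side
  | .left => .right
  | .right => .left
  | .top => .bottom
  | .bottom => .top

/-- The displacement (rows downwards, columns to the right) to the tile across an edge. -/
def Side.offset : Side → ℤ × ℤ
  | .left => (0, -1)
  | .right => (0, 1)
  | .top => (-1, 0)
  | .bottom => (1, 0)

/-- The midpoint of an edge, for the tile of side length one centred at the origin. -/
noncomputable def Side.midpoint : Side → E3
  | .left => !₂[-1 / 2, 0, 0]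
  | .right => !₂[1 / 2, 0, 0]
  | .top => !₂[0, 1 / 2, 0]
  | .bottom => !₂[0, -1 / 2, 0]

/-- The eleven mosaic tiles: the blank tile, four single arcs, two line segments, two double arcs
and two crossings. -/
inductive Tile
  | blank
  | arcLeftBottom | arcRightBottom | arcTopRight | arcTopLeft
  | horizontal | vertical
  | arcsLeftBottomTopRight | arcsRightBottomTopLeft
  | crossingHorizontalOver | crossingVerticalOver
  deriving DecidableEq

/-- The curves drawn on a tile, each given by the pair of edges whose midpoints it joins. -/
def Tile.strands : Tile → List (Side × Side)
  | .blank => []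
  | .arcLeftBottom => [(.left, .bottom)]
  | .arcRightBottom => [(.right, .bottom)]
  | .arcTopRight => [(.top, .right)]
  | .arcTopLeft => [(.top, .left)]
  | .horizontal => [(.left, .right)]
  | .vertical => [(.top, .bottom)]
  | .arcsLeftBottomTopRight => [(.left, .bottom), (.top, .right)]
  | .arcsRightBottomTopLeft => [(.right, .bottom), (.top, .left)]
  | .crossingHorizontalOver => [(.left, .right), (.top, .bottom)]
  | .crossingVerticalOver => [(.left, .right), (.top, .bottom)]

/-- The midpoint of the edge `s` is a connection point of the tile `t`. -/
def Tile.ConnectsAt (t : Tile) (s : Side) : Prop :=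
  ∃ p ∈ t.strands, s = p.1 ∨ s = p.2

/-- The crossing tiles. -/
def Tile.IsCrossing (t : Tile) : Prop :=
  t = .crossingHorizontalOver ∨ t = .crossingVerticalOver

/-- The straight segment joining the midpoints of two edges. -/
def chord (s t : Side) : Set E3 := segment ℝ s.midpoint t.midpoint

/-- A strand joining the midpoints of two opposite edges that is lifted to height one over the
centre of the tile. -/
def bridge (s t : Side) : Set E3 :=
  segment ℝ s.midpoint (!₂[0, 0, 1] : E3) ∪ segment ℝ (!₂[0, 0, 1] : E3) t.midpoint

/-- The piece of the link that a tile depicts, for the tile centred at the origin. Arcs are drawn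
as straight segments, and at a crossing the over strand is lifted out of the plane. -/
def Tile.curve : Tile → Set E3
  | .crossingHorizontalOver => bridge .left .right ∪ chord .top .bottom
  | .crossingVerticalOver => bridge .top .bottom ∪ chord .left .right
  | t => ⋃ p ∈ t.strands, chord p.1 p.2

/-! ### Mosaics -/

/-- An `n`-mosaic: an `n` by `n` array of tiles (rows numbered downwards, columns to the right)
in which each connection point of a tile touches a connection point of an adjacent tile. -/
structure Mosaic (n : ℕ) where
  /-- The tile in a given row and column. -/
  tile : Fin n → Fin n → Tile
  suitablyConnected : ∀ (i j : Fin n) (s : Side), (tile i j).ConnectsAt s →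
    ∃ i' j' : Fin n, (((i' : ℕ) : ℤ), ((j' : ℕ) : ℤ)) = (((i : ℕ) : ℤ), ((j : ℕ) : ℤ)) + s.offset ∧
      (tile i' j').ConnectsAt s.opposite

namespace Mosaic

variable {n : ℕ}

/-- The number of non-blank tiles. -/
def tileNumber (M : Mosaic n) : ℕ :=
  (Finset.univ.filter fun p : Fin n × Fin n => M.tile p.1 p.2 ≠ Tile.blank).card

/-- The row `i` contains a non-blank tile. -/
def RowOccupied (M : Mosaic n) (i : Fin n) : Prop := ∃ j, M.tile i j ≠ Tile.blank

/-- The column `j` contains a non-blank tile. -/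
def ColumnOccupied (M : Mosaic n) (j : Fin n) : Prop := ∃ i, M.tile i j ≠ Tile.blank

/-- The polygonal link in Euclidean three-space depicted by a mosaic; the tile in row `i` and
column `j` is centred at `(j, -i, 0)`. -/
def spatialLink (M : Mosaic n) : Set E3 :=
  ⋃ (i : Fin n) (j : Fin n),
    (fun v : E3 => (!₂[((j : ℕ) : ℝ), -((i : ℕ) : ℝ), 0] : E3) + v) '' (M.tile i j).curve

/-- The link in the three-sphere depicted by a mosaic. -/
def link (M : Mosaic n) : Set S3 := (fun v : E3 => (v : S3)) '' M.spatialLink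

/-- The planar diagram drawn on a mosaic: the projection of the link to the plane. -/
def diagram (M : Mosaic n) : Set (ℝ × ℝ) := (fun v : E3 => (v 0, v 1)) '' M.spatialLink

/-- A mosaic is reduced if no simple closed curve in the plane meets the diagram transversely at a
single crossing and does not meet the diagram at any other point. The strands at a crossing are
horizontal and vertical, so transverse means that no component of the velocity vanishes. -/
def Reduced (M : Mosaic n) : Prop :=
  ¬ ∃ i j : Fin n, (M.tile i j).IsCrossing ∧
    ∃ γ : ℝ → ℝ × ℝ, Continuous γ ∧ Function.Periodic γ 1 ∧ Set.InjOn γ (Set.Ico 0 1) ∧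
      γ 0 = (((j : ℕ) : ℝ), -((i : ℕ) : ℝ)) ∧
      (∃ v : ℝ × ℝ, HasDerivAt γ v 0 ∧ v.1 ≠ 0 ∧ v.2 ≠ 0) ∧
      ∀ t ∈ Set.Ioo (0 : ℝ) 1, γ t ∉ M.diagram

/-- A mosaic is space-efficient if it is reduced and if its tile number is the least among the
mosaics of the same size that depict the same knot or link. -/
def SpaceEfficient (M : Mosaic n) : Prop :=
  M.Reduced ∧ ∀ M' : Mosaic n, AmbientIsotopic M.link M'.link → M.tileNumber ≤ M'.tileNumber

end Mosaic

end KnotMosaic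

/-!
A mosaic is treated as a grid of tiles indexed by `ℤ × ℤ` that is blank outside the square
(`Good`). A space-efficient mosaic gives a grid with the least tile number in its isotopy class,
and no grid in that class contains a loop of four arcs around a vertex, since such a loop is an
unknotted, unlinked component (`HasLoop.isTrivialComponent`). These two properties make up `Tight`,
and the three bounds are proved for tight grids. They are contradicted by moves that replace a few
tiles and lower the tile number.

**Isotopies.** All the moves inside a mosaic are composed of triangle moves, in which an edge of a
polygonal link is replaced by the two other sides of a triangle that misses the rest of the link.
Such a move is realized by a homeomorphism that translates along lines, hence moves points by a
bounded distance (`IsoE`), and the Alexander trick at infinity turns it into an ambient isotopy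
(`IsoE.ambientIsotopic`). Whether the triangles meet the remaining edges of a tile is decided by
linear arithmetic (`Clear`, `LocEq.tri`).

**Upper bounds.** If the corner tile is not blank, it is the corner of an arch; were it narrow in
both directions, its three outer tiles could be removed, or it would close up to a loop, and if it
is wide, one of its legs could be pushed inwards with fewer tiles unless the tile diagonally inside
the corner is blank (`Tight.corner`). So every corner square of four cells has a blank cell, and
`n ^ 2 - 4` is a bound for all `n`. For odd `n` one takes, among the isotopic grids with the least
tile number, one that is optimal in lexicographic order with respect to the number of straight
tiles, the number of tiles on the boundary and the positions of the straight tiles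
(`Tight.exists_optimal`). Its four corners are blank. If the other `n - 2` cells of a side were all
non-blank, they would be filled by arches; as `n - 2` is odd, one of the arches has width at least
three, and pushing in one of its legs, or lowering its top into a gap below, would give a better
grid (`Tight.improvable_or_slidable_of_side`). So each side has a further blank cell.

**Lower bound.** Let `K` be prime and suppose that all the rows are occupied; the case of columns
follows by transposition. A horizontal line between two rows is crossed by an even, nonzero number
of strands. If it were two, with at least two rows on both sides, then the half-space on one side
of the vertical plane over the line would meet `K` in an unknotted arc by primeness. Unknotted arcs
in a ball with the same end points are carried to each other by a homeomorphism of the ball that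
fixes its boundary, and such a homeomorphism is isotopic to the identity (`exists_ball_extension`,
`AmbientIsotopic.of_isUnknottedArc`), so the tiles on that side could be replaced by a single arch
with fewer tiles (`count_capGrid_lt`).
Hence all the lines except for the first and the last one
are crossed at least four times (`Tight.four_le_card_cut`). A row with four strands entering from
above and four leaving below has five tiles, as otherwise it would consist of vertical segments and
could be deleted (`Tight.not_vertical_row`). So the rows have at least `2, 4, 5, …, 5, 4, 2` tiles,
and `2 + 4 + 5 * (n - 4) + 4 + 2 = 5 * n - 8` (`Tight.le_count`).
-/

set_option linter.unusedSimpArgs false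

namespace KnotMosaic

open Set Filter Topology

/-! ### Ambient isotopy and displacement-bounded homeomorphisms -/

theorem AmbientIsotopic.trans {L L' L'' : Set S3} (h : AmbientIsotopic L L')
    (h' : AmbientIsotopic L' L'') : AmbientIsotopic L L'' := by
  obtain ⟨H, hc, h0, h1⟩ := h
  obtain ⟨H', hc', h0', h1'⟩ := h'
  refine ⟨fun t => (H t).trans (H' t), ?_, ?_, ?_⟩
  · exact hc'.comp (continuous_fst.prodMk hc)
  · simp only [h0, h0']; rfl
  · rw [← h1', ← h1, ← image_comp]; rfl

theorem AmbientIsotopic.symm {L L' : Set S3} (h : AmbientIsotopic L L') :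
    AmbientIsotopic L' L := by
  obtain ⟨H, hc, h0, h1⟩ := h
  refine ⟨fun t => (H 1).symm.trans (H (unitInterval.symm t)), ?_, ?_, ?_⟩
  · exact hc.comp ((unitInterval.continuous_symm.comp continuous_fst).prodMk
      ((H 1).symm.continuous.comp continuous_snd))
  · simp only [unitInterval.symm_zero]; ext x; simp
  · rw [← h1, ← image_comp]
    ext x
    simp [h0]

/-- Ambient isotopy is preserved by every homeomorphism of the three-sphere, even one that reverses
orientation. -/
theorem AmbientIsotopic.image {L L' : Set S3} (h : AmbientIsotopic L L') (g : S3 ≃ₜ S3) :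
    AmbientIsotopic (g '' L) (g '' L') := by
  obtain ⟨H, hc, h0, h1⟩ := h
  refine ⟨fun t => (g.symm.trans (H t)).trans g, ?_, ?_, ?_⟩
  · exact g.continuous.comp (hc.comp
      (continuous_fst.prodMk (g.symm.continuous.comp continuous_snd)))
  · simp only [h0]; ext x; simp
  · rw [← h1, ← image_comp, ← image_comp]
    congr 1
    ext x; simp

/-- A subset of Euclidean three-space, viewed in the three-sphere. -/
def lift (L : Set E3) : Set S3 := (fun v : E3 => (v : S3)) '' L

/-- Equivalence of subsets of three-space under homeomorphisms that move every point by a bounded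
distance. Such homeomorphisms are closed under composition and are isotopic to the identity. -/
def IsoE (L L' : Set E3) : Prop :=
  ∃ h : E3 ≃ₜ E3, (∃ C, ∀ x, dist (h x) x ≤ C) ∧ h '' L = L'

theorem IsoE.refl (L : Set E3) : IsoE L L :=
  ⟨Homeomorph.refl _, ⟨0, fun x => by simp⟩, by simp⟩

theorem IsoE.of_eq {L L' : Set E3} (h : L = L') : IsoE L L' := h ▸ IsoE.refl L

theorem IsoE.symm {L L' : Set E3} (h : IsoE L L') : IsoE L' L := by
  obtain ⟨h, ⟨C, hC⟩, rfl⟩ := h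
  refine ⟨h.symm, ⟨C, fun x => ?_⟩, ?_⟩
  · have := hC (h.symm x)
    rwa [h.apply_symm_apply, dist_comm] at this
  · rw [← image_comp]; simp

theorem IsoE.trans {L L' L'' : Set E3} (h : IsoE L L') (h' : IsoE L' L'') : IsoE L L'' := by
  obtain ⟨h, ⟨C, hC⟩, rfl⟩ := h
  obtain ⟨h', ⟨C', hC'⟩, rfl⟩ := h'
  refine ⟨h.trans h', ⟨C' + C, fun x => ?_⟩, ?_⟩
  · exact (dist_triangle _ (h x) _).trans (add_le_add (hC' _) (hC _))
  · rw [← image_comp]; rfl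

theorem IsoE.image {L L' : Set E3} (h : IsoE L L') (g : E3 ≃ᵢ E3) :
    IsoE (g '' L) (g '' L') := by
  obtain ⟨h, ⟨C, hC⟩, rfl⟩ := h
  refine ⟨(g.symm.toHomeomorph.trans h).trans g.toHomeomorph, ⟨C, fun x => ?_⟩, ?_⟩
  · have := hC (g.symm x)
    rw [← g.dist_eq] at this
    simpa using this
  · rw [← image_comp, ← image_comp]
    congr 1
    ext x : 1
    simp

/-- A jointly continuous family of homeomorphisms of three-space that is uniformly proper extends
to an isotopy of the three-sphere. -/
theorem continuous_onePoint_family (H : unitInterval → (E3 ≃ₜ E3))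
    (hc : Continuous fun p : unitInterval × E3 => H p.1 p.2)
    (hp : ∀ R : ℝ, ∃ R' : ℝ, ∀ t x, R' < ‖x‖ → R < ‖H t x‖) :
    Continuous fun p : unitInterval × S3 => (H p.1).onePointCongr p.2 := by
  rw [continuous_iff_continuousAt]
  rintro ⟨t, x⟩
  induction x using OnePoint.rec with
  | infty =>
    unfold ContinuousAt
    have hval : (H t).onePointCongr OnePoint.infty = OnePoint.infty := rfl
    simp only [hval]
    rw [OnePoint.hasBasis_nhds_infty.tendsto_right_iff]
    rintro K ⟨hK, hK'⟩
    obtain ⟨R, hR⟩ := hK'.isBounded.subset_closedBall 0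
    obtain ⟨R', hR'⟩ := hp R
    have hN : ((fun v : E3 => (v : S3)) '' (Metric.closedBall 0 R')ᶜ ∪ {OnePoint.infty}) ∈
        𝓝 (OnePoint.infty : S3) :=
      OnePoint.hasBasis_nhds_infty.mem_of_mem
        ⟨Metric.isClosed_closedBall, isCompact_closedBall _ _⟩
    filter_upwards [prod_mem_nhds (univ_mem : univ ∈ 𝓝 t) hN]
    rintro ⟨s, y⟩ ⟨-, hy⟩
    rcases hy with ⟨v, hv, rfl⟩ | hy
    · left
      refine ⟨H s v, fun hmem => ?_, rfl⟩
      have h1 := hR hmem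
      simp only [mem_compl_iff, Metric.mem_closedBall, dist_zero_right, not_le] at hv h1
      exact absurd (hR' s v hv) (not_lt.2 h1)
    · right
      rw [mem_singleton_iff] at hy ⊢
      simp only at hy
      rw [hy]; rfl
  | coe x =>
    have he : IsOpenEmbedding (fun p : unitInterval × E3 => (p.1, (p.2 : S3))) :=
      IsOpenEmbedding.id.prodMap OnePoint.isOpenEmbedding_coe
    refine (he.continuousAt_iff (g := fun p : unitInterval × S3 => (H p.1).onePointCongr p.2)
      (x := (t, x))).1 ?_
    exact (OnePoint.continuous_coe.comp hc).continuousAt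

/-- The Alexander trick at infinity: `x ↦ t • h (t⁻¹ • x)` shrinks the displacement of `h` to
zero. -/
theorem ambientIsotopic_onePointCongr (h : E3 ≃ₜ E3) {C : ℝ} (hC : ∀ x, dist (h x) x ≤ C)
    (X : Set S3) : AmbientIsotopic X (h.onePointCongr '' X) := by
  have hC0 : 0 ≤ C := dist_nonneg.trans (hC 0)
  let H : unitInterval → (E3 ≃ₜ E3) := fun t =>
    if ht : (t : ℝ) = 0 then Homeomorph.refl E3 else
      ((Homeomorph.smulOfNeZero (t : ℝ) ht).symm.trans h).trans (Homeomorph.smulOfNeZero (t : ℝ) ht)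
  have hH : ∀ t x, H t x = x + (t : ℝ) • (h ((t : ℝ)⁻¹ • x) - (t : ℝ)⁻¹ • x) := by
    intro t x
    by_cases ht : (t : ℝ) = 0
    · simp only [H, ht, dite_true]; simp
    · simp only [H, ht, dite_false, smul_sub, smul_smul, mul_inv_cancel₀ ht, one_smul]
      simp only [add_sub_cancel]
      rfl
  have hd : ∀ t x, dist (H t x) x ≤ (t : ℝ) * C := by
    intro t x
    rw [hH, dist_eq_norm, add_sub_cancel_left, norm_smul, Real.norm_of_nonneg t.2.1]
    exact mul_le_mul_of_nonneg_left (by rw [← dist_eq_norm]; exact hC _) t.2.1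
  have hcont : Continuous fun p : unitInterval × E3 => H p.1 p.2 := by
    rw [continuous_iff_continuousAt]
    rintro ⟨t, x⟩
    by_cases ht : (t : ℝ) = 0
    · have hx : H t x = x := by rw [hH]; simp [ht]
      unfold ContinuousAt
      simp only [hx]
      rw [tendsto_iff_dist_tendsto_zero]
      have hb : Tendsto (fun p : unitInterval × E3 => (p.1 : ℝ) * C + dist p.2 x) (𝓝 (t, x))
          (𝓝 0) := by
        have : Continuous (fun p : unitInterval × E3 => (p.1 : ℝ) * C + dist p.2 x) := by fun_prop
        have h2 := this.tendsto (t, x)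
        simpa [ht] using h2
      refine squeeze_zero (fun _ => dist_nonneg) (fun p => ?_) hb
      exact (dist_triangle _ p.2 _).trans (add_le_add (hd _ _) le_rfl)
    · simp only [hH]
      have h1 : ContinuousAt (fun p : unitInterval × E3 => (p.1 : ℝ)) (t, x) := by fun_prop
      have h2 := h1.inv₀ ht
      have h3 : ContinuousAt (fun p : unitInterval × E3 => p.2) (t, x) := by fun_prop
      have h4 := h2.smul h3
      exact h3.add (h1.smul ((h.continuous.continuousAt.comp h4).sub h4))
  refine ⟨fun t => (H t).onePointCongr, continuous_onePoint_family H hcont ?_, ?_, ?_⟩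
  · intro R
    refine ⟨R + C, fun t x hx => ?_⟩
    have h1 := hd t x
    have h2 : (t : ℝ) * C ≤ C := mul_le_of_le_one_left hC0 t.2.2
    have h3 : ‖x‖ - ‖H t x‖ ≤ dist (H t x) x := by
      rw [dist_comm, dist_eq_norm]; exact norm_sub_norm_le _ _
    linarith
  · have : H 0 = Homeomorph.refl E3 := by simp [H]
    simp only [this]
    ext x
    induction x using OnePoint.rec <;> rfl
  · have h1 : H 1 = h := by
      ext1 x
      rw [hH]; simp
    simp only [h1]

theorem lift_image (g : E3 ≃ₜ E3) (L : Set E3) : lift (g '' L) = g.onePointCongr '' lift L := by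
  unfold lift
  rw [← image_comp, ← image_comp]
  rfl

theorem IsoE.ambientIsotopic {L L' : Set E3} (h : IsoE L L') :
    AmbientIsotopic (lift L) (lift L') := by
  obtain ⟨h, ⟨C, hC⟩, rfl⟩ := h
  rw [lift_image]
  exact ambientIsotopic_onePointCongr h hC _

/-! ### Sweeping an arc across an empty disc -/

/-- The displacement of the piecewise linear self-map of the line which carries `g` to `g'` and is
the identity at distance at least `μ` from the interval between them. -/
noncomputable def shift (g g' μ u : ℝ) : ℝ :=
  (g' - g) * max 0 (min ((u - (min g g' - μ)) / (g - (min g g' - μ)))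
    ((max g g' + μ - u) / (max g g' + μ - g)))

theorem shift_self (g μ u : ℝ) : shift g g μ u = 0 := by simp [shift]

theorem shift_weight_mem {g g' μ u : ℝ} (hμ : 0 < μ) :
    0 ≤ max 0 (min ((u - (min g g' - μ)) / (g - (min g g' - μ)))
      ((max g g' + μ - u) / (max g g' + μ - g))) ∧
    max 0 (min ((u - (min g g' - μ)) / (g - (min g g' - μ)))
      ((max g g' + μ - u) / (max g g' + μ - g))) ≤ 1 := by
  refine ⟨le_max_left _ _, max_le zero_le_one ?_⟩
  have h1 : 0 < g - (min g g' - μ) := by linarith [min_le_left g g']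
  have h2 : 0 < max g g' + μ - g := by linarith [le_max_left g g']
  rcases le_total u g with h | h
  · exact (min_le_left _ _).trans ((div_le_one h1).2 (by linarith))
  · exact (min_le_right _ _).trans ((div_le_one h2).2 (by linarith))

theorem abs_shift_le {g g' μ u : ℝ} (hμ : 0 ≤ μ) (h0 : μ = 0 → g = g') :
    |shift g g' μ u| ≤ |g' - g| := by
  rcases hμ.eq_or_lt with h | h
  · rw [h0 h.symm, shift_self]; simp
  · obtain ⟨h1, h2⟩ := shift_weight_mem (g := g) (g' := g') (u := u) h
    rw [shift, abs_mul, abs_of_nonneg h1]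
    exact mul_le_of_le_one_right (abs_nonneg _) h2

theorem shift_at {g g' μ : ℝ} (hμ : 0 ≤ μ) (h0 : μ = 0 → g = g') : shift g g' μ g = g' - g := by
  rcases hμ.eq_or_lt with h | h
  · rw [h0 h.symm, shift_self]; simp
  · have h1 : 0 < g - (min g g' - μ) := by linarith [min_le_left g g']
    have h2 : 0 < max g g' + μ - g := by linarith [le_max_left g g']
    rw [shift, div_self h1.ne', div_self h2.ne']; simp

theorem shift_eq_zero_of_le {g g' μ u : ℝ} (hμ : 0 < μ) (hu : u ≤ min g g' - μ) :
    shift g g' μ u = 0 := by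
  have h1 : 0 < g - (min g g' - μ) := by linarith [min_le_left g g']
  rw [shift, max_eq_left, mul_zero]
  exact (min_le_left _ _).trans (div_nonpos_of_nonpos_of_nonneg (by linarith) h1.le)

theorem shift_eq_zero_of_ge {g g' μ u : ℝ} (hμ : 0 < μ) (hu : max g g' + μ ≤ u) :
    shift g g' μ u = 0 := by
  have h2 : 0 < max g g' + μ - g := by linarith [le_max_left g g']
  rw [shift, max_eq_left, mul_zero]
  exact (min_le_right _ _).trans (div_nonpos_of_nonpos_of_nonneg (by linarith) h2.le)

theorem shift_shift {g g' μ : ℝ} (hμ : 0 ≤ μ) (h0 : μ = 0 → g = g') (u : ℝ) :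
    shift g' g μ (u + shift g g' μ u) = -shift g g' μ u := by
  rcases hμ.eq_or_lt with h | h
  · rw [h0 h.symm]; simp [shift_self]
  by_cases hlo : u ≤ min g g' - μ
  · rw [shift_eq_zero_of_le h hlo, add_zero, shift_eq_zero_of_le h (by rwa [min_comm]), neg_zero]
  by_cases hhi : max g g' + μ ≤ u
  · rw [shift_eq_zero_of_ge h hhi, add_zero, shift_eq_zero_of_ge h (by rwa [max_comm]), neg_zero]
  push Not at hlo hhi
  unfold shift
  rw [min_comm g' g, max_comm g' g]
  set lo := min g g' - μ with hlo'
  set hi := max g g' + μ with hhi'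
  have a1 : 0 < g - lo := by linarith [min_le_left g g']
  have a2 : 0 < hi - g := by linarith [le_max_left g g']
  have a3 : 0 < g' - lo := by linarith [min_le_right g g']
  have a4 : 0 < hi - g' := by linarith [le_max_right g g']
  rcases le_total u g with hu | hu
  · have e1 : min ((u - lo) / (g - lo)) ((hi - u) / (hi - g)) = (u - lo) / (g - lo) :=
      min_eq_left (((div_le_one a1).2 (by linarith)).trans ((one_le_div a2).2 (by linarith)))
    have p1 : 0 ≤ (u - lo) / (g - lo) := div_nonneg (by linarith) a1.le
    rw [e1, max_eq_right p1]
    set lam := (u - lo) / (g - lo) with hlam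
    have hlam1 : lam ≤ 1 := (div_le_one a1).2 (by linarith)
    have hu' : u = lo + (g - lo) * lam := by rw [hlam]; field_simp; ring
    have e2 : (u + (g' - g) * lam - lo) / (g' - lo) = lam := by
      rw [div_eq_iff a3.ne', hu']; ring
    have e3 : 1 ≤ (hi - (u + (g' - g) * lam)) / (hi - g') := by
      rw [one_le_div a4, hu']
      nlinarith
    rw [e2, min_eq_left (hlam1.trans e3), max_eq_right p1]; ring
  · have e1 : min ((u - lo) / (g - lo)) ((hi - u) / (hi - g)) = (hi - u) / (hi - g) :=
      min_eq_right (((div_le_one a2).2 (by linarith)).trans ((one_le_div a1).2 (by linarith)))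
    have p1 : 0 ≤ (hi - u) / (hi - g) := div_nonneg (by linarith) a2.le
    rw [e1, max_eq_right p1]
    set lam := (hi - u) / (hi - g) with hlam
    have hlam1 : lam ≤ 1 := (div_le_one a2).2 (by linarith)
    have hu' : u = hi - (hi - g) * lam := by rw [hlam]; field_simp; ring
    have e2 : (hi - (u + (g' - g) * lam)) / (hi - g') = lam := by
      rw [div_eq_iff a4.ne', hu']; ring
    have e3 : 1 ≤ (u + (g' - g) * lam - lo) / (g' - lo) := by
      rw [one_le_div a3, hu']
      nlinarith
    rw [e2, min_eq_right (hlam1.trans e3), max_eq_right p1]; ring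

/-- A fibrewise translation along `e` by an amount that is bounded and fibrewise invertible. -/
theorem isoE_of_shift (e : E3) (d d' : E3 → ℝ) (hd : Continuous d) (hd' : Continuous d')
    (h1 : ∀ p, d' (p + d p • e) = -d p) (h2 : ∀ p, d (p + d' p • e) = -d' p)
    (C : ℝ) (hC : ∀ p, |d p| ≤ C) (L : Set E3) :
    IsoE L ((fun p => p + d p • e) '' L) := by
  refine ⟨⟨⟨fun p => p + d p • e, fun p => p + d' p • e, fun p => ?_, fun p => ?_⟩, ?_, ?_⟩,
    ⟨C * ‖e‖, fun p => ?_⟩, rfl⟩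
  · simp only [h1, neg_smul, add_neg_cancel_right]
  · simp only [h2, neg_smul, add_neg_cancel_right]
  · exact continuous_id.add (hd.smul continuous_const)
  · exact continuous_id.add (hd'.smul continuous_const)
  · change dist (p + d p • e) p ≤ _
    rw [dist_eq_norm, add_sub_cancel_left, norm_smul]
    exact mul_le_mul_of_nonneg_right (hC p) (norm_nonneg _)

/-- A closed set is the zero set of a function with Lipschitz constant one. -/
theorem exists_gauge (R : Set E3) (hR : IsClosed R) : ∃ ρ : E3 → ℝ, Continuous ρ ∧
    (∀ p, 0 ≤ ρ p) ∧ (∀ p, ρ p = 0 → p ∈ R) ∧ ∀ p ∈ R, ∀ q, ρ q ≤ dist q p := by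
  rcases R.eq_empty_or_nonempty with rfl | hne
  · exact ⟨fun _ => 1, continuous_const, fun _ => zero_le_one, fun _ h => absurd h one_ne_zero,
      fun _ h => absurd h (notMem_empty _)⟩
  · exact ⟨fun p => Metric.infDist p R, Metric.continuous_infDist_pt R,
      fun p => Metric.infDist_nonneg, fun p h => (hR.mem_iff_infDist_zero hne).2 h,
      fun p hp q => Metric.infDist_le_dist_of_mem hp⟩

/-- The part of a link that is the graph of `g0` (in the direction `e`) over the zero set of `κ` can
be moved to the graph of `g1`, provided that the region swept out meets the rest `R` of the link
only in points where the two graphs agree. -/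
theorem sweep (ℓ : E3 →L[ℝ] ℝ) (e : E3) (he : ℓ e = 1) (g0 g1 κ : E3 → ℝ)
    (hg0 : Continuous g0) (hg1 : Continuous g1) (hκ : Continuous κ)
    (i0 : ∀ p (t : ℝ), g0 (p + t • e) = g0 p) (i1 : ∀ p (t : ℝ), g1 (p + t • e) = g1 p)
    (iκ : ∀ p (t : ℝ), κ (p + t • e) = κ p) (hκ0 : ∀ p, 0 ≤ κ p)
    (hle : ∀ p, g0 p ≤ g1 p) (C : ℝ) (hC : ∀ p, g1 p - g0 p ≤ C)
    (R : Set E3) (hR : IsClosed R)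
    (hcl : ∀ p ∈ R, κ p = 0 → g0 p ≤ ℓ p → ℓ p ≤ g1 p → g0 p = g1 p) :
    IsoE (R ∪ {p | κ p = 0 ∧ ℓ p = g0 p}) (R ∪ {p | κ p = 0 ∧ ℓ p = g1 p}) := by
  obtain ⟨ρ, hρc, hρ0, hρR, hρd⟩ := exists_gauge R hR
  let pt : E3 → ℝ → E3 := fun p t => p + ((g0 p + t * (g1 p - g0 p) - ℓ p : ℝ) • e : E3)
  let m : E3 → ℝ := fun p => sInf ((fun t => ρ (pt p t)) '' Icc (0 : ℝ) 1)
  have hptc : Continuous (fun q : E3 × ℝ => pt q.1 q.2) := by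
    have : Continuous ℓ := ℓ.continuous
    fun_prop
  have hmc : Continuous m :=
    IsCompact.continuous_sInf (f := fun p t => ρ (pt p t)) isCompact_Icc (hρc.comp hptc)
  have hne : (Icc (0 : ℝ) 1).Nonempty := ⟨0, by simp⟩
  have hm_ex : ∀ p, ∃ t ∈ Icc (0 : ℝ) 1, m p = ρ (pt p t) := by
    intro p
    have hc : ContinuousOn (fun t => ρ (pt p t)) (Icc 0 1) :=
      (hρc.comp (hptc.comp (continuous_const.prodMk continuous_id))).continuousOn
    obtain ⟨t, ht, h1, -⟩ := isCompact_Icc.exists_sInf_image_eq_and_le hne hc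
    exact ⟨t, ht, h1⟩
  have hm_le : ∀ p, ∀ t ∈ Icc (0 : ℝ) 1, m p ≤ ρ (pt p t) := by
    intro p t ht
    exact csInf_le ⟨0, by rintro _ ⟨s, -, rfl⟩; exact hρ0 _⟩ ⟨t, ht, rfl⟩
  have hm0 : ∀ p, 0 ≤ m p := fun p => by
    obtain ⟨t, -, h⟩ := hm_ex p
    rw [h]; exact hρ0 _
  have hpti : ∀ (p : E3) (s t : ℝ), pt (p + s • e) t = pt p t := by
    intro p s t
    simp only [pt, i0, i1, map_add, map_smul, he, smul_eq_mul, mul_one]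
    rw [add_assoc, ← add_smul]
    congr 2
    ring
  have hmi : ∀ p (s : ℝ), m (p + s • e) = m p := by
    intro p s
    simp only [m, hpti]
  have hzero : ∀ p, κ p = 0 → m p = 0 → g0 p = g1 p := by
    intro p hp hm
    obtain ⟨t, ht, h⟩ := hm_ex p
    rw [hm] at h
    have hmem := hρR _ h.symm
    have hl : ℓ (pt p t) = g0 p + t * (g1 p - g0 p) := by
      simp only [pt, map_add, map_smul, he, smul_eq_mul, mul_one]; ring
    have hd : 0 ≤ g1 p - g0 p := by linarith [hle p]
    have := hcl _ hmem (by simp only [pt, iκ]; exact hp)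
      (by rw [hl]; simp only [pt, i0]; nlinarith [ht.1])
      (by rw [hl]; simp only [pt, i1]; nlinarith [ht.2])
    simpa only [pt, i0, i1] using this
  -- The target graph is pushed back to `g0` where the rest of the link is close to the disc.
  let G : E3 → ℝ := fun p => g0 p + (g1 p - g0 p) * (m p / (m p + κ p))
  have hq : ∀ p, 0 ≤ m p / (m p + κ p) ∧ m p / (m p + κ p) ≤ 1 := fun p =>
    ⟨div_nonneg (hm0 p) (add_nonneg (hm0 p) (hκ0 p)),
      div_le_one_of_le₀ (by linarith [hκ0 p]) (add_nonneg (hm0 p) (hκ0 p))⟩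
  have hGc : Continuous G := by
    refine hg0.add ?_
    rw [continuous_iff_continuousAt]
    intro p
    by_cases hp : m p + κ p = 0
    · have h1 : m p = 0 := by linarith [hm0 p, hκ0 p]
      have h2 : κ p = 0 := by linarith [hm0 p, hκ0 p]
      have h3 : g1 p - g0 p = 0 := by rw [hzero p h2 h1]; ring
      unfold ContinuousAt
      simp only [h3, zero_mul]
      refine squeeze_zero (fun q => mul_nonneg (by linarith [hle q]) (hq q).1)
        (fun q => mul_le_of_le_one_right (by linarith [hle q]) (hq q).2) ?_
      have := (hg1.sub hg0).tendsto p
      change Tendsto (fun q => g1 q - g0 q) (𝓝 p) (𝓝 (g1 p - g0 p)) at this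
      rwa [h3] at this
    · exact (hg1.sub hg0).continuousAt.mul
        (hmc.continuousAt.div (hmc.add hκ).continuousAt hp)
  have hGi : ∀ p (t : ℝ), G (p + t • e) = G p := by
    intro p t; simp only [G, i0, i1, hmi, iκ]
  have hGle : ∀ p, g0 p ≤ G p ∧ G p ≤ g1 p := by
    intro p
    have hd : 0 ≤ g1 p - g0 p := by linarith [hle p]
    constructor
    · simp only [G]; nlinarith [hq p]
    · simp only [G]; nlinarith [hq p]
  have hGm : ∀ p, m p = 0 → g0 p = G p := by
    intro p hp; simp [G, hp]
  have hG1 : ∀ p, κ p = 0 → G p = g1 p := by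
    intro p hp
    by_cases hm : m p = 0
    · rw [← hGm p hm, hzero p hp hm]
    · simp only [G, hp, add_zero, div_self hm]; ring
  let μ : E3 → ℝ := fun p => m p / (2 * (‖e‖ + 1))
  have hen : 0 < 2 * (‖e‖ + 1) := by positivity
  have hμ0 : ∀ p, 0 ≤ μ p := fun p => div_nonneg (hm0 p) hen.le
  have hμz : ∀ p, μ p = 0 → m p = 0 := by
    intro p h
    simp only [μ, div_eq_zero_iff] at h
    rcases h with h | h
    · exact h
    · exact absurd h hen.ne'
  have hμc : Continuous μ := hmc.div_const _
  have hshiftc : ∀ A B : E3 → ℝ, Continuous A → Continuous B → (∀ p, m p = 0 → A p = B p) →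
      Continuous fun p => shift (A p) (B p) (μ p) (ℓ p) := by
    intro A B hA hB hAB
    rw [continuous_iff_continuousAt]
    intro p
    by_cases hp : m p = 0
    · have h0 : shift (A p) (B p) (μ p) (ℓ p) = 0 := by rw [hAB p hp, shift_self]
      unfold ContinuousAt
      simp only [h0]
      refine squeeze_zero_norm (a := fun q => |B q - A q|) (fun q => ?_) ?_
      · exact abs_shift_le (hμ0 q) fun h => hAB q (hμz q h)
      · have := ((hB.sub hA).abs).tendsto p
        simpa [hAB p hp] using this
    · have hpos : 0 < μ p := div_pos (lt_of_le_of_ne (hm0 p) (Ne.symm hp)) hen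
      have c1 : Continuous fun p => min (A p) (B p) - μ p := (hA.min hB).sub hμc
      have c2 : Continuous fun p => max (A p) (B p) + μ p := (hA.max hB).add hμc
      unfold shift
      refine (hB.sub hA).continuousAt.mul (Tendsto.max tendsto_const_nhds (Tendsto.min ?_ ?_))
      · refine (ℓ.continuous.sub c1).continuousAt.div (hA.sub c1).continuousAt ?_
        have := min_le_left (A p) (B p)
        simp only [ne_eq]
        intro h; linarith
      · refine (c2.sub ℓ.continuous).continuousAt.div (c2.sub hA).continuousAt ?_
        have := le_max_left (A p) (B p)
        simp only [ne_eq]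
        intro h; linarith
  let d : E3 → ℝ := fun p => shift (g0 p) (G p) (μ p) (ℓ p)
  let d' : E3 → ℝ := fun p => shift (G p) (g0 p) (μ p) (ℓ p)
  have hl : ∀ p (t : ℝ), ℓ (p + t • e) = ℓ p + t := by
    intro p t; simp [he]
  have hμi : ∀ p (t : ℝ), μ (p + t • e) = μ p := by intro p t; simp only [μ, hmi]
  have hiso := isoE_of_shift e d d' (hshiftc _ _ hg0 hGc hGm)
    (hshiftc _ _ hGc hg0 fun p h => (hGm p h).symm)
    (fun p => by
      simp only [d', d, hl, hGi, i0, hμi]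
      exact shift_shift (hμ0 p) (fun h => hGm p (hμz p h)) _)
    (fun p => by
      simp only [d', d, hl, hGi, i0, hμi]
      exact shift_shift (hμ0 p) (fun h => (hGm p (hμz p h)).symm) _)
    C (fun p => by
      refine (abs_shift_le (hμ0 p) fun h => hGm p (hμz p h)).trans ?_
      rw [abs_of_nonneg (by linarith [(hGle p).1])]
      linarith [(hGle p).2, hC p])
    (R ∪ {p | κ p = 0 ∧ ℓ p = g0 p})
  refine hiso.trans (IsoE.of_eq ?_)
  rw [image_union]
  have hfix : ∀ p ∈ R, d p = 0 := by
    intro p hp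
    by_cases hm : m p = 0
    · simp only [d, hGm p hm, shift_self]
    have hmpos : 0 < m p := lt_of_le_of_ne (hm0 p) (Ne.symm hm)
    have hpos : 0 < μ p := div_pos hmpos hen
    by_contra hd
    have hlo : min (g0 p) (G p) - μ p < ℓ p := by
      by_contra h
      exact hd (shift_eq_zero_of_le hpos (not_lt.1 h))
    have hhi : ℓ p < max (g0 p) (G p) + μ p := by
      by_contra h
      exact hd (shift_eq_zero_of_ge hpos (not_lt.1 h))
    rw [min_eq_left (hGle p).1] at hlo
    rw [max_eq_right (hGle p).1] at hhi
    -- The nearest point of the swept segment is closer than `m p`, which is absurd.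
    have key : ∃ t ∈ Icc (0 : ℝ) 1, |g0 p + t * (g1 p - g0 p) - ℓ p| ≤ μ p := by
      rcases le_total (ℓ p) (g0 p) with h | h
      · exact ⟨0, by simp, by rw [abs_le]; constructor <;> linarith⟩
      rcases le_total (g1 p) (ℓ p) with h' | h'
      · refine ⟨1, by simp, ?_⟩
        have := (hGle p).2
        rw [abs_le]; constructor <;> linarith
      · rcases (hle p).eq_or_lt with h'' | h''
        · refine ⟨0, by simp, ?_⟩
          rw [abs_le]; constructor <;> linarith
        · have hpos' : 0 < g1 p - g0 p := by linarith
          refine ⟨(ℓ p - g0 p) / (g1 p - g0 p),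
            ⟨div_nonneg (by linarith) hpos'.le, (div_le_one hpos').2 (by linarith)⟩, ?_⟩
          rw [div_mul_cancel₀ _ hpos'.ne']
          simp [hpos.le]
    obtain ⟨t, ht, hlt⟩ := key
    have h1 := hm_le p t ht
    have h2 := hρd p hp (pt p t)
    have h3 : dist (pt p t) p ≤ μ p * ‖e‖ := by
      simp only [pt]
      rw [dist_eq_norm, add_sub_cancel_left, norm_smul]
      exact mul_le_mul_of_nonneg_right hlt (norm_nonneg _)
    have h4 : μ p * (2 * (‖e‖ + 1)) = m p := div_mul_cancel₀ _ hen.ne'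
    nlinarith [norm_nonneg e]
  congr 1
  · ext p
    constructor
    · rintro ⟨q, hq, rfl⟩
      simpa only [hfix q hq, zero_smul, add_zero] using hq
    · intro hp
      exact ⟨p, hp, by simp only [hfix p hp, zero_smul, add_zero]⟩
  · have hdg : ∀ p, ℓ p = g0 p → d p = G p - g0 p := by
      intro p hp
      simp only [d, hp]
      exact shift_at (hμ0 p) fun h => hGm p (hμz p h)
    ext p
    constructor
    · rintro ⟨q, ⟨hq1, hq2⟩, rfl⟩
      refine ⟨by simp only [iκ]; exact hq1, ?_⟩
      simp only [hl, i1, hdg q hq2, hq2, hG1 q hq1]; ring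
    · rintro ⟨hp1, hp2⟩
      have hl' : ℓ (p + (g0 p - ℓ p) • e) = g0 (p + (g0 p - ℓ p) • e) := by
        rw [hl, i0]; ring
      refine ⟨p + (g0 p - ℓ p) • e, ⟨by rw [iκ]; exact hp1, hl'⟩, ?_⟩
      beta_reduce
      rw [hdg _ hl', hGi, i0, hG1 p hp1, hp2, add_assoc, ← add_smul]
      simp

/-- The triangle move: an edge of a link may be replaced by the two other sides of a triangle that
meets the rest of the link at most in the end points of the edge. The hypothesis `hD` says that the
projection of the triangle to some coordinate plane is not degenerate. -/
theorem triangle_move (A B C : E3) (i j : Fin 3)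
    (hD : (B i - A i) * (C j - A j) - (B j - A j) * (C i - A i) ≠ 0) (R : Set E3) (hR : IsClosed R)
    (hcl : ∀ α β γ : ℝ, 0 ≤ α → 0 ≤ β → 0 ≤ γ → α + β + γ = 1 → α • A + β • B + γ • C ∈ R →
      γ = 0 ∧ (α = 0 ∨ β = 0)) :
    IsoE (R ∪ segment ℝ A B) (R ∪ (segment ℝ A C ∪ segment ℝ C B)) := by
  set v : E3 := B - A with hv
  set e : E3 := C - (1 / 2 : ℝ) • (A + B) with he
  set D : ℝ := v i * e j - v j * e i with hDdef
  have hD' : D ≠ 0 := by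
    have : D = (B i - A i) * (C j - A j) - (B j - A j) * (C i - A i) := by
      simp only [hDdef, hv, he, PiLp.sub_apply, PiLp.smul_apply, PiLp.add_apply, smul_eq_mul]
      ring
    rwa [this]
  let P : Fin 3 → (E3 →L[ℝ] ℝ) := fun k => EuclideanSpace.proj k
  let ℓ : E3 →L[ℝ] ℝ := D⁻¹ • (v i • P j - v j • P i)
  let ξ : E3 →L[ℝ] ℝ := D⁻¹ • (e j • P i - e i • P j)
  have hℓ : ∀ p : E3, ℓ p = D⁻¹ * (v i * p j - v j * p i) := fun p => rfl
  have hξ : ∀ p : E3, ξ p = D⁻¹ * (e j * p i - e i * p j) := fun p => rfl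
  have hℓe : ℓ e = 1 := by rw [hℓ, ← hDdef, inv_mul_cancel₀ hD']
  have hℓv : ℓ v = 0 := by rw [hℓ]; ring
  have hξe : ξ e = 0 := by rw [hξ]; ring
  have hξv : ξ v = 1 := by
    rw [hξ, show e j * v i - e i * v j = D by rw [hDdef]; ring, inv_mul_cancel₀ hD']
  let κ : E3 → ℝ := fun p => ‖(p - A) - ξ (p - A) • v - ℓ (p - A) • e‖ +
    (max 0 (-ξ (p - A)) + max 0 (ξ (p - A) - 1))
  let tent : E3 → ℝ := fun p => ℓ A + max 0 (1 - |2 * ξ (p - A) - 1|)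
  have hshift : ∀ (p : E3) (t : ℝ), p + t • e - A = (p - A) + t • e := fun p t => by abel
  have hξs : ∀ (p : E3) (t : ℝ), ξ (p + t • e - A) = ξ (p - A) := by
    intro p t; rw [hshift, map_add, map_smul, hξe, smul_zero, add_zero]
  have hℓs : ∀ (p : E3) (t : ℝ), ℓ (p + t • e - A) = ℓ (p - A) + t := by
    intro p t; rw [hshift, map_add, map_smul, hℓe, smul_eq_mul, mul_one]
  have hform : ∀ x u : ℝ, ξ (A + x • v + u • e - A) = x ∧ ℓ (A + x • v + u • e - A) = u := by
    intro x u
    rw [show A + x • v + u • e - A = x • v + u • e by abel]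
    simp [hξe, hξv, hℓe, hℓv]
  have hκ : ∀ p, κ p = 0 ↔ ∃ x u : ℝ, 0 ≤ x ∧ x ≤ 1 ∧ p = A + x • v + u • e := by
    intro p
    constructor
    · intro h
      have a1 := norm_nonneg ((p - A) - ξ (p - A) • v - ℓ (p - A) • e)
      have a2 := le_max_left 0 (-ξ (p - A))
      have a3 := le_max_left 0 (ξ (p - A) - 1)
      have a4 := le_max_right 0 (-ξ (p - A))
      have a5 := le_max_right 0 (ξ (p - A) - 1)
      simp only [κ] at h
      have h0 : ‖(p - A) - ξ (p - A) • v - ℓ (p - A) • e‖ = 0 := by linarith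
      refine ⟨ξ (p - A), ℓ (p - A), by linarith, by linarith, ?_⟩
      have h1 := norm_eq_zero.1 h0
      rw [sub_sub, sub_sub, sub_eq_zero] at h1
      rw [add_assoc]
      exact h1
    · rintro ⟨x, u, hx0, hx1, rfl⟩
      simp only [κ, (hform x u).1, (hform x u).2]
      rw [max_eq_left (by linarith), max_eq_left (by linarith),
        show A + x • v + u • e - A - x • v - u • e = 0 by abel, norm_zero]
      ring
  have hbary : ∀ x u : ℝ, A + x • v + u • e =
      (1 - x - u / 2) • A + (x - u / 2) • B + u • C := by
    intro x u
    rw [hv, he]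
    module
  have key := sweep ℓ e hℓe (fun _ => ℓ A) tent κ continuous_const (by fun_prop) (by fun_prop)
    (fun _ _ => rfl) (fun p t => by simp only [tent, hξs])
    (fun p t => by
      simp only [κ, hξs, hℓs]
      rw [hshift, add_smul, show p - A + t • e - ξ (p - A) • v - (ℓ (p - A) • e + t • e) =
        p - A - ξ (p - A) • v - ℓ (p - A) • e by abel])
    (fun p => by positivity) (fun p => by simp [tent]) 1
    (fun p => by
      simp only [tent, add_sub_cancel_left]
      exact max_le zero_le_one (by linarith [abs_nonneg (2 * ξ (p - A) - 1)]))
    R hR (fun p hp hk h0 h1 => by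
      obtain ⟨x, u, hx0, hx1, rfl⟩ := (hκ p).1 hk
      have e1 : ℓ (A + x • v + u • e) = ℓ A + u := by simp [hℓv, hℓe]
      simp only [tent, (hform x u).1, e1] at h0 h1 ⊢
      have hu0 : 0 ≤ u := by linarith
      have b1 := le_abs_self (2 * x - 1)
      have b2 := neg_abs_le (2 * x - 1)
      have hu1 : u ≤ 2 * x ∧ u ≤ 2 - 2 * x := by
        rcases max_cases 0 (1 - |2 * x - 1|) with ⟨hm, -⟩ | ⟨hm, -⟩ <;> rw [hm] at h1 <;>
          constructor <;> linarith
      rw [hbary] at hp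
      obtain ⟨c0, c1⟩ := hcl _ _ _ (by linarith) (by linarith) hu0 (by ring) hp
      rcases c1 with c1 | c1
      · have : x = 1 := by linarith
        subst this; norm_num
      · have : x = 0 := by linarith
        subst this; norm_num)
  have hseg0 : {p | κ p = 0 ∧ ℓ p = ℓ A} = segment ℝ A B := by
    ext p
    rw [segment_eq_image']
    constructor
    · rintro ⟨hk, hl⟩
      obtain ⟨x, u, hx0, hx1, rfl⟩ := (hκ p).1 hk
      have e1 : ℓ (A + x • v + u • e) = ℓ A + u := by simp [hℓv, hℓe]
      have : u = 0 := by linarith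
      exact ⟨x, ⟨hx0, hx1⟩, by simp [this, hv]⟩
    · rintro ⟨x, ⟨hx0, hx1⟩, rfl⟩
      refine ⟨(hκ _).2 ⟨x, 0, hx0, hx1, by simp [hv]⟩, ?_⟩
      rw [← hv]; simp [hℓv]
  have hseg1 : {p | κ p = 0 ∧ ℓ p = tent p} = segment ℝ A C ∪ segment ℝ C B := by
    ext p
    rw [segment_eq_image', segment_eq_image']
    constructor
    · rintro ⟨hk, hl⟩
      obtain ⟨x, u, hx0, hx1, rfl⟩ := (hκ p).1 hk
      have e1 : ℓ (A + x • v + u • e) = ℓ A + u := by simp [hℓv, hℓe]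
      simp only [tent, (hform x u).1, e1] at hl
      rcases le_total x (1 / 2) with hx | hx
      · left
        rw [abs_of_nonpos (by linarith), max_eq_right (by linarith)] at hl
        have : u = 2 * x := by linarith
        refine ⟨2 * x, ⟨by linarith, by linarith⟩, ?_⟩
        simp only [this, hbary]
        module
      · right
        rw [abs_of_nonneg (by linarith), max_eq_right (by linarith)] at hl
        have : u = 2 - 2 * x := by linarith
        refine ⟨2 * x - 1, ⟨by linarith, by linarith⟩, ?_⟩
        simp only [this, hbary]
        module
    · rintro (⟨s, ⟨hs0, hs1⟩, rfl⟩ | ⟨s, ⟨hs0, hs1⟩, rfl⟩)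
      · have hp : A + s • (C - A) = A + (s / 2) • v + s • e := by rw [hbary]; module
        beta_reduce
        rw [hp]
        refine ⟨(hκ _).2 ⟨s / 2, s, by linarith, by linarith, rfl⟩, ?_⟩
        simp only [tent, (hform (s / 2) s).1]
        rw [abs_of_nonpos (by linarith), max_eq_right (by linarith)]
        simp [hℓv, hℓe]; ring
      · have hp : C + s • (B - C) = A + ((1 + s) / 2) • v + (1 - s) • e := by rw [hbary]; module
        beta_reduce
        rw [hp]
        refine ⟨(hκ _).2 ⟨(1 + s) / 2, 1 - s, by linarith, by linarith, rfl⟩, ?_⟩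
        simp only [tent, (hform ((1 + s) / 2) (1 - s)).1]
        rw [abs_of_nonneg (by linarith), max_eq_right (by linarith)]
        simp [hℓv, hℓe]; ring
  rw [hseg0, hseg1] at key
  exact key

/-! ### Polygonal pieces of links -/

/-- The point of three-space with the given coordinates. -/
noncomputable def pt (x y z : ℝ) : E3 := !₂[x, y, z]

@[simp] theorem pt_zero (x y z : ℝ) : pt x y z 0 = x := rfl
@[simp] theorem pt_one (x y z : ℝ) : pt x y z 1 = y := rfl
@[simp] theorem pt_two (x y z : ℝ) : pt x y z 2 = z := rfl

theorem ext_pt {p q : E3} (h0 : p 0 = q 0) (h1 : p 1 = q 1) (h2 : p 2 = q 2) : p = q := by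
  ext i
  fin_cases i
  · exact h0
  · exact h1
  · exact h2

theorem pt_add (x y z x' y' z' : ℝ) : pt x y z + pt x' y' z' = pt (x + x') (y + y') (z + z') :=
  ext_pt rfl rfl rfl

theorem mem_segment_iff {A B p : E3} : p ∈ segment ℝ A B ↔ ∃ s t : ℝ, 0 ≤ s ∧ 0 ≤ t ∧ s + t = 1 ∧
    p 0 = s * A 0 + t * B 0 ∧ p 1 = s * A 1 + t * B 1 ∧ p 2 = s * A 2 + t * B 2 := by
  constructor
  · rintro ⟨s, t, hs, ht, h, rfl⟩
    exact ⟨s, t, hs, ht, h, rfl, rfl, rfl⟩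
  · rintro ⟨s, t, hs, ht, h, h0, h1, h2⟩
    exact ⟨s, t, hs, ht, h, ext_pt h0.symm h1.symm h2.symm⟩

/-- The union of the segments whose end points are listed. -/
def poly (l : List (E3 × E3)) : Set E3 := {p | ∃ e ∈ l, p ∈ segment ℝ e.1 e.2}

@[simp] theorem poly_nil : poly [] = ∅ := by ext; simp [poly]

@[simp] theorem poly_cons (e : E3 × E3) (l : List (E3 × E3)) :
    poly (e :: l) = segment ℝ e.1 e.2 ∪ poly l := by
  ext p; simp [poly]

@[simp] theorem poly_append (l l' : List (E3 × E3)) : poly (l ++ l') = poly l ∪ poly l' := by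
  induction l with
  | nil => simp
  | cons e l ih => rw [List.cons_append, poly_cons, poly_cons, ih, union_assoc]

theorem isCompact_segment (A B : E3) : IsCompact (segment ℝ A B) := by
  rw [segment_eq_image]
  exact isCompact_Icc.image (by fun_prop)

theorem isCompact_poly (l : List (E3 × E3)) : IsCompact (poly l) := by
  induction l with
  | nil => simp
  | cons e l ih => rw [poly_cons]; exact (isCompact_segment _ _).union ih

/-- Two lists of segments that agree up to order, repetition and the direction of the segments. -/
def SameEdges (l l' : List (E3 × E3)) : Prop :=
  (∀ e ∈ l, e ∈ l' ∨ e.swap ∈ l') ∧ ∀ e ∈ l', e ∈ l ∨ e.swap ∈ l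

theorem poly_subset_of_edges {l l' : List (E3 × E3)} (h : ∀ e ∈ l, e ∈ l' ∨ e.swap ∈ l') :
    poly l ⊆ poly l' := by
  rintro p ⟨e, he, hp⟩
  rcases h e he with h | h
  · exact ⟨e, h, hp⟩
  · exact ⟨_, h, by rw [segment_symm]; exact hp⟩

theorem SameEdges.poly_eq {l l' : List (E3 × E3)} (h : SameEdges l l') : poly l = poly l' :=
  Subset.antisymm (poly_subset_of_edges h.1) (poly_subset_of_edges h.2)

/-- The translation of three-space by `c`. -/
noncomputable def tr (c : E3) : E3 ≃ᵢ E3 := IsometryEquiv.addLeft c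

@[simp] theorem tr_apply (c p : E3) : tr c p = c + p := rfl

theorem mem_tr_image {c p : E3} {X : Set E3} : p ∈ tr c '' X ↔ p - c ∈ X := by
  constructor
  · rintro ⟨q, hq, rfl⟩; simpa using hq
  · intro h; exact ⟨_, h, by simp⟩

theorem tr_image_poly (c : E3) (l : List (E3 × E3)) :
    tr c '' poly l = poly (l.map fun e => (c + e.1, c + e.2)) := by
  induction l with
  | nil => simp
  | cons e l ih =>
    rw [List.map_cons, poly_cons, poly_cons, image_union, ih]
    congr 1
    exact segment_translate_image ℝ c e.1 e.2

/-! ### Local equivalence -/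

/-- `A` can be replaced by `A'` in every link whose remaining part is closed and meets the region
`Q` only in points of `P`. -/
def LocEq (Q P A A' : Set E3) : Prop :=
  ∀ R : Set E3, IsClosed R → R ∩ Q ⊆ P → IsoE (R ∪ A) (R ∪ A')

theorem LocEq.of_eq {Q P A A' : Set E3} (h : A = A') : LocEq Q P A A' :=
  fun _ _ _ => IsoE.of_eq (by rw [h])

theorem LocEq.symm {Q P A A' : Set E3} (h : LocEq Q P A A') : LocEq Q P A' A :=
  fun R hR hP => (h R hR hP).symm

theorem LocEq.trans {Q P A A' A'' : Set E3} (h : LocEq Q P A A') (h' : LocEq Q P A' A'') :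
    LocEq Q P A A'' := fun R hR hP => (h R hR hP).trans (h' R hR hP)

/-- The vertical column over a rectangle. -/
def box (x₀ x₁ y₀ y₁ : ℝ) : Set E3 := {p | x₀ ≤ p 0 ∧ p 0 ≤ x₁ ∧ y₀ ≤ p 1 ∧ p 1 ≤ y₁}

/-- The triangle `ABC` meets the segment `e` at most in `A` or `B`. -/
def Clear (A B C : E3) (e : E3 × E3) : Prop :=
  ∀ α β γ s t : ℝ, 0 ≤ α → 0 ≤ β → 0 ≤ γ → 0 ≤ s → 0 ≤ t → α + β + γ = 1 → s + t = 1 →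
    α * A 0 + β * B 0 + γ * C 0 = s * e.1 0 + t * e.2 0 →
    α * A 1 + β * B 1 + γ * C 1 = s * e.1 1 + t * e.2 1 →
    α * A 2 + β * B 2 + γ * C 2 = s * e.1 2 + t * e.2 2 → γ = 0 ∧ (α = 0 ∨ β = 0)

/-- The triangle move inside a rectangle. The remaining part of the link consists of the segments
`l` and of a set that meets the rectangle only in the points `P`. -/
theorem LocEq.tri {x₀ x₁ y₀ y₁ : ℝ} {P : List E3} (A B C : E3) (l : List (E3 × E3)) (i j : Fin 3)
    (hD : (B i - A i) * (C j - A j) - (B j - A j) * (C i - A i) ≠ 0)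
    (hA : A ∈ box x₀ x₁ y₀ y₁) (hB : B ∈ box x₀ x₁ y₀ y₁) (hC : C ∈ box x₀ x₁ y₀ y₁)
    (hP : ∀ q ∈ P, Clear A B C (q, q)) (hl : ∀ e ∈ l, Clear A B C e) :
    LocEq (box x₀ x₁ y₀ y₁) {q | q ∈ P} (poly ((A, B) :: l)) (poly ((A, C) :: (C, B) :: l)) := by
  intro R hR hRP
  have h := triangle_move A B C i j hD (R ∪ poly l) (hR.union (isCompact_poly l).isClosed) ?_
  · simp only [poly_cons]
    convert h using 1
    · rw [union_assoc, union_comm (poly l)]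
    · rw [union_assoc, union_comm (poly l), union_assoc]
  · intro α β γ hα hβ hγ h1 hmem
    rcases hmem with hmem | ⟨e, he, hmem⟩
    · have hq : α • A + β • B + γ • C ∈ box x₀ x₁ y₀ y₁ := by
        obtain ⟨a1, a2, a3, a4⟩ := hA
        obtain ⟨b1, b2, b3, b4⟩ := hB
        obtain ⟨c1, c2, c3, c4⟩ := hC
        have lo : ∀ {x a b c : ℝ}, x ≤ a → x ≤ b → x ≤ c → x ≤ α * a + β * b + γ * c := by
          intro x a b c ha hb hc
          calc x = α * x + β * x + γ * x := by rw [← add_mul, ← add_mul, h1, one_mul]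
            _ ≤ _ := by gcongr
        have hi : ∀ {x a b c : ℝ}, a ≤ x → b ≤ x → c ≤ x → α * a + β * b + γ * c ≤ x := by
          intro x a b c ha hb hc
          calc α * a + β * b + γ * c ≤ α * x + β * x + γ * x := by gcongr
            _ = x := by rw [← add_mul, ← add_mul, h1, one_mul]
        exact ⟨lo a1 b1 c1, hi a2 b2 c2, lo a3 b3 c3, hi a4 b4 c4⟩
      exact hP _ (hRP ⟨hmem, hq⟩) α β γ 1 0 hα hβ hγ zero_le_one le_rfl h1 (by ring)
        (by simp) (by simp) (by simp)
    · obtain ⟨s, t, hs, ht, hst, h0, h1', h2⟩ := mem_segment_iff.1 hmem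
      exact hl e he α β γ s t hα hβ hγ hs ht h1 hst h0 h1' h2

/-- A chain of local equivalences starts by pushing the edge `AB` across a triangle. -/
theorem LocEq.add {x₀ x₁ y₀ y₁ : ℝ} {P : List E3} {l₁ l₂ : List (E3 × E3)} (A B C : E3)
    (l : List (E3 × E3)) (i j : Fin 3) (hs : SameEdges l₁ ((A, B) :: l))
    (hD : (B i - A i) * (C j - A j) - (B j - A j) * (C i - A i) ≠ 0)
    (hA : A ∈ box x₀ x₁ y₀ y₁) (hB : B ∈ box x₀ x₁ y₀ y₁) (hC : C ∈ box x₀ x₁ y₀ y₁)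
    (hP : P.Forall fun q => Clear A B C (q, q)) (hl : l.Forall fun e => Clear A B C e)
    (h : LocEq (box x₀ x₁ y₀ y₁) {q | q ∈ P} (poly ((A, C) :: (C, B) :: l)) (poly l₂)) :
    LocEq (box x₀ x₁ y₀ y₁) {q | q ∈ P} (poly l₁) (poly l₂) := by
  rw [hs.poly_eq]
  exact (LocEq.tri A B C l i j hD hA hB hC (List.forall_iff_forall_mem.1 hP)
    (List.forall_iff_forall_mem.1 hl)).trans h

/-- A chain of local equivalences starts by pushing the path `ACB` across a triangle. -/
theorem LocEq.del {x₀ x₁ y₀ y₁ : ℝ} {P : List E3} {l₁ l₂ : List (E3 × E3)} (A B C : E3)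
    (l : List (E3 × E3)) (i j : Fin 3) (hs : SameEdges l₁ ((A, C) :: (C, B) :: l))
    (hD : (B i - A i) * (C j - A j) - (B j - A j) * (C i - A i) ≠ 0)
    (hA : A ∈ box x₀ x₁ y₀ y₁) (hB : B ∈ box x₀ x₁ y₀ y₁) (hC : C ∈ box x₀ x₁ y₀ y₁)
    (hP : P.Forall fun q => Clear A B C (q, q)) (hl : l.Forall fun e => Clear A B C e)
    (h : LocEq (box x₀ x₁ y₀ y₁) {q | q ∈ P} (poly ((A, B) :: l)) (poly l₂)) :
    LocEq (box x₀ x₁ y₀ y₁) {q | q ∈ P} (poly l₁) (poly l₂) := by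
  rw [hs.poly_eq]
  exact (LocEq.tri A B C l i j hD hA hB hC (List.forall_iff_forall_mem.1 hP)
    (List.forall_iff_forall_mem.1 hl)).symm.trans h

theorem LocEq.done {Q P : Set E3} {l₁ l₂ : List (E3 × E3)} (hs : SameEdges l₁ l₂) :
    LocEq Q P (poly l₁) (poly l₂) := LocEq.of_eq hs.poly_eq

/-- A vertex in the interior of a straight edge can be inserted. -/
theorem LocEq.split {Q P : Set E3} (A B C : E3) (l : List (E3 × E3)) (t : ℝ) (h0 : 0 ≤ t)
    (h1 : t ≤ 1) (e0 : C 0 = (1 - t) * A 0 + t * B 0) (e1 : C 1 = (1 - t) * A 1 + t * B 1)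
    (e2 : C 2 = (1 - t) * A 2 + t * B 2) :
    LocEq Q P (poly ((A, B) :: l)) (poly ((A, C) :: (C, B) :: l)) := by
  refine LocEq.of_eq ?_
  simp only [poly_cons, ← union_assoc]
  congr 1
  have hC : C = AffineMap.lineMap A B t := by
    refine ext_pt ?_ ?_ ?_ <;> simp [AffineMap.lineMap_apply, e0, e1, e2] <;> ring
  have hmem : C ∈ segment ℝ A B := mem_segment_iff.2 ⟨1 - t, t, by linarith, h0, by ring, e0, e1,
      e2⟩
  refine Subset.antisymm ?_ (union_subset ?_ ?_)
  · intro p hp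
    obtain ⟨s, u, hs, hu, hsu, p0, p1, p2⟩ := mem_segment_iff.1 hp
    rcases le_total u t with h | h
    · left
      rcases h0.eq_or_lt with ht | ht
      · have : u = 0 := by linarith
        have hp : p = A := by
          have : s = 1 := by linarith
          subst this; subst ‹u = 0›
          exact ext_pt (by linarith) (by linarith) (by linarith)
        rw [hp]; exact left_mem_segment ℝ _ _
      · refine mem_segment_iff.2 ⟨1 - u / t, u / t, ?_, by positivity, by ring, ?_, ?_, ?_⟩
        · rw [sub_nonneg, div_le_one ht]; exact h
        · rw [p0, e0, ← hsu]
          have : s = 1 - u := by linarith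
          subst this; field_simp; ring
        · rw [p1, e1]
          have : s = 1 - u := by linarith
          subst this; field_simp; ring
        · rw [p2, e2]
          have : s = 1 - u := by linarith
          subst this; field_simp; ring
    · right
      rcases h1.eq_or_lt with ht | ht
      · have hp : p = B := by
          have h2 : u = 1 := by linarith
          have h3 : s = 0 := by linarith
          subst h2; subst h3
          exact ext_pt (by linarith) (by linarith) (by linarith)
        rw [hp]; exact right_mem_segment ℝ _ _
      · have ht' : 0 < 1 - t := by linarith
        have hs' : s = 1 - u := by linarith
        subst hs'
        refine mem_segment_iff.2 ⟨(1 - u) / (1 - t), 1 - (1 - u) / (1 - t), by positivity, ?_,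
          by ring, ?_, ?_, ?_⟩
        · rw [sub_nonneg, div_le_one ht']; linarith
        · rw [p0, e0]; field_simp; ring
        · rw [p1, e1]; field_simp; ring
        · rw [p2, e2]; field_simp; ring
  · exact (convex_segment A B).segment_subset (left_mem_segment ℝ A B) hmem
  · exact (convex_segment A B).segment_subset hmem (right_mem_segment ℝ A B)

/-- A chain of local equivalences starts by inserting a vertex in a straight edge. -/
theorem LocEq.addMid {Q P : Set E3} {l₁ l₂ : List (E3 × E3)} (A B C : E3) (l : List (E3 × E3))
    (t : ℝ) (hs : SameEdges l₁ ((A, B) :: l)) (h0 : 0 ≤ t) (h1 : t ≤ 1)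
    (e0 : C 0 = (1 - t) * A 0 + t * B 0) (e1 : C 1 = (1 - t) * A 1 + t * B 1)
    (e2 : C 2 = (1 - t) * A 2 + t * B 2)
    (h : LocEq Q P (poly ((A, C) :: (C, B) :: l)) (poly l₂)) : LocEq Q P (poly l₁) (poly l₂) := by
  rw [hs.poly_eq]
  exact (LocEq.split A B C l t h0 h1 e0 e1 e2).trans h

/-- A chain of local equivalences starts by removing a vertex at which the link is straight. -/
theorem LocEq.delMid {Q P : Set E3} {l₁ l₂ : List (E3 × E3)} (A B C : E3) (l : List (E3 × E3))
    (t : ℝ) (hs : SameEdges l₁ ((A, C) :: (C, B) :: l)) (h0 : 0 ≤ t) (h1 : t ≤ 1)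
    (e0 : C 0 = (1 - t) * A 0 + t * B 0) (e1 : C 1 = (1 - t) * A 1 + t * B 1)
    (e2 : C 2 = (1 - t) * A 2 + t * B 2)
    (h : LocEq Q P (poly ((A, B) :: l)) (poly l₂)) : LocEq Q P (poly l₁) (poly l₂) := by
  rw [hs.poly_eq]
  exact (LocEq.split A B C l t h0 h1 e0 e1 e2).symm.trans h

/-! ### Tiles as polygons -/

/-- The edge with the given side is crossed by a curve of the tile. -/
def Tile.conn (t : Tile) (s : Side) : Bool :=
  t.strands.any fun p => decide (s = p.1) || decide (s = p.2)

theorem Tile.connectsAt_iff (t : Tile) (s : Side) : t.ConnectsAt s ↔ t.conn s = true := by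
  simp [Tile.ConnectsAt, Tile.conn]

/-- The segments of which the curves on a tile consist. -/
noncomputable def Tile.edges : Tile → List (E3 × E3)
  | .blank => []
  | .arcLeftBottom => [(pt (-1 / 2) 0 0, pt 0 (-1 / 2) 0)]
  | .arcRightBottom => [(pt (1 / 2) 0 0, pt 0 (-1 / 2) 0)]
  | .arcTopRight => [(pt 0 (1 / 2) 0, pt (1 / 2) 0 0)]
  | .arcTopLeft => [(pt 0 (1 / 2) 0, pt (-1 / 2) 0 0)]
  | .horizontal => [(pt (-1 / 2) 0 0, pt (1 / 2) 0 0)]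
  | .vertical => [(pt 0 (1 / 2) 0, pt 0 (-1 / 2) 0)]
  | .arcsLeftBottomTopRight =>
      [(pt (-1 / 2) 0 0, pt 0 (-1 / 2) 0), (pt 0 (1 / 2) 0, pt (1 / 2) 0 0)]
  | .arcsRightBottomTopLeft =>
      [(pt (1 / 2) 0 0, pt 0 (-1 / 2) 0), (pt 0 (1 / 2) 0, pt (-1 / 2) 0 0)]
  | .crossingHorizontalOver =>
      [(pt (-1 / 2) 0 0, pt 0 0 1), (pt 0 0 1, pt (1 / 2) 0 0), (pt 0 (1 / 2) 0, pt 0 (-1 / 2) 0)]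
  | .crossingVerticalOver =>
      [(pt 0 (1 / 2) 0, pt 0 0 1), (pt 0 0 1, pt 0 (-1 / 2) 0), (pt (-1 / 2) 0 0, pt (1 / 2) 0 0)]

theorem Tile.curve_eq (t : Tile) : t.curve = poly t.edges := by
  cases t <;>
    simp [Tile.curve, Tile.strands, Tile.edges, chord, bridge, Side.midpoint, pt, union_assoc]

/-- A subset of the unit cell centred at the origin that meets the boundary of the cell only in the
midpoints of the sides selected by `c`. -/
def Framed (X : Set E3) (c : Side → Bool) : Prop :=
  ∀ p ∈ X, (-1 / 2 ≤ p 0 ∧ p 0 ≤ 1 / 2) ∧ (-1 / 2 ≤ p 1 ∧ p 1 ≤ 1 / 2) ∧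
    (p 0 = -1 / 2 → p 1 = 0 ∧ p 2 = 0 ∧ c .left = true) ∧
    (p 0 = 1 / 2 → p 1 = 0 ∧ p 2 = 0 ∧ c .right = true) ∧
    (p 1 = 1 / 2 → p 0 = 0 ∧ p 2 = 0 ∧ c .top = true) ∧
    (p 1 = -1 / 2 → p 0 = 0 ∧ p 2 = 0 ∧ c .bottom = true)

theorem Tile.framed (t : Tile) : Framed t.curve t.conn := by
  intro p hp
  rw [Tile.curve_eq] at hp
  obtain ⟨e, he, hp⟩ := hp
  obtain ⟨s, u, hs, hu, h1, h2, h3, h4⟩ := mem_segment_iff.1 hp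
  cases t <;> simp only [Tile.edges, List.mem_cons, List.not_mem_nil, or_false] at he
  all_goals
    try rcases he with rfl | rfl | rfl
    try rcases he with rfl | rfl
    try subst he
  all_goals
    simp only [pt_zero, pt_one, pt_two] at h2 h3 h4
    refine ⟨⟨by linarith, by linarith⟩, ⟨by linarith, by linarith⟩, ?_, ?_, ?_, ?_⟩
  all_goals
    intro h
    first
    | (exfalso; linarith)
    | exact ⟨by linarith, by linarith, rfl⟩

/-! ### Grids -/

/-- The union of a family of pieces, the piece with index `(i, j)` being placed in the cell with
centre `(j, -i)`. -/
def cells (X : ℤ → ℤ → Set E3) (S : Set (ℤ × ℤ)) : Set E3 :=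
  {p | ∃ i j : ℤ, (i, j) ∈ S ∧ p - pt j (-i) 0 ∈ X i j}

theorem cells_union (X : ℤ → ℤ → Set E3) (S S' : Set (ℤ × ℤ)) :
    cells X (S ∪ S') = cells X S ∪ cells X S' := by
  ext p
  constructor
  · rintro ⟨i, j, h | h, hp⟩
    · exact Or.inl ⟨i, j, h, hp⟩
    · exact Or.inr ⟨i, j, h, hp⟩
  · rintro (⟨i, j, h, hp⟩ | ⟨i, j, h, hp⟩)
    · exact ⟨i, j, Or.inl h, hp⟩
    · exact ⟨i, j, Or.inr h, hp⟩

theorem cells_singleton (X : ℤ → ℤ → Set E3) (i j : ℤ) :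
    cells X {(i, j)} = tr (pt j (-i) 0) '' X i j := by
  ext p
  rw [mem_tr_image]
  constructor
  · rintro ⟨i', j', h, hp⟩
    obtain ⟨rfl, rfl⟩ := Prod.mk.inj h
    exact hp
  · intro hp; exact ⟨i, j, rfl, hp⟩

theorem cells_congr {X X' : ℤ → ℤ → Set E3} {S : Set (ℤ × ℤ)}
    (h : ∀ i j, (i, j) ∈ S → X i j = X' i j) : cells X S = cells X' S := by
  ext p
  constructor
  · rintro ⟨i, j, hS, hp⟩; exact ⟨i, j, hS, h i j hS ▸ hp⟩
  · rintro ⟨i, j, hS, hp⟩; exact ⟨i, j, hS, (h i j hS).symm ▸ hp⟩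

theorem isCompact_cells {X : ℤ → ℤ → Set E3} (hX : ∀ i j, IsCompact (X i j))
    (hfin : {q : ℤ × ℤ | (X q.1 q.2).Nonempty}.Finite) (S : Set (ℤ × ℤ)) :
    IsCompact (cells X S) := by
  have : cells X S = ⋃ q ∈ {q : ℤ × ℤ | (X q.1 q.2).Nonempty} ∩ S,
      tr (pt q.2 (-q.1) 0) '' X q.1 q.2 := by
    ext p
    simp only [mem_iUnion, mem_tr_image, exists_prop]
    constructor
    · rintro ⟨i, j, hS, hp⟩; exact ⟨(i, j), ⟨⟨_, hp⟩, hS⟩, hp⟩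
    · rintro ⟨⟨i, j⟩, ⟨-, hS⟩, hp⟩; exact ⟨i, j, hS, hp⟩
  rw [this]
  exact (hfin.inter_of_left S).isCompact_biUnion fun q _ =>
    (hX _ _).image (tr _).continuous

/-- The rectangular block of cells with upper left cell `(s, a)`, consisting of `m + 1` rows and
`k + 1` columns. -/
def block (s a m k : ℤ) : Set (ℤ × ℤ) := {q | s ≤ q.1 ∧ q.1 ≤ s + m ∧ a ≤ q.2 ∧ q.2 ≤ a + k}

/-- The midpoints of boundary edges of a block at which an outer cell is allowed to have an end
point, in coordinates with origin at the centre of the upper left cell. -/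
def blockPts (c : ℤ → ℤ → Side → Bool) (s a m k : ℤ) : Set E3 :=
  {p | p 2 = 0 ∧
    ((∃ j : ℤ, 0 ≤ j ∧ j ≤ k ∧ p 0 = j ∧
      ((p 1 = 1 / 2 ∧ c (s - 1) (a + j) .bottom = true) ∨
        (p 1 = -m - 1 / 2 ∧ c (s + m + 1) (a + j) .top = true))) ∨
    (∃ i : ℤ, 0 ≤ i ∧ i ≤ m ∧ p 1 = -i ∧
      ((p 0 = -1 / 2 ∧ c (s + i) (a - 1) .right = true) ∨
        (p 0 = k + 1 / 2 ∧ c (s + i) (a + k + 1) .left = true))))}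

theorem cells_compl_block_inter {X : ℤ → ℤ → Set E3} {c : ℤ → ℤ → Side → Bool}
    (hF : ∀ i j, Framed (X i j) (c i j)) (s a m k : ℤ) (hm : 0 ≤ m) (hk : 0 ≤ k) {p : E3}
    (hp : p + pt a (-s) 0 ∈ cells X (block s a m k)ᶜ)
    (hQ : p ∈ box (-1 / 2) (k + 1 / 2) (-m - 1 / 2) (1 / 2)) : p ∈ blockPts c s a m k := by
  obtain ⟨i, j, hS, hX⟩ := hp
  obtain ⟨q1, q2, q3, q4⟩ := hQ
  obtain ⟨⟨f1, f2⟩, ⟨f3, f4⟩, fl, fr, ft, fb⟩ := hF i j _ hX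
  have e0 : (p + pt a (-s) 0 - pt j (-i) 0) 0 = p 0 + a - j := by simp
  have e1 : (p + pt a (-s) 0 - pt j (-i) 0) 1 = p 1 - s + i := by simp; ring
  have e2 : (p + pt a (-s) 0 - pt j (-i) 0) 2 = p 2 := by simp
  rw [e0] at f1 f2 fl fr ft fb
  rw [e1] at f3 f4 fl fr ft fb
  rw [e2] at fl fr ft fb
  have b1 : a - 1 ≤ j := by
    have : ((a - 1 : ℤ) : ℝ) ≤ j := by push_cast; linarith
    exact_mod_cast this
  have b2 : j ≤ a + k + 1 := by
    have : (j : ℝ) ≤ ((a + k + 1 : ℤ) : ℝ) := by push_cast; linarith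
    exact_mod_cast this
  have b3 : s - 1 ≤ i := by
    have : ((s - 1 : ℤ) : ℝ) ≤ i := by push_cast; linarith
    exact_mod_cast this
  have b4 : i ≤ s + m + 1 := by
    have : (i : ℝ) ≤ ((s + m + 1 : ℤ) : ℝ) := by push_cast; linarith
    exact_mod_cast this
  have hout : ¬ (s ≤ i ∧ i ≤ s + m ∧ a ≤ j ∧ j ≤ a + k) := hS
  by_cases hi0 : i = s - 1
  · subst hi0
    push_cast at f3 f4 fl fr ft fb
    obtain ⟨g0, g2, gc⟩ := fb (by linarith)
    have hj : p 0 = ((j - a : ℤ) : ℝ) := by push_cast; linarith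
    have h1 : ((-1 : ℤ) : ℝ) < ((j - a : ℤ) : ℝ) := by rw [← hj]; push_cast; linarith
    have h2 : ((j - a : ℤ) : ℝ) < ((k + 1 : ℤ) : ℝ) := by rw [← hj]; push_cast; linarith
    have h1' : -1 < j - a := by exact_mod_cast h1
    have h2' : j - a < k + 1 := by exact_mod_cast h2
    refine ⟨g2, Or.inl ⟨j - a, by omega, by omega, hj, Or.inl ⟨by linarith, ?_⟩⟩⟩
    rwa [add_sub_cancel]
  by_cases hi1 : i = s + m + 1
  · subst hi1
    push_cast at f3 f4 fl fr ft fb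
    obtain ⟨g0, g2, gc⟩ := ft (by linarith)
    have hj : p 0 = ((j - a : ℤ) : ℝ) := by push_cast; linarith
    have h1 : ((-1 : ℤ) : ℝ) < ((j - a : ℤ) : ℝ) := by rw [← hj]; push_cast; linarith
    have h2 : ((j - a : ℤ) : ℝ) < ((k + 1 : ℤ) : ℝ) := by rw [← hj]; push_cast; linarith
    have h1' : -1 < j - a := by exact_mod_cast h1
    have h2' : j - a < k + 1 := by exact_mod_cast h2
    refine ⟨g2, Or.inl ⟨j - a, by omega, by omega, hj, Or.inr ⟨by linarith, ?_⟩⟩⟩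
    rwa [add_sub_cancel]
  by_cases hj0 : j = a - 1
  · subst hj0
    push_cast at f1 f2 fl fr ft fb
    obtain ⟨g1, g2, gc⟩ := fr (by linarith)
    refine ⟨g2, Or.inr ⟨i - s, by omega, by omega, by push_cast; linarith,
      Or.inl ⟨by linarith, ?_⟩⟩⟩
    rwa [add_sub_cancel]
  · have hj1 : j = a + k + 1 := by omega
    subst hj1
    push_cast at f1 f2 fl fr ft fb
    obtain ⟨g1, g2, gc⟩ := fl (by linarith)
    refine ⟨g2, Or.inr ⟨i - s, by omega, by omega, by push_cast; linarith,
      Or.inr ⟨by linarith, ?_⟩⟩⟩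
    rwa [add_sub_cancel]

/-- A local equivalence can be applied to any block of cells. -/
theorem LocEq.block {X : ℤ → ℤ → Set E3} {c : ℤ → ℤ → Side → Bool}
    (hF : ∀ i j, Framed (X i j) (c i j)) (hX : ∀ i j, IsCompact (X i j))
    (hfin : {q : ℤ × ℤ | (X q.1 q.2).Nonempty}.Finite) (s a m k : ℤ) (hm : 0 ≤ m) (hk : 0 ≤ k)
    {P A A' : Set E3} (hP : blockPts c s a m k ⊆ P)
    (h : LocEq (box (-1 / 2) (k + 1 / 2) (-m - 1 / 2) (1 / 2)) P A A') :
    IsoE (cells X (block s a m k)ᶜ ∪ tr (pt a (-s) 0) '' A)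
      (cells X (block s a m k)ᶜ ∪ tr (pt a (-s) 0) '' A') := by
  set R := cells X (KnotMosaic.block s a m k)ᶜ with hR
  set R' := (tr (pt a (-s) 0)).symm '' R with hR'
  have hcl : IsClosed R' :=
    ((isCompact_cells hX hfin _).image (tr _).symm.continuous).isClosed
  have h1 := (h R' hcl ?_).image (tr (pt a (-s) 0))
  · have h2 : tr (pt a (-s) 0) '' R' = R := by
      rw [hR', ← image_comp]; simp
    rwa [image_union, image_union, h2] at h1
  · rintro p ⟨⟨q, hq, rfl⟩, hQ⟩
    refine hP (cells_compl_block_inter hF s a m k hm hk ?_ hQ)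
    have : (tr (pt a (-s) 0)).symm q + pt a (-s) 0 = q := by
      rw [add_comm]; exact (tr (pt a (-s) 0)).apply_symm_apply q
    rwa [this]

/-! ### Moving a vertical strand by one column -/

/-- The curves on two horizontally adjacent tiles, the left one centred at the origin. -/
noncomputable def pairEdges (t u : Tile) : List (E3 × E3) :=
  t.edges ++ u.edges.map fun e => (pt 1 0 0 + e.1, pt 1 0 0 + e.2)

/-- The pairs of adjacent tiles at which the motion of a vertical strand from the left to the right
tile can start, together with the pairs by which they are replaced: the strand that leaves the left
tile at the bottom leaves the right tile at the bottom instead. -/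
inductive LegStart : Tile → Tile → Tile → Tile → Prop
  | arcHorizontal : LegStart .arcRightBottom .horizontal .blank .arcRightBottom
  | verticalArc : LegStart .vertical .arcTopRight .arcTopRight .arcsLeftBottomTopRight

/-- The pairs of adjacent tiles that the moved strand runs through from top to bottom. The motion
interchanges the two tiles. -/
inductive LegMid : Tile → Tile → Prop
  | horizontalOver : LegMid .crossingHorizontalOver .horizontal
  | verticalOver : LegMid .crossingVerticalOver .horizontal
  | arcs : LegMid .arcsRightBottomTopLeft .horizontal
  | verticalBlank : LegMid .vertical .blank

/-- The pairs of adjacent tiles at which the motion of a strand can stop, together with the pairs by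
which they are replaced: the strand that enters the left tile from above enters the right
tile from above instead. -/
inductive LegEnd : Tile → Tile → Tile → Tile → Prop
  | verticalBlank : LegEnd .vertical .blank .arcRightBottom .arcTopLeft
  | verticalArc : LegEnd .vertical .arcRightBottom .arcRightBottom .arcsRightBottomTopLeft
  | arcBlank : LegEnd .arcTopLeft .blank .horizontal .arcTopLeft
  | arcArc : LegEnd .arcTopLeft .arcRightBottom .horizontal .arcsRightBottomTopLeft
  | turnHorizontal : LegEnd .arcTopRight .horizontal .blank .arcTopRight
  | turnsHorizontal : LegEnd .arcsLeftBottomTopRight .horizontal .arcLeftBottom .arcTopRight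
  | turnDown : LegEnd .arcTopRight .arcLeftBottom .blank .vertical

/-- The upper end of a strand is moved to the right; the new strand is joined to the old one by a
jog on the lower edges of the two tiles. -/
theorem LocEq.leg_start {t u t' u' : Tile} (h : LegStart t u t' u') :
    LocEq (box (-1 / 2) (3 / 2) (-1 / 2) (1 / 2))
    {q | q ∈ [pt (-1 / 2) 0 0, pt (3 / 2) 0 0, pt 0 (1 / 2) 0, pt 1 (1 / 2) 0, pt 0 (-1 / 2) 0]}
    (poly (pairEdges t u)) (poly ((pt 1 (-1 / 2) 0, pt 0 (-1 / 2) 0) :: pairEdges t' u')) := by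
  unfold pairEdges
  cases h
  on_goal 2 =>
    refine .add (pt 0 (1 / 2) 0) (pt 0 (-1 / 2) 0) (pt 1 (-1 / 2) 0) [(pt 1 (1 / 2) 0, pt (3 / 2) 0
        0)] 0 1 ?_ ?_ ?_ ?_ ?_ ?_ ?_
      (.addMid (pt 0 (1 / 2) 0) (pt 1 (-1 / 2) 0) (pt (1 / 2) 0 0) [(pt 1 (-1 / 2) 0, pt 0 (-1 /
        2) 0), (pt 1 (1 / 2) 0, pt (3 / 2) 0 0)] (1 / 2) ?_ ?_ ?_ ?_ ?_ ?_ (.done ?_))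
  on_goal 1 =>
    refine .del (pt (3 / 2) 0 0) (pt 0 (-1 / 2) 0) (pt (1 / 2) 0 0) [] 0 1 ?_ ?_ ?_ ?_ ?_ ?_ ?_
      (.add (pt (3 / 2) 0 0) (pt 0 (-1 / 2) 0) (pt 1 (-1 / 2) 0) [] 0 1 ?_ ?_ ?_ ?_ ?_ ?_ ?_
        (.done ?_))
  -- What remains are inclusions of edge lists and linear inequalities in barycentric coordinates.
  all_goals
    first
    | trivial
    | (unfold SameEdges
       constructor <;>
         simp only [List.forall_mem_cons, List.mem_cons, List.not_mem_nil, Prod.swap_prod_mk,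
           true_or, or_true, or_false, false_or, and_true, true_and, IsEmpty.forall_iff,
           implies_true, List.forall_mem_nil]
       done)
    | (unfold SameEdges
       constructor <;> norm_num [Tile.edges, pt_add]
       done)
    | (norm_num; done)
    | (refine ⟨?_, ?_, ?_, ?_⟩ <;> norm_num; done)
    | (simp only [List.Forall]
       and_intros
       all_goals
         intro α β γ s t hα hβ hγ hs ht h1 h2 h3 h4 h5
         simp only [pt_zero, pt_one, pt_two] at h3 h4 h5
         first
         | (exfalso; linarith)
         | exact ⟨by linarith, Or.inl (by linarith)⟩
         | exact ⟨by linarith, Or.inr (by linarith)⟩)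

set_option maxHeartbeats 2000000 in
/-- The jog is moved down from the upper to the lower edges of the two tiles. -/
theorem LocEq.leg_mid {t u : Tile} (h : LegMid t u) : LocEq (box (-1 / 2) (3 / 2) (-1 / 2) (1 / 2))
    {q | q ∈ [pt (-1 / 2) 0 0, pt (3 / 2) 0 0, pt 1 (1 / 2) 0, pt 0 (-1 / 2) 0]}
    (poly ((pt 1 (1 / 2) 0, pt 0 (1 / 2) 0) :: pairEdges t u))
    (poly ((pt 1 (-1 / 2) 0, pt 0 (-1 / 2) 0) :: pairEdges u t)) := by
  unfold pairEdges
  cases h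
  on_goal 4 =>
    refine .del (pt 1 (1 / 2) 0) (pt 0 (-1 / 2) 0) (pt 0 (1 / 2) 0) [] 0 1 ?_ ?_ ?_ ?_ ?_ ?_ ?_
      (.add (pt 1 (1 / 2) 0) (pt 0 (-1 / 2) 0) (pt 1 (-1 / 2) 0) [] 0 1 ?_ ?_ ?_ ?_ ?_ ?_ ?_
        (.done ?_))
  on_goal 3 =>
    refine .del (pt (3 / 2) 0 0) (pt 0 (-1 / 2) 0) (pt (1 / 2) 0 0) [(pt 1 (1 / 2) 0, pt 0 (1 / 2)
        0), (pt 0 (1 / 2) 0, pt (-1 / 2) 0 0)] 0 1 ?_ ?_ ?_ ?_ ?_ ?_ ?_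
      (.add (pt (3 / 2) 0 0) (pt 0 (-1 / 2) 0) (pt 1 (-1 / 2) 0) [(pt 1 (1 / 2) 0, pt 0 (1 / 2)
        0), (pt 0 (1 / 2) 0, pt (-1 / 2) 0 0)] 0 1 ?_ ?_ ?_ ?_ ?_ ?_ ?_
      (.del (pt 1 (1 / 2) 0) (pt (-1 / 2) 0 0) (pt 0 (1 / 2) 0) [(pt (3 / 2) 0 0, pt 1 (-1 / 2)
        0), (pt 1 (-1 / 2) 0, pt 0 (-1 / 2) 0)] 0 1 ?_ ?_ ?_ ?_ ?_ ?_ ?_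
      (.add (pt 1 (1 / 2) 0) (pt (-1 / 2) 0 0) (pt (1 / 2) 0 0) [(pt (3 / 2) 0 0, pt 1 (-1 / 2)
        0), (pt 1 (-1 / 2) 0, pt 0 (-1 / 2) 0)] 0 1 ?_ ?_ ?_ ?_ ?_ ?_ ?_ (.done ?_))))
  on_goal 2 =>
    refine .del (pt 1 (1 / 2) 0) (pt 0 0 1) (pt 0 (1 / 2) 0) [(pt 0 0 1, pt 0 (-1 / 2) 0), (pt (-1 /
        2) 0 0, pt (1 / 2) 0 0), (pt (1 / 2) 0 0, pt (3 / 2) 0 0)] 0 1 ?_ ?_ ?_ ?_ ?_ ?_ ?_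
      (.add (pt 1 (1 / 2) 0) (pt 0 0 1) (pt 1 0 1) [(pt 0 0 1, pt 0 (-1 / 2) 0), (pt (-1 / 2) 0
        0, pt (1 / 2) 0 0), (pt (1 / 2) 0 0, pt (3 / 2) 0 0)] 0 1 ?_ ?_ ?_ ?_ ?_ ?_ ?_
      (.del (pt 1 0 1) (pt 0 (-1 / 2) 0) (pt 0 0 1) [(pt 1 (1 / 2) 0, pt 1 0 1), (pt (-1 / 2) 0
        0, pt (1 / 2) 0 0), (pt (1 / 2) 0 0, pt (3 / 2) 0 0)] 0 1 ?_ ?_ ?_ ?_ ?_ ?_ ?_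
      (.add (pt 1 0 1) (pt 0 (-1 / 2) 0) (pt 1 (-1 / 2) 0) [(pt 1 (1 / 2) 0, pt 1 0 1), (pt (-1 /
        2) 0 0, pt (1 / 2) 0 0), (pt (1 / 2) 0 0, pt (3 / 2) 0 0)] 0 1 ?_ ?_ ?_ ?_ ?_ ?_ ?_ (.done
          ?_))))
  on_goal 1 =>
    refine .del (pt 0 0 1) (pt (3 / 2) 0 0) (pt (1 / 2) 0 0) [(pt 1 (1 / 2) 0, pt 0 (1 / 2) 0), (pt
        (-1 / 2) 0 0, pt 0 0 1), (pt 0 (1 / 2) 0, pt 0 (-1 / 2) 0)] 0 2 ?_ ?_ ?_ ?_ ?_ ?_ ?_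
      (.del (pt 1 (1 / 2) 0) (pt 0 (-1 / 2) 0) (pt 0 (1 / 2) 0) [(pt 0 0 1, pt (3 / 2) 0 0), (pt
        (-1 / 2) 0 0, pt 0 0 1)] 0 1 ?_ ?_ ?_ ?_ ?_ ?_ ?_
      (.add (pt 1 (1 / 2) 0) (pt 0 (-1 / 2) 0) (pt 1 (-1 / 2) 0) [(pt 0 0 1, pt (3 / 2) 0 0), (pt
        (-1 / 2) 0 0, pt 0 0 1)] 0 1 ?_ ?_ ?_ ?_ ?_ ?_ ?_
      (.add (pt 0 0 1) (pt (3 / 2) 0 0) (pt 1 0 1) [(pt 1 (1 / 2) 0, pt 1 (-1 / 2) 0), (pt 1 (-1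
        / 2) 0, pt 0 (-1 / 2) 0), (pt (-1 / 2) 0 0, pt 0 0 1)] 0 2 ?_ ?_ ?_ ?_ ?_ ?_ ?_
      (.del (pt (-1 / 2) 0 0) (pt 1 0 1) (pt 0 0 1) [(pt 1 0 1, pt (3 / 2) 0 0), (pt 1 (1 / 2) 0,
        pt 1 (-1 / 2) 0), (pt 1 (-1 / 2) 0, pt 0 (-1 / 2) 0)] 0 2 ?_ ?_ ?_ ?_ ?_ ?_ ?_
      (.add (pt (-1 / 2) 0 0) (pt 1 0 1) (pt (1 / 2) 0 0) [(pt 1 0 1, pt (3 / 2) 0 0), (pt 1 (1 /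
        2) 0, pt 1 (-1 / 2) 0), (pt 1 (-1 / 2) 0, pt 0 (-1 / 2) 0)] 0 2 ?_ ?_ ?_ ?_ ?_ ?_ ?_
          (.done ?_))))))
  -- What remains are inclusions of edge lists and linear inequalities in barycentric coordinates.
  all_goals
    first
    | trivial
    | (unfold SameEdges
       constructor <;>
         simp only [List.forall_mem_cons, List.mem_cons, List.not_mem_nil, Prod.swap_prod_mk,
           true_or, or_true, or_false, false_or, and_true, true_and, IsEmpty.forall_iff,
           implies_true, List.forall_mem_nil]
       done)
    | (unfold SameEdges
       constructor <;> norm_num [Tile.edges, pt_add]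
       done)
    | (norm_num; done)
    | (refine ⟨?_, ?_, ?_, ?_⟩ <;> norm_num; done)
    | (simp only [List.Forall]
       and_intros
       all_goals
         intro α β γ s t hα hβ hγ hs ht h1 h2 h3 h4 h5
         simp only [pt_zero, pt_one, pt_two] at h3 h4 h5
         first
         | (exfalso; linarith)
         | exact ⟨by linarith, Or.inl (by linarith)⟩
         | exact ⟨by linarith, Or.inr (by linarith)⟩)

set_option maxHeartbeats 1000000 in
/-- The jog on the upper edges of the two tiles is absorbed. -/
theorem LocEq.leg_end {t u t' u' : Tile} (h : LegEnd t u t' u') :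
    LocEq (box (-1 / 2) (3 / 2) (-1 / 2) (1 / 2))
    {q | q ∈ [pt (-1 / 2) 0 0, pt (3 / 2) 0 0, pt 1 (1 / 2) 0, pt 0 (-1 / 2) 0, pt 1 (-1 / 2) 0]}
    (poly ((pt 1 (1 / 2) 0, pt 0 (1 / 2) 0) :: pairEdges t u)) (poly (pairEdges t' u')) := by
  unfold pairEdges
  cases h
  on_goal 7 =>
    refine .del (pt 1 (1 / 2) 0) (pt (1 / 2) 0 0) (pt 0 (1 / 2) 0) [(pt (1 / 2) 0 0, pt 1 (-1 / 2)
        0)] 0 1 ?_ ?_ ?_ ?_ ?_ ?_ ?_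
      (.del (pt 1 (1 / 2) 0) (pt 1 (-1 / 2) 0) (pt (1 / 2) 0 0) [] 0 1 ?_ ?_ ?_ ?_ ?_ ?_ ?_ (.done
        ?_))
  on_goal 6 =>
    refine .del (pt 1 (1 / 2) 0) (pt (1 / 2) 0 0) (pt 0 (1 / 2) 0) [(pt (-1 / 2) 0 0, pt 0 (-1 / 2)
        0), (pt (1 / 2) 0 0, pt (3 / 2) 0 0)] 0 1 ?_ ?_ ?_ ?_ ?_ ?_ ?_
      (.del (pt 1 (1 / 2) 0) (pt (3 / 2) 0 0) (pt (1 / 2) 0 0) [(pt (-1 / 2) 0 0, pt 0 (-1 / 2)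
        0)] 0 1 ?_ ?_ ?_ ?_ ?_ ?_ ?_ (.done ?_))
  on_goal 5 =>
    refine .del (pt 1 (1 / 2) 0) (pt (1 / 2) 0 0) (pt 0 (1 / 2) 0) [(pt (1 / 2) 0 0, pt (3 / 2) 0
      0)]
        0 1 ?_ ?_ ?_ ?_ ?_ ?_ ?_
      (.del (pt 1 (1 / 2) 0) (pt (3 / 2) 0 0) (pt (1 / 2) 0 0) [] 0 1 ?_ ?_ ?_ ?_ ?_ ?_ ?_ (.done
        ?_))
  on_goal 4 =>
    refine .del (pt 1 (1 / 2) 0) (pt (-1 / 2) 0 0) (pt 0 (1 / 2) 0) [(pt (3 / 2) 0 0, pt 1 (-1 / 2)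
        0)] 0 1 ?_ ?_ ?_ ?_ ?_ ?_ ?_
      (.add (pt 1 (1 / 2) 0) (pt (-1 / 2) 0 0) (pt (1 / 2) 0 0) [(pt (3 / 2) 0 0, pt 1 (-1 / 2)
        0)] 0 1 ?_ ?_ ?_ ?_ ?_ ?_ ?_ (.done ?_))
  on_goal 3 =>
    refine .del (pt 1 (1 / 2) 0) (pt (-1 / 2) 0 0) (pt 0 (1 / 2) 0) [] 0 1 ?_ ?_ ?_ ?_ ?_ ?_ ?_
      (.add (pt 1 (1 / 2) 0) (pt (-1 / 2) 0 0) (pt (1 / 2) 0 0) [] 0 1 ?_ ?_ ?_ ?_ ?_ ?_ ?_ (.done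
        ?_))
  on_goal 2 =>
    refine .del (pt 1 (1 / 2) 0) (pt 0 (-1 / 2) 0) (pt 0 (1 / 2) 0) [(pt (3 / 2) 0 0, pt 1 (-1 / 2)
        0)] 0 1 ?_ ?_ ?_ ?_ ?_ ?_ ?_
      (.addMid (pt 1 (1 / 2) 0) (pt 0 (-1 / 2) 0) (pt (1 / 2) 0 0) [(pt (3 / 2) 0 0, pt 1 (-1 /
        2) 0)] (1 / 2) ?_ ?_ ?_ ?_ ?_ ?_ (.done ?_))
  on_goal 1 =>
    refine .del (pt 1 (1 / 2) 0) (pt 0 (-1 / 2) 0) (pt 0 (1 / 2) 0) [] 0 1 ?_ ?_ ?_ ?_ ?_ ?_ ?_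
      (.addMid (pt 1 (1 / 2) 0) (pt 0 (-1 / 2) 0) (pt (1 / 2) 0 0) [] (1 / 2) ?_ ?_ ?_ ?_ ?_ ?_
        (.done ?_))
  all_goals
    first
    | trivial
    | (unfold SameEdges
       constructor <;>
         simp only [List.forall_mem_cons, List.mem_cons, List.not_mem_nil, Prod.swap_prod_mk,
           true_or, or_true, or_false, false_or, and_true, true_and, IsEmpty.forall_iff,
           implies_true, List.forall_mem_nil]
       done)
    | (unfold SameEdges
       constructor <;> norm_num [Tile.edges, pt_add]
       done)
    | (norm_num; done)
    | (refine ⟨?_, ?_, ?_, ?_⟩ <;> norm_num; done)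
    | (simp only [List.Forall]
       and_intros
       all_goals
         intro α β γ s t hα hβ hγ hs ht h1 h2 h3 h4 h5
         simp only [pt_zero, pt_one, pt_two] at h3 h4 h5
         first
         | (exfalso; linarith)
         | exact ⟨by linarith, Or.inl (by linarith)⟩
         | exact ⟨by linarith, Or.inr (by linarith)⟩)

/-! ### Loops in a corner -/

/-- The curves on a square block of four tiles, the upper left one centred at the origin. -/
noncomputable def quadEdges (t u v w : Tile) : List (E3 × E3) :=
  t.edges ++ u.edges.map (fun e => (pt 1 0 0 + e.1, pt 1 0 0 + e.2)) ++
    (v.edges.map (fun e => (pt 0 (-1) 0 + e.1, pt 0 (-1) 0 + e.2)) ++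
      w.edges.map fun e => (pt 1 (-1) 0 + e.1, pt 1 (-1) 0 + e.2))

/-- An arc that turns around three tiles is shortened to an arc on the fourth tile. -/
theorem LocEq.corner_arc : LocEq (box (-1 / 2) (3 / 2) (-3 / 2) (1 / 2))
    {q | q ∈ [pt (-1 / 2) 0 0, pt (-1 / 2) (-1) 0, pt 0 (1 / 2) 0, pt 1 (1 / 2) 0, pt (3 / 2) 0 0,
    pt (3 / 2) (-1) 0, pt 0 (-3 / 2) 0, pt 1 (-3 / 2) 0]}
    (poly (quadEdges .arcRightBottom .arcLeftBottom .arcTopRight .arcsLeftBottomTopRight))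
    (poly (quadEdges .blank .blank .blank .arcRightBottom)) := by
  unfold quadEdges
  refine .delMid (pt 1 (-3 / 2) 0) (pt 0 (-1 / 2) 0) (pt (1 / 2) (-1) 0) [(pt (1 / 2) 0 0, pt 0
    (-1 /
      2) 0), (pt (1 / 2) 0 0, pt 1 (-1 / 2) 0), (pt 1 (-1 / 2) 0, pt (3 / 2) (-1) 0)] (1 / 2) ?_
      ?_ ?_ ?_ ?_ ?_
    (.delMid (pt (1 / 2) 0 0) (pt (3 / 2) (-1) 0) (pt 1 (-1 / 2) 0) [(pt 1 (-3 / 2) 0, pt 0 (-1 /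
      2) 0), (pt (1 / 2) 0 0, pt 0 (-1 / 2) 0)] (1 / 2) ?_ ?_ ?_ ?_ ?_ ?_
    (.del (pt 1 (-3 / 2) 0) (pt (1 / 2) 0 0) (pt 0 (-1 / 2) 0) [(pt (1 / 2) 0 0, pt (3 / 2) (-1)
      0)] 0 1 ?_ ?_ ?_ ?_ ?_ ?_ ?_
    (.del (pt 1 (-3 / 2) 0) (pt (3 / 2) (-1) 0) (pt (1 / 2) 0 0) [] 0 1 ?_ ?_ ?_ ?_ ?_ ?_ ?_
      (.done ?_))))
  all_goals
    first
    | trivial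
    | (unfold SameEdges
       constructor <;>
         simp only [List.forall_mem_cons, List.mem_cons, List.not_mem_nil, Prod.swap_prod_mk,
           true_or, or_true, or_false, false_or, and_true, true_and, IsEmpty.forall_iff,
           implies_true, List.forall_mem_nil]
       done)
    | (unfold SameEdges
       constructor <;> norm_num [Tile.edges, pt_add]
       done)
    | (norm_num; done)
    | (refine ⟨?_, ?_, ?_, ?_⟩ <;> norm_num; done)
    | (simp only [List.Forall]
       and_intros
       all_goals
         intro α β γ s t hα hβ hγ hs ht h1 h2 h3 h4 h5
         simp only [pt_zero, pt_one, pt_two] at h3 h4 h5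
         first
         | (exfalso; linarith)
         | exact ⟨by linarith, Or.inl (by linarith)⟩
         | exact ⟨by linarith, Or.inr (by linarith)⟩)

/-- The first Reidemeister move for a loop around three tiles. -/
theorem LocEq.corner_loop : LocEq (box (-1 / 2) (3 / 2) (-3 / 2) (1 / 2))
    {q | q ∈ [pt (-1 / 2) 0 0, pt (-1 / 2) (-1) 0, pt 0 (1 / 2) 0, pt 1 (1 / 2) 0, pt (3 / 2) 0 0,
    pt (3 / 2) (-1) 0, pt 0 (-3 / 2) 0, pt 1 (-3 / 2) 0]}
    (poly (quadEdges .arcRightBottom .arcLeftBottom .arcTopRight .crossingHorizontalOver))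
    (poly (quadEdges .blank .blank .blank .arcRightBottom)) := by
  unfold quadEdges
  refine .del (pt 1 (-1 / 2) 0) (pt 0 (-1 / 2) 0) (pt (1 / 2) 0 0) [(pt 0 (-1 / 2) 0, pt (1 / 2)
    (-1)
      0), (pt (1 / 2) (-1) 0, pt 1 (-1) 1), (pt 1 (-1) 1, pt (3 / 2) (-1) 0), (pt 1 (-1 / 2) 0, pt
      1 (-3 / 2) 0)] 0 1 ?_ ?_ ?_ ?_ ?_ ?_ ?_
    (.del (pt 1 (-1 / 2) 0) (pt (1 / 2) (-1) 0) (pt 0 (-1 / 2) 0) [(pt (1 / 2) (-1) 0, pt 1 (-1)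
      1), (pt 1 (-1) 1, pt (3 / 2) (-1) 0), (pt 1 (-1 / 2) 0, pt 1 (-3 / 2) 0)] 0 1 ?_ ?_ ?_ ?_ ?_
      ?_ ?_
    (.del (pt 1 (-1 / 2) 0) (pt 1 (-1) 1) (pt (1 / 2) (-1) 0) [(pt 1 (-1) 1, pt (3 / 2) (-1) 0),
      (pt 1 (-1 / 2) 0, pt 1 (-3 / 2) 0)] 0 1 ?_ ?_ ?_ ?_ ?_ ?_ ?_
    (.del (pt 1 (-1 / 2) 0) (pt (3 / 2) (-1) 0) (pt 1 (-1) 1) [(pt 1 (-1 / 2) 0, pt 1 (-3 / 2)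
      0)] 0 1 ?_ ?_ ?_ ?_ ?_ ?_ ?_
    (.del (pt 1 (-3 / 2) 0) (pt (3 / 2) (-1) 0) (pt 1 (-1 / 2) 0) [] 0 1 ?_ ?_ ?_ ?_ ?_ ?_ ?_
      (.done ?_)))))
  all_goals
    first
    | trivial
    | (unfold SameEdges
       constructor <;>
         simp only [List.forall_mem_cons, List.mem_cons, List.not_mem_nil, Prod.swap_prod_mk,
           true_or, or_true, or_false, false_or, and_true, true_and, IsEmpty.forall_iff,
           implies_true, List.forall_mem_nil]
       done)
    | (unfold SameEdges
       constructor <;> norm_num [Tile.edges, pt_add]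
       done)
    | (norm_num; done)
    | (refine ⟨?_, ?_, ?_, ?_⟩ <;> norm_num; done)
    | (simp only [List.Forall]
       and_intros
       all_goals
         intro α β γ s t hα hβ hγ hs ht h1 h2 h3 h4 h5
         simp only [pt_zero, pt_one, pt_two] at h3 h4 h5
         first
         | (exfalso; linarith)
         | exact ⟨by linarith, Or.inl (by linarith)⟩
         | exact ⟨by linarith, Or.inr (by linarith)⟩)

/-! ### Mosaics as grids -/

/-- A suitably connected grid of tiles that is blank outside the square with rows and columns
`0, …, n - 1`. -/
structure Good (n : ℤ) (T : ℤ → ℤ → Tile) : Prop where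
  support : ∀ i j, T i j ≠ .blank → 0 ≤ i ∧ i < n ∧ 0 ≤ j ∧ j < n
  horiz : ∀ i j, (T i j).conn .right = (T i (j + 1)).conn .left
  vert : ∀ i j, (T i j).conn .bottom = (T (i + 1) j).conn .top

/-- The pieces of link on the tiles of a grid. -/
def curves (T : ℤ → ℤ → Tile) : ℤ → ℤ → Set E3 := fun i j => (T i j).curve

/-- The link depicted by a grid. -/
def gridLink (T : ℤ → ℤ → Tile) : Set E3 := cells (curves T) univ

/-- The grids depict isotopic links. -/
def Sim (T T' : ℤ → ℤ → Tile) : Prop := AmbientIsotopic (lift (gridLink T)) (lift (gridLink T'))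

theorem IsoE.sim {T T' : ℤ → ℤ → Tile} (h : IsoE (gridLink T) (gridLink T')) : Sim T T' :=
  h.ambientIsotopic

theorem Sim.symm {T T' : ℤ → ℤ → Tile} (h : Sim T T') : Sim T' T := AmbientIsotopic.symm h

theorem Sim.trans {T T' T'' : ℤ → ℤ → Tile} (h : Sim T T') (h' : Sim T' T'') : Sim T T'' :=
  AmbientIsotopic.trans h h'

theorem Sim.refl (T : ℤ → ℤ → Tile) : Sim T T := (IsoE.refl _).sim

theorem framed_curves (T : ℤ → ℤ → Tile) (i j : ℤ) : Framed (curves T i j) (T i j).conn :=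
  (T i j).framed

theorem isCompact_curves (T : ℤ → ℤ → Tile) (i j : ℤ) : IsCompact (curves T i j) := by
  unfold curves
  rw [Tile.curve_eq]
  exact isCompact_poly _

theorem Tile.curve_blank : Tile.blank.curve = ∅ := by simp [Tile.curve_eq, Tile.edges]

theorem curves_finite {n : ℤ} {T : ℤ → ℤ → Tile} (h : ∀ i j, T i j ≠ .blank →
    0 ≤ i ∧ i < n ∧ 0 ≤ j ∧ j < n) : {q : ℤ × ℤ | (curves T q.1 q.2).Nonempty}.Finite := by
  refine ((finite_Ico 0 n).prod (finite_Ico 0 n)).subset ?_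
  rintro ⟨i, j⟩ hq
  have := h i j fun hb => by
    rw [mem_ofPred_eq, curves, hb, Tile.curve_blank] at hq
    exact not_nonempty_empty hq
  exact ⟨⟨this.1, this.2.1⟩, this.2.2.1, this.2.2.2⟩

theorem Good.finite {n : ℤ} {T : ℤ → ℤ → Tile} (h : Good n T) :
    {q : ℤ × ℤ | (curves T q.1 q.2).Nonempty}.Finite := curves_finite h.support

theorem gridLink_eq_block (T : ℤ → ℤ → Tile) (s a m k : ℤ) :
    gridLink T = cells (curves T) (block s a m k)ᶜ ∪ cells (curves T) (block s a m k) := by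
  rw [← cells_union, compl_union_self]; rfl

theorem cells_pair (T : ℤ → ℤ → Tile) (s a : ℤ) :
    cells (curves T) (block s a 0 1) =
      tr (pt a (-s) 0) '' poly (pairEdges (T s a) (T s (a + 1))) := by
  have : block s a 0 1 = {(s, a)} ∪ {(s, a + 1)} := by
    ext ⟨i, j⟩
    simp only [block, mem_ofPred_eq, mem_union, mem_singleton_iff, Prod.mk.injEq]
    omega
  rw [this, cells_union, cells_singleton, cells_singleton, pairEdges, poly_append, image_union,
    ← tr_image_poly, ← Tile.curve_eq, ← Tile.curve_eq, ← image_comp]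
  congr 2
  ext p : 1
  refine ext_pt ?_ ?_ ?_ <;> simp [add_assoc]

theorem cells_quad (T : ℤ → ℤ → Tile) (s a : ℤ) :
    cells (curves T) (block s a 1 1) = tr (pt a (-s) 0) '' poly
      (quadEdges (T s a) (T s (a + 1)) (T (s + 1) a) (T (s + 1) (a + 1))) := by
  have : block s a 1 1 = ({(s, a)} ∪ {(s, a + 1)}) ∪ ({(s + 1, a)} ∪ {(s + 1, a + 1)}) := by
    ext ⟨i, j⟩
    simp only [block, mem_ofPred_eq, mem_union, mem_singleton_iff, Prod.mk.injEq]
    omega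
  rw [this, cells_union, cells_union, cells_union, cells_singleton, cells_singleton,
    cells_singleton, cells_singleton, quadEdges, poly_append, poly_append, poly_append, image_union,
    image_union, image_union, ← tr_image_poly, ← tr_image_poly, ← tr_image_poly, ← Tile.curve_eq,
    ← Tile.curve_eq, ← Tile.curve_eq, ← Tile.curve_eq, ← image_comp, ← image_comp, ← image_comp]
  congr 2
  · congr 1
    ext p : 1
    refine ext_pt ?_ ?_ ?_ <;> simp [add_assoc]
  · congr 1
    ext p : 1
    refine ext_pt ?_ ?_ ?_ <;> simp [add_assoc]
    ring
  · congr 1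
    ext p : 1
    refine ext_pt ?_ ?_ ?_ <;> simp [add_assoc]
    ring

/-! ### Moving a strand by one column -/

/-- The grid `T'` arises from `T` by moving a strand in the rows `s, …, r` of column `a` to
column `a + 1`. -/
structure LegShift (T T' : ℤ → ℤ → Tile) (a s r : ℤ) : Prop where
  lt : s < r
  start : LegStart (T s a) (T s (a + 1)) (T' s a) (T' s (a + 1))
  mid : ∀ i, s < i → i < r →
    LegMid (T i a) (T i (a + 1)) ∧ T' i a = T i (a + 1) ∧ T' i (a + 1) = T i a
  finish : LegEnd (T r a) (T r (a + 1)) (T' r a) (T' r (a + 1))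
  off : ∀ i j, ¬ (s ≤ i ∧ i ≤ r ∧ (j = a ∨ j = a + 1)) → T' i j = T i j

/-- The result of moving a strand in the rows `s, …, r` of column `a` to column `a + 1`, with the
given tiles at the two ends. -/
def legGrid (T : ℤ → ℤ → Tile) (a s r : ℤ) (t u t' u' : Tile) : ℤ → ℤ → Tile := fun i j =>
  if s ≤ i ∧ i ≤ r then
    if j = a then if i = s then t else if i = r then t' else T i (a + 1)
    else if j = a + 1 then if i = s then u else if i = r then u' else T i a
    else T i j
  else T i j

theorem legShift_legGrid {T : ℤ → ℤ → Tile} {a s r : ℤ} {t u t' u' : Tile} (hsr : s < r)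
    (h : LegStart (T s a) (T s (a + 1)) t u)
    (hm : ∀ i, s < i → i < r → LegMid (T i a) (T i (a + 1)))
    (h' : LegEnd (T r a) (T r (a + 1)) t' u') : LegShift T (legGrid T a s r t u t' u') a s r where
  lt := hsr
  start := by simpa [legGrid, hsr.le] using h
  mid i h1 h2 := ⟨hm i h1 h2, by simp [legGrid, h1.le, h2.le, h1.ne', h2.ne],
    by simp [legGrid, h1.le, h2.le, h1.ne', h2.ne]⟩
  finish := by simpa [legGrid, hsr.le, hsr.ne'] using h'
  off i j hij := by
    unfold legGrid
    split_ifs with h1 h2 h3 <;> first | rfl | (exfalso; omega)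

theorem LegStart.conn {t u t' u' : Tile} (h : LegStart t u t' u') :
    t'.conn .left = t.conn .left ∧ t'.conn .right = u'.conn .left ∧
    u'.conn .right = u.conn .right ∧ t'.conn .top = t.conn .top ∧ u'.conn .top = u.conn .top ∧
    t'.conn .bottom = false ∧ u'.conn .bottom = true ∧ u.conn .bottom = false ∧
    t.conn .bottom = true ∧ t ≠ .blank ∧ u ≠ .blank := by
  cases h <;> decide

theorem LegMid.conn {t u : Tile} (h : LegMid t u) :
    u.conn .left = t.conn .left ∧ u.conn .right = t.conn .left ∧ t.conn .right = u.conn .right ∧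
    u.conn .top = false ∧ t.conn .top = true ∧ u.conn .bottom = false ∧ t.conn .bottom = true ∧
    t ≠ .blank := by
  cases h <;> decide

theorem LegEnd.conn {t u t' u' : Tile} (h : LegEnd t u t' u') :
    t'.conn .left = t.conn .left ∧ t'.conn .right = u'.conn .left ∧
    u'.conn .right = u.conn .right ∧ t'.conn .bottom = t.conn .bottom ∧
    u'.conn .bottom = u.conn .bottom ∧ t'.conn .top = false ∧ u'.conn .top = true ∧
    u.conn .top = false ∧ t.conn .top = true ∧ t ≠ .blank := by
  cases h <;> decide

theorem blank_conn (s : Side) : Tile.blank.conn s = false := by cases s <;> rfl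

theorem LegShift.good {n : ℤ} {T T' : ℤ → ℤ → Tile} {a s r : ℤ} (hT : Good n T)
    (h : LegShift T T' a s r) : Good n T' := by
  have hs := h.start.conn
  have he := h.finish.conn
  have bs := hT.support s a hs.2.2.2.2.2.2.2.2.2.1
  have bs' := hT.support s (a + 1) hs.2.2.2.2.2.2.2.2.2.2
  have br := hT.support r a he.2.2.2.2.2.2.2.2.2
  have hlt := h.lt
  have key : ∀ i, s ≤ i → i ≤ r → (T' i a).conn .left = (T i a).conn .left ∧
      (T' i a).conn .right = (T' i (a + 1)).conn .left ∧
      (T' i (a + 1)).conn .right = (T i (a + 1)).conn .right ∧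
      ((T' i a).conn .top = if i = s then (T i a).conn .top else false) ∧
      ((T' i (a + 1)).conn .top = if i = s then (T i (a + 1)).conn .top else true) ∧
      ((T' i a).conn .bottom = if i = r then (T i a).conn .bottom else false) ∧
      ((T' i (a + 1)).conn .bottom = if i = r then (T i (a + 1)).conn .bottom else true) := by
    intro i h1 h2
    rcases eq_or_ne i s with rfl | h3
    · simp only [if_true, h.lt.ne, if_false]
      exact ⟨hs.1, hs.2.1, hs.2.2.1, hs.2.2.2.1, hs.2.2.2.2.1, hs.2.2.2.2.2.1, hs.2.2.2.2.2.2.1⟩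
    rcases eq_or_ne i r with rfl | h4
    · simp only [if_true, h3, if_false]
      exact ⟨he.1, he.2.1, he.2.2.1, he.2.2.2.2.2.1, he.2.2.2.2.2.2.1, he.2.2.2.1, he.2.2.2.2.1⟩
    · obtain ⟨hm, e1, e2⟩ := h.mid i (by omega) (by omega)
      have := hm.conn
      simp only [h3, h4, if_false, e1, e2]
      exact ⟨this.1, by rw [this.2.1], by rw [this.2.2.1], this.2.2.2.1, this.2.2.2.2.1,
        this.2.2.2.2.2.1, this.2.2.2.2.2.2.1⟩
  refine ⟨fun i j hb => ?_, fun i j => ?_, fun i j => ?_⟩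
  · by_cases hij : s ≤ i ∧ i ≤ r ∧ (j = a ∨ j = a + 1)
    · omega
    · rw [h.off i j hij] at hb
      exact hT.support i j hb
  · by_cases hi : s ≤ i ∧ i ≤ r
    · obtain ⟨k1, k2, k3, -⟩ := key i hi.1 hi.2
      by_cases h1 : j = a
      · rw [h1, k2]
      by_cases h2 : j = a + 1
      · rw [h2, k3, h.off i (a + 1 + 1) (by omega)]; exact hT.horiz _ _
      by_cases h3 : j + 1 = a
      · rw [h3, k1, h.off i j (by omega), ← h3]; exact hT.horiz _ _
      · rw [h.off i j (by omega), h.off i (j + 1) (by omega)]; exact hT.horiz _ _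
    · rw [h.off i j (by omega), h.off i (j + 1) (by omega)]; exact hT.horiz _ _
  · by_cases hj : j = a ∨ j = a + 1
    · by_cases h1 : s ≤ i ∧ i + 1 ≤ r
      · have k1 := key i (by omega) (by omega)
        have k2 := key (i + 1) (by omega) (by omega)
        rw [if_neg (show ¬ i + 1 = s by omega), if_neg (show ¬ i + 1 = s by omega)] at k2
        rw [if_neg (show ¬ i = r by omega), if_neg (show ¬ i = r by omega)] at k1
        rcases hj with rfl | rfl
        · rw [k1.2.2.2.2.2.1, k2.2.2.2.1]
        · rw [k1.2.2.2.2.2.2, k2.2.2.2.2.1]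
      by_cases h2 : i + 1 = s
      · have k2 := key (i + 1) (by omega) (by omega)
        rw [if_pos h2, if_pos h2] at k2
        rw [h.off i j (by omega)]
        rcases hj with rfl | rfl
        · rw [k2.2.2.2.1]; exact hT.vert _ _
        · rw [k2.2.2.2.2.1]; exact hT.vert _ _
      by_cases h3 : i = r
      · have k1 := key i (by omega) (by omega)
        rw [if_pos h3, if_pos h3] at k1
        rw [h.off (i + 1) j (by omega)]
        rcases hj with rfl | rfl
        · rw [k1.2.2.2.2.2.1]; exact hT.vert _ _
        · rw [k1.2.2.2.2.2.2]; exact hT.vert _ _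
      · rw [h.off i j (by omega), h.off (i + 1) j (by omega)]; exact hT.vert _ _
    · rw [h.off i j (by omega), h.off (i + 1) j (by omega)]; exact hT.vert _ _

/-- The midpoints on the boundary of two horizontally adjacent cells. -/
theorem blockPts_pair {c : ℤ → ℤ → Side → Bool} {s a : ℤ} {p : E3} (hp : p ∈ blockPts c s a 0 1) :
    p = pt (-1 / 2) 0 0 ∨ p = pt (3 / 2) 0 0 ∨
    (p = pt 0 (1 / 2) 0 ∧ c (s - 1) a .bottom = true) ∨
    (p = pt 1 (1 / 2) 0 ∧ c (s - 1) (a + 1) .bottom = true) ∨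
    (p = pt 0 (-1 / 2) 0 ∧ c (s + 1) a .top = true) ∨
    (p = pt 1 (-1 / 2) 0 ∧ c (s + 1) (a + 1) .top = true) := by
  unfold blockPts at hp
  rw [add_zero s] at hp
  obtain ⟨p2, ⟨j, j0, j1, pj, h⟩ | ⟨i, i0, i1, pi, h⟩⟩ := hp
  · have hj : j = 0 ∨ j = 1 := by omega
    rcases hj with rfl | rfl <;> rcases h with ⟨h, hc⟩ | ⟨h, hc⟩
    · exact Or.inr (Or.inr (Or.inl ⟨ext_pt (by simpa using pj) h p2, add_zero a ▸ hc⟩))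
    · exact Or.inr (Or.inr (Or.inr (Or.inr (Or.inl
        ⟨ext_pt (by simpa using pj) (by simp [h]; norm_num) p2, add_zero a ▸ hc⟩))))
    · exact Or.inr (Or.inr (Or.inr (Or.inl ⟨ext_pt (by simpa using pj) h p2, hc⟩)))
    · exact Or.inr (Or.inr (Or.inr (Or.inr (Or.inr
        ⟨ext_pt (by simpa using pj) (by simp [h]; norm_num) p2, hc⟩))))
  · have hi : i = 0 := by omega
    subst hi
    rcases h with ⟨h, -⟩ | ⟨h, -⟩
    · exact Or.inl (ext_pt h (by rw [pi]; simp) p2)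
    · exact Or.inr (Or.inl (ext_pt (by rw [h, pt_zero]; norm_num) (by rw [pi]; simp) p2))

/-- One row of the motion of a strand. -/
theorem isoE_pair {n : ℤ} {X Y : ℤ → ℤ → Tile} (hX : ∀ i j, X i j ≠ .blank →
    0 ≤ i ∧ i < n ∧ 0 ≤ j ∧ j < n) (s a : ℤ) (hXY : ∀ i j, (i, j) ∉ block s a 0 1 → Y i j = X i j)
    {P : Set E3} (hP : blockPts (fun i j => (X i j).conn) s a 0 1 ⊆ P) {l l' : List (E3 × E3)}
    (h : LocEq (box (-1 / 2) (3 / 2) (-1 / 2) (1 / 2)) P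
      (poly (l ++ pairEdges (X s a) (X s (a + 1)))) (poly (l' ++ pairEdges (Y s a) (Y s (a +
          1))))) :
    IsoE (gridLink X ∪ tr (pt a (-s) 0) '' poly l) (gridLink Y ∪ tr (pt a (-s) 0) '' poly l') := by
  have hb : box (-1 / 2) (((1 : ℤ) : ℝ) + 1 / 2) (-((0 : ℤ) : ℝ) - 1 / 2) (1 / 2) =
      box (-1 / 2) (3 / 2) (-1 / 2) (1 / 2) := by norm_num
  have := LocEq.block (framed_curves X) (isCompact_curves X) (curves_finite hX) s a 0 1 le_rfl
    zero_le_one hP (hb ▸ h)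
  rw [gridLink_eq_block X s a 0 1, gridLink_eq_block Y s a 0 1, cells_pair, cells_pair, union_assoc,
    union_assoc, ← image_union, ← image_union, union_comm _ (poly l), union_comm _ (poly l'),
    ← poly_append, ← poly_append]
  rwa [cells_congr (X := curves Y) (X' := curves X)
    fun i j hij => by simp only [curves, hXY i j hij]]

theorem jog_eq (a s : ℤ) : tr (pt a (-s) 0) '' poly [(pt 1 (-1 / 2) 0, pt 0 (-1 / 2) 0)] =
    tr (pt a (-(s + 1 : ℤ)) 0) '' poly [(pt 1 (1 / 2) 0, pt 0 (1 / 2) 0)] := by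
  simp only [tr_image_poly, List.map_cons, List.map_nil, pt_add]
  have e : ∀ x : ℝ, (a : ℝ) + x = a + x ∧ pt (a + x) (-s + -1 / 2) (0 + 0) =
      pt (a + x) (-(s + 1 : ℤ) + 1 / 2) (0 + 0) := fun x => ⟨rfl, by push_cast; congr 1; ring⟩
  rw [(e 1).2, (e 0).2]

/-- A strand can be moved to the next column by an isotopy, which proceeds row by row from the top.
-/
theorem LegShift.isoE {n : ℤ} {T T' : ℤ → ℤ → Tile} {a s r : ℤ} (hT : Good n T)
    (h : LegShift T T' a s r) : IsoE (gridLink T) (gridLink T') := by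
  have hT' := h.good hT
  have hlt := h.lt
  -- The grid in which the rows above row `k` have been changed.
  let Z : ℤ → ℤ → ℤ → Tile := fun k i j => if i < k then T' i j else T i j
  have hZ : ∀ k i j, Z k i j ≠ .blank → 0 ≤ i ∧ i < n ∧ 0 ≤ j ∧ j < n := by
    intro k i j hb
    simp only [Z] at hb
    split_ifs at hb
    · exact hT'.support i j hb
    · exact hT.support i j hb
  have hZs : ∀ k i j, (i, j) ∉ block k a 0 1 → s ≤ k → k ≤ r → Z (k + 1) i j = Z k i j := by
    intro k i j hij hk hk'
    simp only [Z]
    split_ifs with h1 h2 h2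
    · rfl
    · have : i = k := by omega
      subst this
      refine h.off i j fun hc => hij ?_
      simp only [block, mem_ofPred_eq]; omega
    · omega
    · rfl
  have hlt' : ∀ k, Z k k = T k := fun k => by funext j; simp [Z]
  have hlt1 : ∀ k, Z (k + 1) k = T' k := fun k => by funext j; simp [Z]
  have hsucc : ∀ k, Z k (k + 1) = T (k + 1) := fun k => by funext j; simp [Z]
  have hpred : ∀ k, Z k (k - 1) = T' (k - 1) := fun k => by funext j; simp [Z]
  have h0 : Z s = T := by
    funext i j
    simp only [Z]
    split_ifs with h1
    · exact h.off i j (by omega)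
    · rfl
  have h1 : Z (r + 1) = T' := by
    funext i j
    simp only [Z]
    split_ifs with h1
    · rfl
    · exact (h.off i j (by omega)).symm
  have step : ∀ m : ℕ, s + 1 + m ≤ r → IsoE (gridLink T) (gridLink (Z (s + 1 + m)) ∪
      tr (pt a (-(s + 1 + m : ℤ)) 0) '' poly [(pt 1 (1 / 2) 0, pt 0 (1 / 2) 0)]) := by
    intro m
    induction m with
    | zero =>
      intro hr
      have hs := h.start.conn
      have := isoE_pair (hZ s) s a (Y := Z (s + 1)) (fun i j hij => hZs s i j hij le_rfl hlt.le)
        (P := {q | q ∈ [pt (-1 / 2) 0 0, pt (3 / 2) 0 0, pt 0 (1 / 2) 0, pt 1 (1 / 2) 0,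
          pt 0 (-1 / 2) 0]}) (l := []) (l' := [(pt 1 (-1 / 2) 0, pt 0 (-1 / 2) 0)]) (fun p hp => by
          simp only [List.mem_cons, List.not_mem_nil, or_false, mem_ofPred_eq]
          rcases blockPts_pair hp with h | h | ⟨h, -⟩ | ⟨h, -⟩ | ⟨h, -⟩ | ⟨-, h⟩
          iterate 5 simp only [h, true_or, or_true]
          rw [hsucc, ← hT.vert, hs.2.2.2.2.2.2.2.1] at h
          exact absurd h (by simp)) (by
            rw [hlt', hlt1]; exact LocEq.leg_start h.start)
      rw [jog_eq, poly_nil, image_empty, union_empty, h0] at this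
      simpa using this
    | succ m ih =>
      intro hr
      push_cast at hr
      refine (ih (by omega)).trans ?_
      set k := s + 1 + (m : ℤ) with hk
      obtain ⟨hm, e1, e2⟩ := h.mid k (by omega) (by omega)
      have hc := hm.conn
      have hup : (T' (k - 1) a).conn .bottom = false := by
        rw [hT'.vert, sub_add_cancel, e1, hc.2.2.2.1]
      have := isoE_pair (hZ k) k a (Y := Z (k + 1))
        (fun i j hij => hZs k i j hij (by omega) (by omega))
        (P := {q | q ∈ [pt (-1 / 2) 0 0, pt (3 / 2) 0 0, pt 1 (1 / 2) 0, pt 0 (-1 / 2) 0]})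
        (l := [(pt 1 (1 / 2) 0, pt 0 (1 / 2) 0)])
        (l' := [(pt 1 (-1 / 2) 0, pt 0 (-1 / 2) 0)]) (fun p hp => by
          simp only [List.mem_cons, List.not_mem_nil, or_false, mem_ofPred_eq]
          rcases blockPts_pair hp with h | h | ⟨-, h⟩ | ⟨h, -⟩ | ⟨h, -⟩ | ⟨-, h⟩
          · simp only [h, true_or, or_true]
          · simp only [h, true_or, or_true]
          · rw [hpred, hup] at h; exact absurd h (by simp)
          · simp only [h, true_or, or_true]
          · simp only [h, or_true]
          · rw [hsucc, ← hT.vert, hc.2.2.2.2.2.1] at h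
            exact absurd h (by simp)) (by
            rw [hlt', hlt1, e1, e2]; exact LocEq.leg_mid hm)
      rw [jog_eq] at this
      have e3 : s + 1 + ((m + 1 : ℕ) : ℤ) = k + 1 := by push_cast; omega
      rw [e3]
      convert this using 5
  obtain ⟨m, hm⟩ := Int.eq_ofNat_of_zero_le (show 0 ≤ r - (s + 1) by omega)
  have e : s + 1 + (m : ℤ) = r := by omega
  refine (step m (by omega)).trans ?_
  have e' : (s : ℝ) + 1 + m = r := by exact_mod_cast e
  rw [e]
  have hc := h.finish.conn
  have hup : (T' (r - 1) a).conn .bottom = false := by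
    rw [hT'.vert, sub_add_cancel, hc.2.2.2.2.2.1]
  have := isoE_pair (hZ r) r a (Y := Z (r + 1)) (fun i j hij => hZs r i j hij hlt.le le_rfl)
    (P := {q | q ∈ [pt (-1 / 2) 0 0, pt (3 / 2) 0 0, pt 1 (1 / 2) 0, pt 0 (-1 / 2) 0,
      pt 1 (-1 / 2) 0]}) (l := [(pt 1 (1 / 2) 0, pt 0 (1 / 2) 0)]) (l' := []) (fun p hp => by
      simp only [List.mem_cons, List.not_mem_nil, or_false, mem_ofPred_eq]
      rcases blockPts_pair hp with h | h | ⟨-, h⟩ | ⟨h, -⟩ | ⟨h, -⟩ | ⟨h, -⟩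
      · simp only [h, true_or, or_true]
      · simp only [h, true_or, or_true]
      · rw [hpred, hup] at h; exact absurd h (by simp)
      · simp only [h, true_or, or_true]
      · simp only [h, true_or, or_true]
      · simp only [h, true_or, or_true]) (by
        rw [hlt', hlt1]; exact LocEq.leg_end h.finish)
  rw [poly_nil, image_empty, union_empty, h1] at this
  convert this using 4

/-! ### Symmetries of the square -/

/-- The mirror image of a tile under the exchange of left and right. -/
def Tile.mirror : Tile → Tile
  | .arcLeftBottom => .arcRightBottom
  | .arcRightBottom => .arcLeftBottom
  | .arcTopRight => .arcTopLeft
  | .arcTopLeft => .arcTopRight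
  | .arcsLeftBottomTopRight => .arcsRightBottomTopLeft
  | .arcsRightBottomTopLeft => .arcsLeftBottomTopRight
  | t => t

/-- The mirror image of a tile under the reflection in the diagonal that exchanges rows and
columns. -/
def Tile.transpose : Tile → Tile
  | .arcLeftBottom => .arcTopRight
  | .arcTopRight => .arcLeftBottom
  | .horizontal => .vertical
  | .vertical => .horizontal
  | .crossingHorizontalOver => .crossingVerticalOver
  | .crossingVerticalOver => .crossingHorizontalOver
  | t => t

theorem Tile.mirror_mirror (t : Tile) : t.mirror.mirror = t := by cases t <;> rfl

theorem Tile.transpose_transpose (t : Tile) : t.transpose.transpose = t := by cases t <;> rfl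

theorem Tile.mirror_conn (t : Tile) : t.mirror.conn .left = t.conn .right ∧
    t.mirror.conn .right = t.conn .left ∧ t.mirror.conn .top = t.conn .top ∧
    t.mirror.conn .bottom = t.conn .bottom := by cases t <;> decide

theorem Tile.transpose_conn (t : Tile) : t.transpose.conn .left = t.conn .top ∧
    t.transpose.conn .right = t.conn .bottom ∧ t.transpose.conn .top = t.conn .left ∧
    t.transpose.conn .bottom = t.conn .right := by cases t <;> decide

theorem Tile.mirror_blank (t : Tile) : t.mirror = .blank ↔ t = .blank := by cases t <;> decide

theorem Tile.transpose_blank (t : Tile) : t.transpose = .blank ↔ t = .blank := by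
  cases t <;> decide

/-- The mirror image of a grid under the exchange of left and right. -/
def flipX (n : ℤ) (T : ℤ → ℤ → Tile) : ℤ → ℤ → Tile := fun i j => (T i (n - 1 - j)).mirror

/-- The mirror image of a grid under the exchange of rows and columns. -/
def flipD (T : ℤ → ℤ → Tile) : ℤ → ℤ → Tile := fun i j => (T j i).transpose

theorem mirror_mirror (n : ℤ) (T : ℤ → ℤ → Tile) : flipX n (flipX n T) = T := by
  funext i j; simp [flipX, Tile.mirror_mirror]

theorem transpose_transpose (T : ℤ → ℤ → Tile) : flipD (flipD T) = T := by
  funext i j; simp [flipD, Tile.transpose_transpose]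

theorem Good.mirror {n : ℤ} {T : ℤ → ℤ → Tile} (h : Good n T) : Good n (flipX n T) where
  support i j hb := by
    have := h.support i (n - 1 - j) (by simpa [flipX, Tile.mirror_blank] using hb)
    omega
  horiz i j := by
    simp only [flipX, Tile.mirror_conn]
    have := h.horiz i (n - 1 - (j + 1))
    rw [this]; congr 2; ring
  vert i j := by
    simp only [flipX, Tile.mirror_conn]; exact h.vert _ _

theorem Good.transpose {n : ℤ} {T : ℤ → ℤ → Tile} (h : Good n T) : Good n (flipD T) where
  support i j hb := by
    have := h.support j i (by simpa [flipD, Tile.transpose_blank] using hb)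
    omega
  horiz i j := by simp only [flipD, Tile.transpose_conn]; exact h.vert _ _
  vert i j := by simp only [flipD, Tile.transpose_conn]; exact h.horiz _ _

/-- An involution of three-space that preserves distances, as an isometry equivalence. -/
noncomputable def involution (f : E3 → E3) (hf : ∀ p, f (f p) = p)
    (hd : ∀ p q, dist (f p) (f q) = dist p q) : E3 ≃ᵢ E3 where
  toFun := f
  invFun := f
  left_inv := hf
  right_inv := hf
  isometry_toFun := Isometry.of_dist_eq hd

/-- The reflection `x ↦ m - x` in the first coordinate. -/
noncomputable def reflectX (m : ℝ) : E3 ≃ᵢ E3 :=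
  involution (fun p => pt (m - p 0) (p 1) (p 2)) (fun p => by refine ext_pt ?_ ?_ ?_ <;> simp)
    (fun p q => by
      simp only [EuclideanSpace.dist_eq, Fin.sum_univ_three, Real.dist_eq, sq_abs, pt_zero, pt_one,
        pt_two]
      congr 1; ring)

/-- The reflection in the line `x + y = 0`. -/
noncomputable def reflectD : E3 ≃ᵢ E3 :=
  involution (fun p => pt (-p 1) (-p 0) (p 2)) (fun p => by refine ext_pt ?_ ?_ ?_ <;> simp)
    (fun p q => by
      simp only [EuclideanSpace.dist_eq, Fin.sum_univ_three, Real.dist_eq, sq_abs, pt_zero, pt_one,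
        pt_two]
      congr 1; ring)

theorem reflectX_apply (m : ℝ) (p : E3) : reflectX m p = pt (m - p 0) (p 1) (p 2) := rfl

theorem reflectD_apply (p : E3) : reflectD p = pt (-p 1) (-p 0) (p 2) := rfl

theorem mem_poly_reflectX {l l' : List (E3 × E3)} {p : E3} (hp : p ∈ poly l)
    (h : ∀ e ∈ l, (reflectX 0 e.1, reflectX 0 e.2) ∈ l' ∨ (reflectX 0 e.2, reflectX 0 e.1) ∈ l') :
    reflectX 0 p ∈ poly l' := by
  obtain ⟨e, he, hp⟩ := hp
  obtain ⟨s, t, hs, ht, hst, h0, h1, h2⟩ := mem_segment_iff.1 hp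
  have hmem : reflectX 0 p ∈ segment ℝ (reflectX 0 e.1) (reflectX 0 e.2) :=
    mem_segment_iff.2 ⟨s, t, hs, ht, hst, by simp [reflectX_apply, h0]; ring,
      by simp [reflectX_apply, h1], by simp [reflectX_apply, h2]⟩
  rcases h e he with h | h
  · exact ⟨_, h, hmem⟩
  · exact ⟨_, h, by rwa [segment_symm]⟩

theorem mem_poly_reflectD {l l' : List (E3 × E3)} {p : E3} (hp : p ∈ poly l)
    (h : ∀ e ∈ l, (reflectD e.1, reflectD e.2) ∈ l' ∨ (reflectD e.2, reflectD e.1) ∈ l') :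
    reflectD p ∈ poly l' := by
  obtain ⟨e, he, hp⟩ := hp
  obtain ⟨s, t, hs, ht, hst, h0, h1, h2⟩ := mem_segment_iff.1 hp
  have hmem : reflectD p ∈ segment ℝ (reflectD e.1) (reflectD e.2) :=
    mem_segment_iff.2 ⟨s, t, hs, ht, hst, by simp [reflectD_apply, h1]; ring,
      by simp [reflectD_apply, h0]; ring, by simp [reflectD_apply, h2]⟩
  rcases h e he with h | h
  · exact ⟨_, h, hmem⟩
  · exact ⟨_, h, by rwa [segment_symm]⟩

theorem Tile.mem_curve_mirror {t : Tile} {p : E3} (hp : p ∈ t.curve) :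
    reflectX 0 p ∈ t.mirror.curve := by
  rw [Tile.curve_eq] at hp ⊢
  refine mem_poly_reflectX hp ?_
  cases t <;> simp [Tile.edges, Tile.mirror, reflectX_apply, neg_div]

theorem Tile.mem_curve_transpose {t : Tile} {p : E3} (hp : p ∈ t.curve) :
    reflectD p ∈ t.transpose.curve := by
  rw [Tile.curve_eq] at hp ⊢
  refine mem_poly_reflectD hp ?_
  cases t <;> simp [Tile.edges, Tile.transpose, reflectD_apply, neg_div]

theorem gridLink_mirror (n : ℤ) (T : ℤ → ℤ → Tile) :
    gridLink (flipX n T) = reflectX (n - 1) '' gridLink T := by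
  have key : ∀ (T : ℤ → ℤ → Tile) p, p ∈ gridLink T →
      reflectX (n - 1) p ∈ gridLink (flipX n T) := by
    rintro T p ⟨i, j, -, hp⟩
    refine ⟨i, n - 1 - j, trivial, ?_⟩
    simp only [curves, flipX, sub_sub_cancel]
    convert Tile.mem_curve_mirror hp using 1
    refine ext_pt ?_ ?_ ?_ <;> simp [reflectX_apply]
  refine Subset.antisymm (fun p hp => ?_) (image_subset_iff.2 fun p hp => key T p hp)
  refine ⟨_, mirror_mirror n T ▸ key _ p hp, ?_⟩
  refine ext_pt ?_ ?_ ?_ <;> simp [reflectX_apply]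

theorem gridLink_transpose (T : ℤ → ℤ → Tile) :
    gridLink (flipD T) = reflectD '' gridLink T := by
  have key : ∀ (T : ℤ → ℤ → Tile) p, p ∈ gridLink T → reflectD p ∈ gridLink (flipD T) := by
    rintro T p ⟨i, j, -, hp⟩
    refine ⟨j, i, trivial, ?_⟩
    simp only [curves, flipD]
    convert Tile.mem_curve_transpose hp using 1
    refine ext_pt ?_ ?_ ?_ <;> simp [reflectD_apply] <;> ring
  refine Subset.antisymm (fun p hp => ?_) (image_subset_iff.2 fun p hp => key T p hp)
  refine ⟨_, transpose_transpose T ▸ key _ p hp, ?_⟩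
  refine ext_pt ?_ ?_ ?_ <;> simp [reflectD_apply]

theorem Sim.mirror {T T' : ℤ → ℤ → Tile} (n : ℤ) (h : Sim T T') :
    Sim (flipX n T) (flipX n T') := by
  have := AmbientIsotopic.image h (reflectX (n - 1)).toHomeomorph.onePointCongr
  rwa [← lift_image, ← lift_image, IsometryEquiv.coe_toHomeomorph, ← gridLink_mirror,
    ← gridLink_mirror] at this

theorem Sim.transpose {T T' : ℤ → ℤ → Tile} (h : Sim T T') :
    Sim (flipD T) (flipD T') := by
  have := AmbientIsotopic.image h reflectD.toHomeomorph.onePointCongr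
  rwa [← lift_image, ← lift_image, IsometryEquiv.coe_toHomeomorph, ← gridLink_transpose,
    ← gridLink_transpose] at this

/-! ### Weights of grids -/

/-- The sum of a weight, which may depend on the position, over the tiles of a grid. -/
noncomputable def weight (n : ℤ) (w : ℤ → ℤ → Tile → ℤ) (T : ℤ → ℤ → Tile) : ℤ :=
  ∑ i ∈ Finset.Ico 0 n, ∑ j ∈ Finset.Ico 0 n, w i j (T i j)

theorem sum_reflect {n : ℤ} (f : ℤ → ℤ) :
    ∑ j ∈ Finset.Ico 0 n, f (n - 1 - j) = ∑ j ∈ Finset.Ico 0 n, f j := by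
  refine Finset.sum_nbij' (fun j => n - 1 - j) (fun j => n - 1 - j) ?_ ?_ ?_ ?_ ?_ <;>
    simp only [Finset.mem_Ico] <;> intros <;> first | omega | trivial

theorem weight_mirror (n : ℤ) (w : ℤ → ℤ → Tile → ℤ) (T : ℤ → ℤ → Tile) :
    weight n w (flipX n T) = weight n (fun i j t => w i (n - 1 - j) t.mirror) T := by
  refine Finset.sum_congr rfl fun i _ => ?_
  rw [← sum_reflect]
  simp [flipX]

theorem weight_transpose (n : ℤ) (w : ℤ → ℤ → Tile → ℤ) (T : ℤ → ℤ → Tile) :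
    weight n w (flipD T) = weight n (fun i j t => w j i t.transpose) T := by
  unfold weight
  rw [Finset.sum_comm]
  rfl

/-- The weight that counts the non-blank tiles. -/
def nonblank (t : Tile) : ℤ := if t = .blank then 0 else 1

theorem nonblank_mirror (t : Tile) : nonblank t.mirror = nonblank t := by cases t <;> rfl

theorem nonblank_transpose (t : Tile) : nonblank t.transpose = nonblank t := by cases t <;> rfl

theorem nonblank_nonneg (t : Tile) : 0 ≤ nonblank t := by cases t <;> decide

theorem nonblank_le_one (t : Tile) : nonblank t ≤ 1 := by cases t <;> decide

/-- The tile number of a grid. -/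
noncomputable def count (n : ℤ) (T : ℤ → ℤ → Tile) : ℤ := weight n (fun _ _ => nonblank) T

theorem count_mirror (n : ℤ) (T : ℤ → ℤ → Tile) : count n (flipX n T) = count n T := by
  simp only [count, weight_mirror, nonblank_mirror]

theorem count_transpose (n : ℤ) (T : ℤ → ℤ → Tile) : count n (flipD T) = count n T := by
  simp only [count, weight_transpose, nonblank_transpose]

theorem weight_lt {n : ℤ} {w : ℤ → ℤ → Tile → ℤ} {T T' : ℤ → ℤ → Tile}
    (h : ∀ i j, w i j (T' i j) ≤ w i j (T i j)) {i₀ j₀ : ℤ} (hi : 0 ≤ i₀ ∧ i₀ < n)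
    (hj : 0 ≤ j₀ ∧ j₀ < n) (h0 : w i₀ j₀ (T' i₀ j₀) < w i₀ j₀ (T i₀ j₀)) :
    weight n w T' < weight n w T :=
  Finset.sum_lt_sum (fun i _ => Finset.sum_le_sum fun j _ => h i j)
    ⟨i₀, Finset.mem_Ico.2 hi, Finset.sum_lt_sum (fun j _ => h i₀ j) ⟨j₀, Finset.mem_Ico.2 hj, h0⟩⟩

/-- The change of a weight when a strand is moved to the next column. -/
theorem LegShift.weight_le {n : ℤ} {T T' : ℤ → ℤ → Tile} {a s r : ℤ} (hT : Good n T)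
    (h : LegShift T T' a s r) (w : ℤ → ℤ → Tile → ℤ)
    (hm : ∀ i, s < i → i < r → w i a (T i (a + 1)) + w i (a + 1) (T i a) ≤
      w i a (T i a) + w i (a + 1) (T i (a + 1))) :
    weight n w T' ≤ weight n w T +
      (w s a (T' s a) + w s (a + 1) (T' s (a + 1)) - w s a (T s a) - w s (a + 1) (T s (a + 1))) +
      (w r a (T' r a) + w r (a + 1) (T' r (a + 1)) - w r a (T r a) -
        w r (a + 1) (T r (a + 1))) := by
  have hs := h.start.conn
  have he := h.finish.conn
  have bs := hT.support s a hs.2.2.2.2.2.2.2.2.2.1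
  have bs' := hT.support s (a + 1) hs.2.2.2.2.2.2.2.2.2.2
  have br := hT.support r a he.2.2.2.2.2.2.2.2.2
  have hlt := h.lt
  let D : ℤ → ℤ := fun i => w i a (T' i a) + w i (a + 1) (T' i (a + 1)) - w i a (T i a) -
    w i (a + 1) (T i (a + 1))
  have hrow : ∀ i, ∑ j ∈ Finset.Ico 0 n, w i j (T' i j) = ∑ j ∈ Finset.Ico 0 n, w i j (T i j) +
      D i := by
    intro i
    rw [← sub_eq_iff_eq_add', ← Finset.sum_sub_distrib]
    rw [← Finset.sum_subset (s₁ := {a, a + 1}), Finset.sum_pair (by omega)]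
    · simp only [D]; ring
    · intro j hj
      simp only [Finset.mem_insert, Finset.mem_singleton, Finset.mem_Ico] at hj ⊢
      omega
    · intro j _ hj
      simp only [Finset.mem_insert, Finset.mem_singleton] at hj
      rw [h.off i j (by omega), sub_self]
  have hD : ∑ i ∈ Finset.Ico 0 n, D i ≤ D s + D r := by
    rw [← Finset.sum_pair (f := D) hlt.ne]
    refine Finset.sum_le_sum_of_subset_of_nonpos' (fun i hi => ?_) fun i _ hi => ?_
    · simp only [Finset.mem_insert, Finset.mem_singleton, Finset.mem_Ico] at hi ⊢
      omega
    · simp only [Finset.mem_insert, Finset.mem_singleton, not_or] at hi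
      by_cases hi' : s < i ∧ i < r
      · have := hm i hi'.1 hi'.2
        obtain ⟨-, e1, e2⟩ := h.mid i hi'.1 hi'.2
        simp only [D, e1, e2]; linarith
      · simp only [D, h.off i a (by omega), h.off i (a + 1) (by omega)]; linarith
  have : weight n w T' = weight n w T + ∑ i ∈ Finset.Ico 0 n, D i := by
    unfold weight
    rw [← Finset.sum_add_distrib]
    exact Finset.sum_congr rfl fun i _ => hrow i
  rw [this]
  simp only [D] at hD ⊢
  linarith

/-! ### Grids with the least tile number -/

/-- There is a loop around a vertex: the four tiles at the lower right corner of cell `(i, j)` all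
contain the arc around that corner. -/
def HasLoop (T : ℤ → ℤ → Tile) (i j : ℤ) : Prop :=
  (T i j = .arcRightBottom ∨ T i j = .arcsRightBottomTopLeft) ∧
  (T i (j + 1) = .arcLeftBottom ∨ T i (j + 1) = .arcsLeftBottomTopRight) ∧
  (T (i + 1) j = .arcTopRight ∨ T (i + 1) j = .arcsLeftBottomTopRight) ∧
  (T (i + 1) (j + 1) = .arcTopLeft ∨ T (i + 1) (j + 1) = .arcsRightBottomTopLeft)

/-- A grid whose tile number is the least among the grids of the same size that depict the same
link, none of which contains a loop around a vertex. -/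
structure Tight (n : ℤ) (T : ℤ → ℤ → Tile) : Prop where
  good : Good n T
  minimal : ∀ T', Good n T' → Sim T T' → count n T ≤ count n T'
  no_loop : ∀ T', Good n T' → Sim T T' → ∀ i j, ¬ HasLoop T' i j

theorem Tight.of_sim {n : ℤ} {T T' : ℤ → ℤ → Tile} (h : Tight n T) (hT' : Good n T')
    (hs : Sim T T') (hc : count n T' ≤ count n T) : Tight n T' where
  good := hT'
  minimal T'' h1 h2 := hc.trans (h.minimal T'' h1 (hs.trans h2))
  no_loop T'' h1 h2 := h.no_loop T'' h1 (hs.trans h2)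

theorem Tight.mirror {n : ℤ} {T : ℤ → ℤ → Tile} (h : Tight n T) : Tight n (flipX n T) where
  good := h.good.mirror
  minimal T' h1 h2 := by
    have := h.minimal _ h1.mirror (by simpa [mirror_mirror] using h2.mirror n)
    rwa [count_mirror] at this ⊢
  no_loop T' h1 h2 i j hl := by
    refine h.no_loop _ h1.mirror (by simpa [mirror_mirror] using h2.mirror n) i (n - 1 - (j + 1)) ?_
    simp only [HasLoop, flipX] at hl ⊢
    rw [show n - 1 - (n - 1 - (j + 1)) = j + 1 by ring,
      show n - 1 - (n - 1 - (j + 1) + 1) = j by ring]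
    obtain ⟨a | a, b | b, c | c, d | d⟩ := hl <;> simp [a, b, c, d, Tile.mirror]

theorem Tight.transpose {n : ℤ} {T : ℤ → ℤ → Tile} (h : Tight n T) : Tight n (flipD T) where
  good := h.good.transpose
  minimal T' h1 h2 := by
    have := h.minimal _ h1.transpose (by simpa [transpose_transpose] using h2.transpose)
    rwa [count_transpose] at this ⊢
  no_loop T' h1 h2 i j hl := by
    refine h.no_loop _ h1.transpose (by simpa [transpose_transpose] using h2.transpose) j i ?_
    simp only [HasLoop, flipD] at hl ⊢
    obtain ⟨a | a, b | b, c | c, d | d⟩ := hl <;> simp [a, b, c, d, Tile.transpose]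

theorem Good.eq_blank {n : ℤ} {T : ℤ → ℤ → Tile} (h : Good n T) {i j : ℤ}
    (hij : ¬ (0 ≤ i ∧ i < n ∧ 0 ≤ j ∧ j < n)) : T i j = .blank := by
  by_contra hb
  exact hij (h.support i j hb)

theorem Good.left {n : ℤ} {T : ℤ → ℤ → Tile} (h : Good n T) (i j : ℤ) :
    (T i j).conn .left = (T i (j - 1)).conn .right := by
  rw [h.horiz, sub_add_cancel]

theorem Good.top {n : ℤ} {T : ℤ → ℤ → Tile} (h : Good n T) (i j : ℤ) :
    (T i j).conn .top = (T (i - 1) j).conn .bottom := by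
  rw [h.vert, sub_add_cancel]

theorem Good.top_zero {n : ℤ} {T : ℤ → ℤ → Tile} (h : Good n T) (j : ℤ) :
    (T 0 j).conn .top = false := by
  rw [h.top, h.eq_blank (by omega), blank_conn]

/-! #### Tiles with prescribed connection points -/

theorem Tile.of_no_left_top {t : Tile} (hb : t ≠ .blank) (hl : t.conn .left = false)
    (ht : t.conn .top = false) : t = .arcRightBottom := by
  revert hb hl ht; cases t <;> decide

theorem Tile.of_left_no_top {t : Tile} (hl : t.conn .left = true) (ht : t.conn .top = false) :
    t = .horizontal ∨ t = .arcLeftBottom := by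
  revert hl ht; cases t <;> decide

theorem Tile.of_no_left_no_top {t : Tile} (hl : t.conn .left = false) (ht : t.conn .top = false) :
    t = .blank ∨ t = .arcRightBottom := by
  revert hl ht; cases t <;> decide

theorem Tile.of_top_no_left {t : Tile} (ht : t.conn .top = true) (hl : t.conn .left = false) :
    t = .vertical ∨ t = .arcTopRight := by
  revert hl ht; cases t <;> decide

theorem Tile.of_top_no_right {t : Tile} (ht : t.conn .top = true) (hr : t.conn .right = false) :
    t = .vertical ∨ t = .arcTopLeft := by
  revert hr ht; cases t <;> decide

theorem Tile.of_top_right {t : Tile} (ht : t.conn .top = true) (hr : t.conn .right = true) :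
    t = .arcTopRight ∨ t = .arcsLeftBottomTopRight ∨ LegMid t .horizontal := by
  revert hr ht
  cases t <;>
    first
    | decide
    | (intros; exact Or.inr (Or.inr (by constructor)))
    | simp [conn, strands]

theorem Tile.of_left_top {t : Tile} (hl : t.conn .left = true) (ht : t.conn .top = true) :
    t = .arcTopLeft ∨ t = .arcsRightBottomTopLeft ∨ t = .arcsLeftBottomTopRight ∨
      t = .crossingHorizontalOver ∨ t = .crossingVerticalOver := by
  revert hl ht; cases t <;> decide

/-! #### Corners -/

/-- In a tight grid no leg of an arch can be moved without increasing the number of tiles at the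
lower end of the leg. -/
theorem Tight.false_of_legShift {n : ℤ} {T T' : ℤ → ℤ → Tile} {a s r : ℤ} (hT : Tight n T)
    (h : LegShift T T' a s r) (hs : T s a = .arcRightBottom)
    (he : nonblank (T' r a) + nonblank (T' r (a + 1)) ≤
      nonblank (T r a) + nonblank (T r (a + 1))) : False := by
  have h1 := hT.minimal T' (h.good hT.good) (h.isoE hT.good).sim
  have h2 := h.weight_le hT.good (fun _ _ => nonblank) fun i hi hi' => by linarith
  have h3 : nonblank (T' s a) + nonblank (T' s (a + 1)) - nonblank (T s a) -
      nonblank (T s (a + 1)) ≤ -1 := by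
    have := h.start
    rw [hs] at this ⊢
    generalize T s (a + 1) = x1 at this ⊢
    generalize T' s a = x2 at this ⊢
    generalize T' s (a + 1) = x3 at this ⊢
    cases this
    decide
  unfold count at h1
  linarith

/-- The result of removing the three upper left tiles of a loop in the corner. -/
def cornerGrid (T : ℤ → ℤ → Tile) : ℤ → ℤ → Tile := fun i j =>
  if i = 0 ∧ j = 0 ∨ i = 0 ∧ j = 1 ∨ i = 1 ∧ j = 0 then .blank
  else if i = 1 ∧ j = 1 then .arcRightBottom else T i j

theorem blockPts_quad {c : ℤ → ℤ → Side → Bool} {s a : ℤ} : blockPts c s a 1 1 ⊆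
    {q | q ∈ [pt (-1 / 2) 0 0, pt (-1 / 2) (-1) 0, pt 0 (1 / 2) 0, pt 1 (1 / 2) 0, pt (3 / 2) 0 0,
      pt (3 / 2) (-1) 0, pt 0 (-3 / 2) 0, pt 1 (-3 / 2) 0]} := by
  rintro p ⟨p2, ⟨j, j0, j1, pj, h⟩ | ⟨i, i0, i1, pi, h⟩⟩
  · have hj : j = 0 ∨ j = 1 := by omega
    simp only [mem_ofPred_eq, List.mem_cons, List.not_mem_nil, or_false]
    rcases hj with rfl | rfl <;> rcases h with ⟨h, -⟩ | ⟨h, -⟩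
    · exact Or.inr (Or.inr (Or.inl (ext_pt (by simpa using pj) h p2)))
    · iterate 6 right
      exact Or.inl (ext_pt (by simpa using pj) (by rw [h, pt_one]; norm_num) p2)
    · exact Or.inr (Or.inr (Or.inr (Or.inl (ext_pt (by simpa using pj) h p2))))
    · iterate 7 right
      exact ext_pt (by simpa using pj) (by rw [h, pt_one]; norm_num) p2
  · have hi : i = 0 ∨ i = 1 := by omega
    simp only [mem_ofPred_eq, List.mem_cons, List.not_mem_nil, or_false]
    rcases hi with rfl | rfl <;> rcases h with ⟨h, -⟩ | ⟨h, -⟩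
    · exact Or.inl (ext_pt h (by rw [pi]; simp) p2)
    · iterate 4 right
      exact Or.inl (ext_pt (by rw [h, pt_zero]; norm_num) (by rw [pi]; simp) p2)
    · right
      exact Or.inl (ext_pt h (by rw [pi]; simp) p2)
    · iterate 5 right
      exact Or.inl (ext_pt (by rw [h, pt_zero]; norm_num) (by rw [pi]; simp) p2)

/-- Three outer arcs around a corner can be removed: either the link is merely shortened, or a curl
is undone by the first Reidemeister move. -/
theorem Tight.false_of_corner {n : ℤ} {T : ℤ → ℤ → Tile} (hT : Tight n T)
    (h00 : T 0 0 = .arcRightBottom) (h01 : T 0 1 = .arcLeftBottom) (h10 : T 1 0 = .arcTopRight)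
    (h11 : T 1 1 = .arcsLeftBottomTopRight ∨ T 1 1 = .crossingHorizontalOver) : False := by
  have hg := hT.good
  have hb := hg.support 1 1 (by rcases h11 with h | h <;> rw [h] <;> decide)
  have c00 : cornerGrid T 0 0 = .blank := rfl
  have c01 : cornerGrid T 0 1 = .blank := rfl
  have c10 : cornerGrid T 1 0 = .blank := rfl
  have c11 : cornerGrid T 1 1 = .arcRightBottom := rfl
  have coff : ∀ i j, ¬ (0 ≤ i ∧ i ≤ 1 ∧ 0 ≤ j ∧ j ≤ 1) → cornerGrid T i j = T i j := by
    intro i j hij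
    unfold cornerGrid
    rw [if_neg (by omega), if_neg (by omega)]
  have hgood : Good n (cornerGrid T) := by
    refine ⟨fun i j hij => ?_, fun i j => ?_, fun i j => ?_⟩
    · by_cases h : 0 ≤ i ∧ i ≤ 1 ∧ 0 ≤ j ∧ j ≤ 1
      · omega
      · rw [coff i j h] at hij; exact hg.support i j hij
    · by_cases h : 0 ≤ i ∧ i ≤ 1 ∧ -1 ≤ j ∧ j ≤ 1
      · have hi : i = 0 ∨ i = 1 := by omega
        have hj : j = -1 ∨ j = 0 ∨ j = 1 := by omega
        rcases hi with rfl | rfl <;> rcases hj with rfl | rfl | rfl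
        · rw [coff 0 (-1) (by omega), hg.eq_blank (by omega)]; rfl
        · rfl
        · rw [coff 0 (1 + 1) (by omega), ← hg.horiz, h01]; rfl
        · rw [coff 1 (-1) (by omega), hg.eq_blank (by omega)]; rfl
        · rfl
        · rw [coff 1 (1 + 1) (by omega), ← hg.horiz, c11]
          rcases h11 with h | h <;> rw [h] <;> rfl
      · rw [coff i j (by omega), coff i (j + 1) (by omega)]; exact hg.horiz _ _
    · by_cases h : -1 ≤ i ∧ i ≤ 1 ∧ 0 ≤ j ∧ j ≤ 1
      · have hi : i = -1 ∨ i = 0 ∨ i = 1 := by omega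
        have hj : j = 0 ∨ j = 1 := by omega
        rcases hi with rfl | rfl | rfl <;> rcases hj with rfl | rfl
        · rw [coff (-1) 0 (by omega), hg.eq_blank (by omega)]; rfl
        · rw [coff (-1) 1 (by omega), hg.eq_blank (by omega)]; rfl
        · rfl
        · rfl
        · rw [coff (1 + 1) 0 (by omega), ← hg.vert, h10]; rfl
        · rw [coff (1 + 1) 1 (by omega), ← hg.vert, c11]
          rcases h11 with h | h <;> rw [h] <;> rfl
      · rw [coff i j (by omega), coff (i + 1) j (by omega)]; exact hg.vert _ _
  have hiso : IsoE (gridLink T) (gridLink (cornerGrid T)) := by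
    have hb : box (-1 / 2) (((1 : ℤ) : ℝ) + 1 / 2) (-((1 : ℤ) : ℝ) - 1 / 2) (1 / 2) =
        box (-1 / 2) (3 / 2) (-3 / 2) (1 / 2) := by norm_num
    have hloc : LocEq (box (-1 / 2) (3 / 2) (-3 / 2) (1 / 2))
        {q | q ∈ [pt (-1 / 2) 0 0, pt (-1 / 2) (-1) 0, pt 0 (1 / 2) 0, pt 1 (1 / 2) 0,
          pt (3 / 2) 0 0, pt (3 / 2) (-1) 0, pt 0 (-3 / 2) 0, pt 1 (-3 / 2) 0]}
        (poly (quadEdges (T 0 0) (T 0 (0 + 1)) (T (0 + 1) 0) (T (0 + 1) (0 + 1))))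
        (poly (quadEdges (cornerGrid T 0 0) (cornerGrid T 0 (0 + 1)) (cornerGrid T (0 + 1) 0)
          (cornerGrid T (0 + 1) (0 + 1)))) := by
      simp only [zero_add, h00, h01, h10, c00, c01, c10, c11]
      rcases h11 with h | h <;> rw [h]
      · exact LocEq.corner_arc
      · exact LocEq.corner_loop
    have := LocEq.block (framed_curves T) (isCompact_curves T) hg.finite 0 0 1 1 zero_le_one
      zero_le_one blockPts_quad (hb ▸ hloc)
    rw [gridLink_eq_block T 0 0 1 1, gridLink_eq_block (cornerGrid T) 0 0 1 1, cells_quad,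
      cells_quad]
    rwa [cells_congr (X := curves (cornerGrid T)) (X' := curves T)]
    intro i j hij
    simp only [curves]
    rw [coff i j]
    intro h
    refine hij ?_
    simp only [block, mem_ofPred_eq]; omega
  refine absurd (hT.minimal _ hgood hiso.sim) (not_le.2 ?_)
  refine weight_lt (fun i j => ?_) (i₀ := 0) (j₀ := 0) (by omega) (by omega)
    (by rw [h00, c00]; decide)
  by_cases h : 0 ≤ i ∧ i ≤ 1 ∧ 0 ≤ j ∧ j ≤ 1
  · have hi : i = 0 ∨ i = 1 := by omega
    have hj : j = 0 ∨ j = 1 := by omega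
    rcases hi with rfl | rfl <;> rcases hj with rfl | rfl
    · rw [c00]; exact nonblank_nonneg _
    · rw [c01]; exact nonblank_nonneg _
    · rw [c10]; exact nonblank_nonneg _
    · rw [c11]; rcases h11 with h | h <;> rw [h] <;> decide
  · rw [coff i j h]

theorem Tight.corner_of_horizontal {n : ℤ} {T : ℤ → ℤ → Tile} (hT : Tight n T)
    (h00 : T 0 0 = .arcRightBottom) (h01 : T 0 1 = .horizontal) :
    T 1 0 = .vertical ∧ T 1 1 = .blank := by
  have hg := hT.good
  have t10 : (T 1 0).conn .top = true := by rw [hg.top, sub_self, h00]; rfl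
  have l10 : (T 1 0).conn .left = false := by rw [hg.left, hg.eq_blank (by omega)]; rfl
  have t11 : (T 1 1).conn .top = false := by rw [hg.top, sub_self, h01]; rfl
  have l11 : (T 1 1).conn .left = (T 1 0).conn .right := by rw [hg.left, sub_self]
  have key : ∀ t u, LegEnd (T 1 0) (T 1 1) t u →
      nonblank t + nonblank u ≤ nonblank (T 1 0) + nonblank (T 1 1) → False := by
    intro t u h hc
    have hs := legShift_legGrid (T := T) (a := 0) (s := 0) (r := 1) (t := .blank)
      (u := .arcRightBottom) (t' := t) (u' := u) one_pos
      (by rw [h00, zero_add, h01]; constructor) (fun i h1 h2 => by omega) (by simpa using h)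
    exact hT.false_of_legShift hs h00 (by simpa [legGrid] using hc)
  rcases Tile.of_top_no_left t10 l10 with h10 | h10 <;> rw [h10] at l11 key
  · refine ⟨h10, ?_⟩
    rcases Tile.of_no_left_no_top l11 t11 with h11 | h11
    · exact h11
    · rw [h11] at key
      exact (key _ _ .verticalArc (by decide)).elim
  · rcases Tile.of_left_no_top l11 t11 with h11 | h11 <;> rw [h11] at key
    · exact (key _ _ .turnHorizontal (by decide)).elim
    · exact (key _ _ .turnDown (by decide)).elim

/-- In a tight grid a non-blank corner tile belongs to an arch that continues straight in both
directions and has nothing directly inside its corner. -/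
theorem Tight.corner {n : ℤ} {T : ℤ → ℤ → Tile} (hT : Tight n T) (h0 : T 0 0 ≠ .blank) :
    T 0 0 = .arcRightBottom ∧ T 0 1 = .horizontal ∧ T 1 0 = .vertical ∧ T 1 1 = .blank := by
  have hg := hT.good
  have h00 := Tile.of_no_left_top h0 (by rw [hg.left, hg.eq_blank (by omega)]; rfl) (hg.top_zero 0)
  have t10 : (T 1 0).conn .top = true := by rw [hg.top, sub_self, h00]; rfl
  have l10 : (T 1 0).conn .left = false := by rw [hg.left, hg.eq_blank (by omega)]; rfl
  have l01 : (T 0 1).conn .left = true := by rw [hg.left, sub_self, h00]; rfl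
  rcases Tile.of_left_no_top l01 (hg.top_zero 1) with h01 | h01
  · have := hT.corner_of_horizontal h00 h01
    exact ⟨h00, h01, this.1, this.2⟩
  exfalso
  rcases Tile.of_top_no_left t10 l10 with h10 | h10
  · have := hT.transpose.corner_of_horizontal (by simp only [flipD, h00]; rfl)
      (by simp only [flipD, h10]; rfl)
    simp only [flipD, h01] at this
    exact absurd this.1 (by decide)
  · have l11 : (T 1 1).conn .left = true := by rw [hg.left, sub_self, h10]; rfl
    have t11 : (T 1 1).conn .top = true := by rw [hg.top, sub_self, h01]; rfl
    have hloop : ¬ HasLoop T 0 0 := hT.no_loop T hg (Sim.refl T) 0 0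
    simp only [HasLoop, zero_add, h00, h01, h10, true_or, true_and] at hloop
    rcases Tile.of_left_top l11 t11 with h | h | h | h | h
    · exact hloop (Or.inl h)
    · exact hloop (Or.inr h)
    · exact hT.false_of_corner h00 h01 h10 (Or.inl h)
    · exact hT.false_of_corner h00 h01 h10 (Or.inr h)
    · exact hT.transpose.false_of_corner (by simp only [flipD, h00]; rfl)
        (by simp only [flipD, h10]; rfl) (by simp only [flipD, h01]; rfl)
        (Or.inr (by simp only [flipD, h]; rfl))

theorem count_le_of_blank {n : ℤ} (hn : 0 ≤ n) {T : ℤ → ℤ → Tile} (S : Finset (ℤ × ℤ))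
    (hS : ∀ q ∈ S, (0 ≤ q.1 ∧ q.1 < n) ∧ (0 ≤ q.2 ∧ q.2 < n) ∧ T q.1 q.2 = .blank) :
    count n T ≤ n ^ 2 - S.card := by
  have h1 : count n T = ∑ q ∈ Finset.Ico 0 n ×ˢ Finset.Ico 0 n, nonblank (T q.1 q.2) := by
    rw [Finset.sum_product]; rfl
  have h2 : (S.card : ℤ) = ∑ q ∈ S, (1 - nonblank (T q.1 q.2)) := by
    rw [Finset.sum_congr rfl (g := fun _ => (1 : ℤ))]
    · simp
    · intro q hq
      rw [(hS q hq).2.2]; rfl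
  have h3 : ∑ q ∈ S, (1 - nonblank (T q.1 q.2)) ≤
      ∑ q ∈ Finset.Ico 0 n ×ˢ Finset.Ico 0 n, (1 - nonblank (T q.1 q.2)) := by
    refine Finset.sum_le_sum_of_subset_of_nonneg (fun q hq => ?_) fun q _ _ => ?_
    · have := hS q hq
      simp only [Finset.mem_product, Finset.mem_Ico]; exact ⟨this.1, this.2.1⟩
    · linarith [nonblank_le_one (T q.1 q.2)]
  rw [← h2, Finset.sum_sub_distrib, ← h1, Finset.sum_const, Finset.card_product, Int.card_Ico] at h3
  have h4 : ((n - 0).toNat : ℤ) = n := by omega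
  simp only [nsmul_eq_mul, Nat.cast_mul, h4, mul_one] at h3
  nlinarith

/-- One of the four cells in a corner of a tight grid is blank. -/
theorem Tight.exists_blank_corner {n : ℤ} {T : ℤ → ℤ → Tile} (hT : Tight n T) :
    ∃ i j, (i = 0 ∨ i = 1) ∧ (j = 0 ∨ j = 1) ∧ T i j = .blank := by
  by_cases h0 : T 0 0 = .blank
  · exact ⟨0, 0, by simp, by simp, h0⟩
  · exact ⟨1, 1, by simp, by simp, (hT.corner h0).2.2.2⟩

/-- The mirror image of a grid under the exchange of top and bottom. -/
def flipY (n : ℤ) (T : ℤ → ℤ → Tile) : ℤ → ℤ → Tile := flipD (flipX n (flipD T))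

theorem mirrorV_blank (n : ℤ) (T : ℤ → ℤ → Tile) (i j : ℤ) :
    flipY n T i j = .blank ↔ T (n - 1 - i) j = .blank := by
  simp only [flipY, flipD, flipX, Tile.mirror_blank, Tile.transpose_blank]

theorem mirror_blank (n : ℤ) (T : ℤ → ℤ → Tile) (i j : ℤ) :
    flipX n T i j = .blank ↔ T i (n - 1 - j) = .blank := by
  simp only [flipX, Tile.mirror_blank]

theorem transpose_blank (T : ℤ → ℤ → Tile) (i j : ℤ) :
    flipD T i j = .blank ↔ T j i = .blank := by
  simp only [flipD, Tile.transpose_blank]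

theorem Tight.mirrorV {n : ℤ} {T : ℤ → ℤ → Tile} (h : Tight n T) : Tight n (flipY n T) :=
  h.transpose.mirror.transpose

theorem Tight.count_le {n : ℤ} (hn : 4 ≤ n) {T : ℤ → ℤ → Tile} (hT : Tight n T) :
    count n T ≤ n ^ 2 - 4 := by
  obtain ⟨i1, j1, hi1, hj1, h1⟩ := hT.exists_blank_corner
  obtain ⟨i2, j2, hi2, hj2, h2⟩ := hT.mirror.exists_blank_corner
  obtain ⟨i3, j3, hi3, hj3, h3⟩ := hT.mirrorV.exists_blank_corner
  obtain ⟨i4, j4, hi4, hj4, h4⟩ := hT.mirrorV.mirror.exists_blank_corner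
  rw [mirror_blank] at h2 h4
  rw [mirrorV_blank] at h3 h4
  have := count_le_of_blank (n := n) (by omega) (T := T)
    {(i1, j1), (i2, n - 1 - j2), (n - 1 - i3, j3), (n - 1 - i4, n - 1 - j4)} (by
      intro q hq
      simp only [Finset.mem_insert, Finset.mem_singleton] at hq
      rcases hq with rfl | rfl | rfl | rfl
      · exact ⟨by omega, by omega, h1⟩
      · exact ⟨by omega, by omega, h2⟩
      · exact ⟨by omega, by omega, h3⟩
      · exact ⟨by omega, by omega, h4⟩)
  rw [Finset.card_insert_of_notMem, Finset.card_insert_of_notMem, Finset.card_insert_of_notMem,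
    Finset.card_singleton] at this
  · simpa using this
  all_goals
    simp only [Finset.mem_insert, Finset.mem_singleton, Prod.mk.injEq]
    omega

/-! ### Straight tiles, boundary tiles, and arches -/

/-- Counts the straight tiles. -/
def straight (t : Tile) : ℤ := if t = .horizontal ∨ t = .vertical then 1 else 0

/-- Counts the non-blank tiles in the first and last rows and columns. -/
def ring (n : ℤ) : ℤ → ℤ → Tile → ℤ := fun i j t =>
  if i = 0 ∨ i = n - 1 ∨ j = 0 ∨ j = n - 1 then nonblank t else 0

/-- Sums a function of the column over the horizontal tiles. -/
def horizontals (f : ℤ → ℤ) : ℤ → ℤ → Tile → ℤ := fun _ j t => if t = .horizontal then f j else 0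

/-- Sums a function of the row over the vertical tiles. -/
def verticals (f : ℤ → ℤ) : ℤ → ℤ → Tile → ℤ := fun i _ t => if t = .vertical then f i else 0

theorem straight_mirror (t : Tile) : straight t.mirror = straight t := by cases t <;> rfl

theorem straight_transpose (t : Tile) : straight t.transpose = straight t := by cases t <;> rfl

theorem straight_nonneg (t : Tile) : 0 ≤ straight t := by cases t <;> decide

theorem weight_straight_mirror (n : ℤ) (T : ℤ → ℤ → Tile) :
    weight n (fun _ _ => straight) (flipX n T) = weight n (fun _ _ => straight) T := by
  simp only [weight_mirror, straight_mirror]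

theorem weight_straight_transpose (n : ℤ) (T : ℤ → ℤ → Tile) :
    weight n (fun _ _ => straight) (flipD T) = weight n (fun _ _ => straight) T := by
  simp only [weight_transpose, straight_transpose]

theorem weight_ring_mirror (n : ℤ) (T : ℤ → ℤ → Tile) :
    weight n (ring n) (flipX n T) = weight n (ring n) T := by
  rw [weight_mirror]
  congr 1
  funext i j t
  simp only [ring, nonblank_mirror]
  refine if_congr ?_ rfl rfl
  omega

theorem weight_ring_transpose (n : ℤ) (T : ℤ → ℤ → Tile) :
    weight n (ring n) (flipD T) = weight n (ring n) T := by
  rw [weight_transpose]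
  congr 1
  funext i j t
  simp only [ring, nonblank_transpose]
  refine if_congr ?_ rfl rfl
  omega

theorem weight_horizontals_mirror (n : ℤ) (f : ℤ → ℤ) (T : ℤ → ℤ → Tile) :
    weight n (horizontals f) (flipX n T) = weight n (horizontals fun j => f (n - 1 - j)) T := by
  rw [weight_mirror]
  congr 1
  funext i j t
  cases t <;> rfl

theorem weight_verticals_mirror (n : ℤ) (f : ℤ → ℤ) (T : ℤ → ℤ → Tile) :
    weight n (verticals f) (flipX n T) = weight n (verticals f) T := by
  rw [weight_mirror]
  congr 1
  funext i j t
  cases t <;> rfl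

theorem weight_horizontals_transpose (n : ℤ) (f : ℤ → ℤ) (T : ℤ → ℤ → Tile) :
    weight n (horizontals f) (flipD T) = weight n (verticals f) T := by
  rw [weight_transpose]
  congr 1
  funext i j t
  cases t <;> rfl

theorem weight_verticals_transpose (n : ℤ) (f : ℤ → ℤ) (T : ℤ → ℤ → Tile) :
    weight n (verticals f) (flipD T) = weight n (horizontals f) T := by
  rw [weight_transpose]
  congr 1
  funext i j t
  cases t <;> rfl

theorem weight_nonneg {n : ℤ} {w : ℤ → ℤ → Tile → ℤ} (h : ∀ i j t, 0 ≤ i → 0 ≤ j → 0 ≤ w i j t)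
    (T : ℤ → ℤ → Tile) : 0 ≤ weight n w T :=
  Finset.sum_nonneg fun i hi => Finset.sum_nonneg fun j hj =>
    h i j _ (Finset.mem_Ico.1 hi).1 (Finset.mem_Ico.1 hj).1

/-- There is an isotopic grid with no more tiles, and with fewer straight tiles or with the same
number of straight tiles and fewer boundary tiles. -/
def Improvable (n : ℤ) (T : ℤ → ℤ → Tile) : Prop :=
  ∃ T', Good n T' ∧ Sim T T' ∧ count n T' ≤ count n T ∧
    (weight n (fun _ _ => straight) T' < weight n (fun _ _ => straight) T ∨
      (weight n (fun _ _ => straight) T' ≤ weight n (fun _ _ => straight) T ∧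
        weight n (ring n) T' < weight n (ring n) T))

/-- There is an isotopic grid that is no worse and in which the horizontal tiles are further to the
left. -/
def Slidable (n : ℤ) (T : ℤ → ℤ → Tile) : Prop :=
  ∃ T', Good n T' ∧ Sim T T' ∧ count n T' ≤ count n T ∧
    weight n (fun _ _ => straight) T' ≤ weight n (fun _ _ => straight) T ∧
    weight n (ring n) T' ≤ weight n (ring n) T ∧
    weight n (horizontals id) T' < weight n (horizontals id) T ∧
    ∀ f, weight n (verticals f) T' ≤ weight n (verticals f) T

theorem Improvable.of_mirror {n : ℤ} {T : ℤ → ℤ → Tile} (h : Improvable n (flipX n T)) :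
    Improvable n T := by
  obtain ⟨T', h1, h2, h3, h4⟩ := h
  refine ⟨flipX n T', h1.mirror, by simpa [mirror_mirror] using h2.mirror n, ?_, ?_⟩
  · rwa [count_mirror] at h3 ⊢
  · rwa [weight_straight_mirror, weight_ring_mirror] at h4 ⊢

theorem Improvable.of_transpose {n : ℤ} {T : ℤ → ℤ → Tile} (h : Improvable n (flipD T)) :
    Improvable n T := by
  obtain ⟨T', h1, h2, h3, h4⟩ := h
  refine ⟨flipD T', h1.transpose, by simpa [transpose_transpose] using h2.transpose, ?_, ?_⟩
  · rwa [count_transpose] at h3 ⊢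
  · rwa [weight_straight_transpose, weight_ring_transpose] at h4 ⊢

/-- The part of an arch in the first row and of its left leg above row `r`: all the tiles to the
right of the leg are horizontal. -/
structure Leg (T : ℤ → ℤ → Tile) (a r : ℤ) : Prop where
  pos : 0 < r
  corner : T 0 a = .arcRightBottom
  side : ∀ i, 0 ≤ i → i < r → T i (a + 1) = .horizontal

theorem Leg.legShift {T : ℤ → ℤ → Tile} {a r : ℤ} (h : Leg T a r)
    (hm : ∀ i, 0 < i → i < r → LegMid (T i a) .horizontal) {t u : Tile}
    (he : LegEnd (T r a) (T r (a + 1)) t u) :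
    LegShift T (legGrid T a 0 r .blank .arcRightBottom t u) a 0 r :=
  legShift_legGrid h.pos (by rw [h.corner, h.side 0 le_rfl h.pos]; constructor)
    (fun i h1 h2 => by rw [h.side i h1.le h2]; exact hm i h1 h2) he

theorem Tight.false_of_legEnd {n : ℤ} {T : ℤ → ℤ → Tile} (hT : Tight n T) {a r : ℤ}
    (h : Leg T a r) (hm : ∀ i, 0 < i → i < r → LegMid (T i a) .horizontal) {t u t' u' : Tile}
    (ht : T r a = t) (hu : T r (a + 1) = u) (he : LegEnd t u t' u')
    (hc : nonblank t' + nonblank u' ≤ nonblank t + nonblank u) : False := by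
  subst ht hu
  refine hT.false_of_legShift (h.legShift hm he) h.corner ?_
  have hp := h.pos
  simpa [legGrid, hp.le, hp.ne'] using hc

theorem Leg.mono {T : ℤ → ℤ → Tile} {a r r' : ℤ} (h : Leg T a r) (h0 : 0 < r') (hr : r' ≤ r) :
    Leg T a r' := ⟨h0, h.corner, fun i h1 h2 => h.side i h1 (by omega)⟩

/-- The leg enters the row below it from above. -/
theorem Leg.top {n : ℤ} {T : ℤ → ℤ → Tile} (hT : Good n T) {a r : ℤ} (h : Leg T a r)
    (hm : ∀ i, 0 < i → i < r → LegMid (T i a) .horizontal) :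
    (T r a).conn .top = true ∧ (T r (a + 1)).conn .top = false := by
  have hp := h.pos
  constructor
  · rw [hT.top]
    by_cases h1 : r = 1
    · rw [h1, sub_self, h.corner]; rfl
    · exact (hm (r - 1) (by omega) (by omega)).conn.2.2.2.2.2.2.1
  · rw [hT.top, h.side (r - 1) (by omega) (by omega)]; rfl

theorem Tight.legMid {n : ℤ} {T : ℤ → ℤ → Tile} (hT : Tight n T) {a r : ℤ} (h : Leg T a r) :
    ∀ i, 0 < i → i < r → LegMid (T i a) .horizontal := by
  suffices ∀ m : ℕ, ∀ i, 0 < i → i < r → i ≤ m → LegMid (T i a) .horizontal from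
    fun i h1 h2 => this i.toNat i h1 h2 (by omega)
  intro m
  induction m with
  | zero => intro i h1 _ h3; omega
  | succ m ih =>
    intro i h1 h2 h3
    have hi := h.mono h1 h2.le
    have hm : ∀ k, 0 < k → k < i → LegMid (T k a) .horizontal := fun k hk hk' =>
      ih k hk (by omega) (by push_cast at h3; omega)
    have hs := h.side i h1.le h2
    have hr : (T i a).conn .right = true := by rw [hT.good.horiz, hs]; rfl
    rcases Tile.of_top_right (hi.top hT.good hm).1 hr with ht | ht | ht
    · exact (hT.false_of_legEnd hi hm ht hs .turnHorizontal (by decide)).elim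
    · exact (hT.false_of_legEnd hi hm ht hs .turnsHorizontal (by decide)).elim
    · exact ht

/-- The tile to the right of the lower end of the leg is not an arc from right to bottom. -/
theorem Tight.leg_ne_arc {n : ℤ} {T : ℤ → ℤ → Tile} (hT : Tight n T) {a r : ℤ} (h : Leg T a r) :
    T r (a + 1) ≠ .arcRightBottom := by
  intro hu
  have hm := hT.legMid h
  have hr : (T r a).conn .right = false := by rw [hT.good.horiz, hu]; rfl
  rcases Tile.of_top_no_right (h.top hT.good hm).1 hr with ht | ht
  · exact hT.false_of_legEnd h hm ht hu .verticalArc (by decide)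
  · exact hT.false_of_legEnd h hm ht hu .arcArc (by decide)

theorem Leg.weight_le {n : ℤ} {T : ℤ → ℤ → Tile} (hT : Good n T) {a r : ℤ} (h : Leg T a r)
    (hm : ∀ i, 0 < i → i < r → LegMid (T i a) .horizontal) {t u t' u' : Tile}
    (ht : T r a = t) (hu : T r (a + 1) = u) (he : LegEnd t u t' u') (w : ℤ → ℤ → Tile → ℤ)
    (hw : ∀ i, 0 < i → i < r → w i a .horizontal + w i (a + 1) (T i a) ≤
      w i a (T i a) + w i (a + 1) .horizontal) :
    weight n w (legGrid T a 0 r .blank .arcRightBottom t' u') ≤ weight n w T +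
      (w 0 a .blank + w 0 (a + 1) .arcRightBottom - w 0 a .arcRightBottom -
        w 0 (a + 1) .horizontal) + (w r a t' + w r (a + 1) u' - w r a t - w r (a + 1) u) := by
  subst ht hu
  have hp := h.pos
  have := (h.legShift hm he).weight_le hT w fun i h1 h2 => by
    rw [h.side i h1.le h2]; exact hw i h1 h2
  have v1 : legGrid T a 0 r .blank .arcRightBottom t' u' 0 a = .blank := by simp [legGrid, hp.le]
  have v2 : legGrid T a 0 r .blank .arcRightBottom t' u' 0 (a + 1) = .arcRightBottom := by
    simp [legGrid, hp.le]
  have v3 : legGrid T a 0 r .blank .arcRightBottom t' u' r a = t' := by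
    simp [legGrid, hp.le, hp.ne']
  have v4 : legGrid T a 0 r .blank .arcRightBottom t' u' r (a + 1) = u' := by
    simp [legGrid, hp.le, hp.ne']
  rwa [v1, v2, v3, v4, h.corner, h.side 0 le_rfl hp] at this

/-- If the cell to the right of the lower end of the leg is blank, then the leg can be moved to the
right without a change of the tile number. This vacates a boundary cell of the first row, but
occupies one of the last row if the leg extends that far. -/
theorem Tight.improvable_or_slidable_of_blank {n : ℤ} {T : ℤ → ℤ → Tile} (hT : Tight n T)
    {a r : ℤ} (h : Leg T a r) (ha : 0 ≤ a) (han : a + 1 < n - 1) (hu : T r (a + 1) = .blank) :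
    Improvable n T ∨ (r = n - 1 ∧ Slidable n T) := by
  have hp := h.pos
  have hg := hT.good
  have hm := hT.legMid h
  have hr : (T r a).conn .right = false := by rw [hg.horiz, hu]; rfl
  have hswap : ∀ w : Tile → ℤ, ∀ i, 0 < i → i < r → w .horizontal + w (T i a) ≤
      w (T i a) + w .horizontal := fun w i _ _ => (add_comm _ _).le
  rcases Tile.of_top_no_right (h.top hg hm).1 hr with ht | ht
  · left
    have hs := h.legShift hm (ht.symm ▸ hu.symm ▸ LegEnd.verticalBlank)
    refine ⟨_, hs.good hg, (hs.isoE hg).sim, ?_, Or.inl ?_⟩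
    · refine (h.weight_le hg hm ht hu .verticalBlank (fun _ _ => nonblank) (hswap _)).trans ?_
      simp [nonblank, count]
    · refine (h.weight_le hg hm ht hu .verticalBlank _ (hswap _)).trans_lt ?_
      simp [straight]
  · have hs : LegShift T (legGrid T a 0 r .blank .arcRightBottom .horizontal .arcTopLeft) a 0 r :=
      h.legShift hm (by rw [ht, hu]; constructor)
    have hW := h.weight_le hg hm ht hu .arcBlank
    have hsG := hs.good hg
    have hsI := (hs.isoE hg).sim
    clear hs
    generalize legGrid T a 0 r .blank .arcRightBottom .horizontal .arcTopLeft = T' at *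
    have hrn : r < n := (hg.support r a (by rw [ht]; decide)).2.1
    have hcount : count n T' ≤ count n T := by
      refine (hW (fun _ _ => nonblank) (hswap _)).trans ?_
      simp [nonblank, count]
    have hstraight : weight n (fun _ _ => straight) T' ≤ weight n (fun _ _ => straight) T := by
      refine (hW _ (hswap _)).trans ?_
      simp [straight]
    have hring := hW (ring n) fun i h1 h2 => by
      have e1 : nonblank (T i a) = 1 := if_neg (hm i h1 h2).conn.2.2.2.2.2.2.2
      have e2 : nonblank .horizontal = 1 := rfl
      simp only [ring, e1, e2, le_refl]
    have e0 : ring n 0 a .blank + ring n 0 (a + 1) .arcRightBottom - ring n 0 a .arcRightBottom -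
        ring n 0 (a + 1) .horizontal = -1 := by simp [ring, nonblank]
    rw [e0] at hring
    by_cases hlast : r = n - 1
    · right
      refine ⟨hlast, T', hsG, hsI, hcount, hstraight, ?_, ?_, fun f => ?_⟩
      · refine hring.trans ?_
        simp [ring, hlast, nonblank]
      · refine (hW _ fun i h1 h2 => ?_).trans_lt ?_
        · have e1 : T i a ≠ .horizontal := fun h => by
            have := hm i h1 h2
            rw [h] at this; cases this
          simp [horizontals, e1]
        · simp [horizontals]
          linarith
      · refine (hW _ fun i h1 h2 => ?_).trans ?_
        · have e1 : T i a ≠ .vertical := fun h => by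
            have := hm i h1 h2
            rw [h] at this; cases this
          simp [verticals, e1]
        · simp [verticals]
    · left
      refine ⟨T', hsG, hsI, hcount, Or.inr ⟨hstraight, ?_⟩⟩
      have e1 : ring n r a .horizontal = ring n r a .arcTopLeft := rfl
      have e2 : ring n r (a + 1) .arcTopLeft = 0 := if_neg (by omega)
      have e3 : ring n r (a + 1) .blank = 0 := if_neg (by omega)
      rw [e1, e2, e3] at hring
      linarith

/-- A strand of horizontal tiles above a gap is lowered into the gap. -/
theorem Tight.improvable_of_gap {n : ℤ} {T : ℤ → ℤ → Tile} (hT : Tight n T) {c d r : ℤ}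
    (hcd : c < d) (hup : ∀ j, c ≤ j → j ≤ d → T (r - 1) j = .horizontal)
    (hc : T r c = .arcLeftBottom) (hgap : ∀ j, c < j → j < d → T r j = .blank)
    (hd : T r d = .arcRightBottom) : Improvable n T := by
  refine Improvable.of_transpose ?_
  have hg := hT.good.transpose
  have e1 : ∀ i, c ≤ i → i ≤ d → flipD T i (r - 1) = .vertical := fun i h1 h2 => by
    simp only [flipD, hup i h1 h2]; rfl
  have e2 : flipD T c r = .arcTopRight := by simp only [flipD, hc]; rfl
  have e3 : flipD T d r = .arcRightBottom := by simp only [flipD, hd]; rfl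
  have hs := legShift_legGrid (T := flipD T) (a := r - 1) (t := .arcTopRight)
    (u := .arcsLeftBottomTopRight) (t' := .arcRightBottom) (u' := .arcsRightBottomTopLeft) hcd
    (by rw [sub_add_cancel, e1 c le_rfl hcd.le, e2]; constructor)
    (fun i h1 h2 => by
      rw [sub_add_cancel, e1 i h1.le h2.le]
      simp only [flipD, hgap i h1 h2]
      constructor)
    (by rw [sub_add_cancel, e1 d hcd.le le_rfl, e3]; constructor)
  have hne : r ≠ r - 1 := by omega
  refine ⟨_, hs.good hg, (hs.isoE hg).sim, ?_, Or.inl ?_⟩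
  · refine (hs.weight_le hg _ fun i _ _ => (add_comm _ _).le).trans ?_
    simp [legGrid, hcd.le, hcd.ne', hne, e1 c le_rfl hcd.le, e1 d hcd.le le_rfl, e2, e3,
      nonblank, count]
  · refine (hs.weight_le hg _ fun i _ _ => (add_comm _ _).le).trans_lt ?_
    simp [legGrid, hcd.le, hcd.ne', hne, e1 c le_rfl hcd.le, e1 d hcd.le le_rfl, e2, e3, straight]

theorem exists_first {P : ℤ → Prop} {a b : ℤ} (hab : a ≤ b) (hb : P b) :
    ∃ c, a ≤ c ∧ c ≤ b ∧ P c ∧ ∀ j, a ≤ j → j < c → ¬ P j := by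
  classical
  have h : ∃ m : ℕ, P (a + m) := ⟨(b - a).toNat, by rwa [show a + ((b - a).toNat : ℤ) = b by omega]⟩
  refine ⟨a + Nat.find h, by omega, ?_, Nat.find_spec h, fun j h1 h2 hj => ?_⟩
  · have := Nat.find_min' h (m := (b - a).toNat)
      (by rwa [show a + ((b - a).toNat : ℤ) = b by omega])
    omega
  · exact Nat.find_min h (m := (j - a).toNat) (by omega)
      (by rwa [show a + ((j - a).toNat : ℤ) = j by omega])

/-- An arch of width at least three on the first row can be improved or slid. In the first row that
is not filled by horizontal tiles between its legs, there is room to move one of the legs inwards, or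
there is a gap to which the strand above it can be lowered. -/
theorem Tight.improvable_or_slidable_of_arch {n : ℤ} {T : ℤ → ℤ → Tile} (hT : Tight n T) {a b : ℤ}
    (ha : 1 ≤ a) (hab : a + 2 ≤ b) (hb : b ≤ n - 2) (hTa : T 0 a = .arcRightBottom)
    (hTb : T 0 b = .arcLeftBottom) (hH : ∀ j, a < j → j < b → T 0 j = .horizontal) :
    Improvable n T ∨ Slidable n T := by
  have hg := hT.good
  obtain ⟨r, hr1, hrn, ⟨c', hc'⟩, hfirst⟩ := exists_first (a := 1) (b := n)
    (P := fun i => ∃ j, a < j ∧ j < b ∧ T i j ≠ .horizontal) (by omega)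
    ⟨a + 1, by omega, by omega, by rw [hg.eq_blank (by omega)]; decide⟩
  have hrows : ∀ i, 0 ≤ i → i < r → ∀ j, a < j → j < b → T i j = .horizontal := by
    intro i h1 h2 j h3 h4
    by_cases hi : i = 0
    · rw [hi]; exact hH j h3 h4
    · by_contra hne
      exact hfirst i (by omega) h2 ⟨j, h3, h4, hne⟩
  have hleg : Leg T a r :=
    ⟨by omega, hTa, fun i h1 h2 => hrows i h1 h2 _ (by omega) (by omega)⟩
  have hleg' : Leg (flipX n T) (n - 1 - b) r := by
    refine ⟨by omega, ?_, fun i h1 h2 => ?_⟩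
    · simp only [flipX, sub_sub_cancel, hTb]; rfl
    · simp only [flipX]
      rw [hrows i h1 h2 _ (by omega) (by omega)]; rfl
  have hm := hT.legMid hleg
  have hnotop : ∀ j, a < j → j < b → (T r j).conn .top = false := by
    intro j h1 h2
    rw [hg.top, hrows (r - 1) (by omega) (by omega) j h1 h2]; rfl
  -- If the arch can be narrowed at its left leg, this is an improvement.
  by_cases hblank : T r (a + 1) = .blank
  · rcases hT.improvable_or_slidable_of_blank hleg (by omega) (by omega) hblank with h | ⟨-, h⟩
    · exact Or.inl h
    · exact Or.inr h
  left
  obtain ⟨c, hc1, hc2, hcH, hcfirst⟩ := exists_first (a := a + 1)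
    (P := fun j => T r j ≠ .horizontal) (show a + 1 ≤ c' by omega) hc'.2.2
  have hcleft : (T r c).conn .left = true := by
    by_cases h1 : c = a + 1
    · by_contra hl
      rw [h1] at hl
      rcases Tile.of_no_left_no_top (by simpa using hl) (hleg.top hg hm).2 with h | h
      · exact hblank h
      · exact hT.leg_ne_arc hleg h
    · have := hcfirst (c - 1) (by omega) (by omega)
      rw [not_not] at this
      rw [hg.left, this]; rfl
  have hTc : T r c = .arcLeftBottom :=
    (Tile.of_left_no_top hcleft (hnotop c (by omega) (by omega))).resolve_left hcH
  have hrn' : r < n - 1 := by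
    have h1 := hg.vert r c
    rw [hTc] at h1
    have h2 := hg.support (r + 1) c fun h => by rw [h] at h1; exact absurd h1 (by decide)
    omega
  have hright : flipX n T r (n - 1 - b + 1) = (T r (b - 1)).mirror := by
    simp only [flipX]; congr 2; ring
  -- Likewise at its right leg.
  by_cases hblank' : T r (b - 1) = .blank
  · rw [hblank'] at hright
    rcases hT.mirror.improvable_or_slidable_of_blank hleg' (by omega) (by omega) hright with
      h | ⟨h, -⟩
    · exact h.of_mirror
    · omega
  have hcb : c < b - 1 := by
    by_contra hcb
    have : c = b - 1 := by omega
    rw [← this, hTc] at hright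
    exact hT.mirror.leg_ne_arc hleg' hright
  obtain ⟨d, hd1, hd2, hdb, hdfirst⟩ := exists_first (a := c + 1)
    (P := fun j => T r j ≠ .blank) (show c + 1 ≤ b - 1 by omega) hblank'
  refine hT.improvable_of_gap (c := c) (d := d) (r := r) (by omega)
    (fun j h1 h2 => hrows (r - 1) (by omega) (by omega) j (by omega) (by omega)) hTc
    (fun j h1 h2 => not_not.1 (hdfirst j (by omega) h2)) ?_
  refine Tile.of_no_left_top hdb ?_ (hnotop d (by omega) (by omega))
  by_cases h1 : d = c + 1
  · rw [h1, ← hg.horiz, hTc]; rfl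
  · rw [hg.left, not_not.1 (hdfirst (d - 1) (by omega) (by omega))]; rfl

/-- If the first row is blank at its two ends only and `n` is odd, then it contains an arch of width
at least three: arches of width two would fill an even number of cells. -/
theorem Tight.improvable_or_slidable_of_side {n : ℤ} {T : ℤ → ℤ → Tile} (hT : Tight n T)
    (hodd : Odd n) (hn : 3 ≤ n) (h0 : T 0 0 = .blank) (hlast : T 0 (n - 1) = .blank)
    (hside : ∀ j, 1 ≤ j → j ≤ n - 2 → T 0 j ≠ .blank) : Improvable n T ∨ Slidable n T := by
  have hg := hT.good
  by_cases hex : ∃ a, 1 ≤ a ∧ a + 1 ≤ n - 2 ∧ T 0 a = .arcRightBottom ∧ T 0 (a + 1) = .horizontal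
  · obtain ⟨a, ha1, ha2, hTa, hTa'⟩ := hex
    obtain ⟨b, hb1, hb2, hbH, hbfirst⟩ := exists_first (a := a + 2)
      (P := fun j => T 0 j ≠ .horizontal) (show a + 2 ≤ n - 1 by omega) (by rw [hlast]; decide)
    have hH : ∀ j, a < j → j < b → T 0 j = .horizontal := by
      intro j h1 h2
      by_cases h3 : j = a + 1
      · rw [h3, hTa']
      · exact not_not.1 (hbfirst j (by omega) h2)
    have hbl : (T 0 b).conn .left = true := by
      rw [hg.left, hH (b - 1) (by omega) (by omega)]; rfl
    have hTb := (Tile.of_left_no_top hbl (hg.top_zero b)).resolve_left hbH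
    refine hT.improvable_or_slidable_of_arch ha1 (by omega) ?_ hTa hTb hH
    by_contra hlt
    have : b = n - 1 := by omega
    rw [this, hlast] at hTb
    exact absurd hTb (by decide)
  · exfalso
    push Not at hex
    have key : ∀ k : ℕ, 2 * (k : ℤ) + 1 ≤ n - 2 → T 0 (2 * k + 1) = .arcRightBottom := by
      intro k
      induction k with
      | zero =>
        intro hk
        refine Tile.of_no_left_top (hside _ (by omega) hk) ?_ (hg.top_zero _)
        rw [hg.left]
        simp only [Nat.cast_zero, mul_zero, zero_add, sub_self, h0]; rfl
      | succ k ih =>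
        intro hk
        push_cast at hk ⊢
        have h1 := ih (by omega)
        have h2 := hex (2 * k + 1) (by omega) (by omega) h1
        have h3 : (T 0 (2 * (k : ℤ) + 1 + 1)).conn .left = true := by
          rw [← hg.horiz, h1]; rfl
        have h4 := (Tile.of_left_no_top h3 (hg.top_zero _)).resolve_left h2
        refine Tile.of_no_left_top (hside _ (by omega) hk) ?_ (hg.top_zero _)
        rw [hg.left, show 2 * ((k : ℤ) + 1) + 1 - 1 = 2 * k + 1 + 1 by ring, h4]; rfl
    obtain ⟨m, hm⟩ := hodd
    have h1 := key (m - 1).toNat (by omega)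
    have h2 := hg.horiz 0 (2 * ((m - 1).toNat : ℤ) + 1)
    rw [h1, show 2 * ((m - 1).toNat : ℤ) + 1 + 1 = n - 1 by omega, hlast] at h2
    exact absurd h2 (by decide)

/-- Sum of the columns of the horizontal tiles and the rows of the vertical tiles. -/
noncomputable def slide (n : ℤ) (T : ℤ → ℤ → Tile) : ℤ :=
  weight n (horizontals id) T + weight n (verticals id) T

/-- Among the grids with the least tile number there is one that is optimal in lexicographic
order with respect to the number of straight tiles, the number of boundary tiles, and `slide`. -/
theorem Tight.exists_optimal {n : ℤ} {T : ℤ → ℤ → Tile} (hT : Tight n T) :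
    ∃ T', Tight n T' ∧ count n T' = count n T ∧ ¬ Improvable n T' ∧
      ∀ T'', Good n T'' → Sim T' T'' → count n T'' ≤ count n T' →
        weight n (fun _ _ => straight) T'' ≤ weight n (fun _ _ => straight) T' →
        weight n (ring n) T'' ≤ weight n (ring n) T' → slide n T' ≤ slide n T'' := by
  have p1 : ∀ T, 0 ≤ weight n (fun _ _ => straight) T :=
    weight_nonneg fun _ _ t _ _ => straight_nonneg t
  have p2 : ∀ T, 0 ≤ weight n (ring n) T := weight_nonneg fun i j t _ _ => by
    unfold ring; split_ifs
    · exact nonblank_nonneg t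
    · exact le_rfl
  have p3 : ∀ T, 0 ≤ slide n T := fun T => add_nonneg
    (weight_nonneg (fun i j t _ hj => by unfold horizontals; split_ifs <;> [exact hj; exact le_rfl])
      T)
    (weight_nonneg (fun i j t hi _ => by unfold verticals; split_ifs <;> [exact hi; exact le_rfl])
      T)
  let μ : (ℤ → ℤ → Tile) → ℕ ×ₗ (ℕ ×ₗ ℕ) := fun T =>
    toLex ((weight n (fun _ _ => straight) T).toNat, toLex ((weight n (ring n) T).toNat,
      (slide n T).toNat))
  obtain ⟨T', ⟨h1, h2⟩, hmin⟩ := WellFounded.has_min (InvImage.wf μ wellFounded_lt)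
    {T' | Tight n T' ∧ count n T' = count n T} ⟨T, hT, rfl⟩
  have hmem : ∀ T'', Good n T'' → Sim T' T'' → count n T'' ≤ count n T' → ¬ μ T'' < μ T' := by
    intro T'' g1 g2 g3
    exact hmin T'' ⟨h1.of_sim g1 g2 g3, le_antisymm (g3.trans h2.le)
      (h2 ▸ h1.minimal T'' g1 g2)⟩
  refine ⟨T', h1, h2, ?_, ?_⟩
  · rintro ⟨T'', g1, g2, g3, g4⟩
    refine hmem T'' g1 g2 g3 ?_
    have := p1 T''; have := p1 T'; have := p2 T''; have := p2 T'
    simp only [μ, Prod.Lex.toLex_lt_toLex]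
    omega
  · intro T'' g1 g2 g3 g4 g5
    by_contra hlt
    refine hmem T'' g1 g2 g3 ?_
    have := p1 T''; have := p1 T'; have := p2 T''; have := p2 T'; have := p3 T''; have := p3 T'
    simp only [μ, Prod.Lex.toLex_lt_toLex]
    omega

theorem Tight.count_le_of_odd {n : ℤ} (hn : 4 ≤ n) (hodd : Odd n) {T : ℤ → ℤ → Tile}
    (hT : Tight n T) : count n T ≤ n ^ 2 - 8 := by
  obtain ⟨T', hT', hc, himp, hslide⟩ := hT.exists_optimal
  rw [← hc]
  clear hc hT
  revert hT' himp hslide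
  generalize T' = T
  intro hT himp hslide
  have hcorner : ∀ X : ℤ → ℤ → Tile, Tight n X → ¬ Improvable n X → X 0 0 = .blank := by
    intro X hX hi
    by_contra h0
    obtain ⟨h00, h01, h10, h11⟩ := hX.corner h0
    have hl : Leg X 0 1 := ⟨one_pos, h00, fun i h1 h2 => by
      rw [show i = 0 by omega]; exact h01⟩
    rcases hX.improvable_or_slidable_of_blank hl le_rfl (by omega) h11 with h | ⟨h, -⟩
    · exact hi h
    · omega
  have i1 : ¬ Improvable n (flipX n T) := fun h => himp h.of_mirror
  have i2 : ¬ Improvable n (flipD T) := fun h => himp h.of_transpose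
  have i3 : ¬ Improvable n (flipY n T) := fun h => i2 h.of_transpose.of_mirror
  have i4 : ¬ Improvable n (flipX n (flipY n T)) := fun h => i3 h.of_mirror
  have i5 : ¬ Improvable n (flipD (flipX n T)) := fun h => i1 h.of_transpose
  have c1 := hcorner T hT himp
  have c2 := hcorner _ hT.mirror i1
  have c3 := hcorner _ hT.mirrorV i3
  have c4 := hcorner _ hT.mirrorV.mirror i4
  simp only [mirror_blank, mirrorV_blank, sub_zero] at c2 c3 c4
  -- Sliding an arch on any of the four sides towards the first column or row is impossible.
  have s1 : ¬ Slidable n T := by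
    rintro ⟨X, g1, g2, g3, g4, g5, g6, g7⟩
    have := hslide X g1 g2 g3 g4 g5
    have := g7 id
    unfold slide at *
    omega
  have s2 : ¬ Slidable n (flipD T) := by
    rintro ⟨X, g1, g2, g3, g4, g5, g6, g7⟩
    have h := hslide _ g1.transpose (by simpa [transpose_transpose] using g2.transpose)
    have := g7 id
    simp only [slide, weight_straight_transpose, weight_ring_transpose, count_transpose,
      weight_horizontals_transpose, weight_verticals_transpose] at h g3 g4 g5 g6 this
    have := h g3 g4 g5
    omega
  have s3 : ¬ Slidable n (flipY n T) := by
    rintro ⟨X, g1, g2, g3, g4, g5, g6, g7⟩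
    have h := hslide _ g1.transpose.mirror.transpose
      (by simpa [flipY, mirror_mirror, transpose_transpose] using
        (g2.transpose.mirror n).transpose)
    have h7 := g7 fun j => n - 1 - j
    simp only [slide, flipY, weight_straight_transpose, weight_ring_transpose, count_transpose,
      weight_horizontals_transpose, weight_verticals_transpose, weight_straight_mirror,
      weight_ring_mirror, count_mirror, weight_horizontals_mirror, weight_verticals_mirror,
      sub_sub_cancel, id] at h g3 g4 g5 g6 h7
    have := h g3 g4 g5
    change _ ≤ weight n (verticals id) T at h7
    change _ < weight n (horizontals id) T at g6
    have hrev : weight n (horizontals id) X = weight n (horizontals fun j => j) X := rfl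
    omega
  have s4 : ¬ Slidable n (flipD (flipX n T)) := by
    rintro ⟨X, g1, g2, g3, g4, g5, g6, g7⟩
    have h := hslide _ g1.transpose.mirror
      (by simpa [mirror_mirror, transpose_transpose] using g2.transpose.mirror n)
    have h7 := g7 fun j => n - 1 - j
    simp only [slide, weight_straight_transpose, weight_ring_transpose, count_transpose,
      weight_horizontals_transpose, weight_verticals_transpose, weight_straight_mirror,
      weight_ring_mirror, count_mirror, weight_horizontals_mirror, weight_verticals_mirror,
      sub_sub_cancel, id] at h g3 g4 g5 g6 h7
    have := h g3 g4 g5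
    change _ ≤ weight n (horizontals id) T at h7
    change _ < weight n (verticals id) T at g6
    have hrev : weight n (horizontals id) X = weight n (horizontals fun j => j) X := rfl
    omega
  have hside : ∀ X : ℤ → ℤ → Tile, Tight n X → ¬ Improvable n X → ¬ Slidable n X →
      X 0 0 = .blank → X 0 (n - 1) = .blank → ∃ j, 1 ≤ j ∧ j ≤ n - 2 ∧ X 0 j = .blank := by
    intro X hX hi hs h0 h1
    by_contra hne
    push Not at hne
    rcases hX.improvable_or_slidable_of_side hodd (by omega) h0 h1 hne with h | h
    · exact hi h
    · exact hs h
  obtain ⟨j1, a1, b1, d1⟩ := hside T hT himp s1 c1 c2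
  obtain ⟨j2, a2, b2, d2⟩ := hside _ hT.transpose i2 s2 (by rw [transpose_blank]; exact c1)
    (by rw [transpose_blank]; exact c3)
  obtain ⟨j3, a3, b3, d3⟩ := hside _ hT.mirrorV i3 s3 (by rw [mirrorV_blank, sub_zero]; exact c3)
    (by rw [mirrorV_blank, sub_zero]; exact c4)
  obtain ⟨j4, a4, b4, d4⟩ := hside _ hT.mirror.transpose i5 s4
    (by rw [transpose_blank, mirror_blank, sub_zero]; exact c2)
    (by rw [transpose_blank, mirror_blank, sub_zero]; exact c4)
  rw [transpose_blank] at d2 d4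
  rw [mirrorV_blank, sub_zero] at d3
  rw [mirror_blank, sub_zero] at d4
  have := count_le_of_blank (n := n) (by omega) (T := T)
    {(0, 0), (0, n - 1), (n - 1, 0), (n - 1, n - 1), (0, j1), (j2, 0), (n - 1, j3), (j4, n - 1)} (by
      intro q hq
      simp only [Finset.mem_insert, Finset.mem_singleton] at hq
      rcases hq with rfl | rfl | rfl | rfl | rfl | rfl | rfl | rfl
      · exact ⟨by omega, by omega, c1⟩
      · exact ⟨by omega, by omega, c2⟩
      · exact ⟨by omega, by omega, c3⟩
      · exact ⟨by omega, by omega, c4⟩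
      · exact ⟨by omega, by omega, d1⟩
      · exact ⟨by omega, by omega, d2⟩
      · exact ⟨by omega, by omega, d3⟩
      · exact ⟨by omega, by omega, d4⟩)
  rw [Finset.card_insert_of_notMem, Finset.card_insert_of_notMem, Finset.card_insert_of_notMem,
    Finset.card_insert_of_notMem, Finset.card_insert_of_notMem, Finset.card_insert_of_notMem,
    Finset.card_insert_of_notMem, Finset.card_singleton] at this
  · simpa using this
  all_goals
    simp only [Finset.mem_insert, Finset.mem_singleton, Prod.mk.injEq]
    omega

/-! ### Radial homeomorphisms -/

/-- A positively homogeneous continuous function that is positive away from the origin. -/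
structure StarGauge where
  /-- The underlying function. -/
  val : E3 → ℝ
  continuous : Continuous val
  homogeneous : ∀ (c : ℝ) (v : E3), 0 ≤ c → val (c • v) = c * val v
  /-- A lower bound on the unit sphere. -/
  bound : ℝ
  bound_pos : 0 < bound
  le_val : ∀ v, bound * ‖v‖ ≤ val v

namespace StarGauge

variable (N : StarGauge)

theorem val_zero : N.val 0 = 0 := by
  have := N.homogeneous 0 0 le_rfl
  simpa using this

theorem val_nonneg (v : E3) : 0 ≤ N.val v :=
  (mul_nonneg N.bound_pos.le (norm_nonneg v)).trans (N.le_val v)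

theorem val_pos {v : E3} (hv : v ≠ 0) : 0 < N.val v :=
  (mul_pos N.bound_pos (norm_pos_iff.2 hv)).trans_le (N.le_val v)

theorem norm_stretch (v : E3) : ‖(N.val v / ‖v‖) • v‖ = N.val v := by
  by_cases hv : v = 0
  · simp [hv, N.val_zero]
  · rw [norm_smul, Real.norm_of_nonneg (div_nonneg (N.val_nonneg v) (norm_nonneg v)),
      div_mul_cancel₀ _ (norm_ne_zero_iff.2 hv)]

theorem val_shrink (w : E3) : N.val ((‖w‖ / N.val w) • w) = ‖w‖ := by
  by_cases hw : w = 0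
  · simp [hw, N.val_zero]
  · rw [N.homogeneous _ _ (div_nonneg (norm_nonneg w) (N.val_nonneg w)),
      div_mul_cancel₀ _ (N.val_pos hw).ne']

/-- The homeomorphism that preserves all rays from the origin and carries the level sets of the
gauge to round spheres. -/
noncomputable def homeo : E3 ≃ₜ E3 where
  toFun v := (N.val v / ‖v‖) • v
  invFun w := (‖w‖ / N.val w) • w
  left_inv v := by
    by_cases hv : v = 0
    · simp [hv]
    · have h1 := (N.val_pos hv).ne'
      have h2 := norm_ne_zero_iff.2 hv
      have h3 := N.homogeneous (N.val v / ‖v‖) v (div_nonneg (N.val_nonneg v) (norm_nonneg v))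
      simp only [N.norm_stretch, h3, smul_smul]
      rw [show N.val v / (N.val v / ‖v‖ * N.val v) * (N.val v / ‖v‖) = 1 by field_simp, one_smul]
  right_inv w := by
    by_cases hw : w = 0
    · simp [hw]
    · have h1 := (N.val_pos hw).ne'
      have h2 := norm_ne_zero_iff.2 hw
      have h3 : ‖(‖w‖ / N.val w) • w‖ = ‖w‖ / N.val w * ‖w‖ := by
        rw [norm_smul, Real.norm_of_nonneg (div_nonneg (norm_nonneg w) (N.val_nonneg w))]
      simp only [N.val_shrink, h3, smul_smul]
      rw [show ‖w‖ / (‖w‖ / N.val w * ‖w‖) * (‖w‖ / N.val w) = 1 by field_simp, one_smul]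
  continuous_toFun := by
    rw [continuous_iff_continuousAt]
    intro v
    by_cases hv : v = 0
    · subst hv
      unfold ContinuousAt
      beta_reduce
      rw [smul_zero]
      refine squeeze_zero_norm (fun w => (N.norm_stretch w).le) ?_
      simpa [N.val_zero] using N.continuous.tendsto 0
    · exact (N.continuous.continuousAt.div continuous_norm.continuousAt
        (norm_ne_zero_iff.2 hv)).smul continuousAt_id
  continuous_invFun := by
    rw [continuous_iff_continuousAt]
    intro v
    by_cases hv : v = 0
    · subst hv
      unfold ContinuousAt
      beta_reduce
      rw [smul_zero]
      refine squeeze_zero_norm (a := fun w => ‖w‖ / N.bound) (fun w => ?_) ?_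
      · rw [le_div_iff₀ N.bound_pos, mul_comm]
        exact (N.le_val _).trans (N.val_shrink w).le
      · have : Continuous fun w : E3 => ‖w‖ / N.bound := continuous_norm.div_const _
        simpa using this.tendsto 0
    · exact (continuous_norm.continuousAt.div N.continuous.continuousAt
        (N.val_pos hv).ne').smul continuousAt_id

theorem homeo_apply (v : E3) : N.homeo v = (N.val v / ‖v‖) • v := rfl

theorem norm_homeo (v : E3) : ‖N.homeo v‖ = N.val v := N.norm_stretch v

/-- The homeomorphism multiplies every vector by a positive number. -/
theorem homeo_eq_smul (v : E3) : ∃ c : ℝ, 0 < c ∧ N.homeo v = c • v := by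
  by_cases hv : v = 0
  · exact ⟨1, one_pos, by simp [hv, homeo_apply]⟩
  · exact ⟨_, div_pos (N.val_pos hv) (norm_pos_iff.2 hv), rfl⟩

/-- The convex combination of the gauge with the norm. -/
noncomputable def mix (t : unitInterval) : StarGauge where
  val v := (1 - (t : ℝ)) * ‖v‖ + t * N.val v
  continuous := (continuous_const.mul continuous_norm).add (continuous_const.mul N.continuous)
  homogeneous c v hc := by
    rw [N.homogeneous c v hc, norm_smul, Real.norm_of_nonneg hc]; ring
  bound := min 1 N.bound
  bound_pos := lt_min one_pos N.bound_pos
  le_val v := by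
    have h1 : min 1 N.bound * ‖v‖ ≤ ‖v‖ :=
      mul_le_of_le_one_left (norm_nonneg v) (min_le_left _ _)
    have h2 : min 1 N.bound * ‖v‖ ≤ N.val v :=
      (mul_le_mul_of_nonneg_right (min_le_right _ _) (norm_nonneg v)).trans (N.le_val v)
    have h3 := mul_le_mul_of_nonneg_left h1 (sub_nonneg.2 t.2.2)
    have h4 := mul_le_mul_of_nonneg_left h2 t.2.1
    linarith

theorem ambientIsotopic (A : Set E3) : AmbientIsotopic (lift A) (lift (N.homeo '' A)) := by
  refine ⟨fun t => (N.mix t).homeo.onePointCongr,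
    continuous_onePoint_family (fun t => (N.mix t).homeo) ?_ ?_, ?_, ?_⟩
  · have hval : Continuous fun p : unitInterval × E3 => (N.mix p.1).val p.2 := by
      have := N.continuous
      change Continuous fun p : unitInterval × E3 =>
        (1 - (p.1 : ℝ)) * ‖p.2‖ + p.1 * N.val p.2
      fun_prop
    rw [continuous_iff_continuousAt]
    rintro ⟨t, v⟩
    simp only [homeo_apply]
    by_cases hv : v = 0
    · subst hv
      unfold ContinuousAt
      beta_reduce
      rw [smul_zero]
      refine squeeze_zero_norm (fun w => ((N.mix w.1).norm_stretch w.2).le) ?_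
      simpa [(N.mix t).val_zero] using hval.tendsto (t, 0)
    · exact (hval.continuousAt.div continuous_snd.norm.continuousAt
        (norm_ne_zero_iff.2 hv)).smul continuousAt_snd
  · intro R
    have hb : 0 < min 1 N.bound := lt_min one_pos N.bound_pos
    refine ⟨R / min 1 N.bound, fun t x hx => ?_⟩
    rw [norm_homeo]
    rw [div_lt_iff₀ hb, mul_comm] at hx
    exact hx.trans_le ((N.mix t).le_val x)
  · have : (N.mix 0).homeo = Homeomorph.refl E3 := by
      ext1 v
      by_cases hv : v = 0
      · simp [hv, homeo_apply]
      · simp [homeo_apply, mix, div_self (norm_ne_zero_iff.2 hv)]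
    simp only [this]
    ext x
    induction x using OnePoint.rec <;> rfl
  · rw [lift_image]
    have : (N.mix 1).homeo = N.homeo := by
      ext1 v
      simp [homeo_apply, mix]
    simp only [this]

end StarGauge

/-! ### Trivial components -/

theorem IsTrivialComponent.of_isotopic {L L' C : Set S3} (h : IsTrivialComponent L C)
    (hL : AmbientIsotopic L L') : ∃ C', IsTrivialComponent L' C' := by
  obtain ⟨H, hc, h0, rfl⟩ := hL
  obtain ⟨⟨x, hx, rfl⟩, hU, B, ⟨b, rfl⟩, hCB, hd⟩ := h
  set C := connectedComponentIn L x
  refine ⟨H 1 '' C, ⟨H 1 x, mem_image_of_mem _ hx, (H 1).image_connectedComponentIn hx⟩, ?_,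
    H 1 '' (b '' stdBall), ⟨b.trans (H 1), by rw [← image_comp]; rfl⟩, ?_, ?_⟩
  · exact AmbientIsotopic.trans (AmbientIsotopic.symm ⟨H, hc, h0, rfl⟩) hU
  · rw [← (H 1).image_interior]; exact image_mono hCB
  · rw [← image_sdiff (H 1).injective, disjoint_image_iff (H 1).injective]; exact hd

theorem isOpen_lift {A : Set E3} (hA : IsOpen A) : IsOpen (lift A) :=
  OnePoint.isOpenEmbedding_coe.isOpenMap A hA

theorem lift_mono {A B : Set E3} (h : A ⊆ B) : lift A ⊆ lift B := image_mono h

theorem coe_mem_lift {A : Set E3} {v : E3} : (v : S3) ∈ lift A ↔ v ∈ A := by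
  constructor
  · rintro ⟨w, hw, h⟩
    rwa [← OnePoint.coe_injective h]
  · exact fun h => ⟨v, h, rfl⟩

theorem infty_notMem_lift {A : Set E3} : OnePoint.infty ∉ lift A := by
  rintro ⟨w, -, h⟩
  exact OnePoint.coe_ne_infty w h

/-- The gauge whose unit sphere meets the horizontal plane in the square with vertices at distance
one half from the origin. -/
noncomputable def diamondGauge : StarGauge where
  val v := 2 * (|v 0| + |v 1|) + |v 2|
  continuous := by fun_prop
  homogeneous c v hc := by
    simp only [PiLp.smul_apply, smul_eq_mul, abs_mul, abs_of_nonneg hc]; ring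
  bound := 1
  bound_pos := one_pos
  le_val v := by
    rw [one_mul, EuclideanSpace.norm_eq, Fin.sum_univ_three]
    refine Real.sqrt_le_iff.2 ⟨by positivity, ?_⟩
    simp only [Real.norm_eq_abs]
    nlinarith [abs_nonneg (v 0), abs_nonneg (v 1), abs_nonneg (v 2),
      mul_nonneg (abs_nonneg (v 0)) (abs_nonneg (v 1)),
      mul_nonneg (abs_nonneg (v 0)) (abs_nonneg (v 2)),
      mul_nonneg (abs_nonneg (v 1)) (abs_nonneg (v 2))]

/-- The square with vertices at distance one half from the origin. -/
def diamond : Set E3 := {v | diamondGauge.val v = 1 ∧ v 2 = 0}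

/-- The unit circle in the horizontal plane, as a subset of Euclidean space. -/
def circle : Set E3 := {v | v 0 ^ 2 + v 1 ^ 2 = 1 ∧ v 2 = 0}

theorem image_diamond : diamondGauge.homeo '' diamond = circle := by
  have hn : ∀ w : E3, w 2 = 0 → (‖w‖ = 1 ↔ w 0 ^ 2 + w 1 ^ 2 = 1) := by
    intro w hw
    rw [EuclideanSpace.norm_eq, Fin.sum_univ_three, Real.sqrt_eq_one]
    simp [hw]
  have h2 : ∀ v : E3, (diamondGauge.homeo v) 2 = 0 ↔ v 2 = 0 := by
    intro v
    obtain ⟨c, hc, h⟩ := diamondGauge.homeo_eq_smul v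
    rw [h]; simp [hc.ne']
  ext w
  constructor
  · rintro ⟨v, ⟨hv1, hv2⟩, rfl⟩
    have := (h2 v).2 hv2
    exact ⟨(hn _ this).1 (by rw [diamondGauge.norm_homeo, hv1]), this⟩
  · rintro ⟨hw1, hw2⟩
    obtain ⟨v, rfl⟩ := diamondGauge.homeo.surjective w
    refine ⟨v, ⟨?_, (h2 v).1 hw2⟩, rfl⟩
    rw [← diamondGauge.norm_homeo]
    exact (hn _ hw2).2 hw1

theorem isPreconnected_circle : IsPreconnected circle := by
  have : circle = range fun θ : ℝ => pt (Real.cos θ) (Real.sin θ) 0 := by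
    ext v
    constructor
    · rintro ⟨h1, h2⟩
      have hz : ‖(⟨v 0, v 1⟩ : ℂ)‖ = 1 := by
        rw [Complex.norm_def, Complex.normSq_mk, Real.sqrt_eq_one]; linarith
      have h3 := Complex.norm_mul_cos_add_sin_mul_I ⟨v 0, v 1⟩
      rw [hz, Complex.ofReal_one, one_mul] at h3
      refine ⟨Complex.arg ⟨v 0, v 1⟩, ext_pt ?_ ?_ ?_⟩
      · have := congrArg Complex.re h3
        simpa [Complex.cos_ofReal_re, Complex.sin_ofReal_im] using this
      · have := congrArg Complex.im h3
        simpa [Complex.cos_ofReal_im, Complex.sin_ofReal_re] using this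
      · exact h2.symm
    · rintro ⟨θ, rfl⟩
      exact ⟨Real.cos_sq_add_sin_sq θ, rfl⟩
  rw [this]
  refine isPreconnected_range ?_
  have h : Continuous fun θ : ℝ => ![Real.cos θ, Real.sin θ, 0] := by
    refine continuous_pi fun i => ?_
    fin_cases i
    · exact Real.continuous_cos
    · exact Real.continuous_sin
    · exact continuous_const
  exact (PiLp.continuous_toLp 2 _).comp h

/-- A link that meets a neighbourhood of the disc bounded by a small square only in this square
has a trivial component. -/
theorem isTrivialComponent_diamond {L : Set E3} {c : E3} (h1 : ∀ v ∈ diamond, c + v ∈ L)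
    (h2 : ∀ p ∈ L, diamondGauge.val (p - c) ≤ 3 / 2 → p - c ∈ diamond) :
    IsTrivialComponent (lift L) (lift (tr c '' diamond)) := by
  set N := diamondGauge
  have hD : tr c '' diamond ⊆ L := by rintro _ ⟨v, hv, rfl⟩; exact h1 v hv
  have hiso : AmbientIsotopic (lift (tr c '' diamond)) (lift circle) := by
    have e1 : IsoE (tr c '' diamond) diamond := by
      refine IsoE.symm ⟨(tr c).toHomeomorph, ⟨‖c‖, fun x => ?_⟩, rfl⟩
      simp [dist_eq_norm]
    have e2 := N.ambientIsotopic diamond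
    rw [image_diamond] at e2
    exact e1.ambientIsotopic.trans e2
  have hconn : IsPreconnected (lift (tr c '' diamond)) := by
    refine IsPreconnected.image ?_ _ OnePoint.continuous_coe.continuousOn
    refine IsPreconnected.image ?_ _ (tr c).continuous.continuousOn
    have : diamond = N.homeo.symm '' circle := by
      rw [← image_diamond, ← image_comp]; simp [N]
    rw [this]
    exact isPreconnected_circle.image _ N.homeo.symm.continuous.continuousOn
  -- The ball is the sublevel set of the gauge; its interior contains the square.
  let g : E3 ≃ₜ E3 := ((Homeomorph.smulOfNeZero (3 / 2 : ℝ) (by norm_num)).trans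
    N.homeo.symm).trans (tr c).toHomeomorph
  have hg : ∀ w, N.val (g w - c) = 3 / 2 * ‖w‖ := by
    intro w
    have : g w - c = N.homeo.symm ((3 / 2 : ℝ) • w) := by
      simp [g]
    rw [this, ← N.norm_homeo, Homeomorph.apply_symm_apply, norm_smul]
    norm_num
  have hball : ∀ p, p ∈ g '' Metric.closedBall 0 1 ↔ N.val (p - c) ≤ 3 / 2 := by
    intro p
    constructor
    · rintro ⟨w, hw, rfl⟩
      rw [hg]
      have := mem_closedBall_zero_iff.1 hw
      linarith
    · intro hp
      obtain ⟨w, rfl⟩ := g.surjective p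
      rw [hg] at hp
      exact ⟨w, mem_closedBall_zero_iff.2 (by linarith), rfl⟩
  have hopen : IsOpen {p : E3 | N.val (p - c) < 3 / 2} :=
    isOpen_lt (N.continuous.comp (continuous_id.sub continuous_const)) continuous_const
  have hint : lift (tr c '' diamond) ⊆ interior (lift (g '' Metric.closedBall 0 1)) := by
    refine Subset.trans ?_ (interior_maximal (lift_mono fun p hp => ?_) (isOpen_lift hopen))
    · refine lift_mono ?_
      rintro _ ⟨v, hv, rfl⟩
      simp only [mem_ofPred_eq, tr_apply, add_sub_cancel_left]
      rw [hv.1]; norm_num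
    · exact (hball p).2 (le_of_lt hp)
  have hdisj : Disjoint (lift (g '' Metric.closedBall 0 1)) (lift L \ lift (tr c '' diamond)) := by
    rw [Set.disjoint_left]
    rintro _ ⟨p, hp, rfl⟩ ⟨hL, hD'⟩
    refine hD' (coe_mem_lift.2 ?_)
    rw [mem_tr_image]
    exact h2 p (coe_mem_lift.1 hL) ((hball p).1 hp)
  have hv0 : pt (1 / 2) 0 0 ∈ diamond := by
    refine ⟨?_, rfl⟩
    change 2 * (|(1 / 2 : ℝ)| + |0|) + |0| = 1
    norm_num
  have hx : ((c + pt (1 / 2) 0 0 : E3) : S3) ∈ lift (tr c '' diamond) :=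
    coe_mem_lift.2 ⟨_, hv0, rfl⟩
  refine ⟨⟨_, lift_mono hD hx, ?_⟩, hiso, _, ⟨g.onePointCongr, (lift_image g _).symm⟩, hint, hdisj⟩
  refine Subset.antisymm (hconn.subset_connectedComponentIn hx (lift_mono hD)) ?_
  intro y hy
  have hL := connectedComponentIn_subset _ _ hy
  have hpre : IsPreconnected (connectedComponentIn (lift L)
    ((c + pt (1 / 2) 0 0 : E3) : S3)) := isPreconnected_connectedComponentIn
  have hclosed : IsClosed (lift (g '' Metric.closedBall 0 1)) :=
    (((isCompact_closedBall (0 : E3) 1).image g.continuous).image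
      OnePoint.continuous_coe).isClosed
  have hcover : lift L ⊆ interior (lift (g '' Metric.closedBall 0 1)) ∪
      (lift (g '' Metric.closedBall 0 1))ᶜ := by
    intro z hz
    by_cases hz' : z ∈ lift (tr c '' diamond)
    · exact Or.inl (hint hz')
    · exact Or.inr fun h => Set.disjoint_left.1 hdisj h ⟨hz, hz'⟩
  have hsub := hpre.subset_left_of_subset_union isOpen_interior hclosed.isOpen_compl
    (disjoint_compl_right.mono_left interior_subset)
    ((connectedComponentIn_subset _ _).trans hcover)
    ⟨_, mem_connectedComponentIn (lift_mono hD hx), hint hx⟩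
  by_contra hy'
  exact Set.disjoint_left.1 hdisj (interior_subset (hsub hy)) ⟨hL, hy'⟩

/-! ### Loops around a vertex are trivial components -/

theorem mem_arc_iff {σ τ : ℝ} (hσ : σ * σ = 1) (hτ : τ * τ = 1) {p : E3} :
    p ∈ segment ℝ (pt (σ / 2) 0 0) (pt 0 (τ / 2) 0) ↔
      0 ≤ σ * p 0 ∧ 0 ≤ τ * p 1 ∧ σ * p 0 + τ * p 1 = 1 / 2 ∧ p 2 = 0 := by
  rw [mem_segment_iff]
  simp only [pt_zero, pt_one, pt_two, mul_zero, add_zero, zero_add]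
  constructor
  · rintro ⟨s, t, hs, ht, hst, h0, h1, h2⟩
    have e0 : σ * p 0 = s / 2 := by rw [h0]; linear_combination s / 2 * hσ
    have e1 : τ * p 1 = t / 2 := by rw [h1]; linear_combination t / 2 * hτ
    rw [e0, e1]
    exact ⟨by linarith, by linarith, by linarith, h2⟩
  · rintro ⟨h0, h1, h2, h3⟩
    refine ⟨2 * (σ * p 0), 2 * (τ * p 1), by linarith, by linarith, by linarith, ?_, ?_, h3⟩
    · linear_combination -p 0 * hσ
    · linear_combination -p 1 * hτ

theorem mem_rightBottom {p : E3} : p ∈ segment ℝ (pt (1 / 2) 0 0) (pt 0 (-1 / 2) 0) ↔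
    0 ≤ p 0 ∧ p 1 ≤ 0 ∧ p 0 - p 1 = 1 / 2 ∧ p 2 = 0 := by
  have h := mem_arc_iff (σ := 1) (τ := -1) (by norm_num) (by norm_num) (p := p)
  refine h.trans ⟨?_, ?_⟩ <;> rintro ⟨h0, h1, h2, h3⟩ <;>
    exact ⟨by linarith, by linarith, by linarith, h3⟩

theorem mem_leftBottom {p : E3} : p ∈ segment ℝ (pt (-1 / 2) 0 0) (pt 0 (-1 / 2) 0) ↔
    p 0 ≤ 0 ∧ p 1 ≤ 0 ∧ -p 0 - p 1 = 1 / 2 ∧ p 2 = 0 := by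
  have h := mem_arc_iff (σ := -1) (τ := -1) (by norm_num) (by norm_num) (p := p)
  refine h.trans ⟨?_, ?_⟩ <;> rintro ⟨h0, h1, h2, h3⟩ <;>
    exact ⟨by linarith, by linarith, by linarith, h3⟩

theorem mem_topRight {p : E3} : p ∈ segment ℝ (pt 0 (1 / 2) 0) (pt (1 / 2) 0 0) ↔
    0 ≤ p 0 ∧ 0 ≤ p 1 ∧ p 0 + p 1 = 1 / 2 ∧ p 2 = 0 := by
  have h := mem_arc_iff (σ := 1) (τ := 1) (by norm_num) (by norm_num) (p := p)
  rw [segment_symm] at h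
  refine h.trans ⟨?_, ?_⟩ <;> rintro ⟨h0, h1, h2, h3⟩ <;>
    exact ⟨by linarith, by linarith, by linarith, h3⟩

theorem mem_topLeft {p : E3} : p ∈ segment ℝ (pt 0 (1 / 2) 0) (pt (-1 / 2) 0 0) ↔
    p 0 ≤ 0 ∧ 0 ≤ p 1 ∧ p 1 - p 0 = 1 / 2 ∧ p 2 = 0 := by
  have h := mem_arc_iff (σ := -1) (τ := 1) (by norm_num) (by norm_num) (p := p)
  rw [segment_symm] at h
  refine h.trans ⟨?_, ?_⟩ <;> rintro ⟨h0, h1, h2, h3⟩ <;>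
    exact ⟨by linarith, by linarith, by linarith, h3⟩

theorem mem_arcs_rightBottom {t : Tile} (ht : t = .arcRightBottom ∨ t = .arcsRightBottomTopLeft)
    {p : E3} : p ∈ t.curve ↔ (0 ≤ p 0 ∧ p 1 ≤ 0 ∧ p 0 - p 1 = 1 / 2 ∧ p 2 = 0) ∨
      (t = .arcsRightBottomTopLeft ∧ p 0 ≤ 0 ∧ 0 ≤ p 1 ∧ p 1 - p 0 = 1 / 2 ∧ p 2 = 0) := by
  rw [Tile.curve_eq]
  rcases ht with rfl | rfl <;>
    simp only [Tile.edges, poly_cons, poly_nil, union_empty, mem_union, mem_rightBottom,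
        mem_topLeft,
      reduceCtorEq, false_and, or_false, true_and]

theorem mem_arcs_leftBottom {t : Tile} (ht : t = .arcLeftBottom ∨ t = .arcsLeftBottomTopRight)
    {p : E3} : p ∈ t.curve ↔ (p 0 ≤ 0 ∧ p 1 ≤ 0 ∧ -p 0 - p 1 = 1 / 2 ∧ p 2 = 0) ∨
      (t = .arcsLeftBottomTopRight ∧ 0 ≤ p 0 ∧ 0 ≤ p 1 ∧ p 0 + p 1 = 1 / 2 ∧ p 2 = 0) := by
  rw [Tile.curve_eq]
  rcases ht with rfl | rfl <;>
    simp only [Tile.edges, poly_cons, poly_nil, union_empty, mem_union, mem_leftBottom,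
        mem_topRight,
      reduceCtorEq, false_and, or_false, true_and]

theorem mem_arcs_topRight {t : Tile} (ht : t = .arcTopRight ∨ t = .arcsLeftBottomTopRight)
    {p : E3} : p ∈ t.curve ↔ (0 ≤ p 0 ∧ 0 ≤ p 1 ∧ p 0 + p 1 = 1 / 2 ∧ p 2 = 0) ∨
      (t = .arcsLeftBottomTopRight ∧ p 0 ≤ 0 ∧ p 1 ≤ 0 ∧ -p 0 - p 1 = 1 / 2 ∧ p 2 = 0) := by
  rw [Tile.curve_eq]
  rcases ht with rfl | rfl <;>
    simp only [Tile.edges, poly_cons, poly_nil, union_empty, mem_union, mem_leftBottom,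
        mem_topRight,
      reduceCtorEq, false_and, or_false, true_and]
  exact or_comm

theorem mem_arcs_topLeft {t : Tile} (ht : t = .arcTopLeft ∨ t = .arcsRightBottomTopLeft)
    {p : E3} : p ∈ t.curve ↔ (p 0 ≤ 0 ∧ 0 ≤ p 1 ∧ p 1 - p 0 = 1 / 2 ∧ p 2 = 0) ∨
      (t = .arcsRightBottomTopLeft ∧ 0 ≤ p 0 ∧ p 1 ≤ 0 ∧ p 0 - p 1 = 1 / 2 ∧ p 2 = 0) := by
  rw [Tile.curve_eq]
  rcases ht with rfl | rfl <;>
    simp only [Tile.edges, poly_cons, poly_nil, union_empty, mem_union, mem_rightBottom,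
        mem_topLeft,
      reduceCtorEq, false_and, or_false, true_and]
  exact or_comm

theorem mem_diamond {v : E3} : v ∈ diamond ↔ |v 0| + |v 1| = 1 / 2 ∧ v 2 = 0 := by
  change 2 * (|v 0| + |v 1|) + |v 2| = 1 ∧ v 2 = 0 ↔ _
  constructor
  · rintro ⟨h1, h2⟩
    rw [h2, abs_zero] at h1
    exact ⟨by linarith, h2⟩
  · rintro ⟨h1, h2⟩
    rw [h2, abs_zero]
    exact ⟨by linarith, rfl⟩

theorem HasLoop.diamond_subset {T : ℤ → ℤ → Tile} {i j : ℤ} (h : HasLoop T i j) :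
    ∀ v ∈ diamond, pt (j + 1 / 2) (-i - 1 / 2) 0 + v ∈ gridLink T := by
  obtain ⟨h1, h2, h3, h4⟩ := h
  intro v hv
  obtain ⟨hN, hz⟩ := mem_diamond.1 hv
  rcases le_total (v 0) 0 with hx | hx <;> rcases le_total (v 1) 0 with hy | hy
  · rw [abs_of_nonpos hx, abs_of_nonpos hy] at hN
    refine ⟨i + 1, j, trivial, (mem_arcs_topRight h3).2 (Or.inl ?_)⟩
    simp only [PiLp.sub_apply, PiLp.add_apply, pt_zero, pt_one, pt_two]
    push_cast
    refine ⟨?_, ?_, ?_, ?_⟩ <;> linarith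
  · rw [abs_of_nonpos hx, abs_of_nonneg hy] at hN
    refine ⟨i, j, trivial, (mem_arcs_rightBottom h1).2 (Or.inl ?_)⟩
    simp only [PiLp.sub_apply, PiLp.add_apply, pt_zero, pt_one, pt_two]
    refine ⟨?_, ?_, ?_, ?_⟩ <;> linarith
  · rw [abs_of_nonneg hx, abs_of_nonpos hy] at hN
    refine ⟨i + 1, j + 1, trivial, (mem_arcs_topLeft h4).2 (Or.inl ?_)⟩
    simp only [PiLp.sub_apply, PiLp.add_apply, pt_zero, pt_one, pt_two]
    push_cast
    refine ⟨?_, ?_, ?_, ?_⟩ <;> linarith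
  · rw [abs_of_nonneg hx, abs_of_nonneg hy] at hN
    refine ⟨i, j + 1, trivial, (mem_arcs_leftBottom h2).2 (Or.inl ?_)⟩
    simp only [PiLp.sub_apply, PiLp.add_apply, pt_zero, pt_one, pt_two]
    push_cast
    refine ⟨?_, ?_, ?_, ?_⟩ <;> linarith

/-- Near a loop around a vertex the link consists of this loop only. -/
theorem HasLoop.mem_diamond {T : ℤ → ℤ → Tile} {i j : ℤ} (h : HasLoop T i j) {p : E3}
    (hp : p ∈ gridLink T) (hN : diamondGauge.val (p - pt (j + 1 / 2) (-i - 1 / 2) 0) ≤ 3 / 2) :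
    p - pt (j + 1 / 2) (-i - 1 / 2) 0 ∈ diamond := by
  obtain ⟨h1, h2, h3, h4⟩ := h
  obtain ⟨i', j', -, hp⟩ := hp
  change 2 * (|(p - _) 0| + |(p - _) 1|) + |(p - _) 2| ≤ 3 / 2 at hN
  rw [KnotMosaic.mem_diamond]
  obtain ⟨⟨f1, f2⟩, ⟨f3, f4⟩, -⟩ := framed_curves T i' j' _ hp
  simp only [PiLp.sub_apply, pt_zero, pt_one, pt_two] at f1 f2 f3 f4 hN ⊢
  have hz := abs_nonneg (p 2 - 0)
  have hx := abs_nonneg (p 0 - (j + 1 / 2))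
  have hy := abs_nonneg (p 1 - (-i - 1 / 2))
  obtain ⟨x1, x2⟩ := abs_le.1 (show |p 0 - (j + 1 / 2)| ≤ 3 / 4 by linarith)
  obtain ⟨y1, y2⟩ := abs_le.1 (show |p 1 - (-i - 1 / 2)| ≤ 3 / 4 by linarith)
  have x3 := le_abs_self (p 0 - (j + 1 / 2))
  have x4 := neg_le_abs (p 0 - (j + 1 / 2))
  have y3 := le_abs_self (p 1 - (-i - 1 / 2))
  have y4 := neg_le_abs (p 1 - (-i - 1 / 2))
  have b1 : j' = j ∨ j' = j + 1 := by
    have c1 : ((j - 1 : ℤ) : ℝ) < j' := by push_cast; linarith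
    have c2 : (j' : ℝ) < ((j + 2 : ℤ) : ℝ) := by push_cast; linarith
    have c1' : j - 1 < j' := by exact_mod_cast c1
    have c2' : j' < j + 2 := by exact_mod_cast c2
    omega
  have b2 : i' = i ∨ i' = i + 1 := by
    have c1 : ((i - 1 : ℤ) : ℝ) < i' := by push_cast; linarith
    have c2 : (i' : ℝ) < ((i + 2 : ℤ) : ℝ) := by push_cast; linarith
    have c1' : i - 1 < i' := by exact_mod_cast c1
    have c2' : i' < i + 2 := by exact_mod_cast c2
    omega
  rcases b2 with rfl | rfl <;> rcases b1 with rfl | rfl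
  · have := (mem_arcs_rightBottom h1).1 hp
    simp only [PiLp.sub_apply, pt_zero, pt_one, pt_two] at this
    rcases this with ⟨g0, g1, g2, g3⟩ | ⟨-, g0, g1, g2, g3⟩
    · rw [abs_of_nonpos (by linarith), abs_of_nonneg (by linarith)]
      exact ⟨by linarith, by linarith⟩
    · linarith
  · have := (mem_arcs_leftBottom h2).1 hp
    simp only [PiLp.sub_apply, pt_zero, pt_one, pt_two] at this
    push_cast at this
    rcases this with ⟨g0, g1, g2, g3⟩ | ⟨-, g0, g1, g2, g3⟩
    · rw [abs_of_nonneg (by linarith), abs_of_nonneg (by linarith)]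
      exact ⟨by linarith, by linarith⟩
    · linarith
  · have := (mem_arcs_topRight h3).1 hp
    simp only [PiLp.sub_apply, pt_zero, pt_one, pt_two] at this
    push_cast at this
    rcases this with ⟨g0, g1, g2, g3⟩ | ⟨-, g0, g1, g2, g3⟩
    · rw [abs_of_nonpos (by linarith), abs_of_nonpos (by linarith)]
      exact ⟨by linarith, by linarith⟩
    · linarith
  · have := (mem_arcs_topLeft h4).1 hp
    simp only [PiLp.sub_apply, pt_zero, pt_one, pt_two] at this
    push_cast at this
    rcases this with ⟨g0, g1, g2, g3⟩ | ⟨-, g0, g1, g2, g3⟩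
    · rw [abs_of_nonneg (by linarith), abs_of_nonpos (by linarith)]
      exact ⟨by linarith, by linarith⟩
    · linarith

theorem HasLoop.isTrivialComponent {T : ℤ → ℤ → Tile} {i j : ℤ} (h : HasLoop T i j) :
    ∃ C, IsTrivialComponent (lift (gridLink T)) C :=
  ⟨_, isTrivialComponent_diamond h.diamond_subset fun _ => h.mem_diamond⟩

/-! ### From mosaics to grids and back -/

namespace Mosaic

variable {n : ℕ}

/-- The grid of tiles of a mosaic. -/
def grid (M : Mosaic n) : ℤ → ℤ → Tile := fun i j =>
  if h : (0 ≤ i ∧ i < n) ∧ (0 ≤ j ∧ j < n) then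
    M.tile ⟨i.toNat, by omega⟩ ⟨j.toNat, by omega⟩
  else .blank

theorem grid_coe (M : Mosaic n) (i j : Fin n) : M.grid (i : ℕ) (j : ℕ) = M.tile i j := by
  unfold grid
  rw [dif_pos (by omega)]
  rfl

theorem grid_support (M : Mosaic n) (i j : ℤ) (h : M.grid i j ≠ .blank) :
    ∃ i' j' : Fin n, i = (i' : ℕ) ∧ j = (j' : ℕ) := by
  unfold grid at h
  split_ifs at h with hij
  · exact ⟨⟨i.toNat, by omega⟩, ⟨j.toNat, by omega⟩, by simp; omega, by simp; omega⟩
  · exact absurd rfl h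

theorem grid_conn (M : Mosaic n) (i j : ℤ) (s : Side) (h : (M.grid i j).conn s = true) :
    (M.grid (i + s.offset.1) (j + s.offset.2)).conn s.opposite = true := by
  obtain ⟨i, j, rfl, rfl⟩ := M.grid_support i j fun hb => by
    rw [hb, blank_conn] at h; exact absurd h (by simp)
  rw [grid_coe] at h
  obtain ⟨i', j', h1, h2⟩ := M.suitablyConnected i j s ((Tile.connectsAt_iff _ _).2 h)
  have h3 := congrArg Prod.fst h1
  have h4 := congrArg Prod.snd h1
  simp only [Prod.fst_add, Prod.snd_add] at h3 h4
  rw [← h3, ← h4, grid_coe]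
  exact (Tile.connectsAt_iff _ _).1 h2

theorem good_grid (M : Mosaic n) : Good n M.grid where
  support i j h := by
    obtain ⟨i, j, rfl, rfl⟩ := M.grid_support i j h
    omega
  horiz i j := by
    rw [Bool.eq_iff_iff]
    constructor
    · intro h
      simpa [Side.offset, Side.opposite] using M.grid_conn i j .right h
    · intro h
      simpa [Side.offset, Side.opposite] using M.grid_conn i (j + 1) .left h
  vert i j := by
    rw [Bool.eq_iff_iff]
    constructor
    · intro h
      simpa [Side.offset, Side.opposite] using M.grid_conn i j .bottom h
    · intro h
      simpa [Side.offset, Side.opposite] using M.grid_conn (i + 1) j .top h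

theorem gridLink_grid (M : Mosaic n) : gridLink M.grid = M.spatialLink := by
  ext p
  simp only [spatialLink, mem_iUnion]
  constructor
  · rintro ⟨i, j, -, hp⟩
    obtain ⟨i, j, rfl, rfl⟩ := M.grid_support i j fun hb => by
      rw [curves, hb, Tile.curve_blank] at hp; exact hp
    rw [curves, grid_coe] at hp
    exact ⟨i, j, p - pt j (-i) 0, by simpa using hp, by simp [pt]⟩
  · rintro ⟨i, j, v, hv, rfl⟩
    refine ⟨(i : ℕ), (j : ℕ), trivial, ?_⟩
    rw [curves, grid_coe]
    simpa [pt] using hv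

theorem lift_gridLink (M : Mosaic n) : lift (gridLink M.grid) = M.link := by
  rw [gridLink_grid]; rfl

theorem count_grid (M : Mosaic n) : count n M.grid = M.tileNumber := by
  have h : ∀ f : ℤ → ℤ, ∑ i ∈ Finset.Ico (0 : ℤ) n, f i = ∑ i : Fin n, f (i : ℕ) := by
    intro f
    rw [Fin.sum_univ_eq_sum_range (fun i => f i) n]
    refine (Finset.sum_nbij' (fun i : ℕ => (i : ℤ)) (fun i : ℤ => i.toNat) ?_ ?_ ?_ ?_ ?_).symm <;>
      simp only [Finset.mem_Ico, Finset.mem_range] <;> intros <;> first | omega | trivial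
  unfold count weight tileNumber
  rw [h]
  simp only [h, grid_coe]
  rw [Finset.card_filter, ← Finset.univ_product_univ, Finset.sum_product]
  push_cast
  refine Finset.sum_congr rfl fun i _ => Finset.sum_congr rfl fun j _ => ?_
  simp only [nonblank, ne_eq, ite_not]

/-- The mosaic given by a suitably connected grid. -/
def ofGrid (T : ℤ → ℤ → Tile) (hT : Good n T) : Mosaic n where
  tile i j := T (i : ℕ) (j : ℕ)
  suitablyConnected i j s h := by
    rw [Tile.connectsAt_iff] at h
    have key : (T ((i : ℕ) + s.offset.1) ((j : ℕ) + s.offset.2)).conn s.opposite = true := by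
      cases s
      · simpa [Side.offset, Side.opposite, hT.left, sub_eq_add_neg] using h
      · simpa [Side.offset, Side.opposite, hT.horiz] using h
      · simpa [Side.offset, Side.opposite, hT.top, sub_eq_add_neg] using h
      · simpa [Side.offset, Side.opposite, hT.vert] using h
    have hb := hT.support _ _ fun hb => by
      rw [hb, blank_conn] at key; exact absurd key (by simp)
    refine ⟨⟨(((i : ℕ) : ℤ) + s.offset.1).toNat, by omega⟩,
      ⟨(((j : ℕ) : ℤ) + s.offset.2).toNat, by omega⟩, ?_, ?_⟩
    · ext <;> simp <;> omega
    · rw [Tile.connectsAt_iff]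
      convert key using 3
      · simp; omega
      · simp; omega

theorem grid_ofGrid (T : ℤ → ℤ → Tile) (hT : Good n T) : (ofGrid T hT).grid = T := by
  funext i j
  unfold grid
  split_ifs with h
  · simp only [ofGrid]
    congr 1 <;> omega
  · by_contra hb
    exact h (by have := hT.support i j (Ne.symm hb); omega)

theorem tight_grid (M : Mosaic n) (hM : M.SpaceEfficient)
    (hK : ¬ ∃ C : Set S3, IsTrivialComponent M.link C) : Tight n M.grid where
  good := M.good_grid
  minimal T' hT' hs := by
    have h1 := hM.2 (ofGrid T' hT') (by
      rw [← lift_gridLink, ← lift_gridLink, grid_ofGrid]; exact hs)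
    rw [count_grid, ← grid_ofGrid T' hT', count_grid]
    exact_mod_cast h1
  no_loop T' _ hs i j hl := by
    obtain ⟨C, hC⟩ := hl.isTrivialComponent
    refine hK ?_
    rw [← lift_gridLink]
    exact hC.of_isotopic hs.symm

end Mosaic

/-! ### Replacing an unknotted arc in a ball -/

/-- The chart of the three-sphere that omits the point at infinity. -/
noncomputable def chart : OpenPartialHomeomorph S3 E3 :=
  (OnePoint.isOpenEmbedding_coe.toOpenPartialHomeomorph (fun v : E3 => (v : S3))).symm

theorem chart_source : chart.source = range fun v : E3 => (v : S3) :=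
  OnePoint.isOpenEmbedding_coe.toOpenPartialHomeomorph_target _

theorem coe_mem_chart_source (v : E3) : (v : S3) ∈ chart.source := by
  rw [chart_source]; exact mem_range_self v

@[simp] theorem chart_coe (v : E3) : chart (v : S3) = v :=
  OnePoint.isOpenEmbedding_coe.toOpenPartialHomeomorph_left_inv _

theorem coe_chart {x : S3} (hx : x ≠ OnePoint.infty) : (chart x : S3) = x := by
  obtain ⟨v, rfl⟩ := OnePoint.ne_infty_iff_exists.1 hx
  rw [chart_coe]

theorem continuousAt_chart {x : S3} (hx : x ≠ OnePoint.infty) : ContinuousAt chart x := by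
  obtain ⟨v, rfl⟩ := OnePoint.ne_infty_iff_exists.1 hx
  exact chart.continuousAt (coe_mem_chart_source v)

theorem isClosed_stdBall : IsClosed stdBall :=
  ((isCompact_closedBall (0 : E3) 1).image OnePoint.continuous_coe).isClosed

theorem frontier_stdBall : frontier stdBall = lift (Metric.sphere 0 1) := by
  have h1 : interior stdBall = lift (Metric.ball 0 1) := by
    refine Subset.antisymm (fun x hx => ?_)
      (interior_maximal (lift_mono Metric.ball_subset_closedBall) (isOpen_lift Metric.isOpen_ball))
    obtain ⟨v, hv, rfl⟩ := interior_subset hx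
    have h2 := OnePoint.isOpenEmbedding_coe.isOpenMap.preimage_interior_eq_interior_preimage
      OnePoint.continuous_coe stdBall
    have h3 : (fun v : E3 => (v : S3)) ⁻¹' stdBall = Metric.closedBall 0 1 :=
      preimage_image_eq _ OnePoint.coe_injective
    have h4 : v ∈ interior ((fun v : E3 => (v : S3)) ⁻¹' stdBall) := h2 ▸ hx
    rw [h3, interior_closedBall _ one_ne_zero] at h4
    exact ⟨v, h4, rfl⟩
  rw [isClosed_stdBall.frontier_eq, h1]
  unfold stdBall lift
  rw [← image_sdiff OnePoint.coe_injective, Metric.closedBall_sdiff_ball]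

/-- The radial extension of a self-map of the unit sphere. -/
noncomputable def cone (f : E3 → E3) (v : E3) : E3 := ‖v‖ • f (‖v‖⁻¹ • v)

theorem normalize_mem {v : E3} (hv : v ≠ 0) : ‖v‖⁻¹ • v ∈ Metric.sphere (0 : E3) 1 := by
  rw [mem_sphere_zero_iff_norm, norm_smul, norm_inv, norm_norm,
    inv_mul_cancel₀ (norm_ne_zero_iff.2 hv)]

section Cone

variable {f f' : E3 → E3} (hm : MapsTo f (Metric.sphere 0 1) (Metric.sphere 0 1))
include hm

theorem norm_cone (v : E3) : ‖cone f v‖ = ‖v‖ := by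
  by_cases hv : v = 0
  · simp [hv, cone]
  · rw [cone, norm_smul, norm_norm, mem_sphere_zero_iff_norm.1 (hm (normalize_mem hv)), mul_one]

theorem cone_cone (hl : ∀ v ∈ Metric.sphere (0 : E3) 1, f' (f v) = v) (v : E3) :
    cone f' (cone f v) = v := by
  by_cases hv : v = 0
  · simp [hv, cone]
  · have h := norm_ne_zero_iff.2 hv
    rw [cone, norm_cone hm, cone, smul_smul, inv_mul_cancel₀ h, one_smul, hl _ (normalize_mem hv),
      smul_smul, mul_inv_cancel₀ h, one_smul]

theorem continuous_cone (hc : ContinuousOn f (Metric.sphere 0 1)) : Continuous (cone f) := by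
  rw [continuous_iff_continuousAt]
  intro v
  by_cases hv : v = 0
  · subst hv
    have h0 : cone f 0 = 0 := by simp [cone]
    unfold ContinuousAt
    rw [h0]
    refine squeeze_zero_norm (fun w => (norm_cone hm w).le) ?_
    simpa using (continuous_norm (E := E3)).tendsto 0
  · have h1 : ContinuousOn (fun v : E3 => ‖v‖⁻¹ • v) {0}ᶜ :=
      (continuous_norm.continuousOn.inv₀ fun w hw => norm_ne_zero_iff.2 hw).smul continuousOn_id
    have h2 : ContinuousOn (cone f) {0}ᶜ :=
      continuous_norm.continuousOn.smul (hc.comp h1 fun w hw => normalize_mem hw)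
    exact h2.continuousAt (compl_singleton_mem_nhds hv)

end Cone

theorem cone_of_mem_sphere {f : E3 → E3} {v : E3} (hv : v ∈ Metric.sphere (0 : E3) 1) :
    cone f v = f v := by
  rw [mem_sphere_zero_iff_norm] at hv
  simp [cone, hv]

/-- The vertical diameter of the unit ball, as a subset of Euclidean space. -/
def diameter : Set E3 := {v | v 0 = 0 ∧ v 1 = 0 ∧ |v 2| ≤ 1}

theorem stdDiameter_eq : stdDiameter = lift diameter := by
  unfold stdDiameter lift
  congr 1
  ext v
  change v ∈ segment ℝ (pt 0 0 (-1)) (pt 0 0 1) ↔ _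
  rw [mem_segment_iff]
  simp only [pt_zero, pt_one, pt_two, mul_zero, add_zero, diameter, mem_ofPred_eq, abs_le]
  constructor
  · rintro ⟨s, t, hs, ht, hst, h0, h1, h2⟩
    exact ⟨h0, h1, by linarith, by linarith⟩
  · rintro ⟨h0, h1, h2, h3⟩
    exact ⟨(1 - v 2) / 2, (1 + v 2) / 2, by linarith, by linarith, by ring, h0, h1, by ring⟩

theorem smul_mem_diameter {v : E3} {c : ℝ} (hc : c ≠ 0) (h : ‖v‖ ≤ 1) (h' : ‖c • v‖ ≤ 1) :
    c • v ∈ diameter ↔ v ∈ diameter := by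
  have key : ∀ w : E3, ‖w‖ ≤ 1 → |w 2| ≤ 1 := fun w hw => (PiLp.norm_apply_le w 2).trans hw
  simp only [diameter, mem_ofPred_eq, PiLp.smul_apply, smul_eq_mul, mul_eq_zero, hc, false_or]
  have h2 := key _ h'
  rw [PiLp.smul_apply, smul_eq_mul] at h2
  simp only [key v h, h2, and_true]

/-- A self-homeomorphism of the closed unit ball that is the identity on the sphere extends by the
identity. -/
theorem exists_ball_extension {k k' : E3 → E3} (hk : ContinuousOn k (Metric.closedBall 0 1))
    (hk' : ContinuousOn k' (Metric.closedBall 0 1))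
    (hm : MapsTo k (Metric.closedBall 0 1) (Metric.closedBall 0 1))
    (hm' : MapsTo k' (Metric.closedBall 0 1) (Metric.closedBall 0 1))
    (hl : ∀ v ∈ Metric.closedBall (0 : E3) 1, k' (k v) = v)
    (hr : ∀ v ∈ Metric.closedBall (0 : E3) 1, k (k' v) = v)
    (hs : ∀ v ∈ Metric.sphere (0 : E3) 1, k v = v) :
    ∃ h : E3 ≃ₜ E3, (∀ v, dist (h v) v ≤ 2) ∧ (∀ v ∈ Metric.closedBall (0 : E3) 1, h v = k v) ∧
      ∀ v ∉ Metric.closedBall (0 : E3) 1, h v = v := by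
  have hs' : ∀ v ∈ Metric.sphere (0 : E3) 1, k' v = v := fun v hv => by
    rw [← hs v hv, hl v (Metric.sphere_subset_closedBall hv), hs v hv]
  have hcont : ∀ q : E3 → E3, ContinuousOn q (Metric.closedBall 0 1) →
      (∀ v ∈ Metric.sphere (0 : E3) 1, q v = v) →
      Continuous fun v => if ‖v‖ ≤ 1 then q v else v := by
    intro q hq hqs
    refine continuous_if_le continuous_norm continuous_const ?_ continuousOn_id fun v hv => ?_
    · refine hq.mono fun v hv => ?_
      exact mem_closedBall_zero_iff.2 hv
    · exact hqs v (mem_sphere_zero_iff_norm.2 hv)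
  have hinv : ∀ q q' : E3 → E3, MapsTo q (Metric.closedBall 0 1) (Metric.closedBall 0 1) →
      (∀ v ∈ Metric.closedBall (0 : E3) 1, q' (q v) = v) → ∀ v,
      (fun v => if ‖v‖ ≤ 1 then q' v else v) ((fun v => if ‖v‖ ≤ 1 then q v else v) v) = v := by
    intro q q' hq hqq v
    beta_reduce
    by_cases hv : ‖v‖ ≤ 1
    · have h1 := mem_closedBall_zero_iff.1 (hq (mem_closedBall_zero_iff.2 hv))
      rw [if_pos hv, if_pos h1, hqq v (mem_closedBall_zero_iff.2 hv)]
    · rw [if_neg hv, if_neg hv]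
  refine ⟨⟨⟨fun v => if ‖v‖ ≤ 1 then k v else v, fun v => if ‖v‖ ≤ 1 then k' v else v,
    hinv k k' hm hl, hinv k' k hm' hr⟩, hcont k hk hs, hcont k' hk' hs'⟩, ?_, ?_, ?_⟩
  · intro v
    change dist (if ‖v‖ ≤ 1 then k v else v) v ≤ 2
    split_ifs with hv
    · have h1 := mem_closedBall_zero_iff.1 (hm (mem_closedBall_zero_iff.2 hv))
      rw [dist_eq_norm]
      linarith [norm_sub_le (k v) v]
    · simp
  · intro v hv
    exact if_pos (mem_closedBall_zero_iff.1 hv)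
  · intro v hv
    exact if_neg fun h => hv (mem_closedBall_zero_iff.2 h)

/-- Two unknotted arcs in the same ball that have the same end points are interchangeable: a
homeomorphism of the ball between them can be corrected on the boundary by a radial extension, which
preserves diameters. -/
theorem AmbientIsotopic.of_isUnknottedArc {B L L' : Set S3} (h : IsUnknottedArc B (B ∩ L))
    (h' : IsUnknottedArc B (B ∩ L')) (hf : frontier B ∩ L = frontier B ∩ L')
    (hd : L \ B = L' \ B) : AmbientIsotopic L L' := by
  obtain ⟨g, gB, ga⟩ := h
  obtain ⟨g', gB', ga'⟩ := h'
  have hB : IsClosed B := by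
    have := g.isClosed_image (s := B)
    rw [gB] at this
    exact this.1 isClosed_stdBall
  have gf : g '' frontier B = lift (Metric.sphere 0 1) := by
    rw [g.image_frontier, gB, frontier_stdBall]
  have gf' : g' '' frontier B = lift (Metric.sphere 0 1) := by
    rw [g'.image_frontier, gB', frontier_stdBall]
  have memB : ∀ x, g x ∈ stdBall ↔ x ∈ B := fun x => by rw [← gB, g.injective.mem_set_image]
  have memB' : ∀ x, g' x ∈ stdBall ↔ x ∈ B := fun x => by rw [← gB', g'.injective.mem_set_image]
  have memF : ∀ x, g x ∈ lift (Metric.sphere 0 1) ↔ x ∈ frontier B := fun x => by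
    rw [← gf, g.injective.mem_set_image]
  have memF' : ∀ x, g' x ∈ lift (Metric.sphere 0 1) ↔ x ∈ frontier B := fun x => by
    rw [← gf', g'.injective.mem_set_image]
  have mema : ∀ x, g x ∈ lift diameter ↔ x ∈ B ∩ L := fun x => by
    rw [← stdDiameter_eq, ← ga, g.injective.mem_set_image]
  have mema' : ∀ x, g' x ∈ lift diameter ↔ x ∈ B ∩ L' := fun x => by
    rw [← stdDiameter_eq, ← ga', g'.injective.mem_set_image]
  -- The transition map and its inverse, on the closed ball.
  let f : E3 → E3 := fun v => chart (g' (g.symm v))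
  let f' : E3 → E3 := fun v => chart (g (g'.symm v))
  have transition : ∀ (a b : S3 ≃ₜ S3), (∀ x, a x ∈ stdBall ↔ x ∈ B) →
      (∀ x, b x ∈ stdBall ↔ x ∈ B) → ∀ v ∈ Metric.closedBall (0 : E3) 1,
      ((chart (b (a.symm v)) : E3) : S3) = b (a.symm v) ∧
      chart (b (a.symm v)) ∈ Metric.closedBall (0 : E3) 1 ∧
      ContinuousAt (fun v : E3 => chart (b (a.symm v))) v := by
    intro a b ha hb v hv
    have h1 : b (a.symm v) ∈ stdBall := by
      rw [hb, ← ha, a.apply_symm_apply]; exact ⟨v, hv, rfl⟩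
    have h2 : b (a.symm v) ≠ OnePoint.infty := by
      rintro h
      rw [h] at h1
      exact infty_notMem_lift h1
    refine ⟨coe_chart h2, ?_, ?_⟩
    · rw [← coe_chart h2] at h1
      exact coe_mem_lift.1 h1
    · have h3 : Continuous fun v : E3 => b (a.symm v) :=
        b.continuous.comp (a.symm.continuous.comp OnePoint.continuous_coe)
      exact ContinuousAt.comp (f := fun v : E3 => b (a.symm v)) (continuousAt_chart h2)
        h3.continuousAt
  have hf1 := transition g g' memB memB'
  have hf1' := transition g' g memB' memB
  have hff : ∀ v ∈ Metric.closedBall (0 : E3) 1, f' (f v) = v := by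
    intro v hv
    simp only [f, f', (hf1 v hv).1]
    simp
  have hff' : ∀ v ∈ Metric.closedBall (0 : E3) 1, f (f' v) = v := by
    intro v hv
    simp only [f, f', (hf1' v hv).1]
    simp
  have hS := Metric.sphere_subset_closedBall (x := (0 : E3)) (ε := 1)
  have hfS : MapsTo f (Metric.sphere 0 1) (Metric.sphere 0 1) := by
    intro v hv
    have h2 : g' (g.symm v) ∈ lift (Metric.sphere 0 1) := by
      rw [memF', ← memF, g.apply_symm_apply]; exact ⟨v, hv, rfl⟩
    rw [← (hf1 v (hS hv)).1] at h2
    exact coe_mem_lift.1 h2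
  have hfS' : MapsTo f' (Metric.sphere 0 1) (Metric.sphere 0 1) := by
    intro v hv
    have h2 : g (g'.symm v) ∈ lift (Metric.sphere 0 1) := by
      rw [memF, ← memF', g'.apply_symm_apply]; exact ⟨v, hv, rfl⟩
    rw [← (hf1' v (hS hv)).1] at h2
    exact coe_mem_lift.1 h2
  have hfc : ContinuousOn f (Metric.closedBall 0 1) := fun v hv =>
    (hf1 v hv).2.2.continuousWithinAt
  have hfc' : ContinuousOn f' (Metric.closedBall 0 1) := fun v hv =>
    (hf1' v hv).2.2.continuousWithinAt
  have hcB : ∀ {q : E3 → E3}, MapsTo q (Metric.sphere 0 1) (Metric.sphere 0 1) →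
      MapsTo (cone q) (Metric.closedBall 0 1) (Metric.closedBall 0 1) := by
    intro q hq v hv
    rw [mem_closedBall_zero_iff] at hv ⊢
    rwa [norm_cone hq]
  have hc1 := continuous_cone hfS (hfc.mono hS)
  have hc1' := continuous_cone hfS' (hfc'.mono hS)
  have hcc := cone_cone hfS (fun v hv => hff v (hS hv))
  have hcc' := cone_cone hfS' (fun v hv => hff' v (hS hv))
  obtain ⟨h, hdist, hin, hout⟩ := exists_ball_extension (k := fun v => f' (cone f v))
    (k' := fun v => cone f' (f v))
    (hfc'.comp hc1.continuousOn (hcB hfS))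
    (hc1'.continuousOn.comp hfc fun v hv => (hf1 v hv).2.1)
    (fun v hv => (hf1' _ (hcB hfS hv)).2.1)
    (fun v hv => hcB hfS' (hf1 v hv).2.1)
    (fun v hv => by simp only [hff' _ (hcB hfS hv), hcc])
    (fun v hv => by simp only [hcc', hff v hv])
    (fun v hv => by simp only [cone_of_mem_sphere hv, hff v (hS hv)])
  -- The correction preserves the diameter because it permutes the end points.
  have hpole : ∀ u ∈ Metric.sphere (0 : E3) 1, f u ∈ diameter ↔ u ∈ diameter := by
    intro u hu
    have e1 : f u ∈ diameter ↔ g.symm u ∈ B ∩ L' := by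
      rw [← mema', ← (hf1 u (hS hu)).1, coe_mem_lift]
    have e2 : u ∈ diameter ↔ g.symm u ∈ B ∩ L := by
      rw [← mema, g.apply_symm_apply, coe_mem_lift]
    have e3 : g.symm u ∈ frontier B := by
      rw [← memF, g.apply_symm_apply]; exact ⟨u, hu, rfl⟩
    have e4 := hB.frontier_subset e3
    have e5 : g.symm u ∈ frontier B ∩ L ↔ g.symm u ∈ frontier B ∩ L' := by rw [hf]
    rw [e1, e2]
    simpa [e3, e4] using e5.symm
  have hdiam : ∀ v ∈ Metric.closedBall (0 : E3) 1, cone f v ∈ diameter ↔ v ∈ diameter := by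
    intro v hv
    by_cases h0 : v = 0
    · simp [h0, cone]
    have hn := normalize_mem h0
    have hfn := hfS hn
    rw [mem_closedBall_zero_iff] at hv
    have h1 := norm_ne_zero_iff.2 h0
    have h2 : ‖cone f v‖ ≤ 1 := by rwa [norm_cone hfS]
    rw [cone] at h2 ⊢
    rw [smul_mem_diameter h1 (mem_sphere_zero_iff_norm.1 hfn).le h2, hpole _ hn,
      smul_mem_diameter (inv_ne_zero h1) hv (mem_sphere_zero_iff_norm.1 hn).le]
  have hgoal : h.onePointCongr '' (g '' L) = g '' L' := by
    have key : ∀ x, g.symm (h.onePointCongr (g x)) ∈ L' ↔ x ∈ L := by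
      intro x
      by_cases hx : x ∈ B
      · obtain ⟨v, hv, hvx⟩ := (memB x).2 hx
        have e1 : h.onePointCongr (g x) = (f' (cone f v) : E3) := by
          rw [← hvx, ← hin v hv]; rfl
        have e2 := hf1' _ (hcB hfS hv)
        rw [e1, e2.1, g.symm_apply_apply]
        have e3 : g'.symm (cone f v : E3) ∈ B := by
          rw [← memB', g'.apply_symm_apply]; exact ⟨_, hcB hfS hv, rfl⟩
        have e4 : g'.symm (cone f v : E3) ∈ L' ↔ cone f v ∈ diameter := by
          rw [← coe_mem_lift, ← g'.apply_symm_apply (cone f v : E3), mema', mem_inter_iff,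
            g'.apply_symm_apply]
          simp [e3]
        rw [e4, hdiam v hv, ← coe_mem_lift, show (v : S3) = g x from hvx, mema,
          mem_inter_iff]
        simp [hx]
      · have e1 : h.onePointCongr (g x) = g x := by
          by_cases hi : g x = OnePoint.infty
          · rw [hi]; rfl
          · obtain ⟨v, hv⟩ := OnePoint.ne_infty_iff_exists.1 hi
            rw [← hv]
            have : v ∉ Metric.closedBall (0 : E3) 1 := fun hv' =>
              hx ((memB x).1 (hv ▸ ⟨v, hv', rfl⟩))
            exact congrArg _ (hout v this)
        rw [e1, g.symm_apply_apply]
        have : x ∈ L \ B ↔ x ∈ L' \ B := by rw [hd]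
        simpa [hx] using this.symm
    ext y
    constructor
    · rintro ⟨_, ⟨x, hx, rfl⟩, rfl⟩
      exact ⟨_, (key x).2 hx, g.apply_symm_apply _⟩
    · rintro ⟨y, hy, rfl⟩
      obtain ⟨w, hw⟩ := h.onePointCongr.surjective (g y)
      obtain ⟨x, rfl⟩ := g.surjective w
      refine ⟨_, ⟨x, (key x).1 ?_, rfl⟩, hw⟩
      rwa [hw, g.symm_apply_apply]
  have hiso := (ambientIsotopic_onePointCongr h hdist (g '' L)).image g.symm
  rw [hgoal, ← image_comp, ← image_comp] at hiso
  simpa using hiso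

/-! ### Half-spaces and flat caps -/

/-- Inversion of the three-sphere in the sphere of radius `√2` around the origin. -/
noncomputable def invertFun : S3 → S3 := fun x =>
  x.elim ((0 : E3) : S3) fun v : E3 =>
    if v = 0 then OnePoint.infty else (((2 / ‖v‖ ^ 2) • v : E3) : S3)

theorem invertFun_infty : invertFun OnePoint.infty = ((0 : E3) : S3) := rfl

theorem invertFun_zero : invertFun ((0 : E3) : S3) = OnePoint.infty := if_pos rfl

theorem invertFun_coe {v : E3} (hv : v ≠ 0) :
    invertFun v = (((2 / ‖v‖ ^ 2) • v : E3) : S3) := if_neg hv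

theorem norm_invert {v : E3} (hv : v ≠ 0) : ‖(2 / ‖v‖ ^ 2) • v‖ = 2 / ‖v‖ := by
  have := norm_ne_zero_iff.2 hv
  rw [norm_smul, Real.norm_of_nonneg (by positivity)]
  field_simp

theorem invertFun_invertFun (x : S3) : invertFun (invertFun x) = x := by
  induction x using OnePoint.rec with
  | infty => rw [invertFun_infty, invertFun_zero]
  | coe v =>
    by_cases hv : v = 0
    · rw [hv, invertFun_zero, invertFun_infty]
    · have h := norm_ne_zero_iff.2 hv
      have h1 : (2 / ‖v‖ ^ 2) • v ≠ 0 := smul_ne_zero (by positivity) hv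
      rw [invertFun_coe hv, invertFun_coe h1, norm_invert hv, smul_smul]
      rw [show 2 / (2 / ‖v‖) ^ 2 * (2 / ‖v‖ ^ 2) = 1 by field_simp, one_smul]

theorem continuous_invertFun : Continuous invertFun := by
  rw [continuous_iff_continuousAt]
  intro x
  induction x using OnePoint.rec with
  | infty =>
    rw [OnePoint.continuousAt_infty', coclosedCompact_eq_cocompact, ← Metric.cobounded_eq_cocompact,
      invertFun_infty]
    have h1 : Tendsto (fun v : E3 => (2 / ‖v‖ ^ 2) • v) (Bornology.cobounded E3) (𝓝 0) := by
      rw [tendsto_zero_iff_norm_tendsto_zero]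
      have h2 : Tendsto (fun v : E3 => 2 / ‖v‖) (Bornology.cobounded E3) (𝓝 0) :=
        tendsto_const_nhds.div_atTop tendsto_norm_cobounded_atTop
      refine h2.congr' ?_
      filter_upwards [Filter.hasBasis_cobounded_norm.mem_of_mem (i := 1) trivial] with v hv
      refine (norm_invert fun h => ?_).symm
      rw [h, norm_zero] at hv
      linarith
    have h3 := (OnePoint.continuous_coe.tendsto (0 : E3)).comp h1
    refine h3.congr' ?_
    filter_upwards [Filter.hasBasis_cobounded_norm.mem_of_mem (i := 1) trivial] with v hv
    refine (invertFun_coe fun h => ?_).symm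
    rw [h, norm_zero] at hv
    linarith
  | coe v =>
    rw [OnePoint.continuousAt_coe]
    by_cases hv : v = 0
    · subst hv
      rw [continuousAt_iff_punctured_nhds]
      change Tendsto (fun v : E3 => invertFun v) _ (𝓝 (invertFun ((0 : E3) : S3)))
      rw [invertFun_zero]
      have h1 : Tendsto (fun v : E3 => (2 / ‖v‖ ^ 2) • v) (𝓝[≠] 0) (Bornology.cobounded E3) := by
        rw [← tendsto_norm_atTop_iff_cobounded]
        have h2 : Tendsto (fun v : E3 => ‖v‖⁻¹ * 2) (𝓝[≠] 0) atTop := by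
          refine Tendsto.atTop_mul_const two_pos ?_
          exact tendsto_inv_nhdsGT_zero.comp tendsto_norm_nhdsNE_zero
        refine h2.congr' ?_
        filter_upwards [self_mem_nhdsWithin] with v hv
        rw [norm_invert hv, div_eq_inv_mul]
      have h3 := OnePoint.tendsto_coe_infty (X := E3)
      rw [coclosedCompact_eq_cocompact, ← Metric.cobounded_eq_cocompact] at h3
      refine (h3.comp h1).congr' ?_
      filter_upwards [self_mem_nhdsWithin] with v hv
      exact (invertFun_coe hv).symm
    · have h1 : ContinuousAt (fun v : E3 => (((2 / ‖v‖ ^ 2) • v : E3) : S3)) v := by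
        refine OnePoint.continuous_coe.continuousAt.comp ?_
        have h2 := norm_ne_zero_iff.2 hv
        exact ((continuousAt_const.div (continuous_norm.continuousAt.pow 2)
          (pow_ne_zero 2 h2)).smul continuousAt_id)
      refine h1.congr ?_
      filter_upwards [compl_singleton_mem_nhds hv] with w hw
      exact (invertFun_coe hw).symm

/-- Inversion as a homeomorphism. -/
noncomputable def invert : S3 ≃ₜ S3 where
  toFun := invertFun
  invFun := invertFun
  left_inv := invertFun_invertFun
  right_inv := invertFun_invertFun
  continuous_toFun := continuous_invertFun
  continuous_invFun := continuous_invertFun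

/-- Inversion in the sphere of radius `√2` around the south pole `(0, -1, 0)` of the unit ball, with
respect to the second coordinate. -/
noncomputable def polarInvert : S3 ≃ₜ S3 :=
  ((tr (pt 0 (-1) 0)).symm.toHomeomorph.onePointCongr.trans invert).trans
    (tr (pt 0 (-1) 0)).toHomeomorph.onePointCongr

theorem polarInvert_infty : polarInvert OnePoint.infty = (pt 0 (-1) 0 : E3) := by
  change (((pt 0 (-1) 0 : E3) + 0 : E3) : S3) = _
  rw [add_zero]

theorem tr_symm_apply (c v : E3) : (tr c).symm v = v - c := by
  rw [IsometryEquiv.symm_apply_eq, tr_apply, add_sub_cancel]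

theorem polarInvert_coe (v : E3) (hv : v ≠ pt 0 (-1) 0) : ∃ k : ℝ, 0 < k ∧
    k * (v 0 ^ 2 + (v 1 + 1) ^ 2 + v 2 ^ 2) = 2 ∧
    polarInvert v = (pt (k * v 0) (-1 + k * (v 1 + 1)) (k * v 2) : E3) := by
  have h1 : v - pt 0 (-1) 0 ≠ 0 := sub_ne_zero.2 hv
  have h2 := norm_pos_iff.2 h1
  have h3 : v 0 ^ 2 + (v 1 + 1) ^ 2 + v 2 ^ 2 = ‖v - pt 0 (-1) 0‖ ^ 2 := by
    rw [EuclideanSpace.norm_sq_eq, Fin.sum_univ_three]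
    simp
  refine ⟨2 / ‖v - pt 0 (-1) 0‖ ^ 2, by positivity, by rw [h3]; field_simp, ?_⟩
  change (tr (pt 0 (-1) 0)).toHomeomorph.onePointCongr
    (invertFun (((tr (pt 0 (-1) 0)).symm v : E3) : S3)) = _
  rw [tr_symm_apply, invertFun_coe h1]
  change ((pt 0 (-1) 0 + (2 / ‖v - pt 0 (-1) 0‖ ^ 2) • (v - pt 0 (-1) 0) : E3) : S3) = _
  congr 1
  refine ext_pt ?_ ?_ ?_ <;> simp

theorem polarInvert_south : polarInvert (pt 0 (-1) 0 : E3) = OnePoint.infty := by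
  change (tr (pt 0 (-1) 0)).toHomeomorph.onePointCongr
    (invertFun (((tr (pt 0 (-1) 0)).symm (pt 0 (-1) 0) : E3) : S3)) = _
  rw [tr_symm_apply, sub_self, invertFun_zero]
  rfl

/-- The closed half-space above the given height (with respect to the second coordinate), as a ball
in the three-sphere. -/
def halfSpace (y : ℝ) : Set S3 := {OnePoint.infty} ∪ lift {v | y ≤ v 1}

theorem coe_mem_halfSpace {y : ℝ} {v : E3} : (v : S3) ∈ halfSpace y ↔ y ≤ v 1 := by
  rw [halfSpace, mem_union, coe_mem_lift, mem_singleton_iff]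
  simp

theorem infty_mem_halfSpace (y : ℝ) : OnePoint.infty ∈ halfSpace y := Or.inl rfl

theorem isOpen_above (y : ℝ) : IsOpen {v : E3 | y < v 1} :=
  isOpen_lt continuous_const (by fun_prop)

theorem isOpen_below (y : ℝ) : IsOpen {v : E3 | v 1 < y} :=
  isOpen_lt (by fun_prop) continuous_const

theorem compl_halfSpace (y : ℝ) : (halfSpace y)ᶜ = lift {v | v 1 < y} := by
  ext x
  induction x using OnePoint.rec with
  | infty =>
    simp only [mem_compl_iff, infty_mem_halfSpace, not_true_eq_false, false_iff]
    exact infty_notMem_lift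
  | coe v => rw [mem_compl_iff, coe_mem_halfSpace, coe_mem_lift, not_le]; rfl

theorem isClosed_halfSpace (y : ℝ) : IsClosed (halfSpace y) := by
  rw [← isOpen_compl_iff, compl_halfSpace]
  exact isOpen_lift (isOpen_below y)

theorem interior_halfSpace (y : ℝ) : interior (halfSpace y) = lift {v | y < v 1} := by
  refine Subset.antisymm (fun x hx => ?_) (interior_maximal ?_ (isOpen_lift (isOpen_above y)))
  · induction x using OnePoint.rec with
    | infty =>
      exfalso
      have h1 : Tendsto (fun t : ℝ => pt 0 (-t) 0) atTop (Bornology.cobounded E3) := by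
        rw [← tendsto_norm_atTop_iff_cobounded]
        refine tendsto_atTop_mono (fun t => ?_) tendsto_id
        have := PiLp.norm_apply_le (pt 0 (-t) 0) 1
        rw [pt_one, norm_neg] at this
        exact (le_abs_self t).trans this
      have h3 := OnePoint.tendsto_coe_infty (X := E3)
      rw [coclosedCompact_eq_cocompact, ← Metric.cobounded_eq_cocompact] at h3
      have h4 := (h3.comp h1).eventually (isOpen_interior.mem_nhds hx)
      obtain ⟨t, ht, ht'⟩ := (h4.and (eventually_gt_atTop (-y))).exists
      have := coe_mem_halfSpace.1 (interior_subset ht)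
      rw [pt_one] at this
      linarith
    | coe v =>
      have h2 := OnePoint.isOpenEmbedding_coe.isOpenMap.preimage_interior_eq_interior_preimage
        OnePoint.continuous_coe (halfSpace y)
      have h4 : v ∈ interior ((fun v : E3 => (v : S3)) ⁻¹' halfSpace y) := h2 ▸ hx
      have h3 : (fun v : E3 => (v : S3)) ⁻¹' halfSpace y = {v | y ≤ v 1} := by
        ext w; exact coe_mem_halfSpace
      rw [h3] at h4
      have h8 : v ∈ {v : E3 | y ≤ v 1} := interior_subset h4
      rw [mem_ofPred_eq] at h8
      rw [coe_mem_lift, mem_ofPred_eq]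
      refine lt_of_le_of_ne h8 fun he => ?_
      -- A point on the boundary plane is a limit of points below the plane.
      have h5 : Tendsto (fun t : ℝ => v + pt 0 t 0) (𝓝[<] 0) (𝓝 v) := by
        have : Continuous fun t : ℝ => v + pt 0 t 0 := by
          have h : (fun t : ℝ => v + pt 0 t 0) = fun t => v + t • pt 0 1 0 := by
            funext t; congr 1; refine ext_pt ?_ ?_ ?_ <;> simp
          rw [h]; fun_prop
        have h6 := this.tendsto 0
        rw [show v + pt 0 0 0 = v from ext_pt (add_zero _) (add_zero _) (add_zero _)] at h6
        exact h6.mono_left nhdsWithin_le_nhds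
      obtain ⟨t, ht, ht'⟩ := ((h5.eventually (isOpen_interior.mem_nhds h4)).and
        self_mem_nhdsWithin).exists
      have h7 : v + pt 0 t 0 ∈ {v : E3 | y ≤ v 1} := interior_subset ht
      rw [mem_ofPred_eq, PiLp.add_apply, pt_one] at h7
      have : t < 0 := ht'
      linarith
  · refine (lift_mono fun v hv => ?_).trans subset_union_right
    exact le_of_lt (show y < v 1 from hv)

theorem frontier_halfSpace (y : ℝ) :
    frontier (halfSpace y) = {OnePoint.infty} ∪ lift {v | v 1 = y} := by
  rw [(isClosed_halfSpace y).frontier_eq, interior_halfSpace]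
  ext x
  induction x using OnePoint.rec with
  | infty => simp [infty_mem_halfSpace, infty_notMem_lift]
  | coe v =>
    rw [Set.mem_sdiff, coe_mem_halfSpace, coe_mem_lift, mem_union, coe_mem_lift]
    simp only [mem_ofPred_eq, mem_singleton_iff, OnePoint.coe_ne_infty, false_or, not_lt]
    exact ⟨fun h => le_antisymm h.2 h.1, fun h => ⟨h.ge, h.le⟩⟩

theorem closure_compl_halfSpace (y : ℝ) :
    closure (halfSpace y)ᶜ = {OnePoint.infty} ∪ lift {v | v 1 ≤ y} := by
  rw [closure_compl, interior_halfSpace]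
  ext x
  induction x using OnePoint.rec with
  | infty => simp [infty_notMem_lift]
  | coe v =>
    rw [mem_compl_iff, coe_mem_lift, mem_union, coe_mem_lift]
    simp

theorem coe_mem_stdBall {v : E3} : (v : S3) ∈ stdBall ↔ v 0 ^ 2 + v 1 ^ 2 + v 2 ^ 2 ≤ 1 := by
  refine (coe_mem_lift (A := Metric.closedBall 0 1)).trans ?_
  rw [mem_closedBall_zero_iff, EuclideanSpace.norm_eq, Fin.sum_univ_three,
    Real.sqrt_le_one]
  simp

theorem polarInvert_mem_stdBall (x : S3) : polarInvert x ∈ stdBall ↔ x ∈ halfSpace 0 := by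
  induction x using OnePoint.rec with
  | infty =>
    rw [polarInvert_infty, coe_mem_stdBall]
    simp [infty_mem_halfSpace]
  | coe v =>
    rw [coe_mem_halfSpace]
    by_cases hv : v = pt 0 (-1) 0
    · rw [hv, polarInvert_south]
      have : OnePoint.infty ∉ stdBall := infty_notMem_lift
      simp [this]
    · obtain ⟨k, hk, hk2, h⟩ := polarInvert_coe v hv
      rw [h, coe_mem_stdBall]
      simp only [pt_zero, pt_one, pt_two]
      have e : (k * v 0) ^ 2 + (-1 + k * (v 1 + 1)) ^ 2 + (k * v 2) ^ 2 = 1 - 2 * k * v 1 := by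
        linear_combination k * hk2
      rw [e]
      constructor
      · intro h
        by_contra hneg
        push Not at hneg
        nlinarith [mul_pos hk (neg_pos.2 hneg)]
      · intro h
        nlinarith [mul_nonneg hk.le h]

/-- The upper half of the unit circle in the horizontal plane. -/
def semicircle : Set E3 := {v | v 0 ^ 2 + v 1 ^ 2 = 1 ∧ 0 ≤ v 1 ∧ v 2 = 0}

/-- The diameter of the unit ball along the first coordinate. -/
def diameterX : Set E3 := {v | |v 0| ≤ 1 ∧ v 1 = 0 ∧ v 2 = 0}

theorem polarInvert_mem_diameterX (x : S3) :
    polarInvert x ∈ lift diameterX ↔ x ∈ lift semicircle := by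
  induction x using OnePoint.rec with
  | infty =>
    rw [polarInvert_infty, coe_mem_lift]
    simp [infty_notMem_lift, diameterX]
  | coe v =>
    rw [coe_mem_lift]
    by_cases hv : v = pt 0 (-1) 0
    · rw [hv, polarInvert_south]
      have : ¬ (0 : ℝ) ≤ -1 := by norm_num
      simp [infty_notMem_lift, semicircle, this]
    · obtain ⟨k, hk, hk2, h⟩ := polarInvert_coe v hv
      rw [h, coe_mem_lift]
      simp only [diameterX, semicircle, mem_ofPred_eq, pt_zero, pt_one, pt_two, mul_eq_zero, hk.ne',
        false_or]
      rw [← sq_le_one_iff_abs_le_one]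
      have e : (k * v 0) ^ 2 + (-1 + k * (v 1 + 1)) ^ 2 + (k * v 2) ^ 2 = 1 - 2 * k * v 1 := by
        linear_combination k * hk2
      constructor
      · rintro ⟨h0, h1, h2⟩
        rw [h1, h2] at e
        have h3 : k * (v 1 + 1) = 1 := by linarith
        refine ⟨?_, ?_, h2⟩
        · have h4 : k * (v 0 ^ 2 + v 1 ^ 2 - 1) = 0 := by
            rw [h2] at hk2
            linear_combination hk2 - 2 * h3
          have := (mul_eq_zero.1 h4).resolve_left hk.ne'
          linarith
        · by_contra hneg
          push Not at hneg
          nlinarith [mul_pos hk (neg_pos.2 hneg)]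
      · rintro ⟨h0, h1, h2⟩
        rw [h2] at e hk2
        have h3 : k * (v 1 + 1) = 1 := by
          have : k * (2 * (v 1 + 1)) = 2 := by linear_combination hk2 - k * h0
          linarith
        refine ⟨?_, by linarith, h2⟩
        have h4 : -1 + k * (v 1 + 1) = 0 := by linarith
        rw [h4] at e
        nlinarith [mul_nonneg hk.le h1]

/-- The exchange of the first and the third coordinate. -/
noncomputable def swapXZ : E3 ≃ᵢ E3 :=
  involution (fun p => pt (p 2) (p 1) (p 0)) (fun p => by refine ext_pt ?_ ?_ ?_ <;> simp)
    (fun p q => by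
      simp only [EuclideanSpace.dist_eq, Fin.sum_univ_three, Real.dist_eq, sq_abs, pt_zero, pt_one,
        pt_two]
      congr 1; ring)

theorem onePointCongr_mem_lift (e : E3 ≃ₜ E3) {A A' : Set E3} (h : ∀ v, e v ∈ A ↔ v ∈ A')
    (x : S3) : e.onePointCongr x ∈ lift A ↔ x ∈ lift A' := by
  induction x using OnePoint.rec with
  | infty =>
    have : e.onePointCongr OnePoint.infty = OnePoint.infty := rfl
    rw [this]
    simp [infty_notMem_lift]
  | coe v =>
    have : e.onePointCongr (v : S3) = (e v : E3) := rfl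
    rw [this, coe_mem_lift, coe_mem_lift, h]

theorem onePointCongr_mem_halfSpace (e : E3 ≃ₜ E3) {y y' : ℝ} (h : ∀ v, y ≤ e v 1 ↔ y' ≤ v 1)
    (x : S3) : e.onePointCongr x ∈ halfSpace y ↔ x ∈ halfSpace y' := by
  have := onePointCongr_mem_lift e (A := {v | y ≤ v 1}) (A' := {v | y' ≤ v 1}) h x
  have h2 : e.onePointCongr x = OnePoint.infty ↔ x = OnePoint.infty := by
    induction x using OnePoint.rec with
    | infty => exact ⟨fun _ => rfl, fun _ => rfl⟩
    | coe v =>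
      have : e.onePointCongr (v : S3) = (e v : E3) := rfl
      rw [this]
      simp
  simp only [halfSpace, mem_union, mem_singleton_iff, h2, this]

theorem image_eq_of_mem_iff {α β : Type*} (e : α ≃ β) {A : Set α} {B : Set β}
    (h : ∀ x, e x ∈ B ↔ x ∈ A) : e '' A = B := by
  ext y
  obtain ⟨x, rfl⟩ := e.surjective y
  rw [h, e.injective.mem_set_image]

/-- The half-space with a semicircle is a ball with a diameter. -/
theorem isUnknottedArc_of_semicircle {y : ℝ} {A : Set E3} (e : E3 ≃ₜ E3)
    (h1 : ∀ v, 0 ≤ e v 1 ↔ y ≤ v 1) (h2 : ∀ v, e v ∈ semicircle ↔ v ∈ A) :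
    IsUnknottedArc (halfSpace y) (lift A) := by
  refine ⟨(e.onePointCongr.trans polarInvert).trans swapXZ.toHomeomorph.onePointCongr,
    image_eq_of_mem_iff (Homeomorph.toEquiv _) fun x => ?_,
    image_eq_of_mem_iff (Homeomorph.toEquiv _) fun x => ?_⟩
  · change swapXZ.toHomeomorph.onePointCongr (polarInvert (e.onePointCongr x)) ∈ lift _ ↔ _
    rw [onePointCongr_mem_lift swapXZ.toHomeomorph (A' := Metric.closedBall 0 1)]
    · refine (polarInvert_mem_stdBall _).trans ?_
      exact onePointCongr_mem_halfSpace e h1 x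
    · intro v
      rw [← coe_mem_lift, ← coe_mem_lift]
      refine coe_mem_stdBall.trans (Iff.trans ?_ coe_mem_stdBall.symm)
      change (v 2) ^ 2 + (v 1) ^ 2 + (v 0) ^ 2 ≤ 1 ↔ _
      rw [show (v 2) ^ 2 + (v 1) ^ 2 + (v 0) ^ 2 = (v 0) ^ 2 + (v 1) ^ 2 + (v 2) ^ 2 by ring]
  · change swapXZ.toHomeomorph.onePointCongr (polarInvert (e.onePointCongr x)) ∈ _ ↔ _
    rw [stdDiameter_eq, onePointCongr_mem_lift swapXZ.toHomeomorph (A' := diameterX),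
      polarInvert_mem_diameterX, onePointCongr_mem_lift e h2]
    intro v
    change v 2 = 0 ∧ v 1 = 0 ∧ |v 0| ≤ 1 ↔ |v 0| ≤ 1 ∧ v 1 = 0 ∧ v 2 = 0
    tauto

/-- The gauge whose unit sphere meets the horizontal plane in two flat caps of height one half over
an interval of half-length `ρ`. -/
noncomputable def capGauge (ρ : ℝ) (hρ : 0 < ρ) : StarGauge where
  val v := max (2 * |v 1|) ((|v 0| + |v 1|) / ρ) + |v 2|
  continuous := by fun_prop
  homogeneous c v hc := by
    simp only [PiLp.smul_apply, smul_eq_mul, abs_mul, abs_of_nonneg hc]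
    rw [mul_add, mul_max_of_nonneg _ _ hc]
    congr 1
    congr 1 <;> ring
  bound := 1 / (ρ + 1)
  bound_pos := by positivity
  le_val v := by
    have h1 : ‖v‖ ≤ |v 0| + |v 1| + |v 2| := by
      rw [EuclideanSpace.norm_eq, Fin.sum_univ_three]
      refine Real.sqrt_le_iff.2 ⟨by positivity, ?_⟩
      simp only [Real.norm_eq_abs]
      nlinarith [mul_nonneg (abs_nonneg (v 0)) (abs_nonneg (v 1)),
        mul_nonneg (abs_nonneg (v 0)) (abs_nonneg (v 2)),
        mul_nonneg (abs_nonneg (v 1)) (abs_nonneg (v 2))]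
    have h2 : (|v 0| + |v 1|) / (ρ + 1) ≤ (|v 0| + |v 1|) / ρ := by gcongr; linarith
    have h3 : |v 2| / (ρ + 1) ≤ |v 2| := div_le_self (abs_nonneg _) (by linarith)
    calc 1 / (ρ + 1) * ‖v‖ ≤ 1 / (ρ + 1) * (|v 0| + |v 1| + |v 2|) := by gcongr
      _ = (|v 0| + |v 1|) / (ρ + 1) + |v 2| / (ρ + 1) := by ring
      _ ≤ _ := add_le_add (h2.trans (le_max_right _ _)) h3

/-- The flat cap of height one half over an interval. -/
def cap (p q y : ℝ) : Set E3 := {v | v 1 = y + min (1 / 2) (min (v 0 - p) (q - v 0)) ∧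
  p ≤ v 0 ∧ v 0 ≤ q ∧ v 2 = 0}

theorem isUnknottedArc_cap {p q : ℝ} (hpq : p < q) (y : ℝ) :
    IsUnknottedArc (halfSpace y) (lift (cap p q y)) := by
  have hρ : 0 < (q - p) / 2 := by linarith
  set N := capGauge ((q - p) / 2) hρ with hN
  let e : E3 ≃ₜ E3 := (tr (pt ((p + q) / 2) y 0)).symm.toHomeomorph.trans N.homeo
  have he : ∀ v, ∃ c : ℝ, 0 < c ∧ e v 0 = c * (v 0 - (p + q) / 2) ∧ e v 1 = c * (v 1 - y) ∧
      e v 2 = c * v 2 := by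
    intro v
    have h1 : e v = N.homeo (v - pt ((p + q) / 2) y 0) := by
      change N.homeo ((tr _).symm v) = _
      rw [tr_symm_apply]
    obtain ⟨c, hc, h⟩ := N.homeo_eq_smul (v - pt ((p + q) / 2) y 0)
    refine ⟨c, hc, ?_, ?_, ?_⟩ <;> rw [h1, h] <;> simp
  have hn : ∀ v, ‖e v‖ = max (2 * |v 1 - y|) ((|v 0 - (p + q) / 2| + |v 1 - y|) / ((q - p) / 2)) +
      |v 2| := by
    intro v
    change ‖N.homeo ((tr _).symm v)‖ = _
    rw [tr_symm_apply, N.norm_homeo]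
    change max (2 * |(v - _) 1|) ((|(v - _) 0| + |(v - _) 1|) / ((q - p) / 2)) + |(v - _) 2| = _
    simp
  refine isUnknottedArc_of_semicircle e (fun v => ?_) fun v => ?_
  · obtain ⟨c, hc, -, h, -⟩ := he v
    rw [h, mul_nonneg_iff_of_pos_left hc, sub_nonneg]
  · obtain ⟨c, hc, -, h1, h2⟩ := he v
    have h3 : e v ∈ semicircle ↔ ‖e v‖ = 1 ∧ y ≤ v 1 ∧ v 2 = 0 := by
      have e2 : e v 2 = 0 ↔ v 2 = 0 := by rw [h2]; simp [hc.ne']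
      have e1 : 0 ≤ e v 1 ↔ y ≤ v 1 := by
        rw [h1, mul_nonneg_iff_of_pos_left hc, sub_nonneg]
      rw [← e2, ← e1]
      change (_ ∧ _ ∧ _) ↔ _
      refine ⟨fun ⟨a, b, d⟩ => ⟨?_, b, d⟩, fun ⟨a, b, d⟩ => ⟨?_, b, d⟩⟩
      · rw [EuclideanSpace.norm_eq, Fin.sum_univ_three, Real.sqrt_eq_one]
        simp only [Real.norm_eq_abs, sq_abs]
        rw [d, a]; norm_num
      · rw [EuclideanSpace.norm_eq, Fin.sum_univ_three, Real.sqrt_eq_one] at a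
        simp only [Real.norm_eq_abs, sq_abs] at a
        rw [d] at a
        linarith
    rw [h3, hn]
    have hdiv : ∀ a : ℝ, a / ((q - p) / 2) = 1 ↔ a = (q - p) / 2 := fun a => div_eq_one_iff_eq
        hρ.ne'
    have hdiv' : ∀ a : ℝ, a / ((q - p) / 2) ≤ 1 ↔ a ≤ (q - p) / 2 := fun a => div_le_one hρ
    have habs : ∀ t, |v 0 - (p + q) / 2| ≤ t ↔ p - v 0 ≤ t - (q - p) / 2 ∧
        v 0 - q ≤ t - (q - p) / 2 := by
      intro t
      rw [abs_le]
      constructor <;> rintro ⟨a, b⟩ <;> constructor <;> linarith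
    change _ ↔ v 1 = y + min (1 / 2) (min (v 0 - p) (q - v 0)) ∧ p ≤ v 0 ∧ v 0 ≤ q ∧ v 2 = 0
    constructor
    · rintro ⟨a, b, d⟩
      rw [d, abs_zero, add_zero, abs_of_nonneg (sub_nonneg.2 b)] at a
      have a1 := (le_max_left _ _).trans a.le
      have a2 := (hdiv' _).1 ((le_max_right _ _).trans a.le)
      obtain ⟨a3, a4⟩ := (habs ((q - p) / 2 - (v 1 - y))).1 (by linarith)
      refine ⟨?_, by linarith, by linarith, d⟩
      rw [← sub_eq_iff_eq_add']
      refine le_antisymm (le_min (by linarith) (le_min (by linarith) (by linarith))) ?_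
      rcases max_choice (2 * (v 1 - y)) ((|v 0 - (p + q) / 2| + (v 1 - y)) / ((q - p) / 2)) with h
          | h
      · rw [h] at a
        exact (min_le_left _ _).trans (by linarith)
      · rw [h, hdiv] at a
        refine (min_le_right _ _).trans ?_
        rcases abs_cases (v 0 - (p + q) / 2) with ⟨g, -⟩ | ⟨g, -⟩
        · exact (min_le_right _ _).trans (by linarith)
        · exact (min_le_left _ _).trans (by linarith)
    · rintro ⟨a, b, c', d⟩
      set m := min (1 / 2) (min (v 0 - p) (q - v 0)) with hm
      have m0 : 0 ≤ m := le_min (by norm_num) (le_min (by linarith) (by linarith))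
      have m1 : m ≤ 1 / 2 := min_le_left _ _
      have m2 : m ≤ v 0 - p := (min_le_right _ _).trans (min_le_left _ _)
      have m3 : m ≤ q - v 0 := (min_le_right _ _).trans (min_le_right _ _)
      refine ⟨?_, by linarith, d⟩
      have e1 : v 1 - y = m := by linarith
      rw [d, abs_zero, add_zero, e1, abs_of_nonneg m0]
      have h4 : |v 0 - (p + q) / 2| ≤ (q - p) / 2 - m := (habs _).2 ⟨by linarith, by linarith⟩
      refine le_antisymm (max_le (by linarith) ((hdiv' _).2 (by linarith))) ?_
      rcases min_choice (1 / 2) (min (v 0 - p) (q - v 0)) with h | h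
      · rw [← hm] at h
        rw [h]; exact le_trans (by norm_num) (le_max_left _ _)
      · refine le_trans (le_of_eq ?_) (le_max_right _ _)
        symm
        rw [hdiv]
        rcases min_choice (v 0 - p) (q - v 0) with h' | h'
        · rw [← hm, h'] at h
          have : |v 0 - (p + q) / 2| ≥ (q - p) / 2 - m := by
            rw [h]; exact le_trans (by linarith) (neg_le_abs _)
          linarith
        · rw [← hm, h'] at h
          have : |v 0 - (p + q) / 2| ≥ (q - p) / 2 - m := by
            rw [h]; exact le_trans (by linarith) (le_abs_self _)
          linarith

/-! ### Horizontal cuts of a diagram -/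

/-- The piece of link on a tile consists of a segment that descends to the midpoint of the lower
edge and of segments in the upper half of the tile. -/
theorem Tile.exists_foot {t : Tile} (h : t.conn .bottom = true) :
    ∃ A : E3, A 1 = 0 ∧ |A 0| ≤ 1 / 2 ∧ ∃ l : List (E3 × E3),
      t.curve = poly ((A, pt 0 (-1 / 2) 0) :: l) ∧ ∀ e ∈ l, 0 ≤ e.1 1 ∧ 0 ≤ e.2 1 := by
  rw [Tile.curve_eq]
  have hsplit : ∀ l : List (E3 × E3), poly ((pt 0 (1 / 2) 0, pt 0 (-1 / 2) 0) :: l) =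
      poly ((pt 0 0 0, pt 0 (-1 / 2) 0) :: (pt 0 (1 / 2) 0, pt 0 0 0) :: l) := by
    intro l
    have : segment ℝ (pt 0 (1 / 2) 0) (pt 0 (-1 / 2) 0) =
        segment ℝ (pt 0 0 0) (pt 0 (-1 / 2) 0) ∪ segment ℝ (pt 0 (1 / 2) 0) (pt 0 0 0) := by
      ext p
      rw [mem_union, mem_segment_iff, mem_segment_iff, mem_segment_iff]
      simp only [pt_zero, pt_one, pt_two, mul_zero, add_zero, zero_add]
      constructor
      · rintro ⟨s, u, hs, hu, hsu, h0, h1, h2⟩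
        rcases le_total s u with hle | hle
        · exact Or.inl ⟨1 - (u - s), u - s, by linarith, by linarith, by ring, h0, by linarith, h2⟩
        · exact Or.inr ⟨s - u, 1 - (s - u), by linarith, by linarith, by ring, h0, by linarith, h2⟩
      · rintro (⟨s, u, hs, hu, hsu, h0, h1, h2⟩ | ⟨s, u, hs, hu, hsu, h0, h1, h2⟩)
        · exact ⟨s / 2, 1 - s / 2, by linarith, by linarith, by ring, h0, by linarith, h2⟩
        · exact ⟨1 - u / 2, u / 2, by linarith, by linarith, by ring, h0, by linarith, h2⟩
    rw [poly_cons, poly_cons, poly_cons, this, union_assoc]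
  cases t <;> simp [Tile.conn, Tile.strands] at h
  · exact ⟨pt (-1 / 2) 0 0, rfl, by norm_num [abs_of_neg], [], rfl, by simp⟩
  · exact ⟨pt (1 / 2) 0 0, rfl, by norm_num, [], rfl, by simp⟩
  · exact ⟨pt 0 0 0, rfl, by norm_num, _, hsplit [], by norm_num⟩
  · exact ⟨pt (-1 / 2) 0 0, rfl, by norm_num [abs_of_neg], _, rfl, by norm_num⟩
  · exact ⟨pt (1 / 2) 0 0, rfl, by norm_num, _, rfl, by norm_num⟩
  · refine ⟨pt 0 0 0, rfl, by norm_num, _, Eq.trans ?_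
      (hsplit [(pt (-1 / 2) 0 0, pt 0 0 1), (pt 0 0 1, pt (1 / 2) 0 0)]), ?_⟩
    · exact SameEdges.poly_eq (by simp [SameEdges, Tile.edges])
    · norm_num
  · refine ⟨pt 0 0 1, rfl, by norm_num,
      [(pt 0 (1 / 2) 0, pt 0 0 1), (pt (-1 / 2) 0 0, pt (1 / 2) 0 0)], ?_, by norm_num⟩
    exact SameEdges.poly_eq (by simp [SameEdges, Tile.edges])

/-- The counterpart of `Tile.exists_foot` for the upper edge. -/
theorem Tile.exists_head {t : Tile} (h : t.conn .top = true) :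
    ∃ A : E3, A 1 = 0 ∧ |A 0| ≤ 1 / 2 ∧ ∃ l : List (E3 × E3),
      t.curve = poly ((A, pt 0 (1 / 2) 0) :: l) ∧ ∀ e ∈ l, e.1 1 ≤ 0 ∧ e.2 1 ≤ 0 := by
  rw [Tile.curve_eq]
  have hsplit : ∀ l : List (E3 × E3), poly ((pt 0 (1 / 2) 0, pt 0 (-1 / 2) 0) :: l) =
      poly ((pt 0 0 0, pt 0 (1 / 2) 0) :: (pt 0 0 0, pt 0 (-1 / 2) 0) :: l) := by
    intro l
    have : segment ℝ (pt 0 (1 / 2) 0) (pt 0 (-1 / 2) 0) =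
        segment ℝ (pt 0 0 0) (pt 0 (1 / 2) 0) ∪ segment ℝ (pt 0 0 0) (pt 0 (-1 / 2) 0) := by
      ext p
      rw [mem_union, mem_segment_iff, mem_segment_iff, mem_segment_iff]
      simp only [pt_zero, pt_one, pt_two, mul_zero, add_zero, zero_add]
      constructor
      · rintro ⟨s, u, hs, hu, hsu, h0, h1, h2⟩
        rcases le_total s u with hle | hle
        · exact Or.inr ⟨1 - (u - s), u - s, by linarith, by linarith, by ring, h0, by linarith, h2⟩
        · exact Or.inl ⟨1 - (s - u), s - u, by linarith, by linarith, by ring, h0, by linarith, h2⟩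
      · rintro (⟨s, u, hs, hu, hsu, h0, h1, h2⟩ | ⟨s, u, hs, hu, hsu, h0, h1, h2⟩)
        · exact ⟨1 - s / 2, s / 2, by linarith, by linarith, by ring, h0, by linarith, h2⟩
        · exact ⟨s / 2, 1 - s / 2, by linarith, by linarith, by ring, h0, by linarith, h2⟩
    rw [poly_cons, poly_cons, poly_cons, this, union_assoc]
  cases t <;> simp [Tile.conn, Tile.strands] at h
  · exact ⟨pt (1 / 2) 0 0, rfl, by norm_num, [],
      SameEdges.poly_eq (by simp [SameEdges, Tile.edges]), by simp⟩
  · exact ⟨pt (-1 / 2) 0 0, rfl, by norm_num [abs_of_neg], [],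
      SameEdges.poly_eq (by simp [SameEdges, Tile.edges]), by simp⟩
  · exact ⟨pt 0 0 0, rfl, by norm_num, _, hsplit [], by norm_num⟩
  · exact ⟨pt (1 / 2) 0 0, rfl, by norm_num, [(pt (-1 / 2) 0 0, pt 0 (-1 / 2) 0)],
      SameEdges.poly_eq (by simp [SameEdges, Tile.edges]), by norm_num⟩
  · exact ⟨pt (-1 / 2) 0 0, rfl, by norm_num [abs_of_neg], [(pt (1 / 2) 0 0, pt 0 (-1 / 2) 0)],
      SameEdges.poly_eq (by simp [SameEdges, Tile.edges]), by norm_num⟩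
  · refine ⟨pt 0 0 0, rfl, by norm_num, _, Eq.trans ?_
      (hsplit [(pt (-1 / 2) 0 0, pt 0 0 1), (pt 0 0 1, pt (1 / 2) 0 0)]), ?_⟩
    · exact SameEdges.poly_eq (by simp [SameEdges, Tile.edges])
    · norm_num
  · refine ⟨pt 0 0 1, rfl, by norm_num,
      [(pt 0 0 1, pt 0 (-1 / 2) 0), (pt (-1 / 2) 0 0, pt (1 / 2) 0 0)], ?_, by norm_num⟩
    exact SameEdges.poly_eq (by simp [SameEdges, Tile.edges])

theorem poly_nonneg {l : List (E3 × E3)} (h : ∀ e ∈ l, 0 ≤ e.1 1 ∧ 0 ≤ e.2 1) {p : E3}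
    (hp : p ∈ poly l) : 0 ≤ p 1 := by
  obtain ⟨e, he, hp⟩ := hp
  obtain ⟨s, t, hs, ht, -, -, h1, -⟩ := mem_segment_iff.1 hp
  obtain ⟨h2, h3⟩ := h e he
  rw [h1]; positivity

theorem poly_nonpos {l : List (E3 × E3)} (h : ∀ e ∈ l, e.1 1 ≤ 0 ∧ e.2 1 ≤ 0) {p : E3}
    (hp : p ∈ poly l) : p 1 ≤ 0 := by
  obtain ⟨e, he, hp⟩ := hp
  obtain ⟨s, t, hs, ht, -, -, h1, -⟩ := mem_segment_iff.1 hp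
  obtain ⟨h2, h3⟩ := h e he
  rw [h1]
  nlinarith [mul_nonneg hs (neg_nonneg.2 h2), mul_nonneg ht (neg_nonneg.2 h3)]

theorem Tile.curve_nonneg {t : Tile} (h : t.conn .bottom = false) {p : E3} (hp : p ∈ t.curve) :
    0 ≤ p 1 := by
  rw [Tile.curve_eq] at hp
  refine poly_nonneg ?_ hp
  cases t <;> first | (exact absurd h (by decide)) | norm_num [Tile.edges]

theorem Tile.mem_curve_below {t : Tile} (h : t.conn .bottom = true) :
    ∃ α β : ℝ, |α| ≤ 1 ∧ ∀ p : E3, p 1 < 0 → (p ∈ t.curve ↔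
      -1 / 2 ≤ p 1 ∧ p 0 = α * (p 1 + 1 / 2) ∧ p 2 = β * (p 1 + 1 / 2)) := by
  obtain ⟨A, hA, hA0, l, hl, hle⟩ := Tile.exists_foot h
  refine ⟨2 * A 0, 2 * A 2, by rw [abs_mul, abs_two]; linarith, fun p hp => ?_⟩
  rw [hl, poly_cons, mem_union, or_iff_left fun hm => absurd (poly_nonneg hle hm) (not_le.2 hp),
    mem_segment_iff]
  simp only [hA, pt_zero, pt_one, pt_two, mul_zero, add_zero, zero_add]
  constructor
  · rintro ⟨s, u, hs, hu, hsu, h0, h1, h2⟩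
    have : s = 2 * (p 1 + 1 / 2) := by linarith
    subst this
    exact ⟨by linarith, by rw [h0]; ring, by rw [h2]; ring⟩
  · rintro ⟨h0, h1, h2⟩
    exact ⟨2 * (p 1 + 1 / 2), -2 * p 1, by linarith, by linarith, by ring, by rw [h1]; ring,
      by ring, by rw [h2]; ring⟩

theorem Tile.mem_curve_above {t : Tile} (h : t.conn .top = true) :
    ∃ α β : ℝ, |α| ≤ 1 ∧ ∀ p : E3, 0 < p 1 → (p ∈ t.curve ↔
      p 1 ≤ 1 / 2 ∧ p 0 = α * (1 / 2 - p 1) ∧ p 2 = β * (1 / 2 - p 1)) := by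
  obtain ⟨A, hA, hA0, l, hl, hle⟩ := Tile.exists_head h
  refine ⟨2 * A 0, 2 * A 2, by rw [abs_mul, abs_two]; linarith, fun p hp => ?_⟩
  rw [hl, poly_cons, mem_union, or_iff_left fun hm => absurd (poly_nonpos hle hm) (not_le.2 hp),
    mem_segment_iff]
  simp only [hA, pt_zero, pt_one, pt_two, mul_zero, add_zero, zero_add]
  constructor
  · rintro ⟨s, u, hs, hu, hsu, h0, h1, h2⟩
    have : s = 2 * (1 / 2 - p 1) := by linarith
    subst this
    exact ⟨by linarith, by rw [h0]; ring, by rw [h2]; ring⟩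
  · rintro ⟨h0, h1, h2⟩
    exact ⟨2 * (1 / 2 - p 1), 2 * p 1, by linarith, by linarith, by ring, by rw [h1]; ring,
      by ring, by rw [h2]; ring⟩

/-- The row of a point of the link below the upper edge of row `a`. -/
theorem row_le_of_below {a i : ℤ} {y : ℝ} (h1 : y < 1 / 2 - a) (h2 : -1 / 2 ≤ y + i) : a ≤ i := by
  have : ((a - 1 : ℤ) : ℝ) < i := by push_cast; linarith
  have : a - 1 < i := by exact_mod_cast this
  omega

theorem le_row_of_above {a i : ℤ} {y : ℝ} (h1 : 1 / 2 - a ≤ y) (h2 : y + i ≤ 1 / 2) : i ≤ a := by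
  have : (i : ℝ) ≤ a := by linarith
  exact_mod_cast this

/-- The points of the link on the upper edge of row `a`. -/
theorem Good.mem_cut {n : ℤ} {T : ℤ → ℤ → Tile} (hT : Good n T) (a : ℤ) {p : E3}
    (hy : p 1 = 1 / 2 - a) :
    p ∈ gridLink T ↔ ∃ j : ℤ, (T a j).conn .top = true ∧ p = pt j (1 / 2 - a) 0 := by
  constructor
  · rintro ⟨i, j, -, hp⟩
    obtain ⟨-, ⟨f3, f4⟩, -, -, f5, f6⟩ := framed_curves T i j _ hp
    simp only [PiLp.sub_apply, pt_zero, pt_one, pt_two] at f3 f4 f5 f6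
    have hi : i = a ∨ i = a - 1 := by
      have h1 := le_row_of_above hy.ge (by linarith : p 1 + i ≤ 1 / 2)
      have h2 : a - 1 ≤ i := by
        have : ((a - 1 : ℤ) : ℝ) ≤ i := by push_cast; linarith
        exact_mod_cast this
      omega
    rcases hi with rfl | rfl
    · obtain ⟨g0, g2, g⟩ := f5 (by linarith)
      exact ⟨j, g, ext_pt (by rw [pt_zero]; linarith) hy (by rw [pt_two]; linarith)⟩
    · push_cast at f6
      obtain ⟨g0, g2, g⟩ := f6 (by linarith)
      rw [hT.vert, sub_add_cancel] at g
      exact ⟨j, g, ext_pt (by rw [pt_zero]; linarith) hy (by rw [pt_two]; linarith)⟩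
  · rintro ⟨j, hj, rfl⟩
    obtain ⟨α, β, -, h⟩ := Tile.mem_curve_above hj
    refine ⟨a, j, trivial, ?_⟩
    have e : pt j (1 / 2 - a) 0 - pt j (-a) 0 = pt 0 (1 / 2) 0 := by
      refine ext_pt ?_ ?_ ?_ <;> simp
    rw [e]
    exact (h _ (by rw [pt_one]; norm_num)).2 ⟨by simp, by simp, by simp⟩

/-- Near a point in which the link crosses the upper edge of row `a`, the link is a graph. -/
theorem Good.graph_of_top {n : ℤ} {T : ℤ → ℤ → Tile} (hT : Good n T) {a j : ℤ}
    (h : (T a j).conn .top = true) : ∃ f g : ℝ → ℝ, Continuous f ∧ Continuous g ∧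
      f (1 / 2 - a) = 0 ∧ g (1 / 2 - a) = 0 ∧ ∀ p : E3, -a < p 1 → p 1 < 1 - a → j - 1 / 2 < p 0 →
        p 0 < j + 1 / 2 → (p ∈ gridLink T ↔ p 0 = j + f (p 1) ∧ p 2 = g (p 1)) := by
  have h' : (T (a - 1) j).conn .bottom = true := by rw [hT.vert, sub_add_cancel]; exact h
  obtain ⟨α, β, -, hA⟩ := Tile.mem_curve_above h
  obtain ⟨α', β', -, hB⟩ := Tile.mem_curve_below h'
  refine ⟨fun y => α' * max (y - (1 / 2 - a)) 0 + α * max (1 / 2 - a - y) 0,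
    fun y => β' * max (y - (1 / 2 - a)) 0 + β * max (1 / 2 - a - y) 0, by fun_prop, by fun_prop,
    by simp, by simp, fun p h1 h2 h3 h4 => ?_⟩
  have hBp := hB (p - pt j (-(a - 1 : ℤ)) 0) (by simp; linarith)
  have hAp := hA (p - pt j (-a) 0) (by simp; linarith)
  simp only [PiLp.sub_apply, pt_zero, pt_one, pt_two, sub_neg_eq_add, sub_zero] at hBp hAp
  push_cast at hBp
  have key : p ∈ gridLink T ↔ p - pt j (-(a - 1 : ℤ)) 0 ∈ (T (a - 1) j).curve ∨
      p - pt j (-a) 0 ∈ (T a j).curve := by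
    constructor
    · rintro ⟨i, j', -, hp⟩
      obtain ⟨⟨f1, f2⟩, ⟨f3, f4⟩, -⟩ := framed_curves T i j' _ hp
      simp only [PiLp.sub_apply, pt_zero, pt_one] at f1 f2 f3 f4
      have hj : j' = j := by
        have c1 : ((j' - 1 : ℤ) : ℝ) < j := by push_cast; linarith
        have c2 : (j : ℝ) < ((j' + 1 : ℤ) : ℝ) := by push_cast; linarith
        have c1' : j' - 1 < j := by exact_mod_cast c1
        have c2' : j < j' + 1 := by exact_mod_cast c2
        omega
      have hi : i = a - 1 ∨ i = a := by
        have c1 : ((a - 2 : ℤ) : ℝ) < i := by push_cast; linarith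
        have c2 : (i : ℝ) < ((a + 1 : ℤ) : ℝ) := by push_cast; linarith
        have c1' : a - 2 < i := by exact_mod_cast c1
        have c2' : i < a + 1 := by exact_mod_cast c2
        omega
      subst hj
      rcases hi with rfl | rfl
      · exact Or.inl hp
      · exact Or.inr hp
    · rintro (hp | hp)
      · exact ⟨a - 1, j, trivial, hp⟩
      · exact ⟨a, j, trivial, hp⟩
  push_cast at key
  rw [key, hBp, hAp]
  beta_reduce
  rcases lt_trichotomy (p 1) (1 / 2 - a) with hy | hy | hy
  · rw [max_eq_right (by linarith : p 1 - (1 / 2 - a) ≤ 0),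
      max_eq_left (by linarith : 0 ≤ 1 / 2 - a - p 1)]
    rw [or_iff_right fun hc => by linarith [hc.1]]
    constructor
    · rintro ⟨-, g0, g2⟩
      exact ⟨by linarith, by linarith⟩
    · rintro ⟨g0, g2⟩
      exact ⟨by linarith, by linarith, by linarith⟩
  · rw [hy]
    simp only [sub_self, max_self, mul_zero, add_zero]
    ring_nf
    constructor
    · rintro (⟨-, g0, g2⟩ | ⟨-, g0, g2⟩)
      · exact ⟨by linarith, by linarith⟩
      · exact ⟨by linarith, by linarith⟩
    · rintro ⟨g0, g2⟩
      exact Or.inl ⟨by norm_num, by linarith, by linarith⟩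
  · rw [max_eq_left (by linarith : 0 ≤ p 1 - (1 / 2 - a)),
      max_eq_right (by linarith : 1 / 2 - a - p 1 ≤ 0)]
    rw [or_iff_left fun hc => by linarith [hc.1]]
    constructor
    · rintro ⟨-, g0, g2⟩
      exact ⟨by linarith, by linarith⟩
    · rintro ⟨g0, g2⟩
      exact ⟨by linarith, by linarith, by linarith⟩

/-- A shear that straightens a graph over the second coordinate. -/
noncomputable def straighten (x y : ℝ) (f g : ℝ → ℝ) (hf : Continuous f) (hg : Continuous g) :
    E3 ≃ₜ E3 where
  toFun p := pt (p 0 - x - f (p 1)) (p 2 - g (p 1)) (p 1 - y)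
  invFun p := pt (p 0 + x + f (p 2 + y)) (p 2 + y) (p 1 + g (p 2 + y))
  left_inv p := by
    refine ext_pt ?_ ?_ ?_ <;> simp
    ring
  right_inv p := by
    refine ext_pt ?_ ?_ ?_ <;> simp
    ring
  continuous_toFun := by
    refine (PiLp.continuous_toLp 2 _).comp (continuous_pi fun i => ?_)
    fin_cases i <;> simp <;> fun_prop
  continuous_invFun := by
    refine (PiLp.continuous_toLp 2 _).comp (continuous_pi fun i => ?_)
    fin_cases i <;> simp <;> fun_prop

theorem Good.meetTransverselyAt {n : ℤ} {T : ℤ → ℤ → Tile} (hT : Good n T) {a j : ℤ}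
    (h : (T a j).conn .top = true) : MeetTransverselyAt (frontier (halfSpace (1 / 2 - a)))
      (lift (gridLink T)) (pt j (1 / 2 - a) 0 : E3) := by
  obtain ⟨f, g, hf, hg, f0, g0, hfg⟩ := hT.graph_of_top h
  have hopen : IsOpen {p : E3 | -a < p 1 ∧ p 1 < 1 - a ∧ j - 1 / 2 < p 0 ∧ p 0 < j + 1 / 2} := by
    refine (isOpen_lt ?_ ?_).and ((isOpen_lt ?_ ?_).and ((isOpen_lt ?_ ?_).and
      (isOpen_lt ?_ ?_))) <;> fun_prop
  have hsource : ∀ x, x ∈ ((chart.transHomeomorph (straighten j (1 / 2 - a) f g hf hg)).restrOpen _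
      (isOpen_lift hopen)).source ↔ x ∈ lift {p : E3 | -a < p 1 ∧ p 1 < 1 - a ∧ j - 1 / 2 < p 0 ∧
        p 0 < j + 1 / 2} := by
    intro x
    rw [OpenPartialHomeomorph.restrOpen_source, mem_inter_iff]
    refine and_iff_right_of_imp ?_
    rintro ⟨v, -, rfl⟩
    exact coe_mem_chart_source v
  refine ⟨(chart.transHomeomorph (straighten j (1 / 2 - a) f g hf hg)).restrOpen _
    (isOpen_lift hopen), ?_, ?_, ?_⟩
  · rw [hsource, coe_mem_lift]
    simp only [mem_ofPred_eq, pt_one, pt_zero]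
    refine ⟨?_, ?_, ?_, ?_⟩ <;> linarith
  · change straighten j (1 / 2 - a) f g hf hg (chart _) = 0
    rw [chart_coe]
    change pt (j - j - f (1 / 2 - a)) (0 - g (1 / 2 - a)) (1 / 2 - a - (1 / 2 - a)) = 0
    rw [f0, g0]
    refine ext_pt ?_ ?_ ?_ <;> simp
  · intro x hx
    rw [hsource] at hx
    obtain ⟨v, ⟨h1, h2, h3, h4⟩, rfl⟩ := hx
    have e : ((chart.transHomeomorph (straighten j (1 / 2 - a) f g hf hg)).restrOpen _
        (isOpen_lift hopen)) (v : S3) = pt (v 0 - j - f (v 1)) (v 2 - g (v 1))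
          (v 1 - (1 / 2 - a)) := by
      change straighten j (1 / 2 - a) f g hf hg (chart _) = _
      rw [chart_coe]; rfl
    beta_reduce
    rw [e, pt_zero, pt_one, pt_two, frontier_halfSpace, mem_union, coe_mem_lift, coe_mem_lift,
      hfg v h1 h2 h3 h4, sub_eq_zero, sub_eq_zero, sub_eq_zero, sub_eq_iff_eq_add']
    simp

theorem Good.frontier_inter {n : ℤ} {T : ℤ → ℤ → Tile} (hT : Good n T) (a : ℤ) :
    frontier (halfSpace (1 / 2 - a)) ∩ lift (gridLink T) =
      {x : S3 | ∃ j : ℤ, (T a j).conn .top = true ∧ x = (pt j (1 / 2 - a) 0 : E3)} := by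
  ext x
  rw [frontier_halfSpace]
  constructor
  · rintro ⟨h | ⟨v, hv, rfl⟩, ⟨w, hw, h'⟩⟩
    · rw [mem_singleton_iff] at h
      rw [h] at h'
      exact absurd h' (OnePoint.coe_ne_infty w)
    · rw [OnePoint.coe_injective h'] at hw
      obtain ⟨j, hj, rfl⟩ := (hT.mem_cut a hv).1 hw
      exact ⟨j, hj, rfl⟩
  · rintro ⟨j, hj, rfl⟩
    exact ⟨Or.inr (coe_mem_lift.2 rfl), coe_mem_lift.2 ((hT.mem_cut a rfl).2 ⟨j, hj, rfl⟩)⟩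

theorem isTameBall_halfSpace (y : ℝ) : IsTameBall (halfSpace y) := by
  obtain ⟨g, hg, -⟩ := isUnknottedArc_cap zero_lt_one y
  refine ⟨g.symm, ?_⟩
  rw [← hg, ← image_comp]
  simp

/-- Every tame sphere that meets the set transversely in two points cuts off an unknotted arc. -/
def SplitsTrivially (K : Set S3) : Prop :=
  ∀ B : Set S3, IsTameBall B → (frontier B ∩ K).ncard = 2 →
    (∀ x ∈ frontier B ∩ K, MeetTransverselyAt (frontier B) K x) →
      IsUnknottedArc B (B ∩ K) ∨ IsUnknottedArc (closure Bᶜ) (closure Bᶜ ∩ K)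

theorem IsUnknottedArc.image {B a : Set S3} (h : IsUnknottedArc B a) (g : S3 ≃ₜ S3) :
    IsUnknottedArc (g '' B) (g '' a) := by
  obtain ⟨b, hB, ha⟩ := h
  refine ⟨g.symm.trans b, ?_, ?_⟩
  · rw [← image_comp, ← hB]; congr 1; ext x; simp
  · rw [← image_comp, ← ha]; congr 1; ext x; simp

theorem IsTameBall.image {B : Set S3} (h : IsTameBall B) (g : S3 ≃ₜ S3) : IsTameBall (g '' B) := by
  obtain ⟨b, rfl⟩ := h
  exact ⟨b.trans g, by rw [← image_comp]; rfl⟩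

theorem MeetTransverselyAt.image {S K : Set S3} {x : S3} (h : MeetTransverselyAt S K x)
    (g : S3 ≃ₜ S3) : MeetTransverselyAt (g '' S) (g '' K) (g x) := by
  obtain ⟨φ, hx, h0, hφ⟩ := h
  refine ⟨g.symm.transOpenPartialHomeomorph φ, ?_, ?_, ?_⟩
  · simpa using hx
  · simpa using h0
  · intro y hy
    obtain ⟨y, rfl⟩ := g.surjective y
    have := hφ y (by simpa using hy)
    simpa [g.injective.mem_set_image] using this

theorem SplitsTrivially.image {K : Set S3} (h : SplitsTrivially K) (g : S3 ≃ₜ S3) :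
    SplitsTrivially (g '' K) := by
  intro B hB hcard htr
  obtain ⟨B, rfl⟩ : ∃ B', g '' B' = B := ⟨g.symm '' B, by rw [← image_comp]; simp⟩
  have hB' : IsTameBall B := by
    have := hB.image g.symm
    rwa [← image_comp, show ⇑g.symm ∘ ⇑g = id by ext; simp, image_id] at this
  rw [← g.image_frontier, ← image_inter g.injective] at hcard htr
  rw [ncard_image_of_injective _ g.injective] at hcard
  rw [← image_inter g.injective, ← g.image_compl, ← g.image_closure, ← image_inter g.injective]
  refine (h B hB' hcard fun x hx => ?_).imp (fun h => h.image g) fun h => h.image g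
  have := (htr (g x) (mem_image_of_mem g hx)).image g.symm
  simpa [← image_comp] using this

/-- A cut with two strands leaves an unknotted arc on one of its sides. -/
theorem Good.isUnknottedArc_of_pair {n : ℤ} {T : ℤ → ℤ → Tile} (hT : Good n T) {a p q : ℤ}
    (hpq : p < q) (hcut : ∀ j, (T a j).conn .top = true ↔ j = p ∨ j = q)
    (hK : SplitsTrivially (lift (gridLink T))) :
    IsUnknottedArc (halfSpace (1 / 2 - a)) (halfSpace (1 / 2 - a) ∩ lift (gridLink T)) ∨
      IsUnknottedArc (closure (halfSpace (1 / 2 - a))ᶜ)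
        (closure (halfSpace (1 / 2 - a))ᶜ ∩ lift (gridLink T)) := by
  refine hK _ (isTameBall_halfSpace _) ?_ fun x hx => ?_
  · rw [hT.frontier_inter, ncard_eq_two]
    refine ⟨(pt p (1 / 2 - a) 0 : E3), (pt q (1 / 2 - a) 0 : E3), fun he => ?_, ?_⟩
    · have h1 := congrArg (fun v : E3 => v 0) (OnePoint.coe_injective he)
      simp only [pt_zero, Int.cast_inj] at h1
      omega
    · ext x
      simp only [hcut, mem_ofPred_eq, mem_insert_iff, mem_singleton_iff, or_and_right, exists_or,
        exists_eq_left]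
  · rw [hT.frontier_inter] at hx
    obtain ⟨j, hj, rfl⟩ := hx
    exact hT.meetTransverselyAt hj

/-- A knot diagram has no cut without strands that leaves something on both sides. -/
theorem Good.exists_top_of_isPreconnected {n : ℤ} {T : ℤ → ℤ → Tile} (hT : Good n T)
    (hK : IsPreconnected (gridLink T)) {a i j i' j' : ℤ} (hi : i < a) (hi' : a ≤ i')
    (h : T i j ≠ .blank) (h' : T i' j' ≠ .blank) : ∃ k, (T a k).conn .top = true := by
  by_contra! hcon
  have hne : ∀ t : Tile, t ≠ .blank → t.curve.Nonempty := by
    intro t ht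
    rw [Tile.curve_eq]
    cases t
    · exact absurd rfl ht
    all_goals exact ⟨_, _, List.mem_cons_self, left_mem_segment ℝ _ _⟩
  have hmem : ∀ p ∈ gridLink T, p 1 ≠ 1 / 2 - a := by
    intro p hp hy
    obtain ⟨k, hk, -⟩ := (hT.mem_cut a hy).1 hp
    exact hcon k hk
  have hplace : ∀ i j, ∀ v ∈ (T i j).curve, pt j (-i) 0 + v ∈ gridLink T := fun i j v hv =>
    ⟨i, j, trivial, by rwa [add_sub_cancel_left]⟩
  obtain ⟨v, hv⟩ := hne _ h
  obtain ⟨v', hv'⟩ := hne _ h'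
  have hfv := framed_curves T i j v hv
  have hfv' := framed_curves T i' j' v' hv'
  have hm := hplace i j v hv
  have hm' := hplace i' j' v' hv'
  have hsub := hK.subset_left_of_subset_union (isOpen_above (1 / 2 - a)) (isOpen_below (1 / 2 - a))
    (disjoint_left.2 fun p h1 h2 => lt_asymm (show 1 / 2 - (a : ℝ) < p 1 from h1) h2)
    (fun p hp => (lt_or_gt_of_ne (hmem p hp)).symm) ⟨_, hm, ?_⟩
  · have h1 : 1 / 2 - (a : ℝ) < (pt j' (-i') 0 + v') 1 := hsub hm'
    rw [PiLp.add_apply, pt_one] at h1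
    have h2 : (a : ℝ) ≤ i' := by exact_mod_cast hi'
    linarith [hfv'.2.1.2]
  · refine lt_of_le_of_ne ?_ (hmem _ hm).symm
    rw [PiLp.add_apply, pt_one]
    have h2 : ((i + 1 : ℤ) : ℝ) ≤ a := by exact_mod_cast hi
    push_cast at h2
    linarith [hfv.2.1.1]

theorem IsKnot.isPreconnected {L : Set E3} (h : IsKnot (lift L)) : IsPreconnected L := by
  obtain ⟨e⟩ := h
  have h1 : IsPreconnected (lift L) := by
    have : ConnectedSpace Circle := inferInstance
    have h2 : IsPreconnected (range (Subtype.val ∘ e)) :=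
      isPreconnected_range (continuous_subtype_val.comp e.continuous)
    rwa [range_comp, e.surjective.range_eq, image_univ, Subtype.range_coe] at h2
  have h2 : L = chart '' lift L := by
    unfold lift
    rw [← image_comp]
    simp
  rw [h2]
  refine h1.image _ (chart.continuousOn.mono ?_)
  rintro _ ⟨v, -, rfl⟩
  exact coe_mem_chart_source v

/-! ### Parity of cuts -/

/-- The number of connection points of a tile on one of its sides, modulo two. -/
def bit (t : Tile) (s : Side) : ZMod 2 := if t.conn s = true then 1 else 0

theorem bit_sum (t : Tile) : bit t .left + bit t .top + bit t .bottom = bit t .right := by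
  cases t <;> decide

theorem Good.sum_row {n : ℤ} {T : ℤ → ℤ → Tile} (hT : Good n T) (i : ℤ) (c : ℕ) :
    ∑ j ∈ Finset.range c, (bit (T i j) .top + bit (T i j) .bottom) = bit (T i c) .left := by
  induction c with
  | zero =>
    have : (T i (0 : ℕ)).conn .left = false := by
      rw [hT.left, hT.eq_blank (by simp), blank_conn]
    rw [Finset.range_zero, Finset.sum_empty, bit, this]
    rfl
  | succ c ih =>
    rw [Finset.sum_range_succ, ih, ← add_assoc, bit_sum]
    simp [bit, hT.horiz]

/-- The numbers of strands that leave a corner rectangle through its lower and through its right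
side have the same parity. -/
theorem Good.sum_left_eq_sum_top {n : ℤ} {T : ℤ → ℤ → Tile} (hT : Good n T) (a c : ℕ) :
    ∑ i ∈ Finset.range a, bit (T i c) .left = ∑ j ∈ Finset.range c, bit (T a j) .top := by
  induction a with
  | zero =>
    symm
    refine Finset.sum_eq_zero fun j _ => ?_
    have := hT.top_zero j
    simp [bit, this]
  | succ a ih =>
    rw [Finset.sum_range_succ, ih, ← hT.sum_row, ← Finset.sum_add_distrib]
    refine Finset.sum_congr rfl fun j _ => ?_
    rw [← add_assoc, CharTwo.add_self_eq_zero, zero_add]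
    simp [bit, hT.vert]

/-- The columns in which the link crosses the upper edge of row `a`. -/
noncomputable def cut (n : ℤ) (T : ℤ → ℤ → Tile) (a : ℤ) : Finset ℤ :=
  (Finset.Ico 0 n).filter fun j => (T a j).conn .top = true

theorem ne_blank_of_conn {t : Tile} {s : Side} (h : t.conn s = true) : t ≠ .blank := by
  rintro rfl
  rw [blank_conn] at h
  exact absurd h (by simp)

theorem Good.mem_cut_iff {n : ℤ} {T : ℤ → ℤ → Tile} (hT : Good n T) {a j : ℤ} :
    j ∈ cut n T a ↔ (T a j).conn .top = true := by
  simp only [cut, Finset.mem_filter, Finset.mem_Ico, and_iff_right_iff_imp]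
  intro h
  exact (hT.support a j (ne_blank_of_conn h)).2.2

theorem Good.even_card_cut {n : ℤ} {T : ℤ → ℤ → Tile} (hT : Good n T) {a : ℤ} (ha : 0 ≤ a)
    (hn : 0 ≤ n) : Even (cut n T a).card := by
  obtain ⟨a, rfl⟩ := Int.eq_ofNat_of_zero_le ha
  obtain ⟨n, rfl⟩ := Int.eq_ofNat_of_zero_le hn
  have h := hT.sum_left_eq_sum_top a n
  rw [Finset.sum_eq_zero fun i _ => ?_] at h
  · rw [← ZMod.natCast_eq_zero_iff_even, cut, Finset.card_filter, h]
    push_cast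
    refine (Finset.sum_nbij' (fun i : ℤ => i.toNat) (fun i : ℕ => (i : ℤ)) ?_ ?_ ?_ ?_ ?_) <;>
      simp only [Finset.mem_Ico, Finset.mem_range] <;> intro j hj
    · omega
    · omega
    · omega
    · omega
    · rw [show ((j.toNat : ℕ) : ℤ) = j by omega]
      simp [bit]
  · rw [bit, hT.eq_blank (by omega), blank_conn]
    simp

/-! ### Capping off one side of a cut -/

/-- The tiles of a row that joins the columns `p` and `q` by an arch. -/
def capTile (p q j : ℤ) : Tile :=
  if j = p then .arcRightBottom else if j = q then .arcLeftBottom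
  else if p < j ∧ j < q then .horizontal else .blank

theorem capTile_conn {p q : ℤ} (hpq : p < q) (j : ℤ) :
    (capTile p q j).conn .left = decide (p < j ∧ j ≤ q) ∧
    (capTile p q j).conn .right = decide (p ≤ j ∧ j < q) ∧ (capTile p q j).conn .top = false ∧
    (capTile p q j).conn .bottom = decide (j = p ∨ j = q) := by
  unfold capTile
  split_ifs with h1 h2 h3 <;> simp [Tile.conn, Tile.strands] <;> omega

/-- The grid in which everything above row `a` is replaced by an arch joining two columns. -/
def capGrid (T : ℤ → ℤ → Tile) (a p q : ℤ) : ℤ → ℤ → Tile := fun i j =>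
  if a ≤ i then T i j else if i = a - 1 then capTile p q j else .blank

section Cap

variable {n : ℤ} {T : ℤ → ℤ → Tile} {a p q : ℤ}

theorem capGrid_of_le {i : ℤ} (h : a ≤ i) (j : ℤ) : capGrid T a p q i j = T i j := if_pos h

theorem capGrid_cap (j : ℤ) : capGrid T a p q (a - 1) j = capTile p q j := by
  simp [capGrid]

theorem capGrid_above {i : ℤ} (h : i < a - 1) (j : ℤ) : capGrid T a p q i j = .blank := by
  rw [capGrid, if_neg (by omega), if_neg (by omega)]

theorem Good.capGrid (hT : Good n T) (ha : 1 ≤ a) (hpq : p < q)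
    (hcut : ∀ j, (T a j).conn .top = true ↔ j = p ∨ j = q) : Good n (capGrid T a p q) := by
  have hp := hT.support a p (ne_blank_of_conn ((hcut p).2 (Or.inl rfl)))
  have hq := hT.support a q (ne_blank_of_conn ((hcut q).2 (Or.inr rfl)))
  refine ⟨fun i j h => ?_, fun i j => ?_, fun i j => ?_⟩
  · rcases lt_trichotomy i (a - 1) with hi | rfl | hi
    · exact absurd (capGrid_above hi j) h
    · rw [capGrid_cap] at h
      unfold capTile at h
      split_ifs at h <;> first | omega | exact absurd rfl h
    · rw [capGrid_of_le (by omega)] at h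
      exact hT.support i j h
  · rcases lt_trichotomy i (a - 1) with hi | rfl | hi
    · rw [capGrid_above hi, capGrid_above hi]; rfl
    · rw [capGrid_cap, capGrid_cap, (capTile_conn hpq j).2.1, (capTile_conn hpq (j + 1)).1]
      exact decide_eq_decide.2 (by omega)
    · rw [capGrid_of_le (by omega), capGrid_of_le (by omega)]; exact hT.horiz i j
  · rcases lt_trichotomy i (a - 1) with hi | rfl | hi
    · rw [capGrid_above hi]
      rcases eq_or_ne (i + 1) (a - 1) with h | h
      · rw [h, capGrid_cap, (capTile_conn hpq j).2.2.1]; rfl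
      · rw [capGrid_above (by omega)]; rfl
    · rw [capGrid_cap, (capTile_conn hpq j).2.2.2, sub_add_cancel, capGrid_of_le le_rfl,
        Bool.eq_iff_iff, hcut, decide_eq_true_iff]
    · rw [capGrid_of_le (by omega), capGrid_of_le (by omega)]; exact hT.vert i j

theorem mem_capGrid_below {v : E3} (hv : v 1 < 1 / 2 - a) :
    v ∈ gridLink (capGrid T a p q) ↔ v ∈ gridLink T := by
  have key : ∀ T' : ℤ → ℤ → Tile, v ∈ gridLink T' ↔ ∃ i j, a ≤ i ∧
      v - pt j (-i) 0 ∈ (T' i j).curve := by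
    intro T'
    constructor
    · rintro ⟨i, j, -, h⟩
      have hf := (framed_curves T' i j _ h).2.1.1
      simp only [PiLp.sub_apply, pt_one] at hf
      exact ⟨i, j, row_le_of_below hv (by linarith), h⟩
    · rintro ⟨i, j, -, h⟩
      exact ⟨i, j, trivial, h⟩
  rw [key, key]
  refine exists_congr fun i => exists_congr fun j => and_congr_right fun hi => ?_
  rw [capGrid_of_le hi]

/-- Above the cut, the modified grid depicts the flat cap over the two strands. -/
theorem mem_capGrid_above (hpq : p < q)
    (hcut : ∀ j, (T a j).conn .top = true ↔ j = p ∨ j = q) {v : E3} (hv : 1 / 2 - a ≤ v 1) :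
    v ∈ gridLink (capGrid T a p q) ↔ v ∈ cap p q (1 / 2 - a) := by
  have hpq' : (p : ℝ) + 1 ≤ q := by exact_mod_cast hpq
  change _ ↔ v 1 = 1 / 2 - a + min (1 / 2) (min (v 0 - p) (q - v 0)) ∧ p ≤ v 0 ∧ v 0 ≤ q ∧ v 2 = 0
  have hmid : ∀ j : ℤ, p < j → j < q → capTile p q j = .horizontal := by
    intro j h1 h2
    rw [capTile, if_neg (by omega), if_neg (by omega), if_pos ⟨h1, h2⟩]
  have hp : capTile p q p = .arcRightBottom := if_pos rfl
  have hq : capTile p q q = .arcLeftBottom := by rw [capTile, if_neg (by omega), if_pos rfl]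
  have hhor : ∀ u : E3, u ∈ Tile.horizontal.curve ↔
      -1 / 2 ≤ u 0 ∧ u 0 ≤ 1 / 2 ∧ u 1 = 0 ∧ u 2 = 0 := by
    intro u
    rw [Tile.curve_eq, Tile.edges, poly_cons, poly_nil, union_empty, mem_segment_iff]
    simp only [pt_zero, pt_one, pt_two, mul_zero, add_zero]
    constructor
    · rintro ⟨s, t, hs, ht, hst, h0, h1, h2⟩
      exact ⟨by linarith, by linarith, h1, h2⟩
    · rintro ⟨h0, h0', h1, h2⟩
      exact ⟨1 / 2 - u 0, 1 / 2 + u 0, by linarith, by linarith, by ring, by ring, h1, h2⟩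
  have hright := fun u => mem_arcs_rightBottom (t := .arcRightBottom) (Or.inl rfl) (p := u)
  have hleft := fun u => mem_arcs_leftBottom (t := .arcLeftBottom) (Or.inl rfl) (p := u)
  simp only [reduceCtorEq, false_and, or_false] at hright hleft
  constructor
  · rintro ⟨i, j, -, h⟩
    have hf := framed_curves _ i j _ h
    simp only [PiLp.sub_apply, pt_zero, pt_one, pt_two, sub_neg_eq_add, sub_zero] at hf
    obtain ⟨-, ⟨f3, f4⟩, -, -, f5, -⟩ := hf
    have hi := le_row_of_above hv f4
    change _ ∈ (KnotMosaic.capGrid T a p q i j).curve at h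
    rcases lt_trichotomy i (a - 1) with hi' | rfl | hi'
    · rw [capGrid_above hi', Tile.curve_blank] at h
      exact absurd h (notMem_empty _)
    · rw [capGrid_cap] at h
      unfold capTile at h
      split_ifs at h with h1 h2 h3
      · subst h1
        have := (hright _).1 h
        simp only [PiLp.sub_apply, pt_zero, pt_one, pt_two] at this
        push_cast at this
        obtain ⟨g0, g1, g2, g3⟩ := this
        refine ⟨?_, by linarith, by linarith, by linarith⟩
        rw [min_eq_right, min_eq_left]
        · linarith
        · linarith
        · exact (min_le_left _ _).trans (by linarith)
      · subst h2
        have := (hleft _).1 h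
        simp only [PiLp.sub_apply, pt_zero, pt_one, pt_two] at this
        push_cast at this
        obtain ⟨g0, g1, g2, g3⟩ := this
        refine ⟨?_, by linarith, by linarith, by linarith⟩
        rw [min_eq_right, min_eq_right]
        · linarith
        · linarith
        · exact (min_le_right _ _).trans (by linarith)
      · have := (hhor _).1 h
        simp only [PiLp.sub_apply, pt_zero, pt_one, pt_two] at this
        push_cast at this
        obtain ⟨g0, g1, g2, g3⟩ := this
        have h4 : (p : ℝ) + 1 ≤ j := by exact_mod_cast h3.1
        have h5 : (j : ℝ) + 1 ≤ q := by exact_mod_cast h3.2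
        refine ⟨?_, by linarith, by linarith, by linarith⟩
        rw [min_eq_left (le_min (by linarith) (by linarith))]
        linarith
      · rw [Tile.curve_blank] at h
        exact absurd h (notMem_empty _)
    · have : i = a := by omega
      subst this
      obtain ⟨g0, g2, g⟩ := f5 (by linarith)
      rw [capGrid_of_le le_rfl, hcut] at g
      rcases g with rfl | rfl
      · have e : v 0 = j := by linarith
        rw [e, sub_self, min_eq_left (by linarith : (0 : ℝ) ≤ q - j),
          min_eq_right (by norm_num)]
        exact ⟨by linarith, le_rfl, by linarith, g2⟩
      · have e : v 0 = j := by linarith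
        rw [e, sub_self, min_eq_right (by linarith : (0 : ℝ) ≤ j - p),
          min_eq_right (by norm_num)]
        exact ⟨by linarith, by linarith, le_rfl, g2⟩
  · rintro ⟨h1, h2, h3, h4⟩
    by_cases c1 : v 0 ≤ p + 1 / 2
    · refine ⟨a - 1, p, trivial, ?_⟩
      change _ ∈ (KnotMosaic.capGrid T a p q (a - 1) p).curve
      rw [capGrid_cap, hp, hright]
      rw [min_eq_right ((min_le_left _ _).trans (by linarith)), min_eq_left (by linarith)] at h1
      simp only [PiLp.sub_apply, pt_zero, pt_one, pt_two]
      push_cast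
      exact ⟨by linarith, by linarith, by linarith, by linarith⟩
    by_cases c2 : q - 1 / 2 ≤ v 0
    · refine ⟨a - 1, q, trivial, ?_⟩
      change _ ∈ (KnotMosaic.capGrid T a p q (a - 1) q).curve
      rw [capGrid_cap, hq, hleft]
      rw [min_eq_right ((min_le_right _ _).trans (by linarith)), min_eq_right (by linarith)] at h1
      simp only [PiLp.sub_apply, pt_zero, pt_one, pt_two]
      push_cast
      exact ⟨by linarith, by linarith, by linarith, by linarith⟩
    · push Not at c1 c2
      refine ⟨a - 1, ⌊v 0 + 1 / 2⌋, trivial, ?_⟩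
      have f1 := Int.floor_le (v 0 + 1 / 2)
      have f2 := Int.lt_floor_add_one (v 0 + 1 / 2)
      have g1 : p + 1 ≤ ⌊v 0 + 1 / 2⌋ := Int.le_floor.2 (by push_cast; linarith)
      have g2 : ⌊v 0 + 1 / 2⌋ < q := Int.floor_lt.2 (by linarith)
      change _ ∈ (KnotMosaic.capGrid T a p q (a - 1) _).curve
      rw [capGrid_cap, hmid _ (by omega) g2, hhor]
      rw [min_eq_left (le_min (by linarith) (by linarith))] at h1
      simp only [PiLp.sub_apply, pt_zero, pt_one, pt_two]
      push_cast
      exact ⟨by linarith, by linarith, by linarith, by linarith⟩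

/-- If the part of the link above a cut is an unknotted arc, it can be replaced by an arch. -/
theorem sim_capGrid (hT : Good n T) (ha : 1 ≤ a) (hpq : p < q)
    (hcut : ∀ j, (T a j).conn .top = true ↔ j = p ∨ j = q)
    (hU : IsUnknottedArc (halfSpace (1 / 2 - a)) (halfSpace (1 / 2 - a) ∩ lift (gridLink T))) :
    Sim T (capGrid T a p q) := by
  refine AmbientIsotopic.of_isUnknottedArc hU ?_ ?_ ?_
  · convert isUnknottedArc_cap (show (p : ℝ) < q by exact_mod_cast hpq) (1 / 2 - a) using 1
    ext x
    constructor
    · rintro ⟨hx, v, hv, rfl⟩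
      have hy := coe_mem_halfSpace.1 hx
      exact coe_mem_lift.2 ((mem_capGrid_above hpq hcut hy).1 hv)
    · rintro ⟨v, hv, rfl⟩
      have hy : 1 / 2 - a ≤ v 1 := by
        rw [hv.1]
        have : 0 ≤ min (1 / 2) (min (v 0 - p) (q - v 0)) :=
          le_min (by norm_num) (le_min (sub_nonneg.2 hv.2.1) (sub_nonneg.2 hv.2.2.1))
        linarith
      exact ⟨coe_mem_halfSpace.2 hy, coe_mem_lift.2 ((mem_capGrid_above hpq hcut hy).2 hv)⟩
  · rw [hT.frontier_inter, (hT.capGrid ha hpq hcut).frontier_inter]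
    simp only [capGrid_of_le le_rfl]
  · ext x
    rw [Set.mem_sdiff, Set.mem_sdiff, and_comm, and_comm (b := x ∉ _), ← mem_compl_iff,
      compl_halfSpace]
    refine and_congr_right fun hx => ?_
    obtain ⟨v, hv, rfl⟩ := hx
    rw [coe_mem_lift, coe_mem_lift, mem_capGrid_below hv]

theorem count_eq_columns (n : ℤ) (T : ℤ → ℤ → Tile) (a : ℤ) : count n T =
    ∑ j ∈ Finset.Ico 0 n, (∑ i ∈ (Finset.Ico 0 n).filter (· < a), nonblank (T i j) +
      ∑ i ∈ (Finset.Ico 0 n).filter (¬ · < a), nonblank (T i j)) := by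
  unfold count weight
  rw [Finset.sum_comm]
  refine Finset.sum_congr rfl fun j _ => ?_
  rw [Finset.sum_filter_add_sum_filter_not]

theorem one_le_nonblank {t : Tile} (h : t ≠ .blank) : 1 ≤ nonblank t := by
  rw [nonblank, if_neg h]

/-- Replacing the part above a cut by an arch saves a tile, provided that this part occupies at
least two rows. -/
theorem count_capGrid_lt (hT : Good n T) (ha : 2 ≤ a) (hpq : p < q)
    (hcut : ∀ j, (T a j).conn .top = true ↔ j = p ∨ j = q) {j₀ : ℤ}
    (h0 : (T 1 j₀).conn .top = true) : count n (capGrid T a p q) < count n T := by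
  have hp := hT.support a p (ne_blank_of_conn ((hcut p).2 (Or.inl rfl)))
  have hq := hT.support a q (ne_blank_of_conn ((hcut q).2 (Or.inr rfl)))
  have h1 := hT.support 1 j₀ (ne_blank_of_conn h0)
  have hb0 : T 0 j₀ ≠ .blank := by
    have : (T 0 j₀).conn .bottom = true := by rw [hT.vert]; exact h0
    exact ne_blank_of_conn this
  -- Every column between `p` and `q` is occupied above the cut, by parity.
  have hocc : ∀ j, p ≤ j → j ≤ q → ∃ i, 0 ≤ i ∧ i < a ∧ T i j ≠ .blank := by
    have key : ∀ c, p < c → c ≤ q → ∃ i, 0 ≤ i ∧ i < a ∧ (T i c).conn .left = true := by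
      intro c hc1 hc2
      obtain ⟨c, rfl⟩ := Int.eq_ofNat_of_zero_le (show 0 ≤ c by omega)
      obtain ⟨a, rfl⟩ := Int.eq_ofNat_of_zero_le (show 0 ≤ a by omega)
      have hs := hT.sum_left_eq_sum_top a c
      rw [Finset.sum_eq_single_of_mem (a := p.toNat) (s := Finset.range c)] at hs
      · rw [show ((p.toNat : ℕ) : ℤ) = p by omega, bit, if_pos ((hcut p).2 (Or.inl rfl))] at hs
        obtain ⟨i, hi, hne⟩ := Finset.exists_ne_zero_of_sum_ne_zero (hs.trans_ne one_ne_zero)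
        refine ⟨i, by omega, by simpa using hi, ?_⟩
        by_contra h
        exact hne (if_neg h)
      · simp only [Finset.mem_range]; omega
      · intro j hj hne
        simp only [Finset.mem_range] at hj
        refine if_neg fun h => ?_
        have := (hcut j).1 h
        omega
    intro j hj1 hj2
    rcases eq_or_lt_of_le hj1 with rfl | hj
    · obtain ⟨i, hi1, hi2, hi⟩ := key (p + 1) (by omega) (by omega)
      rw [hT.left, add_sub_cancel_right] at hi
      exact ⟨i, hi1, hi2, ne_blank_of_conn hi⟩
    · obtain ⟨i, hi1, hi2, hi⟩ := key j hj hj2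
      exact ⟨i, hi1, hi2, ne_blank_of_conn hi⟩
  have hlow : ∀ j, ∑ i ∈ (Finset.Ico 0 n).filter (¬ · < a), nonblank (capGrid T a p q i j) =
      ∑ i ∈ (Finset.Ico 0 n).filter (¬ · < a), nonblank (T i j) := by
    intro j
    refine Finset.sum_congr rfl fun i hi => ?_
    rw [capGrid_of_le (not_lt.1 (Finset.mem_filter.1 hi).2)]
  have hup : ∀ j, ∑ i ∈ (Finset.Ico 0 n).filter (· < a), nonblank (capGrid T a p q i j) =
      nonblank (capTile p q j) := by
    intro j
    rw [Finset.sum_eq_single_of_mem (a - 1), capGrid_cap]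
    · simp only [Finset.mem_filter, Finset.mem_Ico]; omega
    · intro i hi hne
      simp only [Finset.mem_filter, Finset.mem_Ico] at hi
      rw [capGrid_above (by omega)]; rfl
  rw [count_eq_columns n _ a, count_eq_columns n T a]
  refine Finset.sum_lt_sum (fun j _ => ?_) ⟨j₀, by simp only [Finset.mem_Ico]; omega, ?_⟩
  · rw [hlow, hup]
    refine add_le_add ?_ le_rfl
    by_cases hj : p ≤ j ∧ j ≤ q
    · obtain ⟨i, hi0, hia, hi⟩ := hocc j hj.1 hj.2
      refine (nonblank_le_one _).trans ((one_le_nonblank hi).trans ?_)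
      refine Finset.single_le_sum (f := fun i => nonblank (T i j))
        (fun i _ => nonblank_nonneg _) ?_
      simp only [Finset.mem_filter, Finset.mem_Ico]; omega
    · have : capTile p q j = .blank := by
        rw [capTile, if_neg (by omega), if_neg (by omega), if_neg (by omega)]
      rw [this]
      exact Finset.sum_nonneg fun i _ => nonblank_nonneg _
  · rw [hlow, hup]
    refine add_lt_add_of_lt_of_le ?_ le_rfl
    have h2 : ∑ i ∈ ({0, 1} : Finset ℤ), nonblank (T i j₀) ≤
        ∑ i ∈ (Finset.Ico 0 n).filter (· < a), nonblank (T i j₀) := by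
      refine Finset.sum_le_sum_of_subset_of_nonneg (fun i hi => ?_) fun i _ _ => nonblank_nonneg _
      simp only [Finset.mem_insert, Finset.mem_singleton] at hi
      simp only [Finset.mem_filter, Finset.mem_Ico]; omega
    rw [Finset.sum_pair zero_ne_one] at h2
    have h3 := one_le_nonblank hb0
    have h4 := one_le_nonblank (ne_blank_of_conn h0)
    have h5 := nonblank_le_one (capTile p q j₀)
    linarith

/-- In a tight grid the part above a cut with two strands is not an unknotted arc, unless the cut
is below the first row: otherwise it could be replaced by an arch. -/
theorem Tight.not_isUnknottedArc (hT : Tight n T) (ha : 2 ≤ a) (hpq : p < q)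
    (hcut : ∀ j, (T a j).conn .top = true ↔ j = p ∨ j = q) {j₀ : ℤ}
    (h0 : (T 1 j₀).conn .top = true) :
    ¬ IsUnknottedArc (halfSpace (1 / 2 - a)) (halfSpace (1 / 2 - a) ∩ lift (gridLink T)) :=
  fun hU => (count_capGrid_lt hT.good ha hpq hcut h0).not_ge
    (hT.minimal _ (hT.good.capGrid (by omega) hpq hcut)
      (sim_capGrid hT.good (by omega) hpq hcut hU))

end Cap

/-- The reflection `y ↦ -m - y` in the second coordinate. -/
noncomputable def reflectY (m : ℝ) : E3 ≃ᵢ E3 := (reflectD.trans (reflectX m)).trans reflectD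

theorem reflectY_apply (m : ℝ) (p : E3) : reflectY m p = pt (p 0) (-m - p 1) (p 2) := by
  change reflectD (reflectX m (reflectD p)) = _
  refine ext_pt ?_ ?_ ?_ <;> simp [reflectD_apply, reflectX_apply]
  ring

theorem gridLink_flipY (n : ℤ) (T : ℤ → ℤ → Tile) :
    gridLink (flipY n T) = reflectY (n - 1) '' gridLink T := by
  rw [flipY, gridLink_transpose, gridLink_mirror, gridLink_transpose, ← image_comp, ← image_comp]
  rfl

theorem flipY_conn_top (n : ℤ) (T : ℤ → ℤ → Tile) (i j : ℤ) :
    (flipY n T i j).conn .top = (T (n - 1 - i) j).conn .bottom := by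
  simp only [flipY, flipD, flipX, Tile.transpose_conn, Tile.mirror_conn]

/-- A tight grid that depicts a prime knot has at least four strands between any two consecutive
rows, except for the first two and the last two rows. -/
theorem Tight.four_le_card_cut {n : ℤ} {T : ℤ → ℤ → Tile} (hT : Tight n T)
    (hconn : IsPreconnected (gridLink T)) (hK : SplitsTrivially (lift (gridLink T)))
    (hocc : ∀ i, 0 ≤ i → i < n → ∃ j, T i j ≠ .blank) {a : ℤ} (ha : 2 ≤ a) (han : a + 2 ≤ n) :
    4 ≤ (cut n T a).card := by
  have hne : ∀ b, 1 ≤ b → b < n → ∃ k, (T b k).conn .top = true := by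
    intro b hb hbn
    obtain ⟨j, hj⟩ := hocc 0 le_rfl (by omega)
    obtain ⟨j', hj'⟩ := hocc b (by omega) hbn
    exact hT.good.exists_top_of_isPreconnected hconn (by omega) le_rfl hj hj'
  obtain ⟨k, hk⟩ := hne a (by omega) (by omega)
  have h0 : (cut n T a).card ≠ 0 := Finset.card_ne_zero_of_mem (hT.good.mem_cut_iff.2 hk)
  have h2 : (cut n T a).card ≠ 2 := by
    intro h
    obtain ⟨x, y, hxy, hcut⟩ := Finset.card_eq_two.1 h
    obtain ⟨p, q, hpq, hcut⟩ : ∃ p q, p < q ∧ cut n T a = {p, q} := by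
      rcases lt_or_gt_of_ne hxy with h | h
      · exact ⟨x, y, h, hcut⟩
      · exact ⟨y, x, h, by rw [hcut, Finset.pair_comm]⟩
    have hcut' : ∀ j, (T a j).conn .top = true ↔ j = p ∨ j = q := by
      intro j
      rw [← hT.good.mem_cut_iff, hcut]
      simp
    obtain ⟨j₀, hj₀⟩ := hne 1 le_rfl (by omega)
    obtain ⟨j₁, hj₁⟩ := hne (n - 1) (by omega) (by omega)
    rcases hT.good.isUnknottedArc_of_pair hpq hcut' hK with hU | hU
    · exact hT.not_isUnknottedArc ha hpq hcut' hj₀ hU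
    · have hb : ∀ i j, (flipY n T i j).conn .top = (T (n - i) j).conn .top := by
        intro i j
        rw [flipY_conn_top, hT.good.vert, show n - 1 - i + 1 = n - i by ring]
      refine hT.mirrorV.not_isUnknottedArc (a := n - a) (by omega) hpq (fun j => ?_) (j₀ := j₁) ?_
          ?_
      · rw [hb, sub_sub_cancel]; exact hcut' j
      · rw [hb]; exact hj₁
      · have himg := hU.image (reflectY (n - 1)).toHomeomorph.onePointCongr
        rw [image_inter (Homeomorph.injective _), ← lift_image, IsometryEquiv.coe_toHomeomorph,
          ← gridLink_flipY] at himg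
        have hB : (reflectY (n - 1)).toHomeomorph.onePointCongr '' closure (halfSpace (1 / 2 -
            a))ᶜ =
            halfSpace (1 / 2 - (n - a : ℤ)) := by
          rw [closure_compl_halfSpace, image_union, ← lift_image, image_singleton, halfSpace]
          congr 1
          congr 1
          refine image_eq_of_mem_iff (Homeomorph.toEquiv _) fun v => ?_
          change 1 / 2 - ((n - a : ℤ) : ℝ) ≤ (reflectY (n - 1) v) 1 ↔ v 1 ≤ 1 / 2 - a
          rw [reflectY_apply, pt_one]
          push_cast
          constructor <;> intro h <;> linarith
        rwa [hB] at himg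
  have := hT.good.even_card_cut (a := a) (by omega) (by omega)
  obtain ⟨m, hm⟩ := this
  omega

/-! ### Deleting a row of vertical segments -/

/-- The grid obtained by deleting row `r` and moving up the rows below. -/
def deleteRow (T : ℤ → ℤ → Tile) (r : ℤ) : ℤ → ℤ → Tile := fun i j =>
  if i < r then T i j else T (i + 1) j

section Delete

variable {n : ℤ} {T : ℤ → ℤ → Tile} {r : ℤ}

theorem deleteRow_above {i : ℤ} (h : i < r) (j : ℤ) : deleteRow T r i j = T i j := if_pos h

theorem deleteRow_below {i : ℤ} (h : r ≤ i) (j : ℤ) : deleteRow T r i j = T (i + 1) j :=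
  if_neg (not_lt.2 h)

theorem Good.deleteRow (hT : Good n T) (hr : 0 ≤ r)
    (hrow : ∀ j, T r j = .vertical ∨ T r j = .blank) : Good n (deleteRow T r) := by
  have hconn : ∀ j, (T r j).conn .top = (T r j).conn .bottom := by
    intro j
    rcases hrow j with h | h <;> rw [h] <;> rfl
  refine ⟨fun i j h => ?_, fun i j => ?_, fun i j => ?_⟩
  · rcases lt_or_ge i r with hi | hi
    · rw [deleteRow_above hi] at h
      exact hT.support i j h
    · rw [deleteRow_below hi] at h
      have := hT.support _ j h
      omega
  · rcases lt_or_ge i r with hi | hi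
    · rw [deleteRow_above hi, deleteRow_above hi]; exact hT.horiz i j
    · rw [deleteRow_below hi, deleteRow_below hi]; exact hT.horiz _ j
  · rcases lt_trichotomy (i + 1) r with hi | hi | hi
    · rw [deleteRow_above (by omega), deleteRow_above hi]; exact hT.vert i j
    · rw [deleteRow_above (by omega), deleteRow_below hi.ge, hT.vert, hi, hconn, hT.vert]
    · rw [deleteRow_below (by omega), deleteRow_below hi.le]; exact hT.vert _ j

theorem sum_deleteRow (hT : Good n T) (hr : 0 ≤ r) (hrn : r < n) :
    count n (deleteRow T r) + ∑ j ∈ Finset.Ico 0 n, nonblank (T r j) = count n T := by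
  let f : ℤ → ℤ := fun i => ∑ j ∈ Finset.Ico 0 n, nonblank (T i j)
  have h1 : count n T = ∑ i ∈ (Finset.Ico 0 n).erase r, f i + f r :=
    (Finset.sum_erase_add _ f (Finset.mem_Ico.2 ⟨hr, hrn⟩)).symm
  have h2 : count n (deleteRow T r) = ∑ i ∈ (Finset.Ico 0 n).erase (n - 1),
      ∑ j ∈ Finset.Ico 0 n, nonblank (deleteRow T r i j) := by
    symm
    refine Finset.sum_erase (f := fun i => ∑ j ∈ Finset.Ico 0 n, nonblank (deleteRow T r i j)) _
      (Finset.sum_eq_zero fun j _ => ?_)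
    rw [deleteRow_below (by omega), hT.eq_blank (by omega)]
    rfl
  rw [h1, h2]
  congr 1
  refine Finset.sum_nbij' (fun i => if i < r then i else i + 1) (fun i => if i < r then i else i -
      1)
    ?_ ?_ ?_ ?_ ?_ <;> intro i <;> simp only [Finset.mem_erase, Finset.mem_Ico] <;> intro hi
  · split_ifs <;> omega
  · split_ifs <;> omega
  · split_ifs <;> omega
  · split_ifs <;> omega
  · refine Finset.sum_congr rfl fun j _ => ?_
    unfold deleteRow
    split_ifs <;> rfl

/-- The descending segment of a tile can be bent at a point above the midpoint of the lower edge. -/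
theorem locEq_bend {A : E3} (h1 : A 1 = 0) (h0 : |A 0| ≤ 1 / 2) {l : List (E3 × E3)}
    (hl : ∀ e ∈ l, 0 ≤ e.1 1 ∧ 0 ≤ e.2 1) :
    LocEq (box (-1 / 2) (1 / 2) (-1 / 2) (1 / 2))
      {q | q ∈ [pt (-1 / 2) 0 0, pt (1 / 2) 0 0, pt 0 (1 / 2) 0, pt 0 (-1 / 2) 0]}
      (poly ((A, pt 0 (-1 / 2) 0) :: l))
      (poly ((A, pt 0 (-1 / 6) 0) :: (pt 0 (-1 / 6) 0, pt 0 (-1 / 2) 0) :: l)) := by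
  obtain ⟨ha, hb⟩ := abs_le.1 h0
  by_cases hA : A 0 = 0 ∧ A 2 = 0
  · refine LocEq.split _ _ _ l (1 / 3) (by norm_num) (by norm_num) ?_ ?_ ?_
    · rw [hA.1]; norm_num
    · rw [h1]; norm_num
    · rw [hA.2]; norm_num
  have key : ∀ i j : Fin 3, ((pt 0 (-1 / 2) 0 : E3) i - A i) * ((pt 0 (-1 / 6) 0 : E3) j - A j) -
      ((pt 0 (-1 / 2) 0 : E3) j - A j) * ((pt 0 (-1 / 6) 0 : E3) i - A i) ≠ 0 →
      LocEq (box (-1 / 2) (1 / 2) (-1 / 2) (1 / 2))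
        {q | q ∈ [pt (-1 / 2) 0 0, pt (1 / 2) 0 0, pt 0 (1 / 2) 0, pt 0 (-1 / 2) 0]}
        (poly ((A, pt 0 (-1 / 2) 0) :: l))
        (poly ((A, pt 0 (-1 / 6) 0) :: (pt 0 (-1 / 6) 0, pt 0 (-1 / 2) 0) :: l)) := by
    intro i j hD
    -- The only point of the triangle in the upper half of the tile is `A`.
    have hup : ∀ e : E3 × E3, 0 ≤ e.1 1 → 0 ≤ e.2 1 →
        Clear A (pt 0 (-1 / 2) 0) (pt 0 (-1 / 6) 0) e := by
      intro e he he' α β γ s t hα hβ hγ hs ht hsum hst _ hy _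
      rw [h1, pt_one, pt_one] at hy
      have : 0 ≤ s * e.1 1 + t * e.2 1 := by positivity
      exact ⟨by linarith, Or.inr (by linarith)⟩
    refine LocEq.tri _ _ _ l i j hD ⟨by linarith, hb, by rw [h1]; norm_num, by rw [h1]; norm_num⟩
      ⟨by norm_num, by norm_num, by norm_num, by norm_num⟩
      ⟨by norm_num, by norm_num, by norm_num, by norm_num⟩ ?_ fun e he => hup e (hl e he).1 (hl e
          he).2
    intro q hq
    simp only [List.mem_cons, List.not_mem_nil, or_false] at hq
    rcases hq with rfl | rfl | rfl | rfl
    · exact hup _ le_rfl le_rfl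
    · exact hup _ le_rfl le_rfl
    · exact hup _ (by norm_num) (by norm_num)
    · intro α β γ s t hα hβ hγ hs ht hsum hst _ hy _
      simp only [h1, pt_one] at hy
      exact ⟨by linarith, Or.inl (by linarith)⟩
  by_cases hA0 : A 0 = 0
  · refine key 2 1 ?_
    have : A 2 ≠ 0 := fun h => hA ⟨hA0, h⟩
    simp only [pt_one, pt_two, h1]
    intro h
    exact this (by linarith)
  · refine key 0 1 ?_
    simp only [pt_one, pt_zero, h1]
    intro h
    exact hA0 (by linarith)

theorem framed_bend {t : Tile} (hc : t.conn .bottom = true) {A : E3} (h1 : A 1 = 0)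
    (h0 : |A 0| ≤ 1 / 2) {l : List (E3 × E3)}
    (hl : t.curve = poly ((A, pt 0 (-1 / 2) 0) :: l)) :
    Framed (poly ((A, pt 0 (-1 / 6) 0) :: (pt 0 (-1 / 6) 0, pt 0 (-1 / 2) 0) :: l)) t.conn := by
  obtain ⟨ha, hb⟩ := abs_le.1 h0
  intro p hp
  rw [poly_cons, poly_cons] at hp
  have hA := t.framed A (by rw [hl, poly_cons]; exact Or.inl (left_mem_segment ℝ _ _))
  rcases hp with hp | hp | hp
  · obtain ⟨s, u, hs, hu, hsu, p0, p1, p2⟩ := mem_segment_iff.1 hp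
    simp only [h1, pt_zero, pt_one, pt_two, mul_zero, add_zero, zero_add] at p0 p1 p2
    have hx : s * A 0 ≤ s * (1 / 2) := mul_le_mul_of_nonneg_left hb hs
    have hx' : s * (-(1 / 2)) ≤ s * A 0 := mul_le_mul_of_nonneg_left ha hs
    have hend : s = 1 → p 0 = A 0 ∧ p 1 = 0 ∧ p 2 = A 2 := by
      rintro rfl
      exact ⟨by linarith, by linarith, by linarith⟩
    refine ⟨⟨by linarith, by linarith⟩, ⟨by linarith, by linarith⟩, fun h => ?_, fun h => ?_,
      fun h => by linarith, fun h => by linarith⟩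
    · obtain ⟨e0, e1, e2⟩ := hend (by linarith)
      obtain ⟨-, g2, g⟩ := hA.2.2.1 (by rw [← e0, h])
      exact ⟨e1, e2.trans g2, g⟩
    · obtain ⟨e0, e1, e2⟩ := hend (by linarith)
      obtain ⟨-, g2, g⟩ := hA.2.2.2.1 (by rw [← e0, h])
      exact ⟨e1, e2.trans g2, g⟩
  · obtain ⟨s, u, hs, hu, hsu, p0, p1, p2⟩ := mem_segment_iff.1 hp
    simp only [pt_zero, pt_one, pt_two, mul_zero, add_zero] at p0 p1 p2
    exact ⟨⟨by linarith, by linarith⟩, ⟨by linarith, by linarith⟩, fun h => by linarith,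
      fun h => by linarith, fun h => by linarith, fun h => ⟨p0, p2, hc⟩⟩
  · exact t.framed p (by rw [hl, poly_cons]; exact Or.inr hp)

/-- The piece of link on a tile whose descending segment is bent. -/
noncomputable def bend (A : ℤ → E3) (l : ℤ → List (E3 × E3)) (j : ℤ) : Set E3 :=
  poly ((A j, pt 0 (-1 / 6) 0) :: (pt 0 (-1 / 6) 0, pt 0 (-1 / 2) 0) :: l j)

/-- The pieces of link of a grid, with the descending segments in row `s` and the columns from `k`
on bent. -/
noncomputable def bentCurves (T : ℤ → ℤ → Tile) (s : ℤ) (A : ℤ → E3) (l : ℤ → List (E3 × E3))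
    (k : ℤ) : ℤ → ℤ → Set E3 := fun i j =>
  if i = s ∧ k ≤ j ∧ (T i j).conn .bottom = true then bend A l j else (T i j).curve

/-- The descending strands in a row can be bent, one column after the other. -/
theorem isoE_bentCurves (hT : Good n T) (hn : 0 ≤ n) {s : ℤ} {A : ℤ → E3}
    {l : ℤ → List (E3 × E3)}
    (hA : ∀ j, (T s j).conn .bottom = true → A j 1 = 0 ∧ |A j 0| ≤ 1 / 2 ∧
      (T s j).curve = poly ((A j, pt 0 (-1 / 2) 0) :: l j) ∧
      ∀ e ∈ l j, 0 ≤ e.1 1 ∧ 0 ≤ e.2 1) :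
    IsoE (gridLink T) (cells (bentCurves T s A l 0) univ) := by
  have hframed : ∀ k i j, Framed (bentCurves T s A l k i j) (T i j).conn := by
    intro k i j
    unfold bentCurves
    split_ifs with h
    · obtain ⟨rfl, -, hc⟩ := h
      obtain ⟨h1, h0, hl, -⟩ := hA j hc
      exact framed_bend hc h1 h0 hl
    · exact (T i j).framed
  have hcompact : ∀ k i j, IsCompact (bentCurves T s A l k i j) := by
    intro k i j
    unfold bentCurves
    split_ifs with h
    · exact isCompact_poly _
    · exact isCompact_curves T i j
  have hfin : ∀ k, {q : ℤ × ℤ | (bentCurves T s A l k q.1 q.2).Nonempty}.Finite := by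
    intro k
    refine ((finite_Ico 0 n).prod (finite_Ico 0 n)).subset ?_
    rintro ⟨i, j⟩ hq
    have hb : T i j ≠ .blank := by
      intro hb
      simp only [mem_ofPred_eq, bentCurves, hb, blank_conn, Bool.false_eq_true, and_false,
        if_false, Tile.curve_blank] at hq
      exact not_nonempty_empty hq
    have := hT.support i j hb
    exact ⟨⟨this.1, this.2.1⟩, this.2.2.1, this.2.2.2⟩
  have hsplit : ∀ X : ℤ → ℤ → Set E3, ∀ k, cells X univ =
      cells X (block s k 0 0)ᶜ ∪ tr (pt k (-s) 0) '' X s k := by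
    intro X k
    have : block s k 0 0 = {(s, k)} := by
      ext ⟨i, j⟩
      simp only [block, mem_ofPred_eq, mem_singleton_iff, Prod.mk.injEq]
      omega
    rw [← cells_singleton, ← this, ← cells_union, compl_union_self]
  have step : ∀ k, IsoE (cells (bentCurves T s A l (k + 1)) univ)
      (cells (bentCurves T s A l k) univ) := by
    intro k
    by_cases hc : (T s k).conn .bottom = true
    · obtain ⟨h1, h0, hl, hle⟩ := hA k hc
      have hb : box (-1 / 2) (((0 : ℤ) : ℝ) + 1 / 2) (-((0 : ℤ) : ℝ) - 1 / 2) (1 / 2) =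
          box (-1 / 2) (1 / 2) (-1 / 2) (1 / 2) := by norm_num
      have := LocEq.block (hframed (k + 1)) (hcompact (k + 1)) (hfin (k + 1)) s k 0 0 le_rfl le_rfl
        (P := {q | q ∈ [pt (-1 / 2) 0 0, pt (1 / 2) 0 0, pt 0 (1 / 2) 0, pt 0 (-1 / 2) 0]})
        (fun p hp => ?_) (hb ▸ locEq_bend h1 h0 hle)
      · rw [hsplit _ k, hsplit (bentCurves T s A l k) k,
          cells_congr (X := bentCurves T s A l k) (X' := bentCurves T s A l (k + 1))]
        · convert this using 3
          · rw [bentCurves, if_neg (by omega), hl]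
          · rw [bentCurves, if_pos ⟨rfl, le_rfl, hc⟩]; rfl
        · intro i j hij
          have hne : ¬ (i = s ∧ j = k) := by
            rintro ⟨rfl, rfl⟩
            exact hij ⟨le_rfl, by omega, le_rfl, by omega⟩
          unfold bentCurves
          congr 1
          rw [eq_iff_iff]
          refine and_congr_right fun hi => and_congr_left fun _ => ?_
          omega
      · obtain ⟨p2, ⟨j, j0, j1, pj, h⟩ | ⟨i, i0, i1, pi, h⟩⟩ := hp
        · have hj : j = 0 := by omega
          subst hj
          simp only [mem_ofPred_eq, List.mem_cons, List.not_mem_nil, or_false]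
          rcases h with ⟨h, -⟩ | ⟨h, -⟩
          · exact Or.inr (Or.inr (Or.inl (ext_pt (by simpa using pj) h p2)))
          · exact Or.inr (Or.inr (Or.inr (ext_pt (by simpa using pj)
              (by rw [h, pt_one]; norm_num) p2)))
        · have hi : i = 0 := by omega
          subst hi
          simp only [mem_ofPred_eq, List.mem_cons, List.not_mem_nil, or_false]
          rcases h with ⟨h, -⟩ | ⟨h, -⟩
          · exact Or.inl (ext_pt h (by rw [pi]; simp) p2)
          · exact Or.inr (Or.inl (ext_pt (by rw [h, pt_zero]; norm_num) (by rw [pi]; simp) p2))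
    · refine IsoE.of_eq (cells_congr fun i j _ => ?_)
      unfold bentCurves
      congr 1
      rw [eq_iff_iff]
      refine and_congr_right fun hi => and_congr_left fun hc' => ?_
      have : j ≠ k := by
        rintro rfl
        rw [hi] at hc'
        exact hc hc'
      omega
  have hall : ∀ m : ℕ, IsoE (cells (bentCurves T s A l m) univ)
      (cells (bentCurves T s A l 0) univ) := by
    intro m
    induction m with
    | zero => exact IsoE.refl _
    | succ m ih =>
      have := step m
      exact_mod_cast this.trans ih
  obtain ⟨m, rfl⟩ := Int.eq_ofNat_of_zero_le hn
  refine (IsoE.of_eq (cells_congr fun i j _ => ?_)).trans (hall m)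
  rw [bentCurves, if_neg]
  · rfl
  · rintro ⟨-, h1, h2⟩
    have := hT.support i j (ne_blank_of_conn h2)
    omega

/-- The amount by which the points at height `y` move up when the strip of height `3 / 2` below the
height `c` is compressed to a third of its height. -/
noncomputable def compress (c y : ℝ) : ℝ := max 0 (min 1 (2 / 3 * (c - y)))

theorem compress_of_ge {c y : ℝ} (h : c ≤ y) : compress c y = 0 :=
  max_eq_left ((min_le_right _ _).trans (by linarith))

theorem compress_of_le {c y : ℝ} (h : y ≤ c - 3 / 2) : compress c y = 1 := by
  rw [compress, min_eq_left (by linarith), max_eq_right zero_le_one]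

theorem compress_mid {c y : ℝ} (h : c - 3 / 2 ≤ y) (h' : y ≤ c) :
    compress c y = 2 / 3 * (c - y) := by
  rw [compress, min_eq_right (by linarith), max_eq_right (by linarith)]

/-- The amount by which the points at height `y` move up in the inverse of the compression, up to
sign. -/
noncomputable def expand (c y : ℝ) : ℝ := max 0 (min 1 (2 * (c - y)))

theorem expand_of_ge {c y : ℝ} (h : c ≤ y) : expand c y = 0 :=
  max_eq_left ((min_le_right _ _).trans (by linarith))

theorem expand_of_le {c y : ℝ} (h : y ≤ c - 1 / 2) : expand c y = 1 := by
  rw [expand, min_eq_left (by linarith), max_eq_right zero_le_one]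

theorem expand_mid {c y : ℝ} (h : c - 1 / 2 ≤ y) (h' : y ≤ c) :
    expand c y = 2 * (c - y) := by
  rw [expand, min_eq_right (by linarith), max_eq_right (by linarith)]

theorem expand_compress (c y : ℝ) : expand c (y + compress c y) = compress c y := by
  rcases le_total c y with h | h
  · rw [compress_of_ge h, add_zero, expand_of_ge h]
  rcases le_total (c - 3 / 2) y with h' | h'
  · rw [compress_mid h' h, expand_mid (by linarith) (by linarith)]; ring
  · rw [compress_of_le h', expand_of_le (by linarith)]

theorem compress_expand (c y : ℝ) : compress c (y - expand c y) = expand c y := by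
  rcases le_total c y with h | h
  · rw [expand_of_ge h, sub_zero, compress_of_ge h]
  rcases le_total (c - 1 / 2) y with h' | h'
  · rw [expand_mid h' h, compress_mid (by linarith) (by linarith)]; ring
  · rw [expand_of_le h', compress_of_le (by linarith)]

theorem mem_vertical {p : E3} :
    p ∈ Tile.vertical.curve ↔ p 0 = 0 ∧ -1 / 2 ≤ p 1 ∧ p 1 ≤ 1 / 2 ∧ p 2 = 0 := by
  rw [Tile.curve_eq, Tile.edges, poly_cons, poly_nil, union_empty, mem_segment_iff]
  simp only [pt_zero, pt_one, pt_two, mul_zero, add_zero]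
  constructor
  · rintro ⟨s, t, hs, ht, hst, h0, h1, h2⟩
    exact ⟨h0, by linarith, by linarith, h2⟩
  · rintro ⟨h0, h1, h1', h2⟩
    exact ⟨1 / 2 + p 1, 1 / 2 - p 1, by linarith, by linarith, by ring, h0, by ring, h2⟩

/-- Compressing the strip that consists of row `r` and of the lower half of row `r - 1` to a third
of its height carries the link to that of the grid without row `r`, except that the strands which
descend from row `r - 1` become bent. -/
theorem mem_compress_iff (hT : Good n T) (hrow : ∀ j, T r j = .vertical ∨ T r j = .blank)
    {A : ℤ → E3} {l : ℤ → List (E3 × E3)}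
    (hA : ∀ j, (T (r - 1) j).conn .bottom = true → A j 1 = 0 ∧ |A j 0| ≤ 1 / 2 ∧
      (T (r - 1) j).curve = poly ((A j, pt 0 (-1 / 2) 0) :: l j) ∧
      ∀ e ∈ l j, 0 ≤ e.1 1 ∧ 0 ≤ e.2 1) (v : E3) :
    v + compress (1 - r) (v 1) • pt 0 1 0 ∈ cells (bentCurves (deleteRow T r) (r - 1) A l 0) univ ↔
      v ∈ gridLink T := by
  set w := v + compress (1 - r) (v 1) • pt 0 1 0 with hw
  have w0 : w 0 = v 0 := by simp [hw]
  have w1 : w 1 = v 1 + compress (1 - r) (v 1) := by simp [hw]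
  have w2 : w 2 = v 2 := by simp [hw]
  have hvr : ∀ j, (T (r - 1) j).conn .bottom = true ↔ T r j = .vertical := by
    intro j
    rw [hT.vert, sub_add_cancel]
    rcases hrow j with h | h <;> rw [h] <;> simp [Tile.conn, Tile.strands]
  have hj0 : ∀ j, (T (r - 1) j).conn .bottom = true → 0 ≤ j := fun j h =>
    (hT.support _ j (ne_blank_of_conn h)).2.2.1
  have hlow : ∀ i j : ℤ, v - pt j (-i) 0 ∈ (T i j).curve → v 1 ≤ 1 / 2 - i ∧ -1 / 2 - i ≤ v 1 := by
    intro i j h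
    have := (T i j).framed _ h
    simp only [PiLp.sub_apply, pt_one] at this
    exact ⟨by linarith [this.2.1.2], by linarith [this.2.1.1]⟩
  constructor
  · rintro ⟨i, j, -, h⟩
    have hwv : ∀ i j : ℤ, v 1 = w 1 → w - pt j (-i) 0 = v - pt j (-i) 0 := by
      intro i j h
      have : w = v := ext_pt w0 h.symm w2
      rw [this]
    rcases lt_trichotomy i (r - 1) with hi | rfl | hi
    · rw [bentCurves, if_neg (by omega), deleteRow_above (by omega)] at h
      have hy := ((T i j).framed _ h).2.1.1
      simp only [PiLp.sub_apply, pt_one] at hy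
      have hi' : (i : ℝ) + 2 ≤ r := by exact_mod_cast (by omega : i + 2 ≤ r)
      have hc : compress (1 - r) (v 1) = 0 := by
        rw [← expand_compress, ← w1]
        exact expand_of_ge (by linarith)
      rw [hc, add_zero] at w1
      rw [hwv i j w1.symm] at h
      exact ⟨i, j, trivial, h⟩
    · rw [bentCurves, deleteRow_above (by omega)] at h
      have hupper : w - pt j (-(r - 1 : ℤ)) 0 ∈ (T (r - 1) j).curve →
          0 ≤ (w - pt j (-(r - 1 : ℤ)) 0) 1 → v ∈ gridLink T := by
        intro h hy
        simp only [PiLp.sub_apply, pt_one] at hy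
        push_cast at hy
        have hc : compress (1 - r) (v 1) = 0 := by
          rw [← expand_compress, ← w1]
          exact expand_of_ge (by linarith)
        rw [hc, add_zero] at w1
        rw [hwv _ j w1.symm] at h
        exact ⟨_, j, trivial, h⟩
      by_cases hc : (T (r - 1) j).conn .bottom = true
      · rw [if_pos ⟨rfl, hj0 j hc, hc⟩, bend, poly_cons, poly_cons] at h
        obtain ⟨a1, a0, hl, hle⟩ := hA j hc
        rcases h with h | h | h
        · obtain ⟨s, t, hs, ht, hst, h0, h1, h2⟩ := mem_segment_iff.1 h
          simp only [PiLp.sub_apply, pt_zero, pt_one, pt_two, a1, mul_zero, add_zero, zero_add]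
            at h0 h1 h2
          push_cast at h1
          have hv : v 1 = 1 - r - t / 2 := by
            have : compress (1 - r) (v 1) = t / 3 := by
              rw [← expand_compress, ← w1, expand_mid (by linarith) (by linarith)]
              linarith
            linarith
          refine ⟨r - 1, j, trivial, ?_⟩
          change _ ∈ (T (r - 1) j).curve
          rw [hl, poly_cons]
          refine Or.inl (mem_segment_iff.2 ⟨s, t, hs, ht, hst, ?_, ?_, ?_⟩) <;>
            simp only [PiLp.sub_apply, pt_zero, pt_one, pt_two, a1] <;> push_cast <;> linarith
        · obtain ⟨s, t, hs, ht, hst, h0, h1, h2⟩ := mem_segment_iff.1 h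
          simp only [PiLp.sub_apply, pt_zero, pt_one, pt_two, mul_zero, add_zero] at h0 h1 h2
          push_cast at h1
          have hv : v 1 = 1 - r - s / 2 - 3 * t / 2 := by
            have : compress (1 - r) (v 1) = s / 3 + t := by
              rw [← expand_compress, ← w1, expand_mid (by linarith) (by linarith)]
              linarith
            linarith
          refine ⟨r, j, trivial, ?_⟩
          change _ ∈ (T r j).curve
          rw [(hvr j).1 hc, mem_vertical]
          simp only [PiLp.sub_apply, pt_zero, pt_one, pt_two]
          exact ⟨by linarith, by linarith, by linarith, by linarith⟩
        · exact hupper (by rw [hl, poly_cons]; exact Or.inr h) (poly_nonneg hle h)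
      · rw [if_neg (by tauto)] at h
        exact hupper h (Tile.curve_nonneg (by simpa using hc) h)
    · rw [bentCurves, if_neg (by omega), deleteRow_below (by omega)] at h
      have hy := ((T (i + 1) j).framed _ h).2.1.2
      simp only [PiLp.sub_apply, pt_one] at hy
      have hi' : (r : ℝ) ≤ i := by exact_mod_cast (by omega : r ≤ i)
      have hc : compress (1 - r) (v 1) = 1 := by
        rw [← expand_compress, ← w1]
        exact expand_of_le (by linarith)
      rw [hc] at w1
      refine ⟨i + 1, j, trivial, ?_⟩
      change _ ∈ (T (i + 1) j).curve
      convert h using 1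
      refine ext_pt ?_ ?_ ?_ <;> simp [w0, w1, w2]
      ring
  · rintro ⟨i, j, -, h⟩
    change _ ∈ (T i j).curve at h
    obtain ⟨y1, y2⟩ := hlow i j h
    have hwv : v 1 = w 1 → w = v := fun h => ext_pt w0 h.symm w2
    rcases lt_or_ge i (r - 1) with hi | hi
    · have hi' : (i : ℝ) + 2 ≤ r := by exact_mod_cast (by omega : i + 2 ≤ r)
      rw [compress_of_ge (by linarith), add_zero] at w1
      refine ⟨i, j, trivial, ?_⟩
      rw [bentCurves, if_neg (by omega), deleteRow_above (by omega), hwv w1.symm]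
      exact h
    rcases eq_or_lt_of_le hi with rfl | hi
    · have hupper : 0 ≤ (v - pt j (-(r - 1 : ℤ)) 0) 1 → w = v := by
        intro hy
        simp only [PiLp.sub_apply, pt_one] at hy
        push_cast at hy
        rw [compress_of_ge (by linarith), add_zero] at w1
        exact hwv w1.symm
      refine ⟨r - 1, j, trivial, ?_⟩
      rw [bentCurves, deleteRow_above (by omega)]
      by_cases hc : (T (r - 1) j).conn .bottom = true
      · obtain ⟨a1, a0, hl, hle⟩ := hA j hc
        rw [if_pos ⟨rfl, hj0 j hc, hc⟩, bend, poly_cons, poly_cons]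
        rw [hl, poly_cons] at h
        rcases h with h | h
        · obtain ⟨s, t, hs, ht, hst, h0, h1, h2⟩ := mem_segment_iff.1 h
          simp only [PiLp.sub_apply, pt_zero, pt_one, pt_two, a1, mul_zero, add_zero, zero_add]
            at h0 h1 h2
          push_cast at h1
          rw [compress_mid (by linarith) (by linarith)] at w1
          refine Or.inl (mem_segment_iff.2 ⟨s, t, hs, ht, hst, ?_, ?_, ?_⟩) <;>
            simp only [PiLp.sub_apply, pt_zero, pt_one, pt_two, a1, w0, w1, w2] <;> push_cast <;>
            linarith
        · refine Or.inr (Or.inr ?_)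
          rw [hupper (poly_nonneg hle h)]
          exact h
      · rw [if_neg (by tauto), hupper (Tile.curve_nonneg (by simpa using hc) h)]
        exact h
    rcases eq_or_lt_of_le (show r ≤ i by omega) with rfl | hi
    · have hv : T r j = .vertical := by
        rcases hrow j with hv | hb
        · exact hv
        · rw [hb, Tile.curve_blank] at h
          exact absurd h (notMem_empty _)
      have hc := (hvr j).2 hv
      refine ⟨r - 1, j, trivial, ?_⟩
      rw [bentCurves, deleteRow_above (by omega), if_pos ⟨rfl, hj0 j hc, hc⟩, bend, poly_cons,
        poly_cons]
      rw [hv, mem_vertical] at h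
      simp only [PiLp.sub_apply, pt_zero, pt_one, pt_two] at h
      obtain ⟨h0, h1, h1', h2⟩ := h
      rw [compress_mid (by linarith) (by linarith)] at w1
      refine Or.inr (Or.inl (mem_segment_iff.2 ⟨v 1 + r + 1 / 2, 1 / 2 - (v 1 + r), by linarith,
        by linarith, by ring, ?_, ?_, ?_⟩)) <;>
        simp only [PiLp.sub_apply, pt_zero, pt_one, pt_two, w0, w1, w2] <;> push_cast <;> linarith
    · have hi' : (r : ℝ) + 1 ≤ i := by exact_mod_cast (by omega : r + 1 ≤ i)
      rw [compress_of_le (by linarith)] at w1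
      refine ⟨i - 1, j, trivial, ?_⟩
      rw [bentCurves, if_neg (by omega), deleteRow_below (by omega), sub_add_cancel]
      convert h using 1
      refine ext_pt ?_ ?_ ?_ <;> simp [w0, w1, w2]
      ring

theorem sim_deleteRow (hT : Good n T) (hn : 0 ≤ n) (hr : 0 ≤ r)
    (hrow : ∀ j, T r j = .vertical ∨ T r j = .blank) : Sim T (deleteRow T r) := by
  have hex : ∀ j, ∃ (A : E3) (l : List (E3 × E3)), (T (r - 1) j).conn .bottom = true →
      A 1 = 0 ∧ |A 0| ≤ 1 / 2 ∧ (T (r - 1) j).curve = poly ((A, pt 0 (-1 / 2) 0) :: l) ∧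
      ∀ e ∈ l, 0 ≤ e.1 1 ∧ 0 ≤ e.2 1 := by
    intro j
    by_cases h : (T (r - 1) j).conn .bottom = true
    · obtain ⟨A, h1, h0, l, hl, hle⟩ := Tile.exists_foot h
      exact ⟨A, l, fun _ => ⟨h1, h0, hl, hle⟩⟩
    · exact ⟨0, [], fun h' => absurd h' h⟩
  choose A l hA using hex
  have h1 : IsoE (gridLink T) (cells (bentCurves (deleteRow T r) (r - 1) A l 0) univ) := by
    have h2 := isoE_of_shift (pt 0 1 0) (fun p => compress (1 - r) (p 1))
      (fun p => -expand (1 - r) (p 1)) (by unfold compress; fun_prop) (by unfold expand; fun_prop)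
      (fun p => by simp [expand_compress])
      (fun p => by
        have := compress_expand (1 - r) (p 1)
        simpa [sub_eq_add_neg] using this)
      1 (fun p => abs_le.2 ⟨by
        have : 0 ≤ compress (1 - r) (p 1) := le_max_left _ _
        linarith, max_le zero_le_one (min_le_left _ _)⟩) (gridLink T)
    refine h2.trans (IsoE.of_eq ?_)
    ext w
    constructor
    · rintro ⟨v, hv, rfl⟩
      exact (mem_compress_iff hT hrow hA v).2 hv
    · intro hw
      refine ⟨w - expand (1 - r) (w 1) • pt 0 1 0, ?_, ?_⟩
      · rw [← mem_compress_iff hT hrow hA]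
        simpa [compress_expand] using hw
      · simp [compress_expand]
  have h2 := isoE_bentCurves (hT.deleteRow hr hrow) hn (s := r - 1) (A := A) (l := l) fun j h => by
    rw [deleteRow_above (by omega)] at h ⊢
    exact hA j h
  exact (h1.trans h2.symm).sim

/-- A tight grid has no row that consists of vertical segments and blank tiles only, unless it is
blank. -/
theorem Tight.not_vertical_row (hT : Tight n T) {j₀ : ℤ} (h0 : T r j₀ = .vertical)
    (hrow : ∀ j, T r j = .vertical ∨ T r j = .blank) : False := by
  have hb := hT.good.support r j₀ (by rw [h0]; decide)
  have h1 := hT.minimal _ (hT.good.deleteRow hb.1 hrow)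
    (sim_deleteRow hT.good (by omega) hb.1 hrow)
  have h2 := sum_deleteRow hT.good hb.1 hb.2.1
  have h3 : nonblank (T r j₀) ≤ ∑ j ∈ Finset.Ico 0 n, nonblank (T r j) :=
    Finset.single_le_sum (f := fun j => nonblank (T r j)) (fun j _ => nonblank_nonneg _)
      (Finset.mem_Ico.2 hb.2.2)
  rw [h0] at h3
  have h4 : nonblank .vertical = 1 := rfl
  omega

end Delete

/-! ### Counting the tiles of a grid that depicts a prime knot -/

section Count

variable {n : ℤ} {T : ℤ → ℤ → Tile}

theorem sum_nonblank_eq_card (n : ℤ) (f : ℤ → Tile) :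
    ∑ j ∈ Finset.Ico 0 n, nonblank (f j) =
      ((Finset.Ico 0 n).filter fun j => f j ≠ .blank).card := by
  rw [Finset.card_filter]
  push_cast
  refine Finset.sum_congr rfl fun j _ => ?_
  simp only [nonblank, ne_eq, ite_not]

theorem Good.cut_subset (hT : Good n T) (i : ℤ) :
    cut n T i ⊆ (Finset.Ico 0 n).filter fun j => T i j ≠ .blank := fun j hj => by
  have h := ne_blank_of_conn (hT.mem_cut_iff.1 hj)
  exact Finset.mem_filter.2 ⟨Finset.mem_Ico.2 (hT.support i j h).2.2, h⟩

theorem Good.cut_succ_subset (hT : Good n T) (i : ℤ) :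
    cut n T (i + 1) ⊆ (Finset.Ico 0 n).filter fun j => T i j ≠ .blank := fun j hj => by
  have h := hT.mem_cut_iff.1 hj
  rw [← hT.vert] at h
  have h := ne_blank_of_conn h
  exact Finset.mem_filter.2 ⟨Finset.mem_Ico.2 (hT.support i j h).2.2, h⟩

theorem Good.card_cut_le (hT : Good n T) (i : ℤ) :
    ((cut n T i).card : ℤ) ≤ ∑ j ∈ Finset.Ico 0 n, nonblank (T i j) := by
  rw [sum_nonblank_eq_card]
  exact_mod_cast Finset.card_le_card (hT.cut_subset i)

theorem Good.card_cut_succ_le (hT : Good n T) (i : ℤ) :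
    ((cut n T (i + 1)).card : ℤ) ≤ ∑ j ∈ Finset.Ico 0 n, nonblank (T i j) := by
  rw [sum_nonblank_eq_card]
  exact_mod_cast Finset.card_le_card (hT.cut_succ_subset i)

theorem Tile.eq_vertical {t : Tile} (hl : t.conn .left = false) (ht : t.conn .top = true)
    (hb : t.conn .bottom = true) : t = .vertical := by
  revert hl ht hb
  cases t <;> decide

/-- A row in which four strands enter from above and four leave below has a fifth tile: otherwise
all its tiles would be vertical segments, and the row could be deleted. -/
theorem Tight.five_le_sum_row (hT : Tight n T) {i : ℤ} (h : 4 ≤ (cut n T i).card)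
    (h' : 4 ≤ (cut n T (i + 1)).card) : 5 ≤ ∑ j ∈ Finset.Ico 0 n, nonblank (T i j) := by
  rw [sum_nonblank_eq_card]
  by_contra! hcon
  have hc : ((Finset.Ico 0 n).filter fun j => T i j ≠ .blank).card ≤ 4 := by omega
  have e1 := Finset.eq_of_subset_of_card_le (hT.good.cut_subset i) (by omega)
  have e2 := Finset.eq_of_subset_of_card_le (hT.good.cut_succ_subset i) (by omega)
  have hvert : ∀ j, (T i j).conn .left = false → T i j = .vertical ∨ T i j = .blank := by
    intro j hl
    by_cases hb : T i j = .blank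
    · exact Or.inr hb
    have hj : j ∈ (Finset.Ico 0 n).filter fun j => T i j ≠ .blank :=
      Finset.mem_filter.2 ⟨Finset.mem_Ico.2 (hT.good.support i j hb).2.2, hb⟩
    have ht := hj
    rw [← e1, hT.good.mem_cut_iff] at ht
    rw [← e2, hT.good.mem_cut_iff, ← hT.good.vert] at hj
    exact Or.inl (Tile.eq_vertical hl ht hj)
  have hleft : ∀ j : ℕ, (T i j).conn .left = false := by
    intro j
    induction j with
    | zero => rw [hT.good.left, hT.good.eq_blank (by simp), blank_conn]
    | succ j ih =>
      push_cast
      rw [← hT.good.horiz]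
      rcases hvert j ih with h | h <;> rw [h] <;> rfl
  obtain ⟨j₀, hj₀⟩ := Finset.card_pos.1 (show 0 < (cut n T i).card by omega)
  have hb := ne_blank_of_conn (hT.good.mem_cut_iff.1 hj₀)
  have hrow : ∀ j, T i j = .vertical ∨ T i j = .blank := by
    intro j
    rcases lt_or_ge j 0 with hj | hj
    · exact Or.inr (hT.good.eq_blank (by omega))
    · obtain ⟨j, rfl⟩ := Int.eq_ofNat_of_zero_le hj
      exact hvert j (hleft j)
  exact hT.not_vertical_row ((hrow j₀).resolve_right hb) hrow

/-- The rows of a tight grid that depicts a prime knot have at least `2, 4, 5, …, 5, 4, 2`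
tiles. -/
theorem Tight.le_count (hn : 4 ≤ n) (hT : Tight n T) (hconn : IsPreconnected (gridLink T))
    (hK : SplitsTrivially (lift (gridLink T)))
    (hocc : ∀ i, 0 ≤ i → i < n → ∃ j, T i j ≠ .blank) : 5 * n - 8 ≤ count n T := by
  have htwo : ∀ a, 1 ≤ a → a < n → 2 ≤ (cut n T a).card := by
    intro a ha han
    obtain ⟨j, hj⟩ := hocc 0 le_rfl (by omega)
    obtain ⟨j', hj'⟩ := hocc a (by omega) han
    obtain ⟨k, hk⟩ := hT.good.exists_top_of_isPreconnected hconn (by omega) le_rfl hj hj'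
    have h0 : (cut n T a).card ≠ 0 := Finset.card_ne_zero_of_mem (hT.good.mem_cut_iff.2 hk)
    obtain ⟨m, hm⟩ := hT.good.even_card_cut (a := a) (by omega) (by omega)
    omega
  have hfour : ∀ a, 2 ≤ a → a + 2 ≤ n → 4 ≤ (cut n T a).card := fun a ha han =>
    hT.four_le_card_cut hconn hK hocc ha han
  have hrow : ∀ i ∈ Finset.Ico 0 n, (5 : ℤ) - (if i = 0 then 3 else 0) - (if i = n - 1 then 3 else
      0)
      - (if i = 1 then 1 else 0) - (if i = n - 2 then 1 else 0) ≤
      ∑ j ∈ Finset.Ico 0 n, nonblank (T i j) := by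
    intro i hi
    rw [Finset.mem_Ico] at hi
    have h1 := hT.good.card_cut_le i
    have h2 := hT.good.card_cut_succ_le i
    have h3 := htwo i
    have h4 := htwo (i + 1)
    have h5 := hfour i
    have h6 := hfour (i + 1)
    have h7 := hT.five_le_sum_row (i := i)
    split_ifs <;> omega
  have hsum := Finset.sum_le_sum hrow
  simp only [Finset.sum_sub_distrib, Finset.sum_const, Finset.sum_ite_eq', Finset.mem_Ico] at hsum
  rw [if_pos (by omega), if_pos (by omega), if_pos (by omega), if_pos (by omega), Int.card_Ico,
    nsmul_eq_mul, Int.toNat_of_nonneg (by omega)] at hsum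
  change _ ≤ count n T at hsum
  omega

end Count

theorem Mosaic.le_tileNumber {n : ℕ} (hn : 4 ≤ n) (M : Mosaic n) (hM : M.SpaceEfficient)
    (hK : ¬ ∃ C : Set S3, IsTrivialComponent M.link C)
    (hocc : (∀ i : Fin n, M.RowOccupied i) ∨ (∀ j : Fin n, M.ColumnOccupied j))
    (hP : IsPrimeKnot M.link) : 5 * (n : ℤ) - 8 ≤ M.tileNumber := by
  have hT := M.tight_grid hM hK
  obtain ⟨hknot, -, hsplit⟩ := hP
  rw [← lift_gridLink] at hknot hsplit
  have hconn := hknot.isPreconnected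
  rw [← count_grid]
  rcases hocc with hocc | hocc
  · refine hT.le_count (by omega) hconn hsplit fun i hi hin => ?_
    lift i to ℕ using hi
    obtain ⟨j, hj⟩ := hocc ⟨i, by omega⟩
    rw [← grid_coe] at hj
    exact ⟨_, hj⟩
  · rw [← count_transpose]
    refine hT.transpose.le_count (by omega) ?_ ?_ fun j hj hjn => ?_
    · rw [gridLink_transpose]
      exact hconn.image _ reflectD.continuous.continuousOn
    · have h := SplitsTrivially.image hsplit reflectD.toHomeomorph.onePointCongr
      rwa [← lift_image, IsometryEquiv.coe_toHomeomorph, ← gridLink_transpose] at h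
    · lift j to ℕ using hj
      obtain ⟨i, hi⟩ := hocc ⟨j, by omega⟩
      rw [← grid_coe] at hi
      exact ⟨_, fun h => hi ((transpose_blank _ _ _).1 h)⟩

end KnotMosaic

theorem theorem1 (n : ℕ) (hn : 4 ≤ n) (M : KnotMosaic.Mosaic n) (hM : M.SpaceEfficient)
    (hK : ¬ ∃ C : Set KnotMosaic.S3, KnotMosaic.IsTrivialComponent M.link C)
    (hocc : (∀ i : Fin n, M.RowOccupied i) ∨ (∀ j : Fin n, M.ColumnOccupied j)) :
    (Even n → (M.tileNumber : ℤ) ≤ (n : ℤ) ^ 2 - 4) ∧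
      (Odd n → (M.tileNumber : ℤ) ≤ (n : ℤ) ^ 2 - 8) ∧
      (KnotMosaic.IsPrimeKnot M.link → 5 * (n : ℤ) - 8 ≤ (M.tileNumber : ℤ)) := by
  have hT := M.tight_grid hM hK
  rw [← M.count_grid]
  refine ⟨fun _ => hT.count_le (by omega), fun hodd => ?_, fun hP => ?_⟩
  · exact hT.count_le_of_odd (by omega) (by exact_mod_cast hodd)
  · rw [M.count_grid]
    exact M.le_tileNumber hn hM hK hocc hP
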